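/- In the $k$-Internal Spanning Tree problem ($k$-IST) the input is an undirected graph $G$ on $n$ vertices and a nonnegative integer $k$, and the question is whether $G$ has a spanning tree with at least $k$ internal vertices (vertices of degree at least $2$ in the tree). For every fixed integer $\Delta\ge 2$ there is a Monte-Carlo polynomial-space algorithm that solves $k$-IST on graphs in which every vertex has degree at most $\Delta$ and runs in time \[O^*\left(\min\left\{2^{\left[\frac{3\Delta-5}{\Delta-1}-\frac{x(3\Delta^2+3x+2-6\Delta-2x\Delta)}{\Delta(\Delta-1)^2}\right]k},\;2^{\left[\frac{3\Delta-5}{2\Delta-3}-\frac{x(3\Delta^2+3x+2-6\Delta-2x\Delta)}{\Delta(\Delta-1)(2\Delta-3)}\right]n}\right\}\right),\] where $x$ is the integer nearest to $\frac{3\Delta^2-6\Delta+2}{2(2\Delta-3)}$. Here $O^*$ hides a factor polynomial in the bit length of the input (for fixed $\Delta$). Time and space are measured on a coin-tossing random access machine with logarithmic cost; the bounds hold for all outcomes of the coin tosses. Monte-Carlo means that on a no-instance the algorithm always answers NO and on a yes-instance it answers YES with probability at least $\frac12$. -/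

import Mathlib

/-! ### Spanning trees with many internal vertices -/

/-- `G` has a spanning tree with at least `k` internal vertices
(vertices of degree at least `2` in the tree). -/
def HasInternalSpanningTree {n : ℕ} (G : SimpleGraph (Fin n)) (k : ℕ) : Prop :=
  ∃ T : SimpleGraph (Fin n), T ≤ G ∧ T.IsTree ∧ k ≤ {v | 2 ≤ (T.neighborSet v).ncard}.ncard

/-- Every vertex of `G` has at most `d` neighbours. -/
def MaxDegreeLE {n : ℕ} (G : SimpleGraph (Fin n)) (d : ℕ) : Prop :=
  ∀ v, (G.neighborSet v).ncard ≤ d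

/-! ### Probabilistic random access machines with logarithmic cost

The machine has finitely many named arrays (a program mentions finitely many) of natural numbers,
all but finitely many cells being `0`.  Every operation is charged the number of bits of the
numbers (addresses and contents) that it handles, and a memory occupies the number of bits of the
addresses and contents of its nonzero cells. -/

/-- Memory: `M (a, i)` is the content of cell `i` of array `a`. -/
abbrev Memory : Type := ℕ × ℕ →₀ ℕ

/-- Number of bits occupied by a memory. -/
def Memory.bits (M : Memory) : ℕ := M.sum fun c v => Nat.size c.2 + Nat.size v

/-- Arithmetic operations (`sub` is truncated subtraction, `div` integer division,
`xor` bitwise exclusive or). -/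
inductive ArithOp : Type
  | add | sub | mul | div | xor

/-- The value of an operation. -/
def ArithOp.apply : ArithOp → ℕ → ℕ → ℕ
  | add, u, v => u + v
  | sub, u, v => u - v
  | mul, u, v => u * v
  | div, u, v => u / v
  | xor, u, v => u ^^^ v

/-- Expressions: constants, array reads (the address is itself computed), operations. -/
inductive RamExpr : Type
  | lit (u : ℕ)
  | read (a : ℕ) (i : RamExpr)
  | op (o : ArithOp) (e₁ e₂ : RamExpr)

/-- The value of an expression. -/
def RamExpr.val (M : Memory) : RamExpr → ℕ
  | lit u => u
  | read a i => M (a, i.val M)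
  | op o e₁ e₂ => o.apply (e₁.val M) (e₂.val M)

/-- The time needed to evaluate an expression. -/
def RamExpr.cost (M : Memory) : RamExpr → ℕ
  | lit u => 1 + Nat.size u
  | read a i => i.cost M + 1 + Nat.size (i.val M) + Nat.size (M (a, i.val M))
  | op _ e₁ e₂ => e₁.cost M + e₂.cost M + 1 + Nat.size (e₁.val M) + Nat.size (e₂.val M)

/-- Programs. `assign a i e` stores the value of `e` in cell `i` of array `a`;
`toss a i` stores the outcome (`0` or `1`) of a fresh fair coin toss there;
tests succeed when the expression is nonzero. -/
inductive RamProg : Type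
  | skip
  | assign (a : ℕ) (i e : RamExpr)
  | toss (a : ℕ) (i : RamExpr)
  | seq (P Q : RamProg)
  | cond (e : RamExpr) (P Q : RamProg)
  | loop (e : RamExpr) (P : RamProg)

/-- Memory together with the number of coins tossed so far. The latter only selects the next
coin; it is not accessible to programs. -/
structure RamState : Type where
  mem : Memory
  tossed : ℕ

/-- `Exec ω P σ τ t s`: with `ω` as the sequence of coin tosses, the program `P` started in `σ`
terminates in `τ`, after time `t`, and `s` is the largest number of bits that the memory occupied
on the way. -/
inductive Exec (ω : ℕ → Bool) : RamProg → RamState → RamState → ℕ → ℕ → Prop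
  | skip (σ : RamState) : Exec ω .skip σ σ 1 σ.mem.bits
  | assign (σ : RamState) (M : Memory) (a : ℕ) (i e : RamExpr)
      (hM : M = σ.mem.update (a, i.val σ.mem) (e.val σ.mem)) :
      Exec ω (.assign a i e) σ ⟨M, σ.tossed⟩
        (i.cost σ.mem + e.cost σ.mem + 1 + Nat.size (i.val σ.mem) + Nat.size (e.val σ.mem))
        (max σ.mem.bits M.bits)
  | toss (σ : RamState) (M : Memory) (a : ℕ) (i : RamExpr)
      (hM : M = σ.mem.update (a, i.val σ.mem) (ω σ.tossed).toNat) :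
      Exec ω (.toss a i) σ ⟨M, σ.tossed + 1⟩
        (i.cost σ.mem + 1 + Nat.size (i.val σ.mem) + 1)
        (max σ.mem.bits M.bits)
  | seq {P Q : RamProg} {σ ρ τ : RamState} {t₁ t₂ s₁ s₂ : ℕ}
      (hP : Exec ω P σ ρ t₁ s₁) (hQ : Exec ω Q ρ τ t₂ s₂) :
      Exec ω (.seq P Q) σ τ (t₁ + t₂) (max s₁ s₂)
  | condTrue {e : RamExpr} {P Q : RamProg} {σ τ : RamState} {t s : ℕ}
      (he : e.val σ.mem ≠ 0) (hP : Exec ω P σ τ t s) :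
      Exec ω (.cond e P Q) σ τ (e.cost σ.mem + 1 + t) s
  | condFalse {e : RamExpr} {P Q : RamProg} {σ τ : RamState} {t s : ℕ}
      (he : e.val σ.mem = 0) (hQ : Exec ω Q σ τ t s) :
      Exec ω (.cond e P Q) σ τ (e.cost σ.mem + 1 + t) s
  | loopExit {e : RamExpr} {P : RamProg} {σ : RamState} (he : e.val σ.mem = 0) :
      Exec ω (.loop e P) σ σ (e.cost σ.mem + 1) σ.mem.bits
  | loopStep {e : RamExpr} {P : RamProg} {σ ρ τ : RamState} {t₁ t₂ s₁ s₂ : ℕ}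
      (he : e.val σ.mem ≠ 0) (hP : Exec ω P σ ρ t₁ s₁) (hL : Exec ω (.loop e P) ρ τ t₂ s₂) :
      Exec ω (.loop e P) σ τ (e.cost σ.mem + 1 + t₁ + t₂) (max s₁ s₂)

/-- A program, a start and the coins determine the run: final state, time and space. -/
theorem Exec.deterministic {ω : ℕ → Bool} {P : RamProg} {σ τ τ' : RamState} {t t' s s' : ℕ}
    (h : Exec ω P σ τ t s) (h' : Exec ω P σ τ' t' s') : τ = τ' ∧ t = t' ∧ s = s' := by
  induction h generalizing τ' t' s' with
  | skip σ => cases h'; simp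
  | assign σ M a i e hM => cases h' with | assign _ M' _ _ _ hM' => subst hM hM'; simp
  | toss σ M a i hM => cases h' with | toss _ M' _ _ hM' => subst hM hM'; simp
  | seq _ _ ih₁ ih₂ =>
    cases h' with
    | seq h₁ h₂ =>
      obtain ⟨rfl, rfl, rfl⟩ := ih₁ h₁
      obtain ⟨rfl, rfl, rfl⟩ := ih₂ h₂
      simp
  | condTrue he _ ih =>
    cases h' with
    | condTrue _ h₁ => obtain ⟨rfl, rfl, rfl⟩ := ih h₁; simp
    | condFalse he' _ => exact absurd he' he
  | condFalse he _ ih =>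
    cases h' with
    | condTrue he' _ => exact absurd he he'
    | condFalse _ h₁ => obtain ⟨rfl, rfl, rfl⟩ := ih h₁; simp
  | loopExit he =>
    cases h' with
    | loopExit _ => simp
    | loopStep he' _ _ => exact absurd he he'
  | loopStep he _ _ ih₁ ih₂ =>
    cases h' with
    | loopExit he' => exact absurd he' he
    | loopStep _ h₁ h₂ =>
      obtain ⟨rfl, rfl, rfl⟩ := ih₁ h₁
      obtain ⟨rfl, rfl, rfl⟩ := ih₂ h₂
      simp

/-- With the coins `ω`, the program `P` answers YES on the input memory `M`: it terminates with
the number `1` in cell `0` of array `0`. -/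
def Accepts (P : RamProg) (M : Memory) (ω : ℕ → Bool) : Prop :=
  ∃ τ t s, Exec ω P ⟨M, 0⟩ τ t s ∧ τ.mem (0, 0) = 1

/-- The law of a sequence of independent fair coin tosses. -/
noncomputable def coinMeasure : MeasureTheory.Measure (ℕ → Bool) :=
  MeasureTheory.Measure.infinitePi fun _ => (PMF.uniformOfFintype Bool).toMeasure

/-- On the input `M`, the randomized program `P` always halts within time `time` and space
`space`; it never answers YES if the correct answer is NO; and it answers YES with probability at
least `1/2` if the correct answer is YES. -/
def MonteCarlo (P : RamProg) (M : Memory) (answer : Prop) (time space : ℝ) : Prop :=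
  (∀ ω, ∃ τ t s, Exec ω P ⟨M, 0⟩ τ t s ∧ (t : ℝ) ≤ time ∧ (s : ℝ) ≤ space) ∧
  (¬ answer → ∀ ω, ¬ Accepts P M ω) ∧
  (answer → 1 / 2 ≤ coinMeasure {ω | Accepts P M ω})

/-! ### Instances of the problem -/

open Classical in
/-- The input `(G, k)`: `n` is in cell `0` of array `0`, `k` in cell `0` of array `1`, and the
adjacency matrix of `G` is stored row by row in array `2`. -/
noncomputable def instanceMemory {n : ℕ} (G : SimpleGraph (Fin n)) (k : ℕ) : Memory :=
  Finsupp.single (0, 0) n + Finsupp.single (1, 0) k +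
    ∑ i : Fin n, ∑ j : Fin n, Finsupp.single (2, (i : ℕ) * n + j) (if G.Adj i j then 1 else 0)

/-- Number of bits of the instance: adjacency matrix, `n` and `k` in binary. -/
def instanceSize (n k : ℕ) : ℕ := n * n + Nat.size n + Nat.size k

/-! ### The exponents -/

/-- `x`, the integer nearest to `(3Δ² - 6Δ + 2) / (2(2Δ - 3))`. -/
noncomputable def xRound (Δ : ℕ) : ℝ :=
  (round ((3 * (Δ : ℝ) ^ 2 - 6 * Δ + 2) / (2 * (2 * Δ - 3))) : ℤ)

/-- The coefficient of `k` in the exponent. -/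
noncomputable def kExponent (Δ : ℕ) : ℝ :=
  (3 * (Δ : ℝ) - 5) / (Δ - 1) -
    xRound Δ * (3 * (Δ : ℝ) ^ 2 + 3 * xRound Δ + 2 - 6 * Δ - 2 * xRound Δ * Δ) /
      (Δ * ((Δ : ℝ) - 1) ^ 2)

/-- The coefficient of `n` in the exponent. -/
noncomputable def nExponent (Δ : ℕ) : ℝ :=
  (3 * (Δ : ℝ) - 5) / (2 * Δ - 3) -
    xRound Δ * (3 * (Δ : ℝ) ^ 2 + 3 * xRound Δ + 2 - 6 * Δ - 2 * xRound Δ * Δ) /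
      (Δ * ((Δ : ℝ) - 1) * (2 * Δ - 3))

/-! Combinatorial core. Deleting leaves from a spanning tree with at least k internal vertices leads
to a subtree with exactly k internal vertices in which every neighbour of a leaf has degree 2
(`exists_pruned`). Unless it is a path on three vertices, its leaves inject into the vertices of
degree 2, and counting degrees bounds the leaves by about (Δ-2)k/(Δ-1) (`card_leaves_le`).
Conversely, in a connected graph every subtree with k internal vertices extends to a spanning tree
in which they stay internal (`hasInternalSpanningTree_of_walk`). It remains to detect such subtrees.

Detection. Subtrees are relaxed to branching walks, locally injective images of trees rooted at a
leaf, whose weighted sums obey a recursion over height (`sum_trees_succ`). For a vertex set V₁, the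
objects of a walk are its nodes in V₁, its leaves and its edges avoiding V₁. The walks with L
objects are counted with bijective labellings of the objects by L labels, through
inclusion–exclusion over the 2^L sets of labels; this is the only exponential cost. Modulo two, a
walk with a repeated object cancels because squaring is additive (`sieveSum_of_not_nodup`). A walk
with distinct objects that visits some vertex twice cancels against another such walk: two edges at
the least repeated vertex that lead into the same component of the rest are exchanged, which is an
involution without fixed points (`IsSys.swap`, `swapSys_swapSys`, `sum_not_genuine`). Only genuine
trees survive.

The survivors might still cancel among themselves. Random weights on pairs (object, label) and on
edges make the lightest labelled tree unique with probability at least 1/2 (`coinMeasure_isolates`),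
so some coefficient of the generating polynomial is odd (`SieveData.exists_coeff_ne_zero`). A
no-instance has no surviving tree, so all coefficients that are read are even. The polynomial is
evaluated at a large power of two modulo another one, so its coefficients are digits of the result
(`SieveData.odd_tot_iff`).

Number of labels. In a connected graph, greedy colouring by decreasing distance from vertex 0
properly colours all other vertices with Δ colours (`colM_ne`). With V₁ the union of x colour
classes, averaging over the classes bounds the labels of some choice (`exists_labels_le`); combined
with the bound for leaves this gives both exponents up to an additive constant (`labels_le_Lmax`),
and x as in the theorem minimises them. All 2^Δ choices are tried.

Machine. The algorithm is written with bounded loops; a weakest-precondition calculus (`WP`) carries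
correctness, time and space together. All numbers and addresses have polynomially many bits, and
loops with exponentially many rounds are not nested. -/

/-! ### A structured language with bounded loops -/

/-- Programs with bounded loops. `rep big x e P` runs `P` for `x = 0, 1, …` as long as `x < e`;
the flag `big` distinguishes the loops with exponentially many rounds. -/
inductive Cmd : Type
  | skip
  | asg (a : ℕ) (i e : RamExpr)
  | toss (a : ℕ) (i : RamExpr)
  | seq (P Q : Cmd)
  | ite (e : RamExpr) (P Q : Cmd)
  | rep (big : Bool) (x : ℕ) (e : RamExpr) (P : Cmd)

/-- The scalar variable stored in cell `0` of array `x`. -/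
abbrev RamExpr.var (x : ℕ) : RamExpr := .read x (.lit 0)

namespace Cmd

/-- Translation into machine programs. -/
def compile : Cmd → RamProg
  | skip => .skip
  | asg a i e => .assign a i e
  | toss a i => .toss a i
  | seq P Q => .seq P.compile Q.compile
  | ite e P Q => .cond e P.compile Q.compile
  | rep _ x e P => .seq (.assign x (.lit 0) (.lit 0))
      (.loop (.op .sub e (.var x))
        (.seq P.compile (.assign x (.lit 0) (.op .add (.var x) (.lit 1)))))

/-- The arrays that a program writes. -/
def wr : Cmd → List ℕ
  | skip => []
  | asg a _ _ => [a]
  | toss a _ => [a]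
  | seq P Q => P.wr ++ Q.wr
  | ite _ P Q => P.wr ++ Q.wr
  | rep _ x _ P => x :: P.wr

end Cmd

/-- A bound for the number of bits of a value, if all cells have at most `D` bits. -/
def RamExpr.bitBound (D : ℕ) : RamExpr → ℕ
  | lit u => Nat.size u
  | read _ _ => D
  | op _ e₁ e₂ => e₁.bitBound D + e₂.bitBound D + 1

/-- A bound for the cost of an evaluation, if all cells have at most `D` bits. -/
def RamExpr.costBound (D : ℕ) : RamExpr → ℕ
  | lit u => 1 + Nat.size u
  | read _ i => i.costBound D + 1 + i.bitBound D + D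
  | op _ e₁ e₂ => e₁.costBound D + e₂.costBound D + 1 + e₁.bitBound D + e₂.bitBound D

theorem ArithOp.size_apply_le (o : ArithOp) (u v : ℕ) :
    Nat.size (o.apply u v) ≤ Nat.size u + Nat.size v + 1 := by
  have hu := Nat.lt_size_self u
  have hv := Nat.lt_size_self v
  rw [Nat.size_le]
  have h1 : 2 ^ Nat.size u ≤ 2 ^ (Nat.size u + Nat.size v) := Nat.pow_le_pow_right (by norm_num) (by omega)
  have h2 : 2 ^ Nat.size v ≤ 2 ^ (Nat.size u + Nat.size v) := Nat.pow_le_pow_right (by norm_num) (by omega)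
  have h3 : 2 ^ (Nat.size u + Nat.size v + 1) = 2 * 2 ^ (Nat.size u + Nat.size v) := by ring
  rw [h3]
  cases o with
  | add => simp only [ArithOp.apply]; omega
  | sub => simp only [ArithOp.apply]; omega
  | mul =>
    simp only [ArithOp.apply]
    have : u * v < 2 ^ Nat.size u * 2 ^ Nat.size v := Nat.mul_lt_mul'' hu hv
    rw [← pow_add] at this; omega
  | div =>
    simp only [ArithOp.apply]
    have := Nat.div_le_self u v; omega
  | xor =>
    simp only [ArithOp.apply]
    have := Nat.xor_lt_two_pow (hu.trans_le h1) (hv.trans_le h2); omega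

/-- All cells in use lie in the first `m` arrays, have addresses below `D` and at most `D` bits. -/
def MemOK (m D : ℕ) (M : Memory) : Prop :=
  ∀ a i, M (a, i) ≠ 0 → a < m ∧ i < D ∧ M (a, i) < 2 ^ D

theorem MemOK.lt {m D : ℕ} {M : Memory} (h : MemOK m D M) (a i : ℕ) : M (a, i) < 2 ^ D := by
  by_cases h0 : M (a, i) = 0
  · rw [h0]; positivity
  · exact (h a i h0).2.2

theorem MemOK.bitBound {m D : ℕ} {M : Memory} (h : MemOK m D M) (e : RamExpr) :
    Nat.size (e.val M) ≤ e.bitBound D := by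
  induction e with
  | lit u => exact le_rfl
  | read a i _ => exact Nat.size_le.2 (h.lt a _)
  | op o e₁ e₂ h₁ h₂ =>
    have := o.size_apply_le (e₁.val M) (e₂.val M)
    simp only [RamExpr.val, RamExpr.bitBound]; omega

theorem MemOK.costBound {m D : ℕ} {M : Memory} (h : MemOK m D M) (e : RamExpr) :
    e.cost M ≤ e.costBound D := by
  induction e with
  | lit u => exact le_rfl
  | read a i hi =>
    have h1 := h.bitBound i
    have h2 := h.bitBound (.read a i)
    simp only [RamExpr.cost, RamExpr.costBound, RamExpr.bitBound, RamExpr.val] at *; omega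
  | op o e₁ e₂ h₁ h₂ =>
    have h3 := h.bitBound e₁
    have h4 := h.bitBound e₂
    simp only [RamExpr.cost, RamExpr.costBound]; omega

/-- At most `m * D` cells are nonzero, each with address and content of at most `D` bits. Polynomial
space thus follows from a polynomial `D`, however long the run is. -/
theorem MemOK.bits_le {m D : ℕ} {M : Memory} (h : MemOK m D M) : M.bits ≤ 2 * m * D * D := by
  have hs : M.support ⊆ Finset.range m ×ˢ Finset.range D := by
    intro c hc
    have := h c.1 c.2 (Finsupp.mem_support_iff.1 hc)
    simp [this.1, this.2.1]
  have hb : ∀ c ∈ M.support, Nat.size c.2 + Nat.size (M c) ≤ 2 * D := by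
    intro c hc
    have := h c.1 c.2 (Finsupp.mem_support_iff.1 hc)
    have h1 : Nat.size c.2 ≤ D := Nat.size_le.2 (this.2.1.trans Nat.lt_two_pow_self)
    have h2 : Nat.size (M c) ≤ D := Nat.size_le.2 this.2.2
    omega
  calc M.bits ≤ M.support.card • (2 * D) := Finset.sum_le_card_nsmul _ _ _ hb
    _ ≤ (m * D) * (2 * D) := by
        rw [smul_eq_mul]
        refine Nat.mul_le_mul_right _ ((Finset.card_le_card hs).trans ?_)
        simp
    _ = 2 * m * D * D := by ring

theorem MemOK.update {m D : ℕ} {M : Memory} (h : MemOK m D M) {a i v : ℕ} (ha : a < m)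
    (hi : i < D) (hv : v < 2 ^ D) : MemOK m D (M.update (a, i) v) := by
  intro b j hb
  rw [Finsupp.coe_update, Function.update_apply] at hb ⊢
  split_ifs at hb ⊢ with hc
  · simp only [Prod.mk.injEq] at hc; exact ⟨hc.1 ▸ ha, hc.2 ▸ hi, hv⟩
  · exact h b j hb

/-- The bounds `D` (addresses, bits, rounds of loops), `E` (rounds of big loops) and `m`
(arrays), and the coins. -/
structure Env where
  ω : ℕ → Bool
  m : ℕ
  D : ℕ
  E : ℕ

/-- The time bound of a program. -/
def Cmd.time (D E : ℕ) : Cmd → ℕ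
  | skip => 1
  | asg _ i e => i.costBound D + e.costBound D + 1 + i.bitBound D + e.bitBound D
  | toss _ i => i.costBound D + 1 + i.bitBound D + 1
  | seq P Q => P.time D E + Q.time D E
  | ite e P Q => e.costBound D + 1 + (P.time D E + Q.time D E)
  | rep big _ e P =>
      3 + ((bif big then E else D) * ((e.costBound D + (D + 2) + 1 + e.bitBound D + D) + 1 +
        (P.time D E + ((D + 2) + 5 + D + (1 + D + 1 + 1)))) +
        ((e.costBound D + (D + 2) + 1 + e.bitBound D + D) + 1))

/-- `WP ev c σ post`: from `σ`, the program halts within its bounds in a state that satisfies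
`post`. -/
def WP (ev : Env) (c : Cmd) (σ : RamState) (post : RamState → Prop) : Prop :=
  MemOK ev.m ev.D σ.mem → ∃ τ t s, Exec ev.ω c.compile σ τ t s ∧ t ≤ c.time ev.D ev.E ∧
    s ≤ 2 * ev.m * ev.D * ev.D ∧ MemOK ev.m ev.D τ.mem ∧ post τ

/-- `σ` with `v` stored in cell `i` of array `a`. -/
noncomputable def RamState.set (σ : RamState) (a i v : ℕ) : RamState :=
  ⟨σ.mem.update (a, i) v, σ.tossed⟩

@[simp] theorem RamState.set_tossed (σ : RamState) (a i v : ℕ) : (σ.set a i v).tossed = σ.tossed := rfl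

theorem RamState.set_mem (σ : RamState) (a i v b j : ℕ) :
    (σ.set a i v).mem (b, j) = if b = a ∧ j = i then v else σ.mem (b, j) := by
  simp only [RamState.set, Finsupp.coe_update, Function.update_apply, Prod.mk.injEq]

namespace WP

variable {ev : Env} {σ : RamState} {post : RamState → Prop}

theorem mono {c : Cmd} {post' : RamState → Prop} (h : WP ev c σ post')
    (himp : ∀ τ, post' τ → post τ) : WP ev c σ post := by
  intro hok
  obtain ⟨τ, t, s, h1, h2, h3, h4, h5⟩ := h hok
  exact ⟨τ, t, s, h1, h2, h3, h4, himp τ h5⟩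

theorem skip (h : post σ) : WP ev .skip σ post := fun hok =>
  ⟨σ, _, _, .skip σ, le_rfl, hok.bits_le, hok, h⟩

theorem asg {a : ℕ} {i e : RamExpr} {x v : ℕ} (hx : i.val σ.mem = x) (hv : e.val σ.mem = v)
    (ha : a < ev.m) (hi : x < ev.D) (he : v < 2 ^ ev.D)
    (h : post (σ.set a x v)) : WP ev (.asg a i e) σ post := by
  intro hok
  subst hx hv
  have hok' := hok.update ha hi he
  refine ⟨_, _, _, .assign σ _ a i e rfl, ?_, ?_, hok', h⟩
  · have := hok.bitBound i
    have := hok.bitBound e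
    have := hok.costBound i
    have := hok.costBound e
    simp only [Cmd.time]; omega
  · exact max_le hok.bits_le hok'.bits_le

theorem toss {a : ℕ} {i : RamExpr} {x : ℕ} (hx : i.val σ.mem = x) (ha : a < ev.m)
    (hi : x < ev.D)
    (h : post ⟨(σ.set a x (ev.ω σ.tossed).toNat).mem, σ.tossed + 1⟩) :
    WP ev (.toss a i) σ post := by
  intro hok
  subst hx
  have hv : (ev.ω σ.tossed).toNat < 2 ^ ev.D := by
    have h1 := Bool.toNat_le (ev.ω σ.tossed)
    have : 2 ^ 1 ≤ 2 ^ ev.D := Nat.pow_le_pow_right (by norm_num) (by omega)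
    omega
  have hok' := hok.update ha hi hv
  refine ⟨_, _, _, .toss σ _ a i rfl, ?_, ?_, hok', h⟩
  · have := hok.bitBound i
    have := hok.costBound i
    simp only [Cmd.time]; omega
  · exact max_le hok.bits_le hok'.bits_le

theorem seq {P Q : Cmd} (h : WP ev P σ fun ρ => WP ev Q ρ post) : WP ev (.seq P Q) σ post := by
  intro hok
  obtain ⟨ρ, t, s, h1, h2, h3, h4, h5⟩ := h hok
  obtain ⟨τ, t', s', k1, k2, k3, k4, k5⟩ := h5 h4
  exact ⟨τ, _, _, .seq h1 k1, by simp only [Cmd.time]; omega, max_le h3 k3, k4, k5⟩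

theorem ite {e : RamExpr} {P Q : Cmd} (h1 : e.val σ.mem ≠ 0 → WP ev P σ post)
    (h2 : e.val σ.mem = 0 → WP ev Q σ post) : WP ev (.ite e P Q) σ post := by
  intro hok
  have hc := hok.costBound e
  by_cases he : e.val σ.mem = 0
  · obtain ⟨τ, t', s', k1, k2, k3, k4, k5⟩ := h2 he hok
    exact ⟨τ, _, _, .condFalse he k1, by simp only [Cmd.time]; omega, k3, k4, k5⟩
  · obtain ⟨τ, t', s', k1, k2, k3, k4, k5⟩ := h1 he hok
    exact ⟨τ, _, _, .condTrue he k1, by simp only [Cmd.time]; omega, k3, k4, k5⟩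

/-- `I j` describes the state just after the loop variable has been set to `j`; the body has to
leave that variable unchanged and to prepare the invariant for the state after the increment. The
bound `e` is evaluated again before each round, so it must keep the value `N`. -/
theorem rep {big : Bool} {x : ℕ} {e : RamExpr} {P : Cmd} (N : ℕ) (I : ℕ → RamState → Prop)
    (hx : x < ev.m) (hD : 0 < ev.D) (hN : N ≤ bif big then ev.E else ev.D) (hN' : N < 2 ^ ev.D)
    (h0 : I 0 (σ.set x 0 0))
    (hval : ∀ j ≤ N, ∀ ρ, I j ρ → ρ.mem (x, 0) = j → e.val ρ.mem = N)
    (hstep : ∀ j < N, ∀ ρ, I j ρ → ρ.mem (x, 0) = j →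
      WP ev P ρ fun τ => τ.mem (x, 0) = j ∧ I (j + 1) (τ.set x 0 (j + 1)))
    (hpost : ∀ ρ, I N ρ → ρ.mem (x, 0) = N → post ρ) : WP ev (.rep big x e P) σ post := by
  intro hok
  have hok0 : MemOK ev.m ev.D (σ.set x 0 0).mem := hok.update hx hD (by positivity)
  -- Induction on the number `r` of rounds that are left; the time is `r` times that of a round,
  -- plus the last test, which fails.
  have key : ∀ r j, j + r = N → ∀ ρ, I j ρ → ρ.mem (x, 0) = j → MemOK ev.m ev.D ρ.mem →
      ∃ τ t s, Exec ev.ω (.loop (.op .sub e (.var x))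
        (.seq P.compile (.assign x (.lit 0) (.op .add (.var x) (.lit 1))))) ρ τ t s ∧
        t ≤ r * ((e.costBound ev.D + (ev.D + 2) + 1 + e.bitBound ev.D + ev.D) + 1 +
        (P.time ev.D ev.E + ((ev.D + 2) + 5 + ev.D + (1 + ev.D + 1 + 1)))) +
        ((e.costBound ev.D + (ev.D + 2) + 1 + e.bitBound ev.D + ev.D) + 1) ∧
        s ≤ 2 * ev.m * ev.D * ev.D ∧ MemOK ev.m ev.D τ.mem ∧ post τ := by
    intro r
    induction r with
    | zero =>
      intro j hj ρ hI hxj hokρ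
      obtain rfl : j = N := by omega
      have hc := hokρ.costBound (.op .sub e (.var x))
      refine ⟨ρ, _, _, .loopExit ?_, ?_, hokρ.bits_le, hokρ, hpost ρ hI hxj⟩
      · simp [RamExpr.val, ArithOp.apply, hval j le_rfl ρ hI hxj, hxj]
      · simp only [RamExpr.costBound, RamExpr.bitBound, Nat.size_zero] at hc; omega
    | succ r ih =>
      intro j hj ρ hI hxj hokρ
      have hc := hokρ.costBound (.op .sub e (.var x))
      obtain ⟨τ, t, s, k1, k2, k3, k4, k5, k6⟩ := hstep j (by omega) ρ hI hxj hokρ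
      have hok' : MemOK ev.m ev.D (τ.set x 0 (j + 1)).mem :=
        k4.update hx hD (lt_of_le_of_lt (by omega) hN')
      obtain ⟨τ', t', s', l1, l2, l3, l4, l5⟩ := ih (j + 1) (by omega) _ k6
        (by simp [RamState.set_mem]) hok'
      have hca := k4.costBound (.op .add (.var x) (.lit 1))
      have hcb := k4.bitBound (.op .add (.var x) (.lit 1))
      have hasg := Exec.assign (ω := ev.ω) τ (τ.set x 0 (j + 1)).mem x (.lit 0)
        (.op .add (.var x) (.lit 1)) (by simp [RamState.set, RamExpr.val, ArithOp.apply, k5])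
      refine ⟨τ', _, _, .loopStep ?_ (.seq k1 hasg) l1, ?_, ?_, l4, l5⟩
      · simp only [RamExpr.val, ArithOp.apply, hval j (by omega) ρ hI hxj, hxj]; omega
      · simp only [RamExpr.costBound, RamExpr.bitBound, RamExpr.cost, RamExpr.val,
          Nat.size_zero, Nat.size_one] at hc hca hcb ⊢
        rw [Nat.succ_mul]; omega
      · exact max_le (max_le k3 (max_le k4.bits_le hok'.bits_le)) l3
  obtain ⟨τ, t, s, k1, k2, k3, k4, k5⟩ := key N 0 (by omega) _ h0 (by simp [RamState.set_mem]) hok0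
  refine ⟨τ, _, _, .seq (.assign σ (σ.set x 0 0).mem x _ _ rfl) k1, ?_,
    max_le (max_le hok.bits_le hok0.bits_le) k3, k4, k5⟩
  have := Nat.mul_le_mul_right ((e.costBound ev.D + (ev.D + 2) + 1 + e.bitBound ev.D + ev.D) + 1 +
        (P.time ev.D ev.E + ((ev.D + 2) + 5 + ev.D + (1 + ev.D + 1 + 1)))) hN
  simp only [Cmd.time, RamExpr.cost, RamExpr.val, Nat.size_zero]
  omega

end WP

/-- The list of written arrays is syntactic, so each verification only has to follow the arrays that
the program at hand touches. -/
theorem Exec.frame {ω : ℕ → Bool} {c : Cmd} {σ τ : RamState} {t s : ℕ}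
    (h : Exec ω c.compile σ τ t s) {a : ℕ} (ha : a ∉ c.wr) (i : ℕ) :
    τ.mem (a, i) = σ.mem (a, i) := by
  induction c generalizing σ τ t s with
  | skip => cases h; rfl
  | asg b j e =>
    cases h with | assign _ M _ _ _ hM =>
    simp only [Cmd.wr, List.mem_singleton] at ha
    simp [hM, ha]
  | toss b j =>
    cases h with | toss _ M _ _ hM =>
    simp only [Cmd.wr, List.mem_singleton] at ha
    simp [hM, ha]
  | seq P Q hP hQ =>
    simp only [Cmd.wr, List.mem_append, not_or] at ha
    cases h with | seq h1 h2 => rw [hQ h2 ha.2, hP h1 ha.1]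
  | ite e P Q hP hQ =>
    simp only [Cmd.wr, List.mem_append, not_or] at ha
    cases h with
    | condTrue _ h1 => exact hP h1 ha.1
    | condFalse _ h1 => exact hQ h1 ha.2
  | rep big x e P hP =>
    simp only [Cmd.wr, List.mem_cons, not_or] at ha
    have key : ∀ {R : RamProg} {σ τ : RamState} {t s : ℕ}, Exec ω R σ τ t s →
        R = (.loop (.op .sub e (.var x))
        (.seq P.compile (.assign x (.lit 0) (.op .add (.var x) (.lit 1))))) →
        τ.mem (a, i) = σ.mem (a, i) := by
      intro R σ τ t s h
      induction h with
      | loopExit _ => intro _; rfl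
      | loopStep he h1 h2 _ ih =>
        intro hR
        rw [ih hR]
        injection hR with _ hR
        subst hR
        cases h1 with | seq h3 h4 =>
        cases h4 with | assign _ M _ _ _ hM =>
        rw [← hP h3 ha.2]
        simp [hM, ha.1]
      | _ => intro hR; cases hR
    simp only [Cmd.compile] at h
    cases h with | seq h1 h2 =>
    rw [key h2 rfl]
    cases h1 with | assign _ M _ _ _ hM =>
    simp [hM, ha.1]

theorem WP.frame {ev : Env} {σ : RamState} {post : RamState → Prop} {c : Cmd} (h : WP ev c σ post) :
    WP ev c σ fun τ => post τ ∧ ∀ a, a ∉ c.wr → ∀ i, τ.mem (a, i) = σ.mem (a, i) := by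
  intro hok
  obtain ⟨τ, t, s, h1, h2, h3, h4, h5⟩ := h hok
  exact ⟨τ, t, s, h1, h2, h3, h4, h5, fun a ha i => h1.frame ha i⟩

/-! ### Polynomial bounds -/

/-- A function of natural numbers that is bounded by a polynomial. -/
def PolyBdd (f : ℕ → ℕ) : Prop := ∃ p : Polynomial ℕ, ∀ n, f n ≤ p.eval n

namespace PolyBdd

theorem const (c : ℕ) : PolyBdd fun _ => c := ⟨Polynomial.C c, by simp⟩

theorem id : PolyBdd fun n => n := ⟨Polynomial.X, by simp⟩

theorem add {f g : ℕ → ℕ} (hf : PolyBdd f) (hg : PolyBdd g) : PolyBdd fun n => f n + g n := by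
  obtain ⟨p, hp⟩ := hf
  obtain ⟨q, hq⟩ := hg
  exact ⟨p + q, fun n => by rw [Polynomial.eval_add]; exact add_le_add (hp n) (hq n)⟩

theorem mul {f g : ℕ → ℕ} (hf : PolyBdd f) (hg : PolyBdd g) : PolyBdd fun n => f n * g n := by
  obtain ⟨p, hp⟩ := hf
  obtain ⟨q, hq⟩ := hg
  exact ⟨p * q, fun n => by rw [Polynomial.eval_mul]; exact Nat.mul_le_mul (hp n) (hq n)⟩

theorem of_le {f g : ℕ → ℕ} (hg : PolyBdd g) (h : ∀ n, f n ≤ g n) : PolyBdd f := by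
  obtain ⟨q, hq⟩ := hg
  exact ⟨q, fun n => (h n).trans (hq n)⟩

end PolyBdd

theorem Polynomial.eval_nat_mono (p : Polynomial ℕ) {m n : ℕ} (h : m ≤ n) : p.eval m ≤ p.eval n := by
  rw [Polynomial.eval_eq_sum_range, Polynomial.eval_eq_sum_range]
  exact Finset.sum_le_sum fun i _ => Nat.mul_le_mul_left _ (Nat.pow_le_pow_left h i)

theorem RamExpr.polyBdd_bitBound (e : RamExpr) : PolyBdd fun D => e.bitBound D := by
  induction e with
  | lit u => exact .const _
  | read a i _ => exact .id
  | op o e₁ e₂ h₁ h₂ => exact (h₁.add h₂).add (.const 1)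

theorem RamExpr.polyBdd_costBound (e : RamExpr) : PolyBdd fun D => e.costBound D := by
  induction e with
  | lit u => exact .const _
  | read a i h => exact ((h.add (.const 1)).add i.polyBdd_bitBound).add .id
  | op o e₁ e₂ h₁ h₂ =>
    exact (((h₁.add h₂).add (.const 1)).add e₁.polyBdd_bitBound).add e₂.polyBdd_bitBound

/-- The nesting depth of big loops. -/
def Cmd.bigDepth : Cmd → ℕ
  | skip => 0
  | asg _ _ _ => 0
  | toss _ _ => 0
  | seq P Q => max P.bigDepth Q.bigDepth
  | ite _ P Q => max P.bigDepth Q.bigDepth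
  | rep big _ _ P => P.bigDepth + bif big then 1 else 0

/-- The time of a program is polynomial, up to a factor `E` for each level of big loops. -/
theorem Cmd.exists_time_le (c : Cmd) :
    ∃ f : ℕ → ℕ, PolyBdd f ∧ ∀ D E, 1 ≤ E → c.time D E ≤ f D * E ^ c.bigDepth := by
  induction c with
  | skip => exact ⟨_, .const 1, by simp [time, bigDepth]⟩
  | asg a i e =>
    refine ⟨_, (((i.polyBdd_costBound.add e.polyBdd_costBound).add (.const 1)).add
      i.polyBdd_bitBound).add e.polyBdd_bitBound, fun D E _ => by simp [time, bigDepth]⟩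
  | toss a i =>
    exact ⟨_, ((i.polyBdd_costBound.add (.const 1)).add i.polyBdd_bitBound).add (.const 1),
      fun D E _ => by simp [time, bigDepth]⟩
  | seq P Q hP hQ =>
    obtain ⟨f, hf, h1⟩ := hP
    obtain ⟨g, hg, h2⟩ := hQ
    refine ⟨_, hf.add hg, fun D E hE => ?_⟩
    simp only [time, bigDepth, Nat.add_mul]
    exact add_le_add
      ((h1 D E hE).trans (Nat.mul_le_mul_left _ (Nat.pow_le_pow_right hE (le_max_left _ _))))
      ((h2 D E hE).trans (Nat.mul_le_mul_left _ (Nat.pow_le_pow_right hE (le_max_right _ _))))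
  | ite e P Q hP hQ =>
    obtain ⟨f, hf, h1⟩ := hP
    obtain ⟨g, hg, h2⟩ := hQ
    refine ⟨_, (e.polyBdd_costBound.add (.const 1)).add (hf.add hg), fun D E hE => ?_⟩
    simp only [time, bigDepth]
    rw [Nat.add_mul, Nat.add_mul (f D)]
    refine add_le_add (Nat.le_mul_of_pos_right _ (by positivity)) (add_le_add
      ((h1 D E hE).trans (Nat.mul_le_mul_left _ (Nat.pow_le_pow_right hE (le_max_left _ _))))
      ((h2 D E hE).trans (Nat.mul_le_mul_left _ (Nat.pow_le_pow_right hE (le_max_right _ _)))))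
  | rep big x e P hP =>
    obtain ⟨f, hf, h1⟩ := hP
    have hA : PolyBdd fun D => (e.costBound D + (D + 2) + 1 + e.bitBound D + D) + 1 :=
      ((((e.polyBdd_costBound.add (PolyBdd.id.add (.const 2))).add (.const 1)).add
        e.polyBdd_bitBound).add .id).add (.const 1)
    have hB : PolyBdd fun D => ((D + 2) + 5 + D + (1 + D + 1 + 1)) :=
      (((PolyBdd.id.add (.const 2)).add (.const 5)).add .id).add
        ((((PolyBdd.const 1).add .id).add (.const 1)).add (.const 1))
    cases big with
    | false =>
      refine ⟨_, (PolyBdd.const 3).add ((PolyBdd.id.mul (hA.add (hf.add hB))).add hA),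
        fun D E hE => ?_⟩
      have hp : 1 ≤ E ^ P.bigDepth := Nat.one_le_pow _ _ hE
      have h2 := h1 D E hE
      simp only [time, bigDepth, cond_false, Nat.add_zero]
      generalize e.costBound D + (D + 2) + 1 + e.bitBound D + D + 1 = A
      generalize D + 2 + 5 + D + (1 + D + 1 + 1) = B
      generalize E ^ P.bigDepth = K at *
      calc 3 + (D * (A + (P.time D E + B)) + A)
          ≤ 3 * K + (D * (A * K + (f D * K + B * K)) + A * K) := by
            gcongr <;> exact Nat.le_mul_of_pos_right _ hp
        _ = _ := by ring
    -- Only here a factor `E` appears, matched by the additional level of `bigDepth`. The factor `D`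
    -- of an ordinary loop goes into the polynomial.
    | true =>
      refine ⟨_, (PolyBdd.const 3).add ((hA.add (hf.add hB)).add hA), fun D E hE => ?_⟩
      have hp : 1 ≤ E ^ P.bigDepth := Nat.one_le_pow _ _ hE
      have h2 := h1 D E hE
      simp only [time, bigDepth, cond_true, pow_succ]
      generalize e.costBound D + (D + 2) + 1 + e.bitBound D + D + 1 = A
      generalize D + 2 + 5 + D + (1 + D + 1 + 1) = B
      generalize E ^ P.bigDepth = K at *
      have hKE : 1 ≤ K * E := Nat.mul_pos hp hE
      calc 3 + (E * (A + (P.time D E + B)) + A)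
          ≤ 3 * (K * E) + (E * (A * K + (f D * K + B * K)) + A * (K * E)) := by
            gcongr
            · exact Nat.le_mul_of_pos_right _ hKE
            · exact Nat.le_mul_of_pos_right _ hp
            · exact Nat.le_mul_of_pos_right _ hp
            · exact Nat.le_mul_of_pos_right _ hKE
        _ = _ := by ring


/-! ### Branching walks

A branching walk is a locally injective image of a rooted tree.  It is encoded as a binary tree:
`node w l r` is the forest of the children of a vertex `v` that consists of a child `w` with forest
`r` below it, and of the forest `l` of the smaller children of `v`. -/

namespace BranchingWalk

open BinaryTree

/-- The children of the top vertex. -/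
def chs : BinaryTree ℕ → Finset ℕ
  | nil => ∅
  | node w l _ => insert w (chs l)

/-- The nodes of a forest below `v`, each with the set of its neighbours. -/
def blk : BinaryTree ℕ → ℕ → List (ℕ × Finset ℕ)
  | nil, _ => []
  | node w l r, v => (w, insert v (chs r)) :: (blk l v ++ blk r w)

/-- The edges of a forest below `v`. -/
def edg : BinaryTree ℕ → ℕ → List (Sym2 ℕ)
  | nil, _ => []
  | node w l r, v => s(v, w) :: (edg l v ++ edg r w)

/-- The labelled objects of a forest below `v`: nodes in `V₁`, leaves, and edges that avoid `V₁`. -/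
def obj (V₁ : ℕ → Bool) : BinaryTree ℕ → ℕ → List (Sym2 ℕ)
  | nil, _ => []
  | node w l r, v => (if V₁ v = false ∧ V₁ w = false then [s(v, w)] else []) ++
      ((if V₁ w = true ∨ r = nil then [s(w, w)] else []) ++ (obj V₁ l v ++ obj V₁ r w))

/-- The number of inner nodes of a forest. -/
def inn : BinaryTree ℕ → ℕ
  | nil => 0
  | node _ l r => (if r = nil then 0 else 1) + inn l + inn r

/-- `X` is a forest below `v`, whose parent is `u`, in the graph `a` on `{0, …, n - 1}`; the
children of `v` are smaller than `m`. -/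
def Vld (a : ℕ → ℕ → Prop) (n : ℕ) : BinaryTree ℕ → ℕ → ℕ → ℕ → Prop
  | nil, _, _, _ => True
  | node w l r, u, v, m => w < m ∧ w ≠ u ∧ a v w ∧ Vld a n l u v w ∧ Vld a n r v w n

/-- The nodes of a branching walk with root `r`. -/
def fblk (r : ℕ) (X : BinaryTree ℕ) : List (ℕ × Finset ℕ) := (r, chs X) :: blk X r

/-- The labelled objects of a branching walk whose root `r` is a leaf. -/
def fobj (V₁ : ℕ → Bool) (r : ℕ) (X : BinaryTree ℕ) : List (Sym2 ℕ) := s(r, r) :: obj V₁ X r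

/-- `X` is a branching walk whose root `r` is a leaf. -/
def IsWalk (a : ℕ → ℕ → Prop) (n r : ℕ) (X : BinaryTree ℕ) : Prop :=
  (∃ c Y, X = node c nil Y) ∧ Vld a n X r r n

theorem chs_eq_empty {X : BinaryTree ℕ} : chs X = ∅ ↔ X = nil := by
  cases X <;> simp [chs]

theorem Vld.mem_chs {a : ℕ → ℕ → Prop} {n : ℕ} {X : BinaryTree ℕ} {u v m : ℕ}
    (h : Vld a n X u v m) {w : ℕ} (hw : w ∈ chs X) : w < m ∧ w ≠ u ∧ a v w := by
  induction X generalizing m with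
  | nil => simp [chs] at hw
  | node x l r hl _ =>
    obtain ⟨h1, h2, h3, h4, -⟩ := h
    simp only [chs, Finset.mem_insert] at hw
    rcases hw with rfl | hw
    · exact ⟨h1, h2, h3⟩
    · have := hl h4 hw
      exact ⟨this.1.trans h1, this.2⟩

theorem length_blk (X : BinaryTree ℕ) (v : ℕ) : (blk X v).length = X.numNodes := by
  induction X generalizing v with
  | nil => rfl
  | node w l r hl hr => simp [blk, numNodes, hl, hr]

theorem length_edg (X : BinaryTree ℕ) (v : ℕ) : (edg X v).length = X.numNodes := by
  induction X generalizing v with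
  | nil => rfl
  | node w l r hl hr => simp [edg, numNodes, hl, hr]

theorem length_obj_le (V₁ : ℕ → Bool) (X : BinaryTree ℕ) (v : ℕ) :
    (obj V₁ X v).length ≤ 2 * X.numNodes := by
  induction X generalizing v with
  | nil => simp [obj]
  | node w l r hl hr =>
    have := hl v
    have := hr w
    simp only [obj, List.length_append, numNodes]
    split_ifs <;> simp <;> omega

theorem inn_le (X : BinaryTree ℕ) : inn X ≤ X.numNodes := by
  induction X with
  | nil => simp [inn]
  | node w l r hl hr => simp only [inn, numNodes]; split_ifs <;> omega

/-- An edge of the forest that is mapped to vw has exactly one end over v, and this end is a node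
with w among its neighbours. By local injectivity a node accounts for w only once. The top node over
`v₀` is not listed in `blk`, whence the separate summand for its children. -/
theorem count_dart {a : ℕ → ℕ → Prop} {n : ℕ} (hirr : ∀ v, ¬ a v v) {X : BinaryTree ℕ} {u v₀ m : ℕ} (h : Vld a n X u v₀ m) (v w : ℕ) :
    (blk X v₀).countP (fun b => b.1 = v ∧ w ∈ b.2) + (if v = v₀ ∧ w ∈ chs X then 1 else 0) =
      (edg X v₀).count s(v, w) := by
  induction X generalizing u v₀ m with
  | nil => simp [blk, edg, chs]
  | node x l r hl hr =>
    obtain ⟨h1, h2, h3, h4, h5⟩ := h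
    have ihl := hl h4
    have ihr := hr h5
    have hx : v₀ ≠ x := fun h => hirr _ (h ▸ h3)
    have hvr : v₀ ∉ chs r := fun h => (h5.mem_chs h).2.1 rfl
    have hxl : x ∉ chs l := fun h => lt_irrefl _ (h4.mem_chs h).1
    simp only [blk, edg, chs, List.countP_cons, List.countP_append, List.count_cons,
      List.count_append, ← ihl, ← ihr, Finset.mem_insert, beq_iff_eq, decide_eq_true_eq,
      Sym2.eq_iff]
    by_cases e1 : v = v₀ <;> by_cases e2 : v = x <;> by_cases e3 : w = v₀ <;>
      by_cases e4 : w = x <;> simp_all <;> (try split_ifs) <;> grind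

/-- A node over a vertex of V₁ is always an object, any other node only if it is a leaf. Below the
top, being a leaf means having the parent as the only neighbour; the parent is not among the
children because walks do not turn back. -/
theorem count_diag {a : ℕ → ℕ → Prop} {n : ℕ} (hirr : ∀ v, ¬ a v v) {V₁ : ℕ → Bool} {X : BinaryTree ℕ} {u v₀ m : ℕ} (h : Vld a n X u v₀ m)
    (v : ℕ) :
    (blk X v₀).countP (fun b => b.1 = v ∧ (V₁ v = true ∨ b.2.card = 1)) =
      (obj V₁ X v₀).count s(v, v) := by
  induction X generalizing u v₀ m with
  | nil => simp [blk, obj]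
  | node x l r hl hr =>
    obtain ⟨h1, h2, h3, h4, h5⟩ := h
    have ihl := hl h4
    have ihr := hr h5
    have hx : v₀ ≠ x := fun h => hirr _ (h ▸ h3)
    have hvr : v₀ ∉ chs r := fun h => (h5.mem_chs h).2.1 rfl
    have hc : (insert v₀ (chs r)).card = 1 ↔ r = nil := by
      rw [Finset.card_insert_of_notMem hvr, ← chs_eq_empty, ← Finset.card_eq_zero]; omega
    have hd : s(v₀, x) ≠ s(v, v) := by
      intro h; rw [Sym2.eq_iff] at h; exact hx (by omega)
    simp only [blk, obj, List.countP_cons, List.countP_append, List.count_append, ← ihl, ← ihr, hc,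
      decide_eq_true_eq]
    have e1 : List.count s(v, v) (if V₁ v₀ = false ∧ V₁ x = false then [s(v₀, x)] else []) = 0 := by
      split_ifs <;> simp [hd]
    have e2 : List.count s(v, v) (if V₁ x = true ∨ r = nil then [s(x, x)] else []) =
        if x = v ∧ (V₁ v = true ∨ r = nil) then 1 else 0 := by
      by_cases hxv : x = v
      · subst hxv; split_ifs <;> simp_all
      · have : s(x, x) ≠ s(v, v) := by
          intro h; rw [Sym2.eq_iff] at h; exact hxv (by omega)
        split_ifs <;> simp_all
    rw [e1, e2]; omega

theorem count_obj_of_ne {a : ℕ → ℕ → Prop} {n : ℕ} {V₁ : ℕ → Bool} {X : BinaryTree ℕ} {u v₀ m : ℕ} (h : Vld a n X u v₀ m)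
    {v w : ℕ} (hvw : v ≠ w) :
    (obj V₁ X v₀).count s(v, w) =
      if V₁ v = false ∧ V₁ w = false then (edg X v₀).count s(v, w) else 0 := by
  induction X generalizing u v₀ m with
  | nil => simp [edg, obj]
  | node x l r hl hr =>
    obtain ⟨h1, h2, h3, h4, h5⟩ := h
    have ihl := hl h4
    have ihr := hr h5
    have e2 : List.count s(v, w) (if V₁ x = true ∨ r = nil then [s(x, x)] else []) = 0 := by
      have : s(x, x) ≠ s(v, w) := by
        intro h; rw [Sym2.eq_iff] at h; exact hvw (by omega)
      split_ifs <;> simp [this]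
    have e1 : List.count s(v, w) (if V₁ v₀ = false ∧ V₁ x = false then [s(v₀, x)] else []) =
        if V₁ v = false ∧ V₁ w = false then (if s(v₀, x) = s(v, w) then 1 else 0) else 0 := by
      by_cases he : s(v₀, x) = s(v, w)
      · rcases Sym2.eq_iff.1 he with ⟨rfl, rfl⟩ | ⟨rfl, rfl⟩
        · split_ifs <;> simp_all
        · split_ifs <;> simp_all
      · split_ifs <;> simp [he]
    simp only [obj, edg, List.count_append, List.count_cons, ihl, ihr, e1, e2, beq_iff_eq]
    split_ifs <;> omega

theorem inn_eq {a : ℕ → ℕ → Prop} {n : ℕ} {X : BinaryTree ℕ} {u v₀ m : ℕ} (h : Vld a n X u v₀ m) :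
    inn X = (blk X v₀).countP (fun b => b.2.card ≠ 1) := by
  induction X generalizing u v₀ m with
  | nil => simp [blk, inn]
  | node x l r hl hr =>
    obtain ⟨h1, h2, h3, h4, h5⟩ := h
    have hvr : v₀ ∉ chs r := fun h => (h5.mem_chs h).2.1 rfl
    have hc : (insert v₀ (chs r)).card = 1 ↔ r = nil := by
      rw [Finset.card_insert_of_notMem hvr, ← chs_eq_empty, ← Finset.card_eq_zero]; omega
    simp only [blk, inn, List.countP_cons, List.countP_append, hl h4, hr h5, ne_eq, hc,
      decide_eq_true_eq]
    split_ifs <;> omega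

/-- A forest is determined by its top children and its set of nodes. -/
theorem Vld.ext {a : ℕ → ℕ → Prop} {n : ℕ} {S : Finset (ℕ × Finset ℕ)}
    (hS : ∀ v N N', (v, N) ∈ S → (v, N') ∈ S → ∀ w ∈ N, w ∈ N' → N = N') {X X' : BinaryTree ℕ}
    {u v m m' : ℕ} (h : Vld a n X u v m) (h' : Vld a n X' u v m') (hc : chs X = chs X')
    (hX : ∀ b ∈ blk X v, b ∈ S) (hX' : ∀ b ∈ blk X' v, b ∈ S) : X = X' := by
  induction X generalizing u v m m' X' with
  | nil => exact (chs_eq_empty.1 hc.symm).symm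
  | node x l r hl hr =>
    cases X' with
    | nil => simp [chs] at hc
    | node x' l' r' =>
      obtain ⟨-, -, -, h4, h5⟩ := h
      obtain ⟨-, -, -, h4', h5'⟩ := h'
      have hxl : x ∉ chs l := fun h => lt_irrefl _ (h4.mem_chs h).1
      have hxl' : x' ∉ chs l' := fun h => lt_irrefl _ (h4'.mem_chs h).1
      have hxx : x = x' := by
        have m1 : x ∈ chs (node x' l' r') := hc ▸ Finset.mem_insert_self _ _
        have m2 : x' ∈ chs (node x l r) := hc ▸ Finset.mem_insert_self _ _
        simp only [chs, Finset.mem_insert] at m1 m2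
        rcases m1 with m1 | m1
        · exact m1
        · rcases m2 with m2 | m2
          · exact m2.symm
          · have := (h4.mem_chs m2).1; have := (h4'.mem_chs m1).1; omega
      subst hxx
      have hll : chs l = chs l' := by
        have := congrArg (fun s => Finset.erase s x) hc
        simpa [chs, hxl, hxl'] using this
      have hvr : v ∉ chs r := fun h => (h5.mem_chs h).2.1 rfl
      have hvr' : v ∉ chs r' := fun h => (h5'.mem_chs h).2.1 rfl
      -- Both nodes over `x` have their parent `v` as a neighbour, so `hS` identifies them.
      have hrr : chs r = chs r' := by
        have := hS x _ _ (hX (x, insert v (chs r)) (by simp [blk]))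
          (hX' (x, insert v (chs r')) (by simp [blk])) v (by simp) (by simp)
        have := congrArg (fun s => Finset.erase s v) this
        simpa [hvr, hvr'] using this
      rw [hl h4 h4' hll (fun b hb => hX b (by simp [blk, hb])) (fun b hb => hX' b (by simp [blk, hb])),
        hr h5 h5' hrr (fun b hb => hX b (by simp [blk, hb])) (fun b hb => hX' b (by simp [blk, hb]))]

end BranchingWalk


/-! ### Systems of nodes, and their unfolding into branching walks -/

namespace BranchingWalk

open BinaryTree Relation

/-- Two nodes are linked if each is among the neighbours of the other. -/
def Lnk (S : Finset (ℕ × Finset ℕ)) (b b' : ℕ × Finset ℕ) : Prop :=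
  b ∈ S ∧ b' ∈ S ∧ b'.1 ∈ b.2 ∧ b.1 ∈ b'.2

theorem Lnk.symm {S : Finset (ℕ × Finset ℕ)} {b b' : ℕ × Finset ℕ} (h : Lnk S b b') : Lnk S b' b :=
  ⟨h.2.1, h.1, h.2.2.2, h.2.2.1⟩

/-- The node sets of branching walks without repeated objects. -/
structure IsSys (a : ℕ → ℕ → Prop) (V₁ : ℕ → Bool) (r : ℕ) (S : Finset (ℕ × Finset ℕ)) : Prop where
  adj : ∀ v N, (v, N) ∈ S → ∀ w ∈ N, a v w
  uniq : ∀ v N N', (v, N) ∈ S → (v, N') ∈ S → ∀ w ∈ N, w ∈ N' → N = N'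
  symm : ∀ v N, (v, N) ∈ S → ∀ w ∈ N, ∃ M, (w, M) ∈ S ∧ v ∈ M
  root : ∃ c, (r, {c}) ∈ S
  leaf : ∀ v x y, (v, {x}) ∈ S → (v, {y}) ∈ S → x = y
  one : ∀ v N N', V₁ v = true → (v, N) ∈ S → (v, N') ∈ S → N = N'
  conn : ∀ b ∈ S, ∀ b' ∈ S, ReflTransGen (Lnk S) b b'
  card : ∑ b ∈ S, b.2.card + 2 = 2 * S.card

/-- The graph on a set of nodes. -/
def lnkGraph (S : Finset (ℕ × Finset ℕ)) : SimpleGraph S where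
  Adj b b' := b ≠ b' ∧ Lnk S b b'
  symm := ⟨fun _ _ h => ⟨h.1.symm, h.2.symm⟩⟩
  loopless := ⟨fun _ h => h.1 rfl⟩

namespace IsSys

variable {a : ℕ → ℕ → Prop} {V₁ : ℕ → Bool} {r : ℕ} {S : Finset (ℕ × Finset ℕ)}

theorem ne_of_lnk (h : IsSys a V₁ r S) (hirr : ∀ v, ¬ a v v) {b b' : ℕ × Finset ℕ}
    (hb : Lnk S b b') : b.1 ≠ b'.1 := fun he => hirr b.1 (by
  have := h.adj b.1 b.2 hb.1 _ hb.2.2.1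
  rwa [← he] at this)

/-- By `uniq` and `symm` a node (v, N) is linked to exactly one node over each element of N, so its
degree is |N|. Then `card` says that there is one edge less than there are nodes, and `conn` gives
connectedness. -/
theorem isTree (h : IsSys a V₁ r S) (hirr : ∀ v, ¬ a v v) : (lnkGraph S).IsTree := by
  classical
  obtain ⟨c, hc⟩ := h.root
  rw [SimpleGraph.isTree_iff_connected_and_card]
  refine ⟨(SimpleGraph.connected_iff _).2 ⟨?_, ⟨⟨_, hc⟩⟩⟩, ?_⟩
  · rintro ⟨b, hb⟩ ⟨b', hb'⟩
    have : ∀ x, ReflTransGen (Lnk S) b x → ∀ hx : x ∈ S, (lnkGraph S).Reachable ⟨b, hb⟩ ⟨x, hx⟩ := by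
      intro x hx
      induction hx with
      | refl => intro _; exact SimpleGraph.Reachable.refl _
      | tail _ hl ih =>
        intro hx
        refine (ih hl.1).trans (SimpleGraph.Adj.reachable ⟨?_, hl⟩)
        intro he
        exact h.ne_of_lnk hirr hl (congrArg (fun z : S => z.1.1) he)
    exact this b' (h.conn b hb b' hb') hb'
  · have hdeg : ∀ b : S, (lnkGraph S).degree b = b.1.2.card := by
      rintro ⟨⟨v, N⟩, hb⟩
      rw [← SimpleGraph.card_neighborFinset_eq_degree]
      refine Finset.card_bij (fun x _ => x.1.1) ?_ ?_ ?_
      · intro x hx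
        rw [SimpleGraph.mem_neighborFinset] at hx
        exact hx.2.2.2.1
      · rintro ⟨⟨x, M⟩, hx⟩ hx' ⟨⟨y, M'⟩, hy⟩ hy' (he : x = y)
        subst he
        rw [SimpleGraph.mem_neighborFinset] at hx' hy'
        have := h.uniq x M M' hx hy v hx'.2.2.2.2 hy'.2.2.2.2
        subst this; rfl
      · intro w hw
        obtain ⟨M, hM, hv⟩ := h.symm v N hb w hw
        refine ⟨⟨(w, M), hM⟩, ?_, rfl⟩
        rw [SimpleGraph.mem_neighborFinset]
        have hl : Lnk S (v, N) (w, M) := ⟨hb, hM, hw, hv⟩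
        exact ⟨fun he => h.ne_of_lnk hirr hl (congrArg (fun z : S => z.1.1) he), hl⟩
    have h1 := (lnkGraph S).sum_degrees_eq_twice_card_edges
    simp only [hdeg] at h1
    rw [Finset.sum_coe_sort S (fun b => b.2.card)] at h1
    have h2 := h.card
    rw [Nat.card_eq_fintype_card, Nat.card_eq_fintype_card, Fintype.card_coe,
      ← SimpleGraph.edgeFinset_card]
    omega

/-- The distances from the root. -/
theorem exists_level (h : IsSys a V₁ r S) (hirr : ∀ v, ¬ a v v) {ρ : ℕ × Finset ℕ} (hρ : ρ ∈ S) :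
    ∃ d : ℕ × Finset ℕ → ℕ, (∀ b ∈ S, d b = 0 ↔ b = ρ) ∧
      (∀ b b', Lnk S b b' → d b = d b' + 1 ∨ d b' = d b + 1) ∧
      (∀ b ∈ S, b ≠ ρ → ∃ p, Lnk S b p ∧ d b = d p + 1) ∧
      (∀ b p p', Lnk S b p → Lnk S b p' → d b = d p + 1 → d b = d p' + 1 → p = p') := by
  classical
  have ht := h.isTree hirr
  let Γ := lnkGraph S
  let d : ℕ × Finset ℕ → ℕ := fun b => if hb : b ∈ S then Γ.dist ⟨ρ, hρ⟩ ⟨b, hb⟩ else 0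
  have hd : ∀ b (hb : b ∈ S), d b = Γ.dist ⟨ρ, hρ⟩ ⟨b, hb⟩ := fun b hb => dif_pos hb
  have hadj : ∀ {b b'} (hl : Lnk S b b'), Γ.Adj ⟨b, hl.1⟩ ⟨b', hl.2.1⟩ := fun {b b'} hl =>
    ⟨fun he => h.ne_of_lnk hirr hl (congrArg (fun z : S => z.1.1) he), hl⟩
  have h0 : ∀ b ∈ S, d b = 0 ↔ b = ρ := by
    intro b hb
    rw [hd b hb, ht.1.dist_eq_zero_iff]
    constructor
    · intro he; exact (congrArg Subtype.val he).symm
    · rintro rfl; rfl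
  refine ⟨d, h0, ?_, ?_, ?_⟩
  · intro b b' hl
    rw [hd b hl.1, hd b' hl.2.1]
    exact ht.dist_eq_dist_add_one_of_adj _ (hadj hl)
  · intro b hb hne
    -- The parent of `b` is the last vertex but one of a shortest walk from the root.
    obtain ⟨p, hp⟩ := ht.1.exists_walk_length_eq_dist ⟨ρ, hρ⟩ ⟨b, hb⟩
    have hl : p.length ≠ 0 := by
      rw [hp, ← hd b hb]; exact fun he => hne ((h0 b hb).1 he)
    have hnn : ¬ p.Nil := fun hn => hl (SimpleGraph.Walk.length_eq_zero_iff.2 hn)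
    have ha := p.adj_penultimate hnn
    refine ⟨p.penultimate.1, ha.symm.2, ?_⟩
    rcases ht.dist_eq_dist_add_one_of_adj ⟨ρ, hρ⟩ ha with he | he
    · exfalso
      have h1 : Γ.dist ⟨ρ, hρ⟩ p.penultimate ≤ p.dropLast.length := SimpleGraph.dist_le _
      rw [SimpleGraph.Walk.length_dropLast] at h1
      have he' : Γ.dist ⟨ρ, hρ⟩ p.penultimate = Γ.dist ⟨ρ, hρ⟩ ⟨b, hb⟩ + 1 := he
      have hp' : p.length = Γ.dist ⟨ρ, hρ⟩ ⟨b, hb⟩ := hp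
      omega
    · rw [hd b hb, hd _ p.penultimate.2]; exact he
  · intro b p p' hl hl' e1 e2
    -- Two different parents would yield two paths from the root to `b`.
    have hcon : ∀ {q} (hq : Lnk S b q), d b = d q + 1 →
        ∃ w : Γ.Walk ⟨ρ, hρ⟩ ⟨b, hl.1⟩, w.IsPath ∧ w.penultimate = ⟨q, hq.2.1⟩ := by
      intro q hq e
      obtain ⟨w, hw⟩ := ht.1.exists_walk_length_eq_dist ⟨ρ, hρ⟩ ⟨q, hq.2.1⟩
      refine ⟨w.concat (hadj hq).symm, ?_, SimpleGraph.Walk.penultimate_concat _ _⟩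
      apply SimpleGraph.Walk.isPath_of_length_eq_dist
      rw [SimpleGraph.Walk.length_concat, hw, ← hd, ← hd, e]
    obtain ⟨w, hw, hwp⟩ := hcon hl e1
    obtain ⟨w', hw', hwp'⟩ := hcon hl' e2
    have := (ht.existsUnique_path _ _).unique hw hw'
    subst this
    exact congrArg Subtype.val (hwp.symm.trans hwp')

end IsSys

/-- The forest with children `l` (in decreasing order) and subforests `sub`. -/
def mkForest (sub : ℕ → BinaryTree ℕ) : List ℕ → BinaryTree ℕ
  | [] => nil
  | w :: l => node w (mkForest sub l) (sub w)

theorem chs_mkForest (sub : ℕ → BinaryTree ℕ) (l : List ℕ) : chs (mkForest sub l) = l.toFinset := by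
  induction l with
  | nil => rfl
  | cons w l ih => simp [mkForest, chs, ih]

theorem vld_mkForest {a : ℕ → ℕ → Prop} {n : ℕ} {sub : ℕ → BinaryTree ℕ} {u v : ℕ} {l : List ℕ}
    (hl : l.Pairwise (· > ·)) (h : ∀ w ∈ l, w ≠ u ∧ a v w ∧ Vld a n (sub w) v w n) {m : ℕ}
    (hm : ∀ w ∈ l, w < m) : Vld a n (mkForest sub l) u v m := by
  induction l generalizing m with
  | nil => trivial
  | cons w l ih =>
    rw [List.pairwise_cons] at hl
    have := h w (by simp)
    exact ⟨hm w (by simp), this.1, this.2.1, ih hl.2 (fun x hx => h x (by simp [hx])) hl.1, this.2.2⟩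

theorem count_blk_mkForest (sub : ℕ → BinaryTree ℕ) (v : ℕ) {l : List ℕ} (hl : l.Nodup)
    (b : ℕ × Finset ℕ) :
    (blk (mkForest sub l) v).count b =
      ∑ w ∈ l.toFinset, ((w, insert v (chs (sub w))) :: blk (sub w) w).count b := by
  induction l with
  | nil => simp [mkForest, blk]
  | cons w l ih =>
    rw [List.nodup_cons] at hl
    rw [List.toFinset_cons, Finset.sum_insert (by simpa using hl.1), ← ih hl.2]
    simp only [mkForest, blk, List.count_cons, List.count_append]
    omega

open Classical in
/-- The neighbours of the node `w` that is reached from `v`. -/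
noncomputable def nbSet (S : Finset (ℕ × Finset ℕ)) (v w : ℕ) : Finset ℕ :=
  if h : ∃ N, (w, N) ∈ S ∧ v ∈ N then h.choose else ∅

/-- The forest below `v`, reached from `u`, up to depth `f`. -/
noncomputable def unfold (S : Finset (ℕ × Finset ℕ)) : ℕ → ℕ → ℕ → BinaryTree ℕ
  | 0, _, _ => nil
  | f + 1, u, v => mkForest (fun w => unfold S f v w) (((nbSet S u v).erase u).sort (· ≥ ·))

theorem IsSys.nbSet_eq {a : ℕ → ℕ → Prop} {V₁ : ℕ → Bool} {r : ℕ} {S : Finset (ℕ × Finset ℕ)}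
    (h : IsSys a V₁ r S) {v w : ℕ} {N : Finset ℕ} (hN : (w, N) ∈ S) (hv : v ∈ N) :
    nbSet S v w = N := by
  have hex : ∃ N, (w, N) ∈ S ∧ v ∈ N := ⟨N, hN, hv⟩
  rw [nbSet, dif_pos hex]
  exact h.uniq w _ _ hex.choose_spec.1 hN v hex.choose_spec.2 hv

/-- Every system is the set of nodes of a branching walk. -/
theorem IsSys.exists_isWalk {a : ℕ → ℕ → Prop} {V₁ : ℕ → Bool} {r n : ℕ}
    {S : Finset (ℕ × Finset ℕ)} (h : IsSys a V₁ r S) (hirr : ∀ v, ¬ a v v)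
    (ha : ∀ v w, a v w → w < n) :
    ∃ X, IsWalk a n r X ∧ (fblk r X).Nodup ∧ (fblk r X).toFinset = S := by
  classical
  obtain ⟨c, hc⟩ := h.root
  obtain ⟨d, d0, dl, dex, duq⟩ := h.exists_level hirr hc
  -- `pb b` is the parent of `b` when the tree is rooted at the leaf node (r, {c}).
  choose! pb hpb using dex
  let D := S.sup d + 1
  have hD : ∀ b ∈ S, d b < D := fun b hb => Nat.lt_succ_of_le (Finset.le_sup hb)
  have hiter : ∀ k b, b ∈ S → k ≤ d b → pb^[k] b ∈ S ∧ d (pb^[k] b) + k = d b := by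
    intro k
    induction k with
    | zero => intro b hb _; exact ⟨hb, rfl⟩
    | succ k ih =>
      intro b hb hk
      have hne : b ≠ (r, {c}) := fun he => by rw [(d0 b hb).2 he] at hk; omega
      have := hpb b hb hne
      have := ih (pb b) this.1.2.1 (by omega)
      rw [Function.iterate_succ_apply]
      exact ⟨this.1, by omega⟩
  -- The depth `f` of the unfolding complements the level of (v, N), so all descendants are reached.
  -- The last clause says that each descendant of (v, N) is listed exactly once and nothing else is;
  -- a node descends from (v, N) if its ancestor on that level is (v, N).
  have key : ∀ f u v N, (v, N) ∈ S → u ∈ N → (v, N) ≠ (r, {c}) → (pb (v, N)).1 = u →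
      f + d (v, N) = D → chs (unfold S f u v) = N.erase u ∧ Vld a n (unfold S f u v) u v n ∧
        ∀ b, ((v, N) :: blk (unfold S f u v) v).count b =
          if b ∈ S ∧ d (v, N) ≤ d b ∧ pb^[d b - d (v, N)] b = (v, N) then 1 else 0 := by
    intro f
    induction f with
    | zero => intro u v N hN _ _ _ he; have := hD _ hN; omega
    | succ f ih =>
      intro u v N hN hu hne hpu hf
      have hnb := h.nbSet_eq hN hu
      have hsort : ((N.erase u).sort (· ≥ ·)).toFinset = N.erase u := Finset.sort_toFinset _ _
      have hpw : ((N.erase u).sort (· ≥ ·)).Pairwise (· > ·) := by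
        have h1 := Finset.pairwise_sort (N.erase u) (· ≥ ·)
        have h2 : ((N.erase u).sort (· ≥ ·)).Nodup := Finset.sort_nodup _ _
        exact (h1.and h2).imp fun h => lt_of_le_of_ne h.1 (Ne.symm h.2)
      have hP := hpb _ hN hne
      have hpN : pb (v, N) ∈ S := hP.1.2.1
      have child : ∀ w ∈ N.erase u, ((w, nbSet S v w) ∈ S ∧ v ∈ nbSet S v w ∧
          (w, nbSet S v w) ≠ (r, {c}) ∧ (pb (w, nbSet S v w)) = (v, N) ∧
          d (w, nbSet S v w) = d (v, N) + 1) := by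
        intro w hw
        rw [Finset.mem_erase] at hw
        obtain ⟨M, hM, hvM⟩ := h.symm v N hN w hw.2
        rw [h.nbSet_eq hM hvM]
        have hl : Lnk S (v, N) (w, M) := ⟨hN, hM, hw.2, hvM⟩
        -- The only neighbour on a lower level is the parent, and the parent lies over u, which
        -- differs from w.
        have hd1 : d (w, M) = d (v, N) + 1 := by
          rcases dl _ _ hl with e | e
          · exfalso
            have := duq _ _ _ hl hP.1 e hP.2
            rw [← this] at hpu
            exact hw.1 hpu
          · exact e
        have hne' : (w, M) ≠ (r, {c}) := fun he => by
          have := (d0 _ hM).2 he; omega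
        have h3 := hpb _ hM hne'
        exact ⟨hM, hvM, hne', duq _ _ _ h3.1 hl.symm h3.2 hd1, hd1⟩
      have ihc : ∀ w ∈ N.erase u, _ := fun w hw =>
        ih v w (nbSet S v w) (child w hw).1 (child w hw).2.1 (child w hw).2.2.1
          (by rw [(child w hw).2.2.2.1]) (by have := (child w hw).2.2.2.2; omega)
      simp only [unfold, hnb]
      refine ⟨by rw [chs_mkForest, hsort], ?_, ?_⟩
      · refine vld_mkForest hpw (fun w hw => ?_) (fun w hw => ?_)
        · have hw' : w ∈ N.erase u := by rwa [← hsort, List.mem_toFinset]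
          exact ⟨(Finset.mem_erase.1 hw').1, h.adj v N hN w (Finset.mem_erase.1 hw').2,
            (ihc w hw').2.1⟩
        · have hw' : w ∈ N.erase u := by rwa [← hsort, List.mem_toFinset]
          exact ha v w (h.adj v N hN w (Finset.mem_erase.1 hw').2)
      · intro b
        rw [List.count_cons, count_blk_mkForest _ _ (Finset.sort_nodup _ _), hsort]
        have e1 : ∑ w ∈ N.erase u,
            ((w, insert v (chs (unfold S f v w))) :: blk (unfold S f v w) w).count b =
            ∑ w ∈ N.erase u, if b ∈ S ∧ d (v, N) + 1 ≤ d b ∧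
              pb^[d b - (d (v, N) + 1)] b = (w, nbSet S v w) then 1 else 0 := by
          refine Finset.sum_congr rfl fun w hw => ?_
          have h1 := child w hw
          have h2 := ihc w hw
          rw [h2.1, Finset.insert_erase h1.2.1, h2.2.2 b, h1.2.2.2.2]
        rw [e1]
        by_cases hb : b ∈ S
        swap
        · have : (v, N) ≠ b := fun he => hb (he ▸ hN)
          simp [hb, this]
        by_cases hlt : d (v, N) + 1 ≤ d b
        -- `x` is the ancestor of `b` one level below (v, N). So `b` descends from (v, N) exactly if
        -- `x` is one of the children of (v, N), and then from that child only.
        · set x := pb^[d b - (d (v, N) + 1)] b with hx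
          have hxi := hiter (d b - (d (v, N) + 1)) b hb (by omega)
          rw [← hx] at hxi
          have hxd : d x = d (v, N) + 1 := by omega
          have hxne : x ≠ (r, {c}) := fun he => by
            have := (d0 x hxi.1).2 he; omega
          have hvb : (v, N) ≠ b := fun he => by rw [he] at hlt; omega
          have hpx : pb^[d b - d (v, N)] b = pb x := by
            rw [hx, ← Function.iterate_succ_apply' pb]; congr 1; omega
          have hPx := hpb x hxi.1 hxne
          have hiff : pb x = (v, N) ↔ ∃ w ∈ N.erase u, x = (w, nbSet S v w) := by
            constructor
            · intro he
              rw [he] at hPx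
              have hxS : (x.1, x.2) ∈ S := hxi.1
              refine ⟨x.1, Finset.mem_erase.2 ⟨?_, hPx.1.2.2.2⟩, ?_⟩
              · intro hxu
                have hq := h.symm v N hN u hu
                have h4 : x.2 = (pb (v, N)).2 := by
                  have hpN' : (x.1, (pb (v, N)).2) ∈ S := by
                    rw [hxu, ← hpu]; exact hpN
                  exact h.uniq x.1 _ _ hxS hpN' v hPx.1.2.2.1 hP.1.2.2.2
                have h5 : x = pb (v, N) := Prod.ext (hxu.trans hpu.symm) h4
                have := hP.2
                rw [← h5] at this; omega
              · rw [h.nbSet_eq hxS hPx.1.2.2.1]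
            · rintro ⟨w, hw, he⟩
              rw [he]; exact (child w hw).2.2.2.1
          have hvb' : ((v, N) == b) = false := beq_false_of_ne hvb
          have hbv : ((v, N) == b) = false := hvb'
          by_cases hp : pb x = (v, N)
          · obtain ⟨w, hw, he⟩ := hiff.1 hp
            rw [Finset.sum_eq_single_of_mem w hw]
            · have : d (v, N) ≤ d b := by omega
              simp [hb, hlt, he, hpx, this, hvb, he ▸ hp]
            · intro w' _ hne'
              rw [if_neg]
              rintro ⟨-, -, he'⟩
              rw [he] at he'
              exact hne' (congrArg Prod.fst he').symm
          · rw [Finset.sum_eq_zero]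
            · simp [hpx, hp, hvb]
            · intro w hw
              rw [if_neg]
              rintro ⟨-, -, he'⟩
              exact hp (hiff.2 ⟨w, hw, he'⟩)
        · rw [Finset.sum_eq_zero (fun w _ => if_neg fun hh => hlt hh.2.1), zero_add]
          by_cases hvb : (v, N) = b
          · subst hvb; simp [hb]
          · have : ¬ (b ∈ S ∧ d (v, N) ≤ d b ∧ pb^[d b - d (v, N)] b = (v, N)) := by
              rintro ⟨-, h1, h2⟩
              have : d b - d (v, N) = 0 := by omega
              rw [this] at h2
              exact hvb h2.symm
            simp [hvb, this]
  obtain ⟨M, hM, hrM⟩ := h.symm r {c} hc c (by simp)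
  have hl : Lnk S (r, {c}) (c, M) := ⟨hc, hM, by simp, hrM⟩
  have hrc : r ≠ c := h.ne_of_lnk hirr hl
  have hneM : (c, M) ≠ (r, {c}) := fun he => hrc (congrArg Prod.fst he).symm
  have hd0 : d (r, {c}) = 0 := (d0 _ hc).2 rfl
  have hd1 : d (c, M) = 1 := by
    rcases dl _ _ hl with e | e
    · omega
    · omega
  have hP := hpb _ hM hneM
  have hpM : pb (c, M) = (r, {c}) := (d0 _ hP.1.2.1).1 (by omega)
  obtain ⟨k1, k2, k3⟩ := key (S.sup d) r c M hM hrM hneM (by rw [hpM]) (by rw [hd1])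
  refine ⟨node c nil (unfold S (S.sup d) r c), ⟨⟨_, _, rfl⟩, ?_⟩, ?_⟩
  · exact ⟨ha r c (h.adj r {c} hc c (by simp)), hrc.symm, h.adj r {c} hc c (by simp), trivial, k2⟩
  -- The root has a single neighbour (c, M), so every other node descends from (c, M).
  · have hcount : ∀ b, (fblk r (node c nil (unfold S (S.sup d) r c))).count b =
        if b ∈ S then 1 else 0 := by
      intro b
      have e : fblk r (node c nil (unfold S (S.sup d) r c)) =
          (r, {c}) :: ((c, M) :: blk (unfold S (S.sup d) r c) c) := by
        simp [fblk, chs, blk, k1, Finset.insert_erase hrM]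
      rw [e, List.count_cons, k3 b, hd1]
      by_cases hb : b ∈ S
      · by_cases hbr : b = (r, {c})
        · subst hbr; simp [hd0, hb]
        · have h1 : 1 ≤ d b := Nat.one_le_iff_ne_zero.2 fun he => hbr ((d0 b hb).1 he)
          have h2 := hiter (d b - 1) b hb (by omega)
          have hxne : pb^[d b - 1] b ≠ (r, {c}) := fun he => by
            have := (d0 _ h2.1).2 he; omega
          have h3 := hpb _ h2.1 hxne
          have h4 : pb (pb^[d b - 1] b) = (r, {c}) := (d0 _ h3.1.2.1).1 (by omega)
          rw [h4] at h3
          have h5 : (pb^[d b - 1] b).1 = c := by simpa using h3.1.2.2.2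
          have h6 : pb^[d b - 1] b = (c, M) := by
            refine Prod.ext h5 (h.uniq c _ _ ?_ hM r h3.1.2.2.1 hrM)
            rw [← h5]; exact h2.1
          simp [hb, h1, h6, Ne.symm hbr]
      · have : (r, {c}) ≠ b := fun he => hb (he ▸ hc)
        simp [hb, this]
    constructor
    · rw [List.nodup_iff_count_le_one]
      intro b; rw [hcount]; split_ifs <;> omega
    · ext b
      rw [List.mem_toFinset, ← List.count_pos_iff, hcount]
      split_ifs with hb <;> simp [hb]

end BranchingWalk


/-! ### Walks with distinct objects versus systems of nodes -/

namespace BranchingWalk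

open BinaryTree Relation

theorem two_le_countP {α : Type*} {p : α → Bool} {l : List α} {x y : α} (hx : x ∈ l) (hy : y ∈ l)
    (hxy : x ≠ y) (px : p x = true) (py : p y = true) : 2 ≤ l.countP p := by
  classical
  rw [List.countP_eq_length_filter]
  refine le_trans ?_ (List.toFinset_card_le _)
  exact Finset.one_lt_card.2 ⟨x, by simp [hx, px], y, by simp [hy, py], hxy⟩

theorem lnk_symm {S : Finset (ℕ × Finset ℕ)} {b b' : ℕ × Finset ℕ}
    (h : ReflTransGen (Lnk S) b b') : ReflTransGen (Lnk S) b' b := by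
  induction h with
  | refl => exact .refl
  | tail _ hl ih => exact .head hl.symm ih

theorem Lnk.mono {S T : Finset (ℕ × Finset ℕ)} (h : S ⊆ T) {b b' : ℕ × Finset ℕ} (hb : Lnk S b b') :
    Lnk T b b' := ⟨h hb.1, h hb.2.1, hb.2.2⟩

theorem lnk_mono {S T : Finset (ℕ × Finset ℕ)} (h : S ⊆ T) {b b' : ℕ × Finset ℕ}
    (hb : ReflTransGen (Lnk S) b b') : ReflTransGen (Lnk T) b b' := by
  induction hb with
  | refl => exact .refl
  | tail _ hl ih => exact ih.tail (hl.mono h)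

section walk

variable {a : ℕ → ℕ → Prop} {n : ℕ} {V₁ : ℕ → Bool} {r : ℕ} {X : BinaryTree ℕ}

theorem Vld.adj_blk (hsymm : ∀ v w, a v w → a w v) {u v m : ℕ} (h : Vld a n X u v m) :
    ∀ b ∈ blk X v, ∀ w ∈ b.2, a b.1 w := by
  induction X generalizing u v m with
  | nil => simp [blk]
  | node x l r hl hr =>
    obtain ⟨h1, h2, h3, h4, h5⟩ := h
    intro b hb w hw
    simp only [blk, List.mem_cons, List.mem_append] at hb
    rcases hb with rfl | hb | hb
    · simp only [Finset.mem_insert] at hw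
      rcases hw with rfl | hw
      · exact hsymm _ _ h3
      · exact (h5.mem_chs hw).2.2
    · exact hl h4 b hb w hw
    · exact hr h5 b hb w hw

theorem blk_nonempty (X : BinaryTree ℕ) (v : ℕ) : ∀ b ∈ blk X v, b.2.Nonempty := by
  induction X generalizing v with
  | nil => simp [blk]
  | node x l r hl hr =>
    intro b hb
    simp only [blk, List.mem_cons, List.mem_append] at hb
    rcases hb with rfl | hb | hb
    · exact Finset.insert_nonempty _ _
    · exact hl v b hb
    · exact hr x b hb

/-- Handshake: each edge is counted at both of its ends, at the top vertex by `chs X`. -/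
theorem Vld.sum_card {u v m : ℕ} (h : Vld a n X u v m) :
    ((blk X v).map fun b => b.2.card).sum + (chs X).card = 2 * X.numNodes := by
  induction X generalizing u v m with
  | nil => simp [blk, chs]
  | node x l r hl hr =>
    obtain ⟨h1, h2, h3, h4, h5⟩ := h
    have hvr : v ∉ chs r := fun h => (h5.mem_chs h).2.1 rfl
    have hxl : x ∉ chs l := fun h => lt_irrefl _ (h4.mem_chs h).1
    have := hl h4
    have := hr h5
    simp only [blk, chs, List.map_cons, List.map_append, List.sum_cons, List.sum_append,
      Finset.card_insert_of_notMem hvr, Finset.card_insert_of_notMem hxl, numNodes]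
    omega

theorem Vld.linked {S : Finset (ℕ × Finset ℕ)} {u v m : ℕ} (h : Vld a n X u v m) {N : Finset ℕ}
    (hN : (v, N) ∈ S) (hc : chs X ⊆ N) (hS : ∀ b ∈ blk X v, b ∈ S) :
    ∀ b ∈ blk X v, ReflTransGen (Lnk S) (v, N) b := by
  induction X generalizing u v m N with
  | nil => simp [blk]
  | node x l r hl hr =>
    obtain ⟨h1, h2, h3, h4, h5⟩ := h
    have hx : (x, insert v (chs r)) ∈ S := hS _ (by simp [blk])
    have hlk : Lnk S (v, N) (x, insert v (chs r)) :=
      ⟨hN, hx, hc (by simp [chs]), by simp⟩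
    intro b hb
    simp only [blk, List.mem_cons, List.mem_append] at hb
    rcases hb with rfl | hb | hb
    · exact .single hlk
    · exact hl h4 hN ((Finset.subset_insert _ _).trans hc) (fun b hb => hS b (by simp [blk, hb])) b hb
    · exact .head hlk (hr h5 hx (Finset.subset_insert _ _) (fun b hb => hS b (by simp [blk, hb])) b hb)

theorem IsWalk.chs_eq (h : IsWalk a n r X) : ∃ c, chs X = {c} := by
  obtain ⟨⟨c, Y, rfl⟩, -⟩ := h
  exact ⟨c, by simp [chs]⟩

theorem IsWalk.count_dart (h : IsWalk a n r X) (hirr : ∀ v, ¬ a v v) (v w : ℕ) :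
    (fblk r X).countP (fun b => b.1 = v ∧ w ∈ b.2) = (edg X r).count s(v, w) := by
  rw [← BranchingWalk.count_dart hirr h.2, fblk, List.countP_cons]
  simp [eq_comm (a := r)]

theorem IsWalk.count_diag (h : IsWalk a n r X) (hirr : ∀ v, ¬ a v v) (v : ℕ) :
    (fblk r X).countP (fun b => b.1 = v ∧ (V₁ v = true ∨ b.2.card = 1)) =
      (fobj V₁ r X).count s(v, v) := by
  obtain ⟨c, hc⟩ := h.chs_eq
  rw [fobj, fblk, List.countP_cons, List.count_cons, BranchingWalk.count_diag hirr h.2]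
  simp [hc]

theorem IsWalk.count_obj (h : IsWalk a n r X) {v w : ℕ} (hvw : v ≠ w) :
    (fobj V₁ r X).count s(v, w) =
      if V₁ v = false ∧ V₁ w = false then (edg X r).count s(v, w) else 0 := by
  have : s(r, r) ≠ s(v, w) := by intro h; rw [Sym2.eq_iff] at h; omega
  rw [fobj, List.count_cons, count_obj_of_ne h.2 hvw]
  simp [this]

theorem IsWalk.adj_fblk (h : IsWalk a n r X) (hsymm : ∀ v w, a v w → a w v) :
    ∀ b ∈ fblk r X, ∀ w ∈ b.2, a b.1 w := by
  intro b hb w hw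
  simp only [fblk, List.mem_cons] at hb
  rcases hb with rfl | hb
  · exact (h.2.mem_chs hw).2.2
  · exact h.2.adj_blk hsymm b hb w hw

theorem IsWalk.inn_eq (h : IsWalk a n r X) :
    inn X = (fblk r X).countP (fun b => b.2.card ≠ 1) := by
  obtain ⟨c, hc⟩ := h.chs_eq
  rw [fblk, List.countP_cons, BranchingWalk.inn_eq h.2]
  simp [hc]

/-- An edge that avoids V₁ is itself an object. If an end lies in V₁, each occurrence of the edge
uses up a node over that end, and nodes over a vertex of V₁ are objects. Neither can repeat. -/
theorem IsWalk.count_edg_le (h : IsWalk a n r X) (hirr : ∀ v, ¬ a v v)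
    (hsymm : ∀ v w, a v w → a w v) (hn : (fobj V₁ r X).Nodup) (v w : ℕ) :
    (edg X r).count s(v, w) ≤ 1 := by
  have h1 : ∀ v w, V₁ v = true → (edg X r).count s(v, w) ≤ 1 := by
    intro v w hv
    rw [← h.count_dart hirr]
    refine le_trans (List.countP_mono_left ?_)
      ((h.count_diag hirr v).le.trans (List.nodup_iff_count_le_one.1 hn _))
    intro b _ hb
    simp only [decide_eq_true_eq] at hb ⊢
    exact ⟨hb.1, Or.inl hv⟩
  by_cases hv : V₁ v = true
  · exact h1 v w hv
  by_cases hw : V₁ w = true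
  · rw [Sym2.eq_swap]; exact h1 w v hw
  by_cases hvw : v = w
  · subst hvw
    rw [← h.count_dart hirr, List.countP_eq_zero.2]
    · exact zero_le_one
    · intro b hb hb'
      simp only [decide_eq_true_eq] at hb'
      have := h.adj_fblk hsymm b hb v hb'.2
      rw [hb'.1] at this
      exact hirr v this
  · have := h.count_obj (V₁ := V₁) hvw
    rw [if_pos (by simp_all)] at this
    rw [← this]
    exact List.nodup_iff_count_le_one.1 hn _

/-- The nodes of a branching walk without repeated objects. -/
theorem IsWalk.isSys (h : IsWalk a n r X) (hirr : ∀ v, ¬ a v v)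
    (hsymm : ∀ v w, a v w → a w v) (hn : (fobj V₁ r X).Nodup) :
    (fblk r X).Nodup ∧ IsSys a V₁ r (fblk r X).toFinset := by
  obtain ⟨c, hc⟩ := h.chs_eq
  have hle := h.count_edg_le hirr hsymm hn
  have huniq : ∀ v N N', (v, N) ∈ fblk r X → (v, N') ∈ fblk r X → ∀ w ∈ N, w ∈ N' → N = N' := by
    intro v N N' h1 h2 w hw hw'
    by_contra hne
    have := two_le_countP (p := fun b => decide (b.1 = v ∧ w ∈ b.2)) h1 h2
      (fun he => hne (congrArg Prod.snd he)) (by simp [hw]) (by simp [hw'])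
    rw [h.count_dart hirr] at this
    have := hle v w
    omega
  have hdiag : ∀ v N N', (v, N) ∈ fblk r X → (v, N') ∈ fblk r X → (V₁ v = true ∨ N.card = 1) →
      (V₁ v = true ∨ N'.card = 1) → N = N' := by
    intro v N N' h1 h2 k1 k2
    by_contra hne
    have := two_le_countP (p := fun b => decide (b.1 = v ∧ (V₁ v = true ∨ b.2.card = 1))) h1 h2
      (fun he => hne (congrArg Prod.snd he)) (by simpa using k1) (by simpa using k2)
    rw [h.count_diag hirr] at this
    have := List.nodup_iff_count_le_one.1 hn s(v, v)
    omega
  have hnodup : (fblk r X).Nodup := by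
    rw [List.nodup_iff_count_le_one]
    intro b
    by_cases hb : b ∈ fblk r X
    · have hne : b.2.Nonempty := by
        rcases List.mem_cons.1 hb with rfl | hb
        · simp [hc]
        · exact blk_nonempty X r b hb
      obtain ⟨w, hw⟩ := hne
      refine le_trans ?_ ((h.count_dart hirr b.1 w).le.trans (hle _ _))
      rw [List.count]
      refine List.countP_mono_left ?_
      intro x _ hx
      rw [beq_iff_eq] at hx
      subst hx
      simp [hw]
    · rw [List.count_eq_zero.2 hb]; exact zero_le_one
  refine ⟨hnodup, ?_⟩
  have hroot : (r, {c}) ∈ fblk r X := by rw [← hc]; simp [fblk]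
  constructor
  · intro v N hN w hw
    exact h.adj_fblk hsymm _ (List.mem_toFinset.1 hN) w hw
  · intro v N N' h1 h2
    exact huniq v N N' (List.mem_toFinset.1 h1) (List.mem_toFinset.1 h2)
  · intro v N hN w hw
    have h1 : 0 < (fblk r X).countP (fun b => b.1 = v ∧ w ∈ b.2) :=
      List.countP_pos_iff.2 ⟨_, List.mem_toFinset.1 hN, by simp [hw]⟩
    rw [h.count_dart hirr, Sym2.eq_swap, ← h.count_dart hirr] at h1
    obtain ⟨b, hb, hb'⟩ := List.countP_pos_iff.1 h1
    simp only [decide_eq_true_eq] at hb'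
    refine ⟨b.2, List.mem_toFinset.2 ?_, hb'.2⟩
    rw [← hb'.1]; exact hb
  · exact ⟨c, List.mem_toFinset.2 hroot⟩
  · intro v x y h1 h2
    have := hdiag v _ _ (List.mem_toFinset.1 h1) (List.mem_toFinset.1 h2) (by simp) (by simp)
    simpa using this
  · intro v N N' hv h1 h2
    exact hdiag v _ _ (List.mem_toFinset.1 h1) (List.mem_toFinset.1 h2) (.inl hv) (.inl hv)
  · have h1 : ∀ b ∈ (fblk r X).toFinset, ReflTransGen (Lnk (fblk r X).toFinset) (r, {c}) b := by
      intro b hb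
      rw [List.mem_toFinset, fblk, List.mem_cons] at hb
      rcases hb with rfl | hb
      · rw [hc]
      · refine h.2.linked (List.mem_toFinset.2 hroot) hc.le (fun b hb => ?_) b hb
        simp [fblk, hb]
    intro b hb b' hb'
    exact (lnk_symm (h1 b hb)).trans (h1 b' hb')
  · rw [List.toFinset_card_of_nodup hnodup, List.sum_toFinset _ hnodup]
    have := h.2.sum_card
    simp only [fblk, List.map_cons, List.sum_cons, List.length_cons, length_blk, hc,
      Finset.card_singleton] at this ⊢
    omega

theorem countP_eq_card_filter {S : Finset (ℕ × Finset ℕ)} (hn : (fblk r X).Nodup)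
    (hS : (fblk r X).toFinset = S) (p : ℕ × Finset ℕ → Prop) [DecidablePred p] :
    (fblk r X).countP (fun b => p b) = (S.filter p).card := by
  rw [List.countP_eq_length_filter, ← List.toFinset_card_of_nodup (hn.filter _),
    List.toFinset_filter, hS]
  simp

/-- A branching walk whose nodes form a system has no repeated objects. -/
theorem IsWalk.fobj_nodup (h : IsWalk a n r X) (hirr : ∀ v, ¬ a v v) {S : Finset (ℕ × Finset ℕ)}
    (hS : IsSys a V₁ r S) (hn : (fblk r X).Nodup) (hX : (fblk r X).toFinset = S) :
    (fobj V₁ r X).Nodup := by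
  rw [List.nodup_iff_count_le_one]
  intro q
  induction q using Sym2.ind with
  | _ v w =>
    by_cases hvw : v = w
    · subst hvw
      rw [← h.count_diag hirr, countP_eq_card_filter hn hX, Finset.card_le_one]
      rintro ⟨x, N⟩ hx ⟨y, N'⟩ hy
      simp only [Finset.mem_filter] at hx hy
      obtain ⟨hx1, rfl, hx2⟩ := hx
      obtain ⟨hy1, rfl, hy2⟩ := hy
      rcases hx2 with hx2 | hx2
      · rw [hS.one y N N' hx2 hx1 hy1]
      rcases hy2 with hy2 | hy2
      · rw [hS.one y N N' hy2 hx1 hy1]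
      rw [Finset.card_eq_one] at hx2 hy2
      obtain ⟨x, rfl⟩ := hx2
      obtain ⟨x', rfl⟩ := hy2
      rw [hS.leaf y x x' hx1 hy1]
    · rw [h.count_obj hvw]
      split_ifs
      · rw [← h.count_dart hirr, countP_eq_card_filter hn hX, Finset.card_le_one]
        rintro ⟨x, N⟩ hx ⟨y, N'⟩ hy
        simp only [Finset.mem_filter] at hx hy
        obtain ⟨hx1, rfl, hx2⟩ := hx
        obtain ⟨hy1, rfl, hy2⟩ := hy
        rw [hS.uniq y N N' hx1 hy1 w hx2 hy2]
      · exact zero_le_one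

end walk

/-! ### Exchanging two edges at a repeated vertex -/

/-- The neighbours `e` and `f` are exchanged in all nodes at `v`. -/
def swapAt (v e f : ℕ) (b : ℕ × Finset ℕ) : ℕ × Finset ℕ :=
  if b.1 = v then (b.1, b.2.image (Equiv.swap e f)) else b

theorem swapAt_fst (v e f : ℕ) (b : ℕ × Finset ℕ) : (swapAt v e f b).1 = b.1 := by
  unfold swapAt; split_ifs <;> rfl

theorem swapAt_card (v e f : ℕ) (b : ℕ × Finset ℕ) : (swapAt v e f b).2.card = b.2.card := by
  unfold swapAt; split_ifs
  · exact Finset.card_image_of_injective _ (Equiv.injective _)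
  · rfl

theorem swapAt_swapAt (v e f : ℕ) (b : ℕ × Finset ℕ) : swapAt v e f (swapAt v e f b) = b := by
  by_cases h : b.1 = v
  · simp [swapAt, h, Finset.image_image, ← Equiv.coe_trans]
    exact Prod.ext h.symm rfl
  · simp [swapAt, h]

theorem swapAt_injective (v e f : ℕ) : Function.Injective (swapAt v e f) :=
  Function.LeftInverse.injective (g := swapAt v e f) (swapAt_swapAt v e f)

theorem mem_image_swapAt {v e f : ℕ} {S : Finset (ℕ × Finset ℕ)} {b : ℕ × Finset ℕ} :
    b ∈ S.image (swapAt v e f) ↔ swapAt v e f b ∈ S := by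
  rw [Finset.mem_image]
  constructor
  · rintro ⟨x, hx, rfl⟩; rwa [swapAt_swapAt]
  · intro h; exact ⟨_, h, swapAt_swapAt _ _ _ _⟩

theorem swapAt_of_ne {v e f : ℕ} {b : ℕ × Finset ℕ} (h : b.1 ≠ v) : swapAt v e f b = b := if_neg h

theorem swapAt_self (v e f : ℕ) (N : Finset ℕ) :
    swapAt v e f (v, N) = (v, N.image (Equiv.swap e f)) := if_pos rfl

theorem mem_image_swap {e f w : ℕ} {N : Finset ℕ} :
    w ∈ N.image (Equiv.swap e f) ↔ Equiv.swap e f w ∈ N := by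
  rw [Finset.mem_image]
  constructor
  · rintro ⟨x, hx, rfl⟩; simpa
  · intro h; exact ⟨_, h, by simp⟩

/-- `e` and `f` lead from `v` into the same component of the nodes outside `v`. -/
def Paired (T : Finset (ℕ × Finset ℕ)) (v e f : ℕ) : Prop :=
  e ≠ f ∧ ∃ M M', (e, M) ∈ T ∧ v ∈ M ∧ (f, M') ∈ T ∧ v ∈ M' ∧ ReflTransGen (Lnk T) (e, M) (f, M')


theorem filter_image_swapAt (v e f : ℕ) (S : Finset (ℕ × Finset ℕ)) :
    (S.image (swapAt v e f)).filter (fun b => b.1 ≠ v) = S.filter (fun b => b.1 ≠ v) := by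
  ext b
  simp only [Finset.mem_filter, mem_image_swapAt]
  constructor
  · rintro ⟨h1, h2⟩; rw [swapAt_of_ne h2] at h1; exact ⟨h1, h2⟩
  · rintro ⟨h1, h2⟩; rw [swapAt_of_ne h2]; exact ⟨h1, h2⟩

namespace IsSys

variable {a : ℕ → ℕ → Prop} {V₁ : ℕ → Bool} {r : ℕ} {S : Finset (ℕ × Finset ℕ)}

/-- The nodes away from `v` keep their links, so (e, Me) and (f, Mf) stay connected through them.
Hence every old link at `v` can be replaced by a new link and a detour through that component. The
number of nodes and their degrees do not change, so the result is again a tree. -/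
theorem swap (h : IsSys a V₁ r S) (hirr : ∀ v, ¬ a v v) (hsymm : ∀ v w, a v w → a w v) {v e f : ℕ}
    (hp : Paired (S.filter fun b => b.1 ≠ v) v e f) : IsSys a V₁ r (S.image (swapAt v e f)) := by
  obtain ⟨hef, Me, Mf, he, hve, hf, hvf, hcon⟩ := hp
  rw [Finset.mem_filter] at he hf
  -- Since there are nodes over `e` and over `f` with `v` as a neighbour, the exchange permutes the
  -- vertices that `v` is attached to.
  have port : ∀ w M, (w, M) ∈ S → v ∈ M → ∃ M', (Equiv.swap e f w, M') ∈ S ∧ v ∈ M' := by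
    intro w M hw hv
    by_cases h1 : w = e
    · subst h1; rw [Equiv.swap_apply_left]; exact ⟨_, hf.1, hvf⟩
    by_cases h2 : w = f
    · subst h2; rw [Equiv.swap_apply_right]; exact ⟨_, he.1, hve⟩
    · rw [Equiv.swap_apply_of_ne_of_ne h1 h2]; exact ⟨M, hw, hv⟩
  have ne_v : ∀ w M, (w, M) ∈ S → v ∈ M → w ≠ v := by
    rintro w M hw hv rfl; exact hirr w (h.adj w M hw w hv)
  constructor
  · intro x N hN w hw
    rw [mem_image_swapAt] at hN
    by_cases hx : x = v
    · subst hx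
      rw [swapAt_self] at hN
      have h1 : Equiv.swap e f w ∈ N.image (Equiv.swap e f) := by
        rw [mem_image_swap]; simpa using hw
      obtain ⟨M, hM, hv⟩ := h.symm _ _ hN _ h1
      obtain ⟨M', hM', hv'⟩ := port _ _ hM hv
      rw [Equiv.swap_apply_self] at hM'
      exact hsymm _ _ (h.adj _ _ hM' _ hv')
    · rw [swapAt_of_ne hx] at hN
      exact h.adj x N hN w hw
  · intro x N N' hN hN' w hw hw'
    rw [mem_image_swapAt] at hN hN'
    by_cases hx : x = v
    · subst hx
      rw [swapAt_self] at hN hN'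
      have := h.uniq x _ _ hN hN' (Equiv.swap e f w) (by rw [mem_image_swap]; simpa using hw)
        (by rw [mem_image_swap]; simpa using hw')
      exact Finset.image_injective (Equiv.injective _) this
    · rw [swapAt_of_ne hx] at hN hN'
      exact h.uniq x _ _ hN hN' w hw hw'
  · intro x N hN w hw
    rw [mem_image_swapAt] at hN
    by_cases hx : x = v
    · subst hx
      rw [swapAt_self] at hN
      have h1 : Equiv.swap e f w ∈ N.image (Equiv.swap e f) := by
        rw [mem_image_swap]; simpa using hw
      obtain ⟨M, hM, hv⟩ := h.symm _ _ hN _ h1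
      obtain ⟨M', hM', hv'⟩ := port _ _ hM hv
      rw [Equiv.swap_apply_self] at hM'
      refine ⟨M', ?_, hv'⟩
      rw [mem_image_swapAt, swapAt_of_ne]
      · exact hM'
      · exact ne_v _ _ hM' hv'
    · rw [swapAt_of_ne hx] at hN
      obtain ⟨M, hM, hxM⟩ := h.symm _ _ hN w hw
      by_cases hwv : w = v
      · subst hwv
        obtain ⟨M', hM', hv'⟩ := port x N hN hw
        obtain ⟨M'', hM'', hxM''⟩ := h.symm _ _ hM' _ hv'
        refine ⟨M''.image (Equiv.swap e f), ?_, ?_⟩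
        · rw [mem_image_swapAt, ← swapAt_self, swapAt_swapAt]; exact hM''
        · rw [mem_image_swap]; exact hxM''
      · refine ⟨M, ?_, hxM⟩
        rw [mem_image_swapAt, swapAt_of_ne hwv]; exact hM
  · obtain ⟨c, hc⟩ := h.root
    by_cases hr : r = v
    · subst hr
      refine ⟨Equiv.swap e f c, ?_⟩
      rw [mem_image_swapAt, swapAt_self]; simpa using hc
    · refine ⟨c, ?_⟩
      rw [mem_image_swapAt, swapAt_of_ne hr]; exact hc
  · intro x y z hy hz
    rw [mem_image_swapAt] at hy hz
    by_cases hx : x = v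
    · subst hx
      rw [swapAt_self, Finset.image_singleton] at hy hz
      exact (Equiv.swap e f).injective (h.leaf x _ _ hy hz)
    · rw [swapAt_of_ne hx] at hy hz
      exact h.leaf x _ _ hy hz
  · intro x N N' hx hN hN'
    rw [mem_image_swapAt] at hN hN'
    by_cases hxv : x = v
    · subst hxv
      rw [swapAt_self] at hN hN'
      exact Finset.image_injective (Equiv.injective _) (h.one x _ _ hx hN hN')
    · rw [swapAt_of_ne hxv] at hN hN'
      exact h.one x _ _ hx hN hN'
  · set S' := S.image (swapAt v e f) with hS'
    have hsub : S.filter (fun b => b.1 ≠ v) ⊆ S' := by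
      rw [hS', ← filter_image_swapAt v e f S]; exact Finset.filter_subset _ _
    have hcon' : ReflTransGen (Lnk S') (e, Me) (f, Mf) :=
      lnk_mono hsub hcon
    -- The link of a node at `v` to (e, Me) becomes one to (f, Mf), from which (e, Me) is still
    -- reached outside `v`; likewise with the roles exchanged.
    have step1 : ∀ b b', Lnk S b b' → b.1 = v → ReflTransGen (Lnk S') (swapAt v e f b) b' := by
      rintro ⟨x, N⟩ ⟨w, M⟩ ⟨l1, l2, l3, l4⟩ (rfl : x = v)
      simp only at l3 l4
      have hwx : w ≠ x := ne_v _ _ l2 l4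
      rw [swapAt_self]
      have hmem : (x, N.image (Equiv.swap e f)) ∈ S' := by
        rw [hS', mem_image_swapAt, ← swapAt_self, swapAt_swapAt]; exact l1
      have htail : ∀ w' M', (w', M') ∈ S → x ∈ M' → Equiv.swap e f w' = w →
          Lnk S' (x, N.image (Equiv.swap e f)) (w', M') := by
        intro w' M' hw' hx' hs
        refine ⟨hmem, hsub ?_, ?_, hx'⟩
        · rw [Finset.mem_filter]; exact ⟨hw', ne_v _ _ hw' hx'⟩
        · change w' ∈ _; rw [mem_image_swap, hs]; exact l3
      by_cases h1 : w = e
      · subst h1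
        obtain rfl : M = Me := h.uniq w _ _ l2 he.1 x l4 hve
        exact .head (htail f Mf hf.1 hvf (Equiv.swap_apply_right _ _))
          (lnk_symm hcon')
      by_cases h2 : w = f
      · subst h2
        obtain rfl : M = Mf := h.uniq w _ _ l2 hf.1 x l4 hvf
        exact .head (htail e Me he.1 hve (Equiv.swap_apply_left _ _)) hcon'
      · exact .single (htail w M l2 l4 (Equiv.swap_apply_of_ne_of_ne h1 h2))
    have step : ∀ b b', Lnk S b b' →
        ReflTransGen (Lnk S') (swapAt v e f b) (swapAt v e f b') := by
      intro b b' hl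
      have hne := h.ne_of_lnk hirr hl
      by_cases hb : b.1 = v
      · rw [swapAt_of_ne (b := b') (by rw [← hb]; exact hne.symm)]
        exact step1 b b' hl hb
      · rw [swapAt_of_ne hb]
        by_cases hb' : b'.1 = v
        · exact lnk_symm (step1 b' b hl.symm hb')
        · rw [swapAt_of_ne hb']
          refine .single ⟨hsub ?_, hsub ?_, hl.2.2⟩
          · exact Finset.mem_filter.2 ⟨hl.1, hb⟩
          · exact Finset.mem_filter.2 ⟨hl.2.1, hb'⟩
    intro b hb b' hb'
    rw [hS', mem_image_swapAt] at hb hb'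
    have := h.conn _ hb _ hb'
    have h2 : ReflTransGen (Lnk S') (swapAt v e f (swapAt v e f b))
        (swapAt v e f (swapAt v e f b')) := ReflTransGen.lift' (swapAt v e f) step _ _ this
    rwa [swapAt_swapAt, swapAt_swapAt] at h2
  · rw [Finset.sum_image (fun _ _ _ _ he => swapAt_injective v e f he),
      Finset.card_image_of_injective _ (swapAt_injective v e f)]
    simp only [swapAt_card]
    exact h.card

/-- Otherwise the link from (v, N) to the node over `e`, the connection outside `v` and the link
back from the node over `f` would form a cycle, although every edge of a tree is a bridge. -/
theorem not_mem_of_paired (h : IsSys a V₁ r S) (hirr : ∀ v, ¬ a v v) {v e f : ℕ}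
    (hp : Paired (S.filter fun b => b.1 ≠ v) v e f) {N : Finset ℕ} (hN : (v, N) ∈ S) (he : e ∈ N) :
    f ∉ N := by
  intro hfN
  obtain ⟨hef, Me, Mf, hMe, hve, hMf, hvf, hcon⟩ := hp
  have hMe' := (Finset.mem_filter.1 hMe).1
  have hMf' := (Finset.mem_filter.1 hMf).1
  have hadj : ∀ {b b'} (hl : Lnk S b b'), (lnkGraph S).Adj ⟨b, hl.1⟩ ⟨b', hl.2.1⟩ := fun {b b'} hl =>
    ⟨fun he => h.ne_of_lnk hirr hl (congrArg (fun z : S => z.1.1) he), hl⟩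
  have hl1 : Lnk S (v, N) (e, Me) := ⟨hN, hMe', he, hve⟩
  have hl2 : Lnk S (v, N) (f, Mf) := ⟨hN, hMf', hfN, hvf⟩
  have hbr := SimpleGraph.isAcyclic_iff_forall_adj_isBridge.1 (h.isTree hirr).2 (hadj hl1)
  rw [SimpleGraph.isBridge_iff] at hbr
  have hdel : ∀ {b b'} (hl : Lnk S b b'), s(b, b') ≠ s((v, N), (e, Me)) →
      ((lnkGraph S) \ SimpleGraph.fromEdgeSet {s(⟨(v, N), hN⟩, ⟨(e, Me), hMe'⟩)}).Adj
        ⟨b, hl.1⟩ ⟨b', hl.2.1⟩ := by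
    intro b b' hl hne
    rw [SimpleGraph.sdiff_adj, SimpleGraph.fromEdgeSet_adj]
    refine ⟨hadj hl, fun hh => hne ?_⟩
    have := congrArg (Sym2.map Subtype.val) (Set.mem_singleton_iff.1 hh.1)
    simpa using this
  have key : ∀ x, ReflTransGen (Lnk (S.filter fun b => b.1 ≠ v)) (e, Me) x → ∀ hx : x ∈ S,
      ((lnkGraph S) \ SimpleGraph.fromEdgeSet {s(⟨(v, N), hN⟩, ⟨(e, Me), hMe'⟩)}).Reachable
        ⟨(e, Me), hMe'⟩ ⟨x, hx⟩ := by
    intro x hx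
    induction hx with
    | refl => intro _; exact SimpleGraph.Reachable.refl _
    | tail _ hl ih =>
      intro hx
      have hl' : Lnk S _ _ := hl.mono (Finset.filter_subset _ _)
      refine (ih hl'.1).trans (SimpleGraph.Adj.reachable (hdel hl' fun heq => ?_))
      have h1 := (Finset.mem_filter.1 hl.1).2
      have h2 := (Finset.mem_filter.1 hl.2.1).2
      rcases Sym2.eq_iff.1 heq with ⟨h3, -⟩ | ⟨-, h3⟩
      · rw [h3] at h1; exact h1 rfl
      · rw [h3] at h2; exact h2 rfl
  have hlast := SimpleGraph.Adj.reachable (hdel hl2 (by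
    intro heq
    rcases Sym2.eq_iff.1 heq with ⟨-, h3⟩ | ⟨h3, -⟩
    · exact hef (congrArg Prod.fst h3).symm
    · exact h.ne_of_lnk hirr hl1 (congrArg Prod.fst h3)))
  have := hlast.trans (key _ hcon hMf').symm
  first
    | exact hbr.2 this
    | exact hbr this

/-- Without a pair, a path that leaves (v, N) into a component of the nodes outside `v` can only
come back to `v` through the neighbour by which it left. By `uniq` it then comes back to (v, N)
itself and never arrives at (v, N'). -/
theorem exists_paired (h : IsSys a V₁ r S) (hirr : ∀ v, ¬ a v v) {v : ℕ} {N N' : Finset ℕ}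
    (hN : (v, N) ∈ S) (hN' : (v, N') ∈ S) (hne : N ≠ N') :
    ∃ e f, Paired (S.filter fun b => b.1 ≠ v) v e f := by
  by_contra hno
  push Not at hno
  have key : ∀ x, ReflTransGen (Lnk S) (v, N) x → x = (v, N) ∨ (x.1 ≠ v ∧ ∃ e ∈ N, ∃ M,
      (e, M) ∈ S.filter (fun b => b.1 ≠ v) ∧ v ∈ M ∧
      ReflTransGen (Lnk (S.filter fun b => b.1 ≠ v)) (e, M) x) := by
    intro x hx
    induction hx with
    | refl => exact .inl rfl
    | @tail x y _ hl ih =>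
      have hxy := h.ne_of_lnk hirr hl
      rcases ih with rfl | ⟨hxv, e, he, M, hM, hvM, hcon⟩
      · exact .inr ⟨hxy.symm, y.1, hl.2.2.1, y.2, Finset.mem_filter.2 ⟨hl.2.1, hxy.symm⟩,
          hl.2.2.2, .refl⟩
      · by_cases hyv : y.1 = v
        · have hx : (x.1, x.2) ∈ S.filter (fun b => b.1 ≠ v) := Finset.mem_filter.2 ⟨hl.1, hxv⟩
          have hex : e = x.1 := by
            by_contra hne
            exact hno e x.1 ⟨hne, M, x.2, hM, hvM, hx, by rw [← hyv]; exact hl.2.2.1, hcon⟩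
          have hy : (v, y.2) ∈ S := by rw [← hyv]; exact hl.2.1
          have := h.uniq v _ _ hy hN e (by rw [hex]; exact hl.2.2.2) he
          exact .inl (Prod.ext hyv this)
        · exact .inr ⟨hyv, e, he, M, hM, hvM,
            hcon.tail ⟨Finset.mem_filter.2 ⟨hl.1, hxv⟩, Finset.mem_filter.2 ⟨hl.2.1, hyv⟩, hl.2.2⟩⟩
  rcases key _ (h.conn _ hN _ hN') with h1 | h1
  · exact hne (congrArg Prod.snd h1).symm
  · exact h1.1 rfl

/-- Let N contain `e` and N' contain `f`; these sets are disjoint. If the system were fixed, the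
exchange would map N onto N', and any further element of N would lie in both. So N = {e} and N' =
{f} would be two leaves over `v`, which `leaf` forbids. -/
theorem image_swapAt_ne (h : IsSys a V₁ r S) (hirr : ∀ v, ¬ a v v) {v e f : ℕ}
    (hp : Paired (S.filter fun b => b.1 ≠ v) v e f) : S.image (swapAt v e f) ≠ S := by
  intro heq
  have hnm := fun N => h.not_mem_of_paired hirr hp (N := N)
  obtain ⟨hef, Me, Mf, hMe, hve, hMf, hvf, -⟩ := hp
  obtain ⟨N, hN, heN⟩ := h.symm _ _ (Finset.mem_filter.1 hMe).1 _ hve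
  obtain ⟨N', hN', hfN⟩ := h.symm _ _ (Finset.mem_filter.1 hMf).1 _ hvf
  have hfN' := hnm N hN heN
  have heN' : e ∉ N' := fun hh => hnm N' hN' hh hfN
  have hNN : N ≠ N' := fun hh => heN' (hh ▸ heN)
  have him : ∀ {M}, (v, M) ∈ S → (v, M.image (Equiv.swap e f)) ∈ S := by
    intro M hM
    rw [← heq, mem_image_swapAt, ← swapAt_self, swapAt_swapAt]; exact hM
  have h1 : N.image (Equiv.swap e f) = N' :=
    h.uniq v _ _ (him hN) hN' f (by rw [mem_image_swap]; simpa using heN) hfN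
  have h2 : N'.image (Equiv.swap e f) = N :=
    h.uniq v _ _ (him hN') hN e (by rw [mem_image_swap]; simpa using hfN) heN
  have h3 : N = {e} := by
    refine Finset.eq_singleton_iff_unique_mem.2 ⟨heN, fun w hw => ?_⟩
    by_contra hwe
    have hwf : w ≠ f := fun hh => hfN' (hh ▸ hw)
    have : w ∈ N' := by
      rw [← h1, mem_image_swap, Equiv.swap_apply_of_ne_of_ne hwe hwf]; exact hw
    exact hNN (h.uniq v _ _ hN hN' w hw this)
  have h4 : N' = {f} := by rw [← h1, h3]; simp
  rw [h3] at hN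
  rw [h4] at hN'
  exact hef (h.leaf v _ _ hN hN')

end IsSys

end BranchingWalk


/-! ### The involution on walks that are not trees -/

namespace BranchingWalk

open BinaryTree Relation

/-- No vertex occurs twice in the branching walk, so that it is a tree. -/
def Genuine (r : ℕ) (X : BinaryTree ℕ) : Prop :=
  ∀ b ∈ fblk r X, ∀ b' ∈ fblk r X, b.1 = b'.1 → b = b'

/-- The least vertex that occurs twice. -/
noncomputable def repVertex (S : Finset (ℕ × Finset ℕ)) : ℕ :=
  sInf {v | ∃ N N', (v, N) ∈ S ∧ (v, N') ∈ S ∧ N ≠ N'}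

open Classical in
/-- A choice of a pair. -/
noncomputable def pickPair (T : Finset (ℕ × Finset ℕ)) (v : ℕ) : ℕ × ℕ :=
  if h : ∃ p : ℕ × ℕ, Paired T v p.1 p.2 then h.choose else (0, 0)

theorem pickPair_spec {T : Finset (ℕ × Finset ℕ)} {v e f : ℕ} (h : Paired T v e f) :
    Paired T v (pickPair T v).1 (pickPair T v).2 := by
  have hex : ∃ p : ℕ × ℕ, Paired T v p.1 p.2 := ⟨(e, f), h⟩
  rw [pickPair, dif_pos hex]
  exact hex.choose_spec

/-- The exchange of a canonical pair of edges at the least repeated vertex. -/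
noncomputable def swapSys (S : Finset (ℕ × Finset ℕ)) : Finset (ℕ × Finset ℕ) :=
  S.image (swapAt (repVertex S) (pickPair (S.filter fun b => b.1 ≠ repVertex S) (repVertex S)).1
    (pickPair (S.filter fun b => b.1 ≠ repVertex S) (repVertex S)).2)

open Classical in
/-- A branching walk with the given nodes. -/
noncomputable def walkOf (a : ℕ → ℕ → Prop) (n r : ℕ) (S : Finset (ℕ × Finset ℕ)) : BinaryTree ℕ :=
  if h : ∃ X, IsWalk a n r X ∧ (fblk r X).Nodup ∧ (fblk r X).toFinset = S then h.choose else nil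

theorem walkOf_spec {a : ℕ → ℕ → Prop} {n r : ℕ} {S : Finset (ℕ × Finset ℕ)}
    (h : ∃ X, IsWalk a n r X ∧ (fblk r X).Nodup ∧ (fblk r X).toFinset = S) :
    IsWalk a n r (walkOf a n r S) ∧ (fblk r (walkOf a n r S)).Nodup ∧
      (fblk r (walkOf a n r S)).toFinset = S := by
  rw [walkOf, dif_pos h]
  exact h.choose_spec

theorem repeated_image {S : Finset (ℕ × Finset ℕ)} {v e f x : ℕ}
    (h : ∃ N N', (x, N) ∈ S ∧ (x, N') ∈ S ∧ N ≠ N') :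
    ∃ N N', (x, N) ∈ S.image (swapAt v e f) ∧ (x, N') ∈ S.image (swapAt v e f) ∧ N ≠ N' := by
  obtain ⟨N, N', h1, h2, h3⟩ := h
  refine ⟨(swapAt v e f (x, N)).2, (swapAt v e f (x, N')).2, ?_, ?_, fun he => h3 ?_⟩
  · convert Finset.mem_image_of_mem (swapAt v e f) h1
    exact (swapAt_fst v e f (x, N)).symm
  · convert Finset.mem_image_of_mem (swapAt v e f) h2
    exact (swapAt_fst v e f (x, N')).symm
  · have : swapAt v e f (x, N) = swapAt v e f (x, N') :=
      Prod.ext (by rw [swapAt_fst, swapAt_fst]) he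
    exact congrArg Prod.snd (swapAt_injective v e f this)

theorem image_image_swapAt (S : Finset (ℕ × Finset ℕ)) (v e f : ℕ) :
    (S.image (swapAt v e f)).image (swapAt v e f) = S := by
  ext b; rw [mem_image_swapAt, mem_image_swapAt, swapAt_swapAt]

theorem repVertex_image (S : Finset (ℕ × Finset ℕ)) (v e f : ℕ) :
    repVertex (S.image (swapAt v e f)) = repVertex S := by
  unfold repVertex
  congr 1
  ext x
  refine ⟨fun h => ?_, repeated_image⟩
  have := repeated_image (v := v) (e := e) (f := f) h
  rwa [image_image_swapAt] at this

/-- The exchange keeps the set of repeated vertices and all nodes away from the chosen vertex. The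
vertex and the pair are chosen from these data alone, so the second exchange is the same as the
first. -/
theorem swapSys_swapSys (S : Finset (ℕ × Finset ℕ)) : swapSys (swapSys S) = S := by
  have h1 : repVertex (swapSys S) = repVertex S := repVertex_image _ _ _ _
  have h2 : (swapSys S).filter (fun b => b.1 ≠ repVertex S) =
      S.filter (fun b => b.1 ≠ repVertex S) := filter_image_swapAt _ _ _ _
  rw [swapSys, h1, h2]
  exact image_image_swapAt _ _ _ _

theorem card_filter_swapSys (S : Finset (ℕ × Finset ℕ)) (p : ℕ → ℕ → Prop)
    [∀ x y, Decidable (p x y)] :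
    ((swapSys S).filter fun b => p b.1 b.2.card).card = (S.filter fun b => p b.1 b.2.card).card := by
  rw [swapSys, Finset.filter_image, Finset.card_image_of_injective _ (swapAt_injective _ _ _)]
  simp only [swapAt_fst, swapAt_card]

/-- The last clause is what preserves the weights: exactly one node at the repeated vertex has `e`
as a neighbour, exactly one has `f`, and this remains true after the exchange. So the edges of the
two walks agree with multiplicity. -/
theorem IsSys.swapSys {a : ℕ → ℕ → Prop} {V₁ : ℕ → Bool} {r : ℕ} {S : Finset (ℕ × Finset ℕ)}
    (h : IsSys a V₁ r S) (hirr : ∀ v, ¬ a v v) (hsymm : ∀ v w, a v w → a w v)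
    (hrep : ∃ v N N', (v, N) ∈ S ∧ (v, N') ∈ S ∧ N ≠ N') :
    IsSys a V₁ r (swapSys S) ∧ swapSys S ≠ S ∧
      (∃ v N N', (v, N) ∈ BranchingWalk.swapSys S ∧ (v, N') ∈ BranchingWalk.swapSys S ∧ N ≠ N') ∧
      ∀ v w, ((BranchingWalk.swapSys S).filter fun b => b.1 = v ∧ w ∈ b.2).card =
        (S.filter fun b => b.1 = v ∧ w ∈ b.2).card := by
  obtain ⟨N, N', hN, hN', hne⟩ : repVertex S ∈ {v | ∃ N N', (v, N) ∈ S ∧ (v, N') ∈ S ∧ N ≠ N'} :=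
    Nat.sInf_mem hrep
  obtain ⟨e, f, hef⟩ := h.exists_paired hirr hN hN' hne
  have hp := pickPair_spec hef
  refine ⟨h.swap hirr hsymm hp, h.image_swapAt_ne hirr hp,
    ⟨repVertex S, repeated_image ⟨N, N', hN, hN', hne⟩⟩, fun x w => ?_⟩
  rw [BranchingWalk.swapSys]
  generalize pickPair (S.filter fun b => b.1 ≠ repVertex S) (repVertex S) = p at hp
  obtain ⟨e, f⟩ := p
  simp only at hp ⊢
  generalize repVertex S = v at hp
  rw [Finset.filter_image, Finset.card_image_of_injective _ (swapAt_injective _ _ _)]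
  by_cases hx : x = v
  · subst hx
    have e1 : (S.filter fun b => (swapAt x e f b).1 = x ∧ w ∈ (swapAt x e f b).2) =
        S.filter fun b => b.1 = x ∧ Equiv.swap e f w ∈ b.2 := by
      ext b
      simp only [Finset.mem_filter, swapAt_fst]
      refine and_congr_right fun _ => and_congr_right fun hb => ?_
      rw [swapAt, if_pos hb, mem_image_swap]
    rw [e1]
    obtain ⟨-, Me, Mf, hMe, hve, hMf, hvf, -⟩ := hp
    have h1 : ∀ z M, (z, M) ∈ S → x ∈ M → (S.filter fun b => b.1 = x ∧ z ∈ b.2).card = 1 := by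
      intro z M hz hx
      obtain ⟨K, hK, hzK⟩ := h.symm z M hz x hx
      rw [Finset.card_eq_one]
      refine ⟨(x, K), Finset.eq_singleton_iff_unique_mem.2 ⟨by simp [hK, hzK], ?_⟩⟩
      rintro ⟨y, L⟩ hy
      simp only [Finset.mem_filter] at hy
      obtain ⟨hy1, rfl, hy2⟩ := hy
      rw [h.uniq y L K hy1 hK z hy2 hzK]
    have he := h1 e Me (Finset.mem_filter.1 hMe).1 hve
    have hf := h1 f Mf (Finset.mem_filter.1 hMf).1 hvf
    by_cases hwe : w = e
    · subst hwe; rw [Equiv.swap_apply_left, he, hf]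
    by_cases hwf : w = f
    · subst hwf; rw [Equiv.swap_apply_right, he, hf]
    rw [Equiv.swap_apply_of_ne_of_ne hwe hwf]
  · congr 1
    ext b
    simp only [Finset.mem_filter, swapAt_fst]
    refine and_congr_right fun _ => and_congr_right fun hb => ?_
    rw [swapAt_of_ne (by rw [hb]; exact hx)]

section involution

variable {a : ℕ → ℕ → Prop} {n : ℕ} {V₁ : ℕ → Bool} {r : ℕ}

/-- A branching walk is determined by the set of its nodes. -/
theorem IsWalk.ext {X X' : BinaryTree ℕ} (h : IsWalk a n r X) (h' : IsWalk a n r X')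
    (hS : IsSys a V₁ r (fblk r X).toFinset) (he : (fblk r X).toFinset = (fblk r X').toFinset) :
    X = X' := by
  obtain ⟨c, hc⟩ := h.chs_eq
  obtain ⟨c', hc'⟩ := h'.chs_eq
  have h1 : (r, {c}) ∈ (fblk r X).toFinset := by rw [← hc]; simp [fblk]
  have h2 : (r, {c'}) ∈ (fblk r X).toFinset := by rw [he, ← hc']; simp [fblk]
  have := hS.leaf r c c' h1 h2
  subst this
  refine Vld.ext hS.uniq h.2 h'.2 (hc.trans hc'.symm) (fun b hb => ?_) (fun b hb => ?_)
  · rw [List.mem_toFinset]; simp [fblk, hb]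
  · rw [he, List.mem_toFinset]; simp [fblk, hb]

theorem not_genuine_iff {X : BinaryTree ℕ} : ¬ Genuine r X ↔
    ∃ v N N', (v, N) ∈ (fblk r X).toFinset ∧ (v, N') ∈ (fblk r X).toFinset ∧ N ≠ N' := by
  simp only [Genuine, List.mem_toFinset]
  push Not
  constructor
  · rintro ⟨⟨v, N⟩, h1, ⟨v', N'⟩, h2, h3, h4⟩
    simp only at h3
    subst h3
    exact ⟨v, N, N', h1, h2, fun h => h4 (by rw [h])⟩
  · rintro ⟨v, N, N', h1, h2, h3⟩
    exact ⟨_, h1, _, h2, rfl, fun h => h3 (congrArg Prod.snd h)⟩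

/-- The branching walks without repeated objects that are not trees cancel in pairs. -/
theorem sum_not_genuine {R : Type*} [AddCommMonoid R] (h2 : ∀ x : R, x + x = 0)
    (hirr : ∀ v, ¬ a v v) (hsymm : ∀ v w, a v w → a w v) (hlt : ∀ v w, a v w → w < n)
    (κ : BinaryTree ℕ → R) (W : Finset (BinaryTree ℕ))
    (hW : ∀ X ∈ W, IsWalk a n r X ∧ (fobj V₁ r X).Nodup ∧ ¬ Genuine r X)
    (hcl : ∀ X ∈ W, ∀ X', IsWalk a n r X' → (fobj V₁ r X').Nodup → ¬ Genuine r X' →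
      (edg X' r).Perm (edg X r) → (fobj V₁ r X').Perm (fobj V₁ r X) → inn X' = inn X →
      X' ∈ W ∧ κ X' = κ X) : ∑ X ∈ W, κ X = 0 := by
  let g : BinaryTree ℕ → BinaryTree ℕ := fun X => walkOf a n r (swapSys (fblk r X).toFinset)
  have hg : ∀ X ∈ W, (IsWalk a n r (g X) ∧ (fblk r (g X)).Nodup ∧
      (fblk r (g X)).toFinset = swapSys (fblk r X).toFinset) ∧
      IsSys a V₁ r (fblk r X).toFinset ∧ swapSys (fblk r X).toFinset ≠ (fblk r X).toFinset ∧
      g X ∈ W ∧ κ (g X) = κ X := by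
    intro X hX
    obtain ⟨h1, h2, h3⟩ := hW X hX
    obtain ⟨hnd, hS⟩ := h1.isSys hirr hsymm h2
    obtain ⟨k1, k2, k3, k4⟩ := hS.swapSys hirr hsymm (not_genuine_iff.1 h3)
    have hs := walkOf_spec (k1.exists_isWalk hirr hlt)
    refine ⟨hs, hS, k2, ?_⟩
    -- The number of nodes over v that have w as a neighbour is the multiplicity of the edge vw.
    have hperm : (edg (g X) r).Perm (edg X r) := by
      rw [List.perm_iff_count]
      intro q
      induction q using Sym2.ind with
      | _ v w =>
        rw [← hs.1.count_dart hirr, ← h1.count_dart hirr, countP_eq_card_filter hs.2.1 hs.2.2,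
          countP_eq_card_filter hnd rfl]
        exact k4 v w
    refine hcl X hX (g X) hs.1 (hs.1.fobj_nodup hirr k1 hs.2.1 hs.2.2) ?_ hperm ?_ ?_
    · rw [not_genuine_iff, hs.2.2]; exact k3
    · rw [List.perm_iff_count]
      intro q
      induction q using Sym2.ind with
      | _ v w =>
        by_cases hvw : v = w
        · subst hvw
          rw [← hs.1.count_diag hirr, ← h1.count_diag hirr, countP_eq_card_filter hs.2.1 hs.2.2,
            countP_eq_card_filter hnd rfl]
          exact card_filter_swapSys _ (fun x y => x = v ∧ (V₁ v = true ∨ y = 1))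
        · rw [hs.1.count_obj hvw, h1.count_obj hvw, hperm.count_eq]
    · rw [hs.1.inn_eq, h1.inn_eq, countP_eq_card_filter hs.2.1 hs.2.2,
        countP_eq_card_filter hnd rfl]
      exact card_filter_swapSys _ (fun _ y => y ≠ 1)
  refine Finset.sum_involution (fun X _ => g X) ?_ ?_ ?_ ?_
  · intro X hX
    rw [(hg X hX).2.2.2.2, h2]
  · intro X hX _ he
    apply (hg X hX).2.2.1
    rw [← (hg X hX).1.2.2, he]
  · intro X hX
    exact (hg X hX).2.2.2.1
  · intro X hX
    have h1 := hg X hX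
    have h3 := hg (g X) h1.2.2.2.1
    -- A walk is recovered from its set of nodes, so `g` inherits being an involution from
    -- `swapSys`.
    refine IsWalk.ext (V₁ := V₁) h3.1.1 (hW X hX).1 ?_ ?_
    · rw [h3.1.2.2, h1.1.2.2, swapSys_swapSys]; exact h1.2.1
    · rw [h3.1.2.2, h1.1.2.2, swapSys_swapSys]

end involution

end BranchingWalk


/-! ### Inclusion–exclusion in characteristic two -/

section sieve

variable {R : Type*} [CommRing R]

/-- The inclusion–exclusion sum over the sets of labels below `L`, coded by `A < 2 ^ L`. -/
def sieveSum (L : ℕ) (ys : List (ℕ → R)) : R :=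
  ∑ A ∈ Finset.range (2 ^ L),
    (ys.map fun y => ∑ j ∈ Finset.range L, if A.testBit j then y j else 0).prod

/-- The sum runs over the sets A that contain the image of φ. If φ is onto, the full set is the only
one; if φ misses a label j, toggling j pairs these sets up. -/
theorem sum_testBit [CharP R 2] (L : ℕ) {m : ℕ} (φ : Fin m → ℕ) (hφ : ∀ i, φ i < L) (c : R) :
    (∑ A ∈ Finset.range (2 ^ L), if ∀ i, A.testBit (φ i) = true then c else 0) =
      if ∀ j < L, ∃ i, φ i = j then c else 0 := by
  classical
  split_ifs with h
  · rw [Finset.sum_eq_single_of_mem (2 ^ L - 1) (by simp)]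
    · rw [if_pos]
      intro i
      rw [Nat.testBit_two_pow_sub_one]
      simpa using hφ i
    · intro A hA hne
      rw [if_neg]
      intro hall
      apply hne
      refine Nat.eq_of_testBit_eq fun j => ?_
      rw [Nat.testBit_two_pow_sub_one]
      by_cases hj : j < L
      · obtain ⟨i, hi⟩ := h j hj
        rw [← hi, hall i]
        simpa [hi] using hj
      · rw [Nat.testBit_lt_two_pow ((Finset.mem_range.1 hA).trans_le
          (Nat.pow_le_pow_right (by norm_num) (by omega)))]
        simp [hj]
  · push Not at h
    obtain ⟨j, hj, hno⟩ := h
    rw [← Finset.sum_filter]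
    refine Finset.sum_involution (fun A _ => A ^^^ 2 ^ j) ?_ ?_ ?_ ?_
    · intro A _; exact CharTwo.add_self_eq_zero c
    · intro A _ _ he
      have := congrArg (fun x => x.testBit j) he
      simp [Nat.testBit_xor] at this
    · intro A hA
      rw [Finset.mem_filter, Finset.mem_range] at hA ⊢
      refine ⟨Nat.xor_lt_two_pow hA.1 (Nat.pow_lt_pow_right (by norm_num) hj), fun i => ?_⟩
      rw [Nat.testBit_xor, hA.2 i, Nat.testBit_two_pow]
      simp [Ne.symm (hno i)]
    · intro A _
      simp

/-- Expanding the product chooses a label for each factor; after exchanging the sums, `sum_testBit`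
keeps the choices that use every label. -/
theorem sieveSum_eq [CharP R 2] (L : ℕ) (ys : List (ℕ → R)) :
    sieveSum L ys = ∑ φ ∈ (Fintype.piFinset fun _ : Fin ys.length => Finset.range L).filter
      (fun φ => ∀ j < L, ∃ i, φ i = j), ∏ i : Fin ys.length, ys[i] (φ i) := by
  classical
  have h1 : ∀ A : ℕ, (ys.map fun y => ∑ j ∈ Finset.range L, if A.testBit j then y j else 0).prod =
      ∑ φ ∈ Fintype.piFinset fun _ : Fin ys.length => Finset.range L,
        if ∀ i, A.testBit (φ i) = true then ∏ i : Fin ys.length, ys[i] (φ i) else 0 := by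
    intro A
    rw [← Fin.prod_univ_fun_getElem, Finset.prod_univ_sum]
    refine Finset.sum_congr rfl fun φ _ => ?_
    rw [Finset.prod_ite_zero]
    simp
  simp only [sieveSum, h1]
  rw [Finset.sum_comm, Finset.sum_filter]
  refine Finset.sum_congr rfl fun φ hφ => ?_
  rw [sum_testBit]
  intro i
  simpa using Fintype.mem_piFinset.1 hφ i

theorem sieveSum_of_length_lt [CharP R 2] {L : ℕ} {ys : List (ℕ → R)} (h : ys.length < L) :
    sieveSum L ys = 0 := by
  rw [sieveSum_eq, Finset.filter_false_of_mem, Finset.sum_empty]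
  intro φ _ hs
  have h1 : Finset.range L ⊆ Finset.univ.image φ := by
    intro j hj
    obtain ⟨i, hi⟩ := hs j (Finset.mem_range.1 hj)
    exact Finset.mem_image.2 ⟨i, Finset.mem_univ _, hi⟩
  have h2 := (Finset.card_le_card h1).trans Finset.card_image_le
  simp at h2
  omega

theorem sieveSum_perm {L : ℕ} {ys ys' : List (ℕ → R)} (h : ys.Perm ys') :
    sieveSum L ys = sieveSum L ys' := by
  unfold sieveSum
  exact Finset.sum_congr rfl fun A _ => (h.map _).prod_eq

/-- In characteristic two the product of the two factors of a repeated object is the sum of the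
squares, hence a single factor of the same shape. The remaining fewer than `L` factors cannot use
all `L` labels. -/
theorem sieveSum_of_not_nodup [CharP R 2] {α : Type*} {L : ℕ} {l : List α} (y : α → ℕ → R)
    (hL : l.length = L) (h : ¬ l.Nodup) : sieveSum L (l.map y) = 0 := by
  rw [List.nodup_iff_sublist] at h
  push Not at h
  obtain ⟨q, hq⟩ := h
  obtain ⟨l', hl'⟩ := hq.exists_perm_append
  rw [sieveSum_perm (hl'.map y)]
  have h1 : sieveSum L (([q, q] ++ l').map y) =
      sieveSum L ((fun j => y q j ^ 2) :: l'.map y) := by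
    unfold sieveSum
    refine Finset.sum_congr rfl fun A _ => ?_
    simp only [List.cons_append, List.nil_append, List.map_cons, List.prod_cons]
    rw [← mul_assoc, ← sq, CharTwo.sum_sq]
    congr 1
    refine Finset.sum_congr rfl fun j _ => ?_
    split_ifs <;> simp
  rw [h1]
  apply sieveSum_of_length_lt
  have := hl'.length_eq
  simp at this ⊢
  omega

end sieve

namespace BranchingWalk

open BinaryTree

/-! ### Enumeration of branching walks -/

open Classical in
/-- The forests below `v`, reached from `u`, with children below `m` and subforests from `g`. -/
noncomputable def forests (a : ℕ → ℕ → Prop) (g : ℕ → ℕ → Finset (BinaryTree ℕ)) (u v : ℕ) :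
    ℕ → Finset (BinaryTree ℕ)
  | 0 => {nil}
  | m + 1 => forests a g u v m ∪ if m ≠ u ∧ a v m then
      (forests a g u v m ×ˢ g v m).image (fun p => node m p.1 p.2) else ∅

/-- The forests below `w`, reached from `v`, of height less than `t`. -/
noncomputable def trees (a : ℕ → ℕ → Prop) (n : ℕ) : ℕ → ℕ → ℕ → Finset (BinaryTree ℕ)
  | 0, _, _ => ∅
  | t + 1, v, w => forests a (trees a n t) v w n

variable {a : ℕ → ℕ → Prop} {n : ℕ}

theorem forests_mono {g : ℕ → ℕ → Finset (BinaryTree ℕ)} {u v m m' : ℕ} (h : m ≤ m') :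
    forests a g u v m ⊆ forests a g u v m' := by
  induction h with
  | refl => exact subset_rfl
  | step _ ih => exact ih.trans Finset.subset_union_left

theorem Vld.mono {X : BinaryTree ℕ} {u v m m' : ℕ} (h : m ≤ m') (hX : Vld a n X u v m) :
    Vld a n X u v m' := by
  cases X with
  | nil => trivial
  | node w l r => exact ⟨hX.1.trans_le h, hX.2⟩

theorem vld_of_mem_forests {g : ℕ → ℕ → Finset (BinaryTree ℕ)}
    (hg : ∀ v w, ∀ X ∈ g v w, Vld a n X v w n) {u v m : ℕ} {X : BinaryTree ℕ}
    (hX : X ∈ forests a g u v m) : Vld a n X u v m := by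
  induction m generalizing X with
  | zero => simp only [forests, Finset.mem_singleton] at hX; subst hX; trivial
  | succ m ih =>
    simp only [forests, Finset.mem_union] at hX
    rcases hX with hX | hX
    · exact (ih hX).mono (Nat.le_succ m)
    · split_ifs at hX with hc
      · obtain ⟨⟨l, r⟩, hp, rfl⟩ := Finset.mem_image.1 hX
        rw [Finset.mem_product] at hp
        exact ⟨Nat.lt_succ_self m, hc.1, hc.2, ih hp.1, hg v m r hp.2⟩
      · simp at hX

theorem vld_of_mem_trees {t v w : ℕ} {X : BinaryTree ℕ} (hX : X ∈ trees a n t v w) :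
    Vld a n X v w n := by
  induction t generalizing v w X with
  | zero => simp [trees] at hX
  | succ t ih => exact vld_of_mem_forests (fun v w X hX => ih hX) hX

theorem Vld.mem_forests {X : BinaryTree ℕ} {t u v m : ℕ} (h : Vld a n X u v m)
    (ht : X.numNodes ≤ t) : X ∈ forests a (trees a n t) u v m := by
  induction X generalizing t u v m with
  | nil => exact forests_mono (Nat.zero_le m) (by simp [forests])
  | node w l r hl hr =>
    obtain ⟨h1, h2, h3, h4, h5⟩ := h
    simp only [numNodes] at ht
    have hl' := hl h4 (t := t) (by omega)
    obtain ⟨t, rfl⟩ : ∃ t', t = t' + 1 := ⟨t - 1, by omega⟩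
    have hr' := hr h5 (t := t) (by omega)
    refine forests_mono (Nat.succ_le_of_lt h1) ?_
    simp only [forests, Finset.mem_union]
    refine .inr ?_
    rw [if_pos ⟨h2, h3⟩]
    exact Finset.mem_image.2 ⟨(l, r), Finset.mem_product.2 ⟨hl', hr'⟩, rfl⟩

theorem Vld.mem_trees {X : BinaryTree ℕ} {t v w : ℕ} (h : Vld a n X v w n)
    (ht : X.numNodes < t) : X ∈ trees a n t v w := by
  obtain ⟨t, rfl⟩ : ∃ t', t = t' + 1 := ⟨t - 1, by omega⟩
  exact h.mem_forests (by omega)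

section weights

variable {R : Type*} [CommSemiring R] (ed : ℕ → ℕ → R) (nl ni : ℕ → R)

/-- The weight of a forest below `v`: the product of weights of edges, leaves and inner nodes. -/
def wgt : BinaryTree ℕ → ℕ → R
  | nil, _ => 1
  | node w l r, v => wgt l v * (ed v w * (if r = nil then nl w else ni w * wgt r w))

/-- The weight of the edge from `v` to `w` and the forest below `w`. -/
def twgt (v w : ℕ) (Y : BinaryTree ℕ) : R :=
  ed v w * (if Y = nil then nl w else ni w * wgt ed nl ni Y w)

/-- A forest amounts to an independent decision for each vertex j other than the parent: no child
over j, or a child over j with a forest below it. The formula is distributivity; storing the largest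
child on top makes it an induction on `m`. -/
theorem sum_forests (ha : ∀ v w, ¬ a v w → ed v w = 0) (g : ℕ → ℕ → Finset (BinaryTree ℕ))
    (hg : ∀ v w, ∀ X ∈ g v w, Vld a n X v w n) (u v m : ℕ) :
    ∑ X ∈ forests a g u v m, wgt ed nl ni X v =
      ∏ j ∈ Finset.range m, if j = u then 1 else (1 + ∑ Y ∈ g v j, twgt ed nl ni v j Y) := by
  classical
  induction m with
  | zero => simp [forests, wgt]
  | succ m ih =>
    rw [Finset.prod_range_succ, ← ih, forests]
    have hdisj : Disjoint (forests a g u v m) (if m ≠ u ∧ a v m then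
        (forests a g u v m ×ˢ g v m).image (fun p => node m p.1 p.2) else ∅) := by
      rw [Finset.disjoint_left]
      intro X hX hX'
      split_ifs at hX' with hc
      · obtain ⟨⟨l, r⟩, -, rfl⟩ := Finset.mem_image.1 hX'
        exact lt_irrefl _ (vld_of_mem_forests hg hX).1
      · simp at hX'
    rw [Finset.sum_union hdisj]
    by_cases hu : m = u
    · simp [hu]
    · rw [if_neg hu, mul_add, mul_one]
      congr 1
      by_cases hc : a v m
      · rw [if_pos ⟨hu, hc⟩, Finset.sum_image, Finset.sum_product, Finset.sum_mul]
        · refine Finset.sum_congr rfl fun X _ => ?_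
          rw [Finset.mul_sum]
          rfl
        · rintro ⟨l, r⟩ _ ⟨l', r'⟩ _ he
          simp only [node.injEq, true_and] at he
          exact Prod.ext he.1 he.2
      · rw [if_neg (fun h => hc h.2), Finset.sum_empty]
        have : ∑ Y ∈ g v m, twgt ed nl ni v m Y = 0 := Finset.sum_eq_zero fun Y _ => by
          rw [twgt, ha v m hc, zero_mul]
        rw [this, mul_zero]

/-- The recursion for the sum of the weights of the branching walks of bounded height. -/
theorem sum_trees_succ {R : Type*} [CommRing R] (ed : ℕ → ℕ → R) (nl ni : ℕ → R)
    (ha : ∀ v w, ¬ a v w → ed v w = 0) (t v w : ℕ) :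
    ∑ Y ∈ trees a n (t + 1) v w, twgt ed nl ni v w Y = ed v w * (nl w + ni w *
      ((∏ j ∈ Finset.range n, if j = v then 1 else
        (1 + ∑ Y ∈ trees a n t w j, twgt ed nl ni w j Y)) - 1)) := by
  classical
  rw [← sum_forests ed nl ni ha (trees a n t) (fun v w X hX => vld_of_mem_trees hX)]
  -- The empty forest means that `w` is a leaf, with weight `nl` in place of `ni`; this is why its
  -- contribution 1 is subtracted from the product.
  have hnil : nil ∈ forests a (trees a n t) v w n :=
    forests_mono (Nat.zero_le n) (by simp [forests])
  rw [trees, ← Finset.add_sum_erase _ _ hnil, ← Finset.add_sum_erase _ _ hnil]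
  have : ∑ Y ∈ (forests a (trees a n t) v w n).erase nil, twgt ed nl ni v w Y =
      ed v w * (ni w * ∑ Y ∈ (forests a (trees a n t) v w n).erase nil, wgt ed nl ni Y w) := by
    rw [Finset.mul_sum, Finset.mul_sum]
    refine Finset.sum_congr rfl fun Y hY => ?_
    rw [twgt, if_neg (Finset.ne_of_mem_erase hY)]
  rw [this, twgt, if_pos rfl, wgt]
  ring

/-- The weight in terms of edges, objects and the number of inner nodes. -/
theorem wgt_eq {V₁ : ℕ → Bool} (E O : Sym2 ℕ → R) (I : R)
    (hed : ∀ v w, a v w → ed v w = E s(v, w) *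
      (if V₁ v = false ∧ V₁ w = false then O s(v, w) else 1))
    (hnl : ∀ w, nl w = O s(w, w)) (hni : ∀ w, ni w = (if V₁ w = true then O s(w, w) else 1) * I)
    {X : BinaryTree ℕ} {u v m : ℕ} (h : Vld a n X u v m) :
    wgt ed nl ni X v = ((edg X v).map E).prod * ((obj V₁ X v).map O).prod * I ^ inn X := by
  induction X generalizing u v m with
  | nil => simp [wgt, edg, obj, inn]
  | node w l r hl hr =>
    obtain ⟨h1, h2, h3, h4, h5⟩ := h
    simp only [wgt, edg, obj, inn, hl h4, hed v w h3, List.map_cons, List.map_append,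
      List.prod_cons, List.prod_append]
    have e1 : ((if V₁ v = false ∧ V₁ w = false then [s(v, w)] else []).map O).prod =
        if V₁ v = false ∧ V₁ w = false then O s(v, w) else 1 := by split_ifs <;> simp
    rw [e1]
    by_cases hnil : r = nil
    · subst hnil
      simp [hnl, edg, obj, inn]
      ring_nf
    · have e2 : ((if V₁ w = true ∨ r = nil then [s(w, w)] else []).map O).prod =
          if V₁ w = true then O s(w, w) else 1 := by split_ifs <;> simp_all
      rw [if_neg hnil, if_neg hnil, hr h5, hni, e2]
      ring

end weights

end BranchingWalk


/-! ### Parities of coefficients from the value at a power of two -/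

open Polynomial in
/-- If the coefficients are smaller than `β`, then they are the digits of the value at `β`. -/
theorem Polynomial.eval_div_pow_mod {β : ℕ} (hβ : 0 < β) (P : ℕ[X]) (hP : ∀ e, P.coeff e < β) (e : ℕ) :
    P.eval β / β ^ e % β = P.coeff e := by
  have hdiv : ∀ P : ℕ[X], P.eval β = P.coeff 0 + β * P.divX.eval β := by
    intro P
    conv_lhs => rw [← P.divX_mul_X_add]
    simp
    ring
  induction e generalizing P with
  | zero =>
    rw [hdiv, pow_zero, Nat.div_one, Nat.add_mul_mod_self_left, Nat.mod_eq_of_lt (hP 0)]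
  | succ e ih =>
    rw [pow_succ', ← Nat.div_div_eq_div_mul, hdiv, Nat.add_mul_div_left _ _ hβ,
      Nat.div_eq_of_lt (hP 0), zero_add, ih, coeff_divX]
    intro e
    rw [coeff_divX]
    exact hP _

/-- Both sides are the bit number B * e, and the residue modulo 2 ^ (B * K) determines the bits
below B * K. -/
theorem Nat.ModEq.div_pow_mod_two {x y B K e : ℕ} (h : x ≡ y [MOD 2 ^ (B * K)]) (hB : 0 < B)
    (he : e < K) : x / (2 ^ B) ^ e % 2 = y / (2 ^ B) ^ e % 2 := by
  have h1 : B * e < B * K := Nat.mul_lt_mul_of_pos_left he hB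
  have key : ∀ z : ℕ, z / (2 ^ B) ^ e % 2 = (z % 2 ^ (B * K)) / (2 ^ B) ^ e % 2 := by
    intro z
    have h2 := Nat.testBit_mod_two_pow z (B * K) (B * e)
    rw [decide_eq_true h1, Bool.true_and, Nat.testBit_eq_decide_div_mod_eq, Nat.testBit_eq_decide_div_mod_eq,
      pow_mul 2 B e] at h2
    simp only [decide_eq_decide] at h2
    rcases Nat.mod_two_eq_zero_or_one (z / (2 ^ B) ^ e) with h3 | h3 <;>
    rcases Nat.mod_two_eq_zero_or_one (z % 2 ^ (B * K) / (2 ^ B) ^ e) with h4 | h4 <;> omega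
  rw [key x, key y, h]

namespace BranchingWalk

open BinaryTree

section hom

variable {R R' : Type*} [CommSemiring R] [CommSemiring R'] {ed : ℕ → ℕ → R} {nl ni : ℕ → R}

theorem map_wgt (f : R →+* R') (X : BinaryTree ℕ) (v : ℕ) :
    f (wgt ed nl ni X v) = wgt (fun v w => f (ed v w)) (fun w => f (nl w)) (fun w => f (ni w)) X v := by
  induction X generalizing v with
  | nil => simp [wgt]
  | node w l r hl hr =>
    simp only [wgt, map_mul, hl]
    split_ifs
    · rfl
    · rw [map_mul, hr]

theorem map_twgt (f : R →+* R') (v w : ℕ) (Y : BinaryTree ℕ) :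
    f (twgt ed nl ni v w Y) =
      twgt (fun v w => f (ed v w)) (fun w => f (nl w)) (fun w => f (ni w)) v w Y := by
  simp only [twgt, map_mul]
  split_ifs
  · rfl
  · rw [map_mul, map_wgt]

theorem wgt_node_nil (c v : ℕ) (Y : BinaryTree ℕ) :
    wgt ed nl ni (node c nil Y) v = twgt ed nl ni v c Y := by
  simp [wgt, twgt]

theorem wgt_scale (q : R) (X : BinaryTree ℕ) (v : ℕ) :
    wgt (fun v w => q * ed v w) nl ni X v = q ^ X.numNodes * wgt ed nl ni X v := by
  induction X generalizing v with
  | nil => simp [wgt, numNodes]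
  | node w l r hl hr =>
    simp only [wgt, hl, hr, numNodes]
    split_ifs with h
    · subst h; simp only [numNodes]; ring
    · ring

theorem twgt_scale (q : R) (v w : ℕ) (Y : BinaryTree ℕ) :
    twgt (fun v w => q * ed v w) nl ni v w Y = q ^ (Y.numNodes + 1) * twgt ed nl ni v w Y := by
  rw [← wgt_node_nil, wgt_scale, wgt_node_nil]
  simp [numNodes]

end hom

section bound

variable {a : ℕ → ℕ → Prop} {n : ℕ}

/-- A bound for the number of branching walks of bounded size. -/
theorem sum_twgt_le {ed : ℕ → ℕ → ℕ} {nl ni : ℕ → ℕ} (ha : ∀ v w, ¬ a v w → ed v w = 0) {c : ℕ}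
    (hc : 0 < c) (hed : ∀ v w, ed v w ≤ c) (hnl : ∀ w, nl w ≤ c) (hni : ∀ w, ni w ≤ c) (t m v w : ℕ) :
    ∑ Y ∈ (trees a n t v w).filter (fun Y => Y.numNodes < m), twgt ed nl ni v w Y ≤
      (c * c * 2 ^ n) ^ m := by
  -- Each edge is given an additional factor q, chosen so that the recursion keeps all sums at most
  -- 1, whatever the height: q * c * (c + c * (2 ^ n - 1)) = 1. A walk with at most m edges,
  -- counting the one from v to w, loses no more than the factor q ^ m.
  let q : ℚ := ((c * c * 2 ^ n : ℕ) : ℚ)⁻¹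
  have hC : 1 ≤ c * c * 2 ^ n := Nat.one_le_iff_ne_zero.2 (by positivity)
  have hC' : (1 : ℚ) ≤ ((c * c * 2 ^ n : ℕ) : ℚ) := by exact_mod_cast hC
  have hq0 : 0 < q := by positivity
  have hq1 : q ≤ 1 := inv_le_one_of_one_le₀ hC'
  let tq : ℕ → ℕ → BinaryTree ℕ → ℚ :=
    twgt (fun v w => q * (ed v w : ℚ)) (fun w => (nl w : ℚ)) (fun w => (ni w : ℚ))
  have htq : ∀ v w Y, tq v w Y = q ^ (Y.numNodes + 1) * (twgt ed nl ni v w Y : ℕ) := by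
    intro v w Y
    have h1 := map_twgt (ed := ed) (nl := nl) (ni := ni) (Nat.castRingHom ℚ) v w Y
    simp only [eq_natCast] at h1
    rw [h1]
    exact twgt_scale q v w Y
  have h0 : ∀ v w Y, 0 ≤ tq v w Y := fun v w Y => by rw [htq]; positivity
  have key : ∀ t v w, ∑ Y ∈ trees a n t v w, tq v w Y ≤ 1 := by
    intro t
    induction t with
    | zero => intro v w; simp [trees]
    | succ t ih =>
      intro v w
      show ∑ Y ∈ trees a n (t + 1) v w, twgt _ _ _ v w Y ≤ 1
      rw [sum_trees_succ _ _ _ (fun v w h => by simp [ha v w h])]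
      have h1 : (∏ j ∈ Finset.range n, if j = v then 1 else
          (1 + ∑ Y ∈ trees a n t w j, tq w j Y)) ≤ 2 ^ n := by
        calc _ ≤ ∏ j ∈ Finset.range n, (2 : ℚ) := by
              refine Finset.prod_le_prod (fun j _ => ?_) fun j _ => ?_
              · split_ifs
                · norm_num
                · exact add_nonneg zero_le_one (Finset.sum_nonneg fun Y _ => h0 _ _ _)
              · split_ifs
                · norm_num
                · linarith [ih w j]
          _ = 2 ^ n := by simp
      have h1' : 1 ≤ (∏ j ∈ Finset.range n, if j = v then 1 else
          (1 + ∑ Y ∈ trees a n t w j, tq w j Y)) := by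
        refine Finset.prod_induction _ (fun x : ℚ => 1 ≤ x) (fun x y hx hy => one_le_mul_of_one_le_of_one_le hx hy) le_rfl fun j _ => ?_
        split_ifs
        · exact le_rfl
        · exact le_add_of_nonneg_right (Finset.sum_nonneg fun Y _ => h0 _ _ _)
      have h2 : (nl w : ℚ) ≤ c := by exact_mod_cast hnl w
      have h3 : (ni w : ℚ) ≤ c := by exact_mod_cast hni w
      have h4 : (ed v w : ℚ) ≤ c := by exact_mod_cast hed v w
      have h5 : (nl w : ℚ) + ni w * ((∏ j ∈ Finset.range n, if j = v then 1 else
          (1 + ∑ Y ∈ trees a n t w j, tq w j Y)) - 1) ≤ c * 2 ^ n := by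
        calc _ ≤ (c : ℚ) + c * (2 ^ n - 1) := by
              gcongr
          _ = c * 2 ^ n := by ring
      calc q * (ed v w : ℚ) * _ ≤ q * c * (c * 2 ^ n) := by
            refine mul_le_mul (by gcongr) h5 ?_ (by positivity)
            have : (0 : ℚ) ≤ ni w * ((∏ j ∈ Finset.range n, if j = v then 1 else
              (1 + ∑ Y ∈ trees a n t w j, tq w j Y)) - 1) := mul_nonneg (by positivity) (by linarith)
            positivity
        _ = q * ((c * c * 2 ^ n : ℕ) : ℚ) := by push_cast; ring
        _ = 1 := inv_mul_cancel₀ (by positivity)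
  have h1 : q ^ m * ((∑ Y ∈ (trees a n t v w).filter (fun Y => Y.numNodes < m),
      twgt ed nl ni v w Y : ℕ) : ℚ) ≤ 1 := by
    rw [Nat.cast_sum, Finset.mul_sum]
    refine le_trans (Finset.sum_le_sum fun Y hY => ?_)
      ((Finset.sum_le_sum_of_subset_of_nonneg (Finset.filter_subset _ _) fun Y _ _ => h0 v w Y).trans
        (key t v w))
    rw [htq]
    refine mul_le_mul_of_nonneg_right ?_ (by positivity)
    exact pow_le_pow_of_le_one hq0.le hq1 (Finset.mem_filter.1 hY).2
  have h2 : ((∑ Y ∈ (trees a n t v w).filter (fun Y => Y.numNodes < m),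
      twgt ed nl ni v w Y : ℕ) : ℚ) ≤ (((c * c * 2 ^ n) ^ m : ℕ) : ℚ) := by
    rw [inv_pow, inv_mul_le_iff₀ (by positivity), mul_one] at h1
    exact_mod_cast h1
  exact_mod_cast h2

end bound

/-! ### The table -/

/-- The product over the children below `m` in the recursion for the table. -/
def tblAcc (M v : ℕ) (row : ℕ → ℕ) : ℕ → ℕ
  | 0 => 1
  | m + 1 => if m = v then tblAcc M v row m else tblAcc M v row m * (1 + row m) % M

/-- The sums of the weights of branching walks modulo `M`. -/
def tbl (M n : ℕ) (ed : ℕ → ℕ → ℕ) (nl ni : ℕ → ℕ) : ℕ → ℕ → ℕ → ℕ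
  | 0, _, _ => 0
  | t + 1, v, w => ed v w * (nl w + ni w * (tblAcc M v (tbl M n ed nl ni t w) n + (M - 1))) % M

theorem cast_tblAcc {M : ℕ} (v : ℕ) (row : ℕ → ℕ) (m : ℕ) :
    (tblAcc M v row m : ZMod M) = ∏ j ∈ Finset.range m, if j = v then 1 else (1 + (row j : ZMod M)) := by
  induction m with
  | zero => simp [tblAcc]
  | succ m ih =>
    rw [Finset.prod_range_succ, ← ih, tblAcc]
    split_ifs <;> simp

theorem cast_tbl {a : ℕ → ℕ → Prop} {M n : ℕ} (hM : 0 < M) {ed : ℕ → ℕ → ℕ} {nl ni : ℕ → ℕ}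
    (ha : ∀ v w, ¬ a v w → ed v w = 0) (t v w : ℕ) :
    (tbl M n ed nl ni t v w : ZMod M) =
      ((∑ Y ∈ trees a n t v w, twgt ed nl ni v w Y : ℕ) : ZMod M) := by
  have hcast : ∀ t v w, ((∑ Y ∈ trees a n t v w, twgt ed nl ni v w Y : ℕ) : ZMod M) =
      ∑ Y ∈ trees a n t v w, twgt (fun v w => (ed v w : ZMod M)) (fun w => (nl w : ZMod M))
        (fun w => (ni w : ZMod M)) v w Y := by
    intro t v w
    rw [Nat.cast_sum]
    refine Finset.sum_congr rfl fun Y _ => ?_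
    have h1 := map_twgt (ed := ed) (nl := nl) (ni := ni) (Nat.castRingHom (ZMod M)) v w Y
    simpa only [eq_natCast] using h1
  induction t generalizing v w with
  | zero => simp [tbl, trees]
  | succ t ih =>
    -- The summand `M - 1` in `tbl` stands for the -1 of the recursion, as natural numbers have no
    -- negatives.
    have h1 : ((M - 1 : ℕ) : ZMod M) = -1 := by
      rw [Nat.cast_sub hM]; simp
    rw [hcast, sum_trees_succ _ _ _ (fun v w h => by simp [ha v w h]), tbl]
    simp only [← hcast, ← ih]
    rw [ZMod.natCast_mod]
    push_cast
    rw [cast_tblAcc, h1]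
    ring

/-! ### The sieve -/

/-- The data that determine the weights of branching walks. -/
structure SieveData where
  adj : ℕ → ℕ → Prop
  n : ℕ
  r : ℕ
  V₁ : ℕ → Bool
  wS : Sym2 ℕ → ℕ → ℕ
  L : ℕ
  J : ℕ
  W₁ : ℕ
  W₂ : ℕ
  W₃ : ℕ

namespace SieveData

variable (p : SieveData) {R : Type*} [CommSemiring R] (z : R) (A : ℕ)

/-- The weight of an edge. -/
def E (q : Sym2 ℕ) : R := z ^ (p.W₃ + p.wS q (p.J - 1))

/-- The weight of an object with labels in `A`. -/
def O (q : Sym2 ℕ) : R := ∑ j ∈ Finset.range p.L, if A.testBit j then z ^ (p.W₂ + p.wS q j) else 0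

open Classical in
/-- The weight of an edge, including that of the object. -/
noncomputable def ed (v w : ℕ) : R := if p.adj v w then
  p.E z s(v, w) * (if p.V₁ v = false ∧ p.V₁ w = false then p.O z A s(v, w) else 1) else 0

/-- The weight of a leaf. -/
def nl (w : ℕ) : R := p.O z A s(w, w)

/-- The weight of an inner node. -/
def ni (w : ℕ) : R := (if p.V₁ w = true then p.O z A s(w, w) else 1) * z ^ p.W₁

/-- The total weight of a branching walk. -/
noncomputable def full (X : BinaryTree ℕ) : R :=
  p.nl z A p.r * wgt (p.ed z A) (p.nl z A) (p.ni z A) X p.r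

/-- The number that the algorithm computes. -/
noncomputable def tot (B : ℕ) : ℕ := ∑ A ∈ Finset.range (2 ^ p.L), ∑ c ∈ Finset.range p.n,
  p.nl (2 ^ B) A p.r * tbl (2 ^ (B * ((p.n + 1) * p.W₃))) p.n (p.ed (2 ^ B) A) (p.nl (2 ^ B) A)
    (p.ni (2 ^ B) A) p.n p.r c

open Classical in
/-- The branching walks with at most `n` edges. -/
noncomputable def walks : Finset (BinaryTree ℕ) := (Finset.range p.n).biUnion fun c =>
  ((trees p.adj p.n p.n p.r c).filter fun Y => Y.numNodes < p.n ∧ p.adj p.r c).image (node c nil)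

/-- The weights of the branching walks, apart from `W₁`, `W₂` and `W₃`. -/
noncomputable def κ (X : BinaryTree ℕ) : Polynomial (ZMod 2) :=
  Polynomial.X ^ (((edg X p.r).map fun q => p.wS q (p.J - 1)).sum) *
    sieveSum p.L ((fobj p.V₁ p.r X).map fun q j => Polynomial.X ^ p.wS q j)

variable {p}

theorem mem_walks (hirr : ∀ v, ¬ p.adj v v) {X : BinaryTree ℕ} :
    X ∈ p.walks ↔ IsWalk p.adj p.n p.r X ∧ X.numNodes ≤ p.n := by
  simp only [walks, Finset.mem_biUnion, Finset.mem_range, Finset.mem_image, Finset.mem_filter]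
  constructor
  · rintro ⟨c, hc, Y, ⟨hY, h1, h2⟩, rfl⟩
    refine ⟨⟨⟨c, Y, rfl⟩, hc, fun h => hirr _ (h ▸ h2), h2, trivial, vld_of_mem_trees hY⟩, ?_⟩
    simp only [numNodes]; omega
  · rintro ⟨⟨⟨c, Y, rfl⟩, h1, h2, h3, -, h5⟩, h6⟩
    simp only [numNodes] at h6
    exact ⟨c, h1, Y, ⟨h5.mem_trees (by omega), by omega, h3⟩, rfl⟩

open Classical in
theorem sum_walks {M : Type*} [AddCommMonoid M] (f : BinaryTree ℕ → M) :
    ∑ X ∈ p.walks, f X = ∑ c ∈ Finset.range p.n,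
      ∑ Y ∈ (trees p.adj p.n p.n p.r c).filter (fun Y => Y.numNodes < p.n ∧ p.adj p.r c),
        f (node c nil Y) := by
  rw [walks, Finset.sum_biUnion]
  · refine Finset.sum_congr rfl fun c _ => ?_
    rw [Finset.sum_image fun Y _ Y' _ h => by simpa using h]
  · intro c _ c' _ hne
    simp only [Function.onFun]
    rw [Finset.disjoint_left]
    intro X hX hX'
    obtain ⟨Y, -, rfl⟩ := Finset.mem_image.1 hX
    obtain ⟨Y', -, h⟩ := Finset.mem_image.1 hX'
    simp only [node.injEq] at h
    exact hne h.1.symm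

section hom

variable {R' : Type*} [CommSemiring R'] (f : R →+* R')

theorem map_E (q : Sym2 ℕ) : f (p.E z q) = p.E (f z) q := by simp [E]

theorem map_O (q : Sym2 ℕ) : f (p.O z A q) = p.O (f z) A q := by
  simp only [O, map_sum]
  refine Finset.sum_congr rfl fun j _ => ?_
  split_ifs <;> simp

theorem map_ed (v w : ℕ) : f (p.ed z A v w) = p.ed (f z) A v w := by
  simp only [ed]
  split_ifs <;> simp [map_E, map_O]

theorem map_nl (w : ℕ) : f (p.nl z A w) = p.nl (f z) A w := map_O _ _ _ _

theorem map_ni (w : ℕ) : f (p.ni z A w) = p.ni (f z) A w := by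
  simp only [ni]
  split_ifs <;> simp [map_O]

theorem map_full (X : BinaryTree ℕ) : f (p.full z A X) = p.full (f z) A X := by
  simp only [full, map_mul, map_nl, map_wgt, map_ed, map_ni]

end hom

theorem ed_of_not {v w : ℕ} (h : ¬ p.adj v w) : p.ed z A v w = 0 := if_neg h

theorem wgt_eq_prod {u v m : ℕ} {X : BinaryTree ℕ} (h : Vld p.adj p.n X u v m) :
    wgt (p.ed z A) (p.nl z A) (p.ni z A) X v =
      ((edg X v).map (p.E z)).prod * ((obj p.V₁ X v).map (p.O z A)).prod * (z ^ p.W₁) ^ inn X :=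
  wgt_eq _ _ _ _ _ _ (fun _ _ hvw => if_pos hvw) (fun _ => rfl) (fun _ => rfl) h

theorem prod_E (l : List (Sym2 ℕ)) : (l.map (p.E z)).prod =
    z ^ (p.W₃ * l.length + (l.map fun q => p.wS q (p.J - 1)).sum) := by
  induction l with
  | nil => simp
  | cons q l ih => simp only [List.map_cons, List.prod_cons, ih, E, List.length_cons,
      List.sum_cons]; ring

theorem full_eq_prod {X : BinaryTree ℕ} (h : IsWalk p.adj p.n p.r X) :
    p.full z A X = z ^ (p.W₃ * X.numNodes + p.W₁ * inn X +
      ((edg X p.r).map fun q => p.wS q (p.J - 1)).sum) * ((fobj p.V₁ p.r X).map (p.O z A)).prod := by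
  rw [full, wgt_eq_prod z A h.2, prod_E, length_edg, fobj, List.map_cons, List.prod_cons, nl]
  ring

/-- The table bounds the height of walks but not their size. Every edge contributes at least `W₃` to
the exponent, so walks with more than n edges vanish modulo 2 ^ (B * ((n + 1) * W₃)), and only the
finitely many in `walks` remain. -/
theorem tot_modEq (B : ℕ) : p.tot B ≡ ∑ A ∈ Finset.range (2 ^ p.L), ∑ X ∈ p.walks,
    p.full (2 ^ B) A X [MOD 2 ^ (B * ((p.n + 1) * p.W₃))] := by
  classical
  rw [← ZMod.natCast_eq_natCast_iff, tot]
  push_cast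
  refine Finset.sum_congr rfl fun A _ => ?_
  rw [sum_walks]
  refine Finset.sum_congr rfl fun c hc => ?_
  rw [cast_tbl (a := p.adj) (by positivity) (fun _ _ h => ed_of_not _ _ h), Nat.cast_sum,
    Finset.mul_sum, Finset.sum_filter]
  refine Finset.sum_congr rfl fun Y hY => ?_
  by_cases hac : p.adj p.r c
  · by_cases hn : Y.numNodes < p.n
    · rw [if_pos ⟨hn, hac⟩, full, wgt_node_nil]
      push_cast
      rfl
    · rw [if_neg (fun h => hn h.1), ← Nat.cast_mul, ZMod.natCast_eq_zero_iff, ← wgt_node_nil]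
      have hne : wgt (p.ed (2 ^ B) A) (p.nl (2 ^ B) A) (p.ni (2 ^ B) A) (node c nil Y) p.r =
          p.ed (2 ^ B) A p.r c * (if Y = nil then p.nl (2 ^ B) A c else p.ni (2 ^ B) A c *
            wgt (p.ed (2 ^ B) A) (p.nl (2 ^ B) A) (p.ni (2 ^ B) A) Y c) := by simp [wgt]
      have h1 : (2 ^ B) ^ p.W₃ ∣ p.ed (2 ^ B) A p.r c := by
        rw [ed, if_pos hac, E, pow_add]
        exact Dvd.dvd.mul_right (Dvd.dvd.mul_right dvd_rfl _) _
      have h2 : (2 ^ B) ^ (p.W₃ * Y.numNodes) ∣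
          wgt (p.ed (2 ^ B) A) (p.nl (2 ^ B) A) (p.ni (2 ^ B) A) Y c := by
        rw [wgt_eq_prod (2 ^ B) A (vld_of_mem_trees hY), prod_E, length_edg, pow_add]
        exact Dvd.dvd.mul_right (Dvd.dvd.mul_right (Dvd.dvd.mul_right dvd_rfl _) _) _
      refine Dvd.dvd.mul_left ?_ _
      rw [hne]
      split_ifs with h3
      · have hn0 : p.n = 0 := by rw [h3, numNodes] at hn; omega
        have := Finset.mem_range.1 hc
        omega
      · have h4 : 2 ^ (B * ((p.n + 1) * p.W₃)) ∣ (2 ^ B) ^ p.W₃ * (2 ^ B) ^ (p.W₃ * Y.numNodes) := by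
          rw [← pow_add, ← pow_mul]
          refine pow_dvd_pow _ (Nat.mul_le_mul_left B ?_)
          rw [show p.W₃ + p.W₃ * Y.numNodes = p.W₃ * (Y.numNodes + 1) by ring, mul_comm]
          exact Nat.mul_le_mul_left _ (by omega)
        exact h4.trans (mul_dvd_mul h1 (Dvd.dvd.mul_left h2 _))
  · rw [if_neg (fun h => hac h.2), twgt, ed_of_not _ _ hac]
    simp

end SieveData

end BranchingWalk


/-! ### The walks that survive modulo two -/

namespace BranchingWalk

open BinaryTree

theorem length_fobj_le (V₁ : ℕ → Bool) (r : ℕ) (X : BinaryTree ℕ) :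
    (fobj V₁ r X).length ≤ 2 * X.numNodes + 1 := by
  have := length_obj_le V₁ X r
  simp only [fobj, List.length_cons]; omega

theorem radix_unique {a b x y W : ℕ} (hx : x < W) (hy : y < W) (h : a * W + x = b * W + y) :
    a = b ∧ x = y := by
  have h1 := congrArg (· / W) h
  have hW : 0 < W := by omega
  simp only [Nat.add_comm _ x, Nat.add_comm _ y, Nat.add_mul_div_right _ _ hW,
    Nat.div_eq_of_lt hx, Nat.div_eq_of_lt hy, zero_add] at h1
  subst h1
  exact ⟨rfl, by omega⟩

theorem sieveSum_map_mul {R α : Type*} [CommRing R] (L : ℕ) (l : List α) (c : R) (y : α → ℕ → R) :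
    sieveSum L (l.map fun q j => c * y q j) = c ^ l.length * sieveSum L (l.map y) := by
  rw [sieveSum, sieveSum, Finset.mul_sum]
  refine Finset.sum_congr rfl fun A _ => ?_
  induction l with
  | nil => simp
  | cons q l ih =>
    have : (∑ j ∈ Finset.range L, if A.testBit j then c * y q j else 0) =
        c * ∑ j ∈ Finset.range L, if A.testBit j then y q j else 0 := by
      rw [Finset.mul_sum]
      exact Finset.sum_congr rfl fun j _ => by split_ifs <;> simp
    simp only [List.map_cons, List.prod_cons, ih, this, List.length_cons]
    ring

namespace SieveData

open Polynomial

/-- The sizes of the weights fit together. -/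
structure Fits (p : SieveData) (wmax B : ℕ) : Prop where
  irr : ∀ v, ¬ p.adj v v
  symm : ∀ v w, p.adj v w → p.adj w v
  lt : ∀ v w, p.adj v w → w < p.n
  L_lt : p.L < p.J
  wS_lt : ∀ q j, p.wS q j < wmax
  W₁_eq : p.W₁ = (3 * p.n + 2) * wmax
  W₂_eq : p.W₂ = p.W₁ * (p.n + 2)
  W₃_eq : p.W₃ = p.W₂ * (2 * p.n + 2 + p.J)
  B_eq : B = (2 * p.J + p.n) * p.n + 2 * p.J + p.n + 1

variable {p : SieveData} {wmax B : ℕ}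

/-- The generating polynomial. -/
noncomputable def gen (p : SieveData) (R : Type*) [CommSemiring R] : R[X] :=
  ∑ A ∈ Finset.range (2 ^ p.L), ∑ Y ∈ p.walks, p.full (X : R[X]) A Y

theorem eval_gen (z : ℕ) : (p.gen ℕ).eval z =
    ∑ A ∈ Finset.range (2 ^ p.L), ∑ Y ∈ p.walks, p.full z A Y := by
  rw [gen, ← coe_evalRingHom, map_sum]
  refine Finset.sum_congr rfl fun A _ => ?_
  rw [map_sum]
  refine Finset.sum_congr rfl fun Y _ => ?_
  rw [map_full, coe_evalRingHom, eval_X]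

theorem map_gen (R : Type*) [CommSemiring R] : (p.gen ℕ).map (Nat.castRingHom R) = p.gen R := by
  rw [gen, gen, ← coe_mapRingHom, map_sum]
  refine Finset.sum_congr rfl fun A _ => ?_
  rw [map_sum]
  refine Finset.sum_congr rfl fun Y _ => ?_
  rw [map_full, coe_mapRingHom, map_X]

/-- The coefficients are nonnegative, so the value at 1 bounds them. There every local weight is at
most J, `sum_twgt_le` bounds the sum over walks, and `B` is the resulting exponent plus one. No
carries arise between the digits. -/
theorem coeff_gen_lt (hp : p.Fits wmax B) (e : ℕ) : (p.gen ℕ).coeff e < 2 ^ B := by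
  classical
  have h0 : (p.gen ℕ).coeff e ≤ (p.gen ℕ).eval 1 := by
    rw [eval_eq_sum_range]
    simp only [one_pow, mul_one]
    by_cases he : e ∈ Finset.range ((p.gen ℕ).natDegree + 1)
    · exact Finset.single_le_sum (f := fun i => (p.gen ℕ).coeff i) (fun i _ => Nat.zero_le _) he
    · rw [coeff_eq_zero_of_natDegree_lt (by simpa using he)]
      exact Nat.zero_le _
  refine h0.trans_lt ?_
  have hJ : 1 ≤ p.J := by have := hp.L_lt; omega
  have hO : ∀ A q, p.O (1 : ℕ) A q ≤ p.J := by
    intro A q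
    calc p.O (1 : ℕ) A q ≤ ∑ j ∈ Finset.range p.L, 1 :=
          Finset.sum_le_sum fun j _ => by split_ifs <;> simp
      _ ≤ p.J := by simp [hp.L_lt.le]
  have hed : ∀ A v w, p.ed (1 : ℕ) A v w ≤ p.J := by
    intro A v w
    simp only [ed, E, one_pow, one_mul]
    split_ifs
    · exact hO A _
    · exact hJ
    · exact Nat.zero_le _
  have hni : ∀ A w, p.ni (1 : ℕ) A w ≤ p.J := by
    intro A w
    simp only [ni, one_pow, mul_one]
    split_ifs
    · exact hO A _
    · exact hJ
  have h1 : ∀ A, ∑ Y ∈ p.walks, p.full (1 : ℕ) A Y ≤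
      p.n * (p.J * (p.J * p.J * 2 ^ p.n) ^ p.n) := by
    intro A
    rw [sum_walks]
    refine (Finset.sum_le_card_nsmul _ _ (p.J * (p.J * p.J * 2 ^ p.n) ^ p.n) fun c _ => ?_).trans
      (by simp)
    simp only [full, wgt_node_nil, ← Finset.mul_sum]
    refine Nat.mul_le_mul (hO A _) (le_trans (Finset.sum_le_sum_of_subset_of_nonneg (fun Y hY => ?_)
      fun _ _ _ => Nat.zero_le _) (sum_twgt_le (a := p.adj) (n := p.n) (fun _ _ h => ed_of_not _ _ h)
        hJ (hed A) (fun w => hO A s(w, w)) (hni A) p.n p.n p.r c))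
    rw [Finset.mem_filter] at hY ⊢
    exact ⟨hY.1, hY.2.1⟩
  have h2 : p.J * p.J * 2 ^ p.n ≤ 2 ^ (2 * p.J + p.n) := by
    rw [pow_add, two_mul, pow_add]
    have := (Nat.lt_two_pow_self (n := p.J)).le
    gcongr
  calc (p.gen ℕ).eval 1 ≤ ∑ A ∈ Finset.range (2 ^ p.L), p.n * (p.J * (p.J * p.J * 2 ^ p.n) ^ p.n) := by
        rw [eval_gen]; exact Finset.sum_le_sum fun A _ => h1 A
    _ = 2 ^ p.L * (p.n * (p.J * (p.J * p.J * 2 ^ p.n) ^ p.n)) := by simp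
    _ ≤ 2 ^ p.J * (2 ^ p.n * (2 ^ p.J * (2 ^ (2 * p.J + p.n)) ^ p.n)) := by
        have := (Nat.lt_two_pow_self (n := p.J)).le
        have := (Nat.lt_two_pow_self (n := p.n)).le
        have := hp.L_lt.le
        gcongr
        norm_num
    _ = 2 ^ ((2 * p.J + p.n) * p.n + 2 * p.J + p.n) := by
        rw [← pow_mul]; simp only [← pow_add]; congr 1; ring
    _ < 2 ^ B := by rw [hp.B_eq]; exact Nat.pow_lt_pow_right (by norm_num) (Nat.lt_succ_self _)

theorem sum_full (hY : BinaryTree ℕ) (h : IsWalk p.adj p.n p.r hY) :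
    ∑ A ∈ Finset.range (2 ^ p.L), p.full (X : (ZMod 2)[X]) A hY =
      X ^ (hY.numNodes * p.W₃ + (fobj p.V₁ p.r hY).length * p.W₂ + inn hY * p.W₁) * p.κ hY := by
  simp only [full_eq_prod _ _ h, ← Finset.mul_sum]
  have h1 : ∑ A ∈ Finset.range (2 ^ p.L), ((fobj p.V₁ p.r hY).map (p.O (X : (ZMod 2)[X]) A)).prod =
      sieveSum p.L ((fobj p.V₁ p.r hY).map fun q j => X ^ p.W₂ * X ^ p.wS q j) := by
    rw [sieveSum]
    refine Finset.sum_congr rfl fun A _ => ?_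
    rw [List.map_map]
    congr 2
    funext q
    simp [O, pow_add]
  rw [h1, sieveSum_map_mul, κ]
  ring

/-- At most n edges and 2n + 1 objects each add less than `wmax` to the degree. Hence the random
weights never reach `W₁`, which is (3n + 2) * wmax. -/
theorem coeff_κ_of_le (hp : p.Fits wmax B) {Y : BinaryTree ℕ} (hY : Y.numNodes ≤ p.n) {w : ℕ}
    (hw : p.W₁ ≤ w) : (p.κ Y).coeff w = 0 := by
  have hwm : 0 < wmax := by have := hp.wS_lt s(0, 0) 0; omega
  apply coeff_eq_zero_of_natDegree_lt
  have h1 : ((edg Y p.r).map fun q => p.wS q (p.J - 1)).sum ≤ p.n * wmax := by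
    refine (List.sum_le_card_nsmul _ wmax ?_).trans ?_
    · intro x hx
      obtain ⟨q, -, rfl⟩ := List.mem_map.1 hx
      exact (hp.wS_lt q _).le
    · rw [List.length_map, length_edg, smul_eq_mul]; gcongr
  have h2 : (sieveSum p.L ((fobj p.V₁ p.r Y).map fun q j =>
      (X : (ZMod 2)[X]) ^ p.wS q j)).natDegree ≤ (2 * p.n + 1) * wmax := by
    refine natDegree_sum_le_of_forall_le _ _ fun A _ => ?_
    refine (natDegree_list_prod_le _).trans ((List.sum_le_card_nsmul _ wmax ?_).trans ?_)
    · intro x hx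
      simp only [List.map_map, List.mem_map, Function.comp_apply] at hx
      obtain ⟨q, -, rfl⟩ := hx
      refine natDegree_sum_le_of_forall_le _ _ fun j _ => ?_
      split_ifs
      · rw [natDegree_X_pow]; exact (hp.wS_lt q _).le
      · simp
    · have := length_fobj_le p.V₁ p.r Y
      simp only [List.length_map, smul_eq_mul]
      gcongr; omega
  have h3 := natDegree_mul_le (p := (X : (ZMod 2)[X]) ^ (((edg Y p.r).map fun q => p.wS q (p.J - 1)).sum))
    (q := sieveSum p.L ((fobj p.V₁ p.r Y).map fun q j => (X : (ZMod 2)[X]) ^ p.wS q j))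
  rw [natDegree_X_pow] at h3
  rw [κ]
  have : p.W₁ = p.n * wmax + (2 * p.n + 1) * wmax + wmax := by rw [hp.W₁_eq]; ring
  omega

/-- The numbers of edges, objects and inner nodes and the random weight are the digits of the
exponent in a mixed radix; each range is large enough that these digits are unique. So one
coefficient isolates the walks of prescribed type. -/
theorem coeff_sum_full (hp : p.Fits wmax B) {Y : BinaryTree ℕ} (h : IsWalk p.adj p.n p.r Y)
    (hY : Y.numNodes ≤ p.n) {N k w : ℕ} (hk : k < p.n + 2) (hw : w < p.W₁) :
    (∑ A ∈ Finset.range (2 ^ p.L), p.full (X : (ZMod 2)[X]) A Y).coeff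
      (N * p.W₃ + p.L * p.W₂ + k * p.W₁ + w) =
    if Y.numNodes = N ∧ (fobj p.V₁ p.r Y).length = p.L ∧ inn Y = k then (p.κ Y).coeff w else 0 := by
  rw [sum_full Y h, coeff_X_pow_mul']
  by_cases hc : Y.numNodes = N ∧ (fobj p.V₁ p.r Y).length = p.L ∧ inn Y = k
  · rw [if_pos hc]
    obtain ⟨h1, h2, h3⟩ := hc
    rw [h1, h2, h3, if_pos (by omega)]
    congr 1; omega
  · rw [if_neg hc]
    split_ifs with hle
    · obtain ⟨d, hd⟩ := Nat.exists_eq_add_of_le hle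
      rw [hd, Nat.add_sub_cancel_left]
      by_cases hdw : d < p.W₁
      · exfalso
        apply hc
        have hin := inn_le Y
        have hfo := length_fobj_le p.V₁ p.r Y
        have hL := hp.L_lt
        have r1 : ∀ i x, i < p.n + 2 → x < p.W₁ → i * p.W₁ + x < p.W₂ := by
          intro i x hi hx
          rw [hp.W₂_eq]
          calc i * p.W₁ + x < i * p.W₁ + p.W₁ := by omega
            _ = p.W₁ * (i + 1) := by ring
            _ ≤ _ := Nat.mul_le_mul_left _ hi
        have r2 : ∀ l y, l < 2 * p.n + 2 + p.J → y < p.W₂ → l * p.W₂ + y < p.W₃ := by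
          intro i x hi hx
          rw [hp.W₃_eq]
          calc i * p.W₂ + x < i * p.W₂ + p.W₂ := by omega
            _ = p.W₂ * (i + 1) := by ring
            _ ≤ _ := Nat.mul_le_mul_left _ hi
        have e1 : N * p.W₃ + (p.L * p.W₂ + (k * p.W₁ + w)) = Y.numNodes * p.W₃ +
            ((fobj p.V₁ p.r Y).length * p.W₂ + (inn Y * p.W₁ + d)) := by omega
        obtain ⟨a1, a2⟩ := radix_unique (r2 _ _ (by omega) (r1 _ _ hk hw))
          (r2 _ _ (by omega) (r1 _ _ (by omega) hdw)) e1
        obtain ⟨b1, b2⟩ := radix_unique (r1 _ _ hk hw) (r1 _ _ (by omega) hdw) a2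
        obtain ⟨c1, -⟩ := radix_unique hw hdw b2
        exact ⟨a1.symm, b1.symm, c1.symm⟩
      · exact coeff_κ_of_le hp hY (not_lt.1 hdw)
    · rfl

open Classical in
/-- The trees that the sieve detects. -/
noncomputable def good (p : SieveData) (N k : ℕ) : Finset (BinaryTree ℕ) :=
  p.walks.filter fun Y => (Y.numNodes = N ∧ (fobj p.V₁ p.r Y).length = p.L ∧ inn Y = k) ∧
    (fobj p.V₁ p.r Y).Nodup ∧ Genuine p.r Y

/-- Walks with a repeated object have κ = 0 because their number of objects is exactly L; among the
others, those that are not trees cancel under the involution, which preserves κ and the three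
numbers. -/
theorem sum_good (hp : p.Fits wmax B) (N k : ℕ) : (∑ Y ∈ p.walks, if Y.numNodes = N ∧
    (fobj p.V₁ p.r Y).length = p.L ∧ inn Y = k then p.κ Y else 0) = ∑ Y ∈ p.good N k, p.κ Y := by
  classical
  rw [← Finset.sum_filter]
  set W := p.walks.filter fun Y => Y.numNodes = N ∧ (fobj p.V₁ p.r Y).length = p.L ∧ inn Y = k
    with hWdef
  have hW : ∀ Y ∈ W, (IsWalk p.adj p.n p.r Y ∧ Y.numNodes ≤ p.n) ∧
      (fobj p.V₁ p.r Y).length = p.L := fun Y hY =>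
    ⟨(mem_walks hp.irr).1 (Finset.mem_filter.1 hY).1, (Finset.mem_filter.1 hY).2.2.1⟩
  have hg : p.good N k = (W.filter fun Y => (fobj p.V₁ p.r Y).Nodup).filter (Genuine p.r) := by
    ext Y
    simp only [good, hWdef, Finset.mem_filter]
    tauto
  rw [hg, ← Finset.sum_filter_add_sum_filter_not W (fun Y => (fobj p.V₁ p.r Y).Nodup),
    ← Finset.sum_filter_add_sum_filter_not (W.filter fun Y => (fobj p.V₁ p.r Y).Nodup)
      (fun Y => Genuine p.r Y)]
  have z1 : ∑ Y ∈ W.filter (fun Y => ¬ (fobj p.V₁ p.r Y).Nodup), p.κ Y = 0 := by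
    refine Finset.sum_eq_zero fun Y hY => ?_
    rw [Finset.mem_filter] at hY
    rw [κ, sieveSum_of_not_nodup _ (hW Y hY.1).2 hY.2, mul_zero]
  have z2 : ∑ Y ∈ (W.filter fun Y => (fobj p.V₁ p.r Y).Nodup).filter (fun Y => ¬ Genuine p.r Y),
      p.κ Y = 0 := by
    refine sum_not_genuine (V₁ := p.V₁) (r := p.r) CharTwo.add_self_eq_zero hp.irr hp.symm hp.lt p.κ _
      (fun Y hY => ?_) fun Y hY Y' h1 h2 h3 h4 h5 h6 => ?_
    · simp only [Finset.mem_filter] at hY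
      exact ⟨(hW Y hY.1.1).1.1, hY.1.2, hY.2⟩
    · simp only [Finset.mem_filter, hWdef] at hY ⊢
      have hlen : Y'.numNodes = Y.numNodes := by
        rw [← length_edg Y' p.r, ← length_edg Y p.r]; exact h4.length_eq
      rw [mem_walks hp.irr] at hY ⊢
      refine ⟨⟨⟨⟨⟨h1, ?_⟩, ?_, ?_, ?_⟩, h2⟩, h3⟩, ?_⟩
      · rw [hlen]; exact hY.1.1.1.2
      · rw [hlen]; exact hY.1.1.2.1
      · rw [h5.length_eq]; exact hY.1.1.2.2.1
      · rw [h6]; exact hY.1.1.2.2.2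
      · rw [κ, κ, (h4.map _).sum_eq, sieveSum_perm (h5.map _)]
  rw [z1, z2, add_zero, add_zero]

/-- The left side is a bit that the program can read. The exponent lies below (n + 1) * W₃, hence
within the precision of the modulus, and reducing the coefficient modulo two gives the generating
polynomial over `ZMod 2`. -/
theorem odd_tot_iff (hp : p.Fits wmax B) {N k w : ℕ} (hN : N ≤ p.n) (hk : k < p.n + 2)
    (hw : w < p.W₁) :
    p.tot B / (2 ^ B) ^ (N * p.W₃ + p.L * p.W₂ + k * p.W₁ + w) % 2 = 1 ↔
      ((∑ Y ∈ p.good N k, p.κ Y).coeff w) ≠ 0 := by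
  have hL := hp.L_lt
  have hB : 0 < B := by rw [hp.B_eq]; omega
  have he : N * p.W₃ + p.L * p.W₂ + k * p.W₁ + w < (p.n + 1) * p.W₃ := by
    have h1 : k * p.W₁ + w < p.W₂ := by
      rw [hp.W₂_eq]
      calc k * p.W₁ + w < k * p.W₁ + p.W₁ := by omega
        _ = p.W₁ * (k + 1) := by ring
        _ ≤ _ := Nat.mul_le_mul_left _ hk
    have h2 : p.L * p.W₂ + p.W₂ ≤ p.W₃ := by
      rw [hp.W₃_eq]
      calc p.L * p.W₂ + p.W₂ = p.W₂ * (p.L + 1) := by ring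
        _ ≤ _ := Nat.mul_le_mul_left _ (by omega)
    have h3 : N * p.W₃ + p.W₃ ≤ (p.n + 1) * p.W₃ := by
      rw [← Nat.succ_mul]; exact Nat.mul_le_mul_right _ (by omega)
    omega
  rw [(tot_modEq B).div_pow_mod_two hB he, ← eval_gen]
  have h4 := eval_div_pow_mod (by positivity) (p.gen ℕ) (coeff_gen_lt hp)
    (N * p.W₃ + p.L * p.W₂ + k * p.W₁ + w)
  have h5 : (p.gen ℕ).eval (2 ^ B) / (2 ^ B) ^ (N * p.W₃ + p.L * p.W₂ + k * p.W₁ + w) % 2 =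
      (p.gen ℕ).coeff (N * p.W₃ + p.L * p.W₂ + k * p.W₁ + w) % 2 := by
    rw [← h4, Nat.mod_mod_of_dvd _ (dvd_pow_self 2 hB.ne')]
  rw [h5, ← Nat.odd_iff, ← ZMod.natCast_ne_zero_iff_odd]
  have h6 : (((p.gen ℕ).coeff (N * p.W₃ + p.L * p.W₂ + k * p.W₁ + w) : ℕ) : ZMod 2) =
      (∑ Y ∈ p.good N k, p.κ Y).coeff w := by
    have := congrArg (fun P => P.coeff (N * p.W₃ + p.L * p.W₂ + k * p.W₁ + w)) (map_gen (p := p) (ZMod 2))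
    simp only [coeff_map, eq_natCast] at this
    rw [this, gen, Finset.sum_comm, finsetSum_coeff, ← sum_good hp, finsetSum_coeff]
    refine Finset.sum_congr rfl fun Y hY => ?_
    rw [mem_walks hp.irr] at hY
    rw [coeff_sum_full hp hY.1 hY.2 hk hw]
    split_ifs <;> simp
  rw [h6]

end SieveData

end BranchingWalk


/-! ### Labelled trees as weighted sets -/

/-- The weights `wt` single out a set of the family `F` as the one of least weight. -/
def Isolates (wt : ℕ → ℕ) (F : Set (Finset ℕ)) : Prop :=
  ∃ s ∈ F, ∀ s' ∈ F, s' ≠ s → ∑ i ∈ s, wt i < ∑ i ∈ s', wt i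

namespace BranchingWalk

open BinaryTree

section walk

variable {a : ℕ → ℕ → Prop} {n r : ℕ} {X : BinaryTree ℕ} {V₁ : ℕ → Bool}

theorem IsWalk.mem_edg_iff (h : IsWalk a n r X) (hirr : ∀ v, ¬ a v v) {v w : ℕ} :
    s(v, w) ∈ edg X r ↔ ∃ b ∈ fblk r X, b.1 = v ∧ w ∈ b.2 := by
  rw [← List.count_pos_iff, ← h.count_dart hirr, List.countP_pos_iff]
  simp

theorem IsWalk.nonempty_fblk (h : IsWalk a n r X) {b : ℕ × Finset ℕ} (hb : b ∈ fblk r X) :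
    b.2.Nonempty := by
  obtain ⟨c, hc⟩ := h.chs_eq
  simp only [fblk, List.mem_cons] at hb
  rcases hb with rfl | hb
  · simp [hc]
  · exact blk_nonempty X r b hb

theorem IsWalk.adj_of_mem_edg (h : IsWalk a n r X) (hirr : ∀ v, ¬ a v v)
    (hsymm : ∀ v w, a v w → a w v) {v w : ℕ} (hq : s(v, w) ∈ edg X r) : a v w := by
  obtain ⟨b, hb, rfl, hw⟩ := (h.mem_edg_iff hirr).1 hq
  exact h.adj_fblk hsymm b hb w hw

theorem IsWalk.lt_of_mem_edg (h : IsWalk a n r X) (hirr : ∀ v, ¬ a v v)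
    (hsymm : ∀ v w, a v w → a w v) (hlt : ∀ v w, a v w → w < n) {q : Sym2 ℕ} (hq : q ∈ edg X r) :
    q.inf < n ∧ q.sup < n := by
  induction q using Sym2.ind with
  | _ v w =>
    have h1 := h.adj_of_mem_edg hirr hsymm hq
    have h2 := hlt _ _ h1
    have h3 := hlt _ _ (hsymm _ _ h1)
    simp [h2, h3]

theorem IsWalk.lt_of_mem_fobj (h : IsWalk a n r X) (hirr : ∀ v, ¬ a v v)
    (hsymm : ∀ v w, a v w → a w v) (hlt : ∀ v w, a v w → w < n) {q : Sym2 ℕ}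
    (hq : q ∈ fobj V₁ r X) : q.inf < n ∧ q.sup < n := by
  induction q using Sym2.ind with
  | _ v w =>
    by_cases hvw : v = w
    · subst hvw
      rw [← List.count_pos_iff, ← h.count_diag hirr, List.countP_pos_iff] at hq
      obtain ⟨b, hb, h1⟩ := hq
      simp only [decide_eq_true_eq] at h1
      obtain ⟨w, hw⟩ := h.nonempty_fblk hb
      have := hlt _ _ (hsymm _ _ (h.adj_fblk hsymm b hb w hw))
      rw [h1.1] at this
      simp [this]
    · rw [← List.count_pos_iff, h.count_obj hvw] at hq
      split_ifs at hq
      · exact h.lt_of_mem_edg hirr hsymm hlt (List.count_pos_iff.1 hq)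
      · omega

/-- In a genuine walk each vertex has a single node, and the edges at the vertex list its
neighbours. So the edges determine the nodes, and the nodes determine the walk. -/
theorem IsWalk.ext_edg {X' : BinaryTree ℕ} (h : IsWalk a n r X) (h' : IsWalk a n r X')
    (hirr : ∀ v, ¬ a v v) (hS : IsSys a V₁ r (fblk r X).toFinset) (hg : Genuine r X)
    (hg' : Genuine r X') (he : ∀ q, q ∈ edg X r ↔ q ∈ edg X' r) : X = X' := by
  have key : ∀ {X X' : BinaryTree ℕ}, IsWalk a n r X → IsWalk a n r X' → Genuine r X →
      Genuine r X' → (∀ q, q ∈ edg X r ↔ q ∈ edg X' r) → ∀ b ∈ fblk r X, b ∈ fblk r X' := by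
    intro X X' h h' hg hg' he b hb
    obtain ⟨w, hw⟩ := h.nonempty_fblk hb
    obtain ⟨b', hb', h1, -⟩ := (h'.mem_edg_iff hirr).1
      ((he _).1 ((h.mem_edg_iff hirr).2 ⟨b, hb, rfl, hw⟩))
    have : b = b' := by
      refine Prod.ext h1.symm (Finset.ext fun x => ⟨fun hx => ?_, fun hx => ?_⟩)
      · obtain ⟨c, hc, h2, h3⟩ := (h'.mem_edg_iff hirr).1
          ((he _).1 ((h.mem_edg_iff hirr).2 ⟨b, hb, rfl, hx⟩))
        rwa [← hg' c hc b' hb' (h2.trans h1.symm)]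
      · obtain ⟨c, hc, h2, h3⟩ := (h.mem_edg_iff hirr).1
          ((he _).2 ((h'.mem_edg_iff hirr).2 ⟨b', hb', rfl, hx⟩))
        rwa [← hg c hc b hb (h2.trans h1)]
    rwa [this]
  refine h.ext h' hS (Finset.ext fun b => ?_)
  rw [List.mem_toFinset, List.mem_toFinset]
  exact ⟨key h h' hg hg' he b, key h' h hg' hg (fun q => (he q).symm) b⟩

end walk

/-- The number of the weight of `q` with label `j`. -/
def idx (n J : ℕ) (x : Sym2 ℕ × ℕ) : ℕ := (x.1.inf * n + x.1.sup) * J + x.2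

theorem idx_inj {n J : ℕ} {x y : Sym2 ℕ × ℕ} (hx : x.1.sup < n) (hy : y.1.sup < n) (hx' : x.2 < J)
    (hy' : y.2 < J) (h : idx n J x = idx n J y) : x = y := by
  obtain ⟨h1, h2⟩ := radix_unique hx' hy' h
  obtain ⟨h3, h4⟩ := radix_unique hx hy h1
  exact Prod.ext (Sym2.inf_eq_inf_and_sup_eq_sup.1 ⟨h3, h4⟩) h2

theorem idx_lt {n J : ℕ} {x : Sym2 ℕ × ℕ} (h1 : x.1.inf < n) (h2 : x.1.sup < n) (h3 : x.2 < J) :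
    idx n J x < n * n * J := by
  have e1 : x.1.inf * n + x.1.sup < n * n := by
    calc x.1.inf * n + x.1.sup < x.1.inf * n + n := by omega
      _ = (x.1.inf + 1) * n := by ring
      _ ≤ _ := Nat.mul_le_mul_right _ h1
  calc idx n J x < (x.1.inf * n + x.1.sup) * J + J := by unfold idx; omega
    _ = (x.1.inf * n + x.1.sup + 1) * J := by ring
    _ ≤ _ := Nat.mul_le_mul_right _ e1

namespace SieveData

open Polynomial

variable {p : SieveData} {wmax B : ℕ}

/-- The weighted pairs of a labelled tree. -/
def pset (p : SieveData) (Y : BinaryTree ℕ) (φ : Fin (fobj p.V₁ p.r Y).length → ℕ) :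
    Finset (Sym2 ℕ × ℕ) :=
  (edg Y p.r).toFinset.image (fun q => (q, p.J - 1)) ∪
    Finset.univ.image fun i => ((fobj p.V₁ p.r Y)[i], φ i)

/-- The labelled trees, as sets of numbers of weights. -/
def fam (p : SieveData) (N k : ℕ) : Set (Finset ℕ) :=
  {s | ∃ Y ∈ p.good N k, ∃ φ : Fin (fobj p.V₁ p.r Y).length → ℕ,
    (∀ i, φ i < p.L) ∧ (∀ j < p.L, ∃ i, φ i = j) ∧ s = (p.pset Y φ).image (idx p.n p.J)}

theorem mem_good (hp : p.Fits wmax B) {N k : ℕ} {Y : BinaryTree ℕ} : Y ∈ p.good N k ↔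
    (IsWalk p.adj p.n p.r Y ∧ Y.numNodes ≤ p.n) ∧
      (Y.numNodes = N ∧ (fobj p.V₁ p.r Y).length = p.L ∧ inn Y = k) ∧
      (fobj p.V₁ p.r Y).Nodup ∧ Genuine p.r Y := by
  simp only [good, Finset.mem_filter, mem_walks hp.irr]

theorem lt_of_mem_pset (hp : p.Fits wmax B) {N k : ℕ} {Y : BinaryTree ℕ} (hY : Y ∈ p.good N k)
    {φ : Fin (fobj p.V₁ p.r Y).length → ℕ} (hφ : ∀ i, φ i < p.L) {x : Sym2 ℕ × ℕ}
    (hx : x ∈ p.pset Y φ) : x.1.inf < p.n ∧ x.1.sup < p.n ∧ x.2 < p.J := by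
  have h := ((mem_good hp).1 hY).1.1
  have hL := hp.L_lt
  rw [pset, Finset.mem_union, Finset.mem_image, Finset.mem_image] at hx
  rcases hx with ⟨q, hq, rfl⟩ | ⟨i, -, rfl⟩
  · have := h.lt_of_mem_edg hp.irr hp.symm hp.lt (List.mem_toFinset.1 hq)
    exact ⟨this.1, this.2, by show p.J - 1 < p.J; omega⟩
  · have := h.lt_of_mem_fobj hp.irr hp.symm hp.lt (List.getElem_mem (l := fobj p.V₁ p.r Y) i.2)
    exact ⟨this.1, this.2, (hφ i).trans hL⟩

theorem fam_subset (hp : p.Fits wmax B) {N k : ℕ} {s : Finset ℕ} (hs : s ∈ p.fam N k) :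
    s ⊆ Finset.range (p.n * p.n * p.J) := by
  obtain ⟨Y, hY, φ, h1, -, rfl⟩ := hs
  intro i hi
  obtain ⟨x, hx, rfl⟩ := Finset.mem_image.1 hi
  obtain ⟨k1, k2, k3⟩ := lt_of_mem_pset hp hY h1 hx
  exact Finset.mem_range.2 (idx_lt k1 k2 k3)

theorem nodup_edg (hp : p.Fits wmax B) {N k : ℕ} {Y : BinaryTree ℕ} (hY : Y ∈ p.good N k) :
    (edg Y p.r).Nodup := by
  obtain ⟨h1, -, h2, -⟩ := (mem_good hp).1 hY
  rw [List.nodup_iff_count_le_one]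
  intro q
  induction q using Sym2.ind with
  | _ v w => exact h1.1.count_edg_le hp.irr hp.symm h2 v w

theorem sum_pset (hp : p.Fits wmax B) {wt : ℕ → ℕ} (hwt : ∀ q j, p.wS q j = wt (idx p.n p.J (q, j)))
    {N k : ℕ} {Y : BinaryTree ℕ} (hY : Y ∈ p.good N k)
    {φ : Fin (fobj p.V₁ p.r Y).length → ℕ} (hφ : ∀ i, φ i < p.L) :
    ∑ i ∈ (p.pset Y φ).image (idx p.n p.J), wt i =
      ((edg Y p.r).map fun q => p.wS q (p.J - 1)).sum +
        ∑ i : Fin (fobj p.V₁ p.r Y).length, p.wS (fobj p.V₁ p.r Y)[i] (φ i) := by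
  have hL := hp.L_lt
  have hnd := ((mem_good hp).1 hY).2.2.1
  rw [Finset.sum_image, pset, Finset.sum_union]
  · congr 1
    · rw [Finset.sum_image (fun q _ q' _ h => (Prod.mk.inj h).1),
        List.sum_toFinset _ (nodup_edg hp hY)]
      simp only [hwt]
    · rw [Finset.sum_image]
      · simp only [hwt]
      · intro i _ i' _ h
        exact Fin.ext ((hnd.getElem_inj_iff).1 (Prod.mk.inj h).1)
  · rw [Finset.disjoint_left]
    intro x hx hx'
    obtain ⟨q, -, rfl⟩ := Finset.mem_image.1 hx
    obtain ⟨i, -, h⟩ := Finset.mem_image.1 hx'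
    have h1 := hφ i
    have h2 := (Prod.mk.inj h).2
    omega
  · intro x hx y hy h
    obtain ⟨-, a2, a3⟩ := lt_of_mem_pset hp hY hφ hx
    obtain ⟨-, b2, b3⟩ := lt_of_mem_pset hp hY hφ hy
    exact idx_inj a2 b2 a3 b3 h

/-- Labels are smaller than J - 1, so the pairs in slot J - 1 are those of the edges and give back
the tree. As the objects of a tree are distinct, the other pairs form the graph of the labelling.
The labellings are compared by `HEq` because their domain depends on the tree. -/
theorem pset_inj (hp : p.Fits wmax B) {N k : ℕ} {Y Y' : BinaryTree ℕ} (hY : Y ∈ p.good N k)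
    (hY' : Y' ∈ p.good N k)
    {φ : Fin (fobj p.V₁ p.r Y).length → ℕ} (hφ : ∀ i, φ i < p.L)
    {φ' : Fin (fobj p.V₁ p.r Y').length → ℕ} (hφ' : ∀ i, φ' i < p.L)
    (h : (p.pset Y φ).image (idx p.n p.J) = (p.pset Y' φ').image (idx p.n p.J)) :
    Y = Y' ∧ HEq φ φ' := by
  have hL := hp.L_lt
  have key : ∀ {Y Y' : BinaryTree ℕ} (_ : Y ∈ p.good N k) (_ : Y' ∈ p.good N k)
      {φ : Fin (fobj p.V₁ p.r Y).length → ℕ} (_ : ∀ i, φ i < p.L)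
      {φ' : Fin (fobj p.V₁ p.r Y').length → ℕ} (_ : ∀ i, φ' i < p.L),
      (p.pset Y φ).image (idx p.n p.J) = (p.pset Y' φ').image (idx p.n p.J) →
      p.pset Y φ ⊆ p.pset Y' φ' := by
    intro Y Y' hY hY' φ hφ φ' hφ' h x hx
    have h1 := Finset.mem_image_of_mem (idx p.n p.J) hx
    rw [h] at h1
    obtain ⟨y, hy, he⟩ := Finset.mem_image.1 h1
    obtain ⟨-, a2, a3⟩ := lt_of_mem_pset hp hY hφ hx
    obtain ⟨-, b2, b3⟩ := lt_of_mem_pset hp hY' hφ' hy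
    rwa [← idx_inj b2 a2 b3 a3 he]
  have hps : p.pset Y φ = p.pset Y' φ' :=
    (key hY hY' hφ hφ' h).antisymm (key hY' hY hφ' hφ h.symm)
  have hedg : ∀ {Y : BinaryTree ℕ} {φ : Fin (fobj p.V₁ p.r Y).length → ℕ} (_ : ∀ i, φ i < p.L)
      (q : Sym2 ℕ), q ∈ edg Y p.r ↔ (q, p.J - 1) ∈ p.pset Y φ := by
    intro Y φ hφ q
    rw [pset, Finset.mem_union, Finset.mem_image, Finset.mem_image]
    constructor
    · intro hq; exact .inl ⟨q, List.mem_toFinset.2 hq, rfl⟩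
    · rintro (⟨q', hq', he⟩ | ⟨i, -, he⟩)
      · rw [← (Prod.mk.inj he).1]; exact List.mem_toFinset.1 hq'
      · have h1 := hφ i
        have h2 := (Prod.mk.inj he).2
        omega
  obtain ⟨w1, -, n1, g1⟩ := (mem_good hp).1 hY
  obtain ⟨w2, -, n2, g2⟩ := (mem_good hp).1 hY'
  have hYY : Y = Y' := w1.1.ext_edg w2.1 hp.irr (w1.1.isSys hp.irr hp.symm n1).2 g1 g2 fun q => by
    rw [hedg hφ, hedg hφ', hps]
  subst hYY
  refine ⟨rfl, heq_of_eq (funext fun i => ?_)⟩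
  have h1 : ((fobj p.V₁ p.r Y)[i], φ i) ∈ p.pset Y φ' := by
    rw [← hps, pset]
    exact Finset.mem_union_right _ (Finset.mem_image_of_mem _ (Finset.mem_univ i))
  rw [pset, Finset.mem_union, Finset.mem_image, Finset.mem_image] at h1
  rcases h1 with ⟨q, -, he⟩ | ⟨i', -, he⟩
  · have h1 := hφ i
    have h2 := (Prod.mk.inj he).2
    omega
  · have h2 := Fin.ext (n1.getElem_inj_iff.1 (Prod.mk.inj he).1)
    rw [← (Prod.mk.inj he).2, h2]

theorem coeff_κ (Y : BinaryTree ℕ) (w : ℕ) : (p.κ Y).coeff w =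
    ∑ φ ∈ (Fintype.piFinset fun _ : Fin (fobj p.V₁ p.r Y).length => Finset.range p.L).filter
      (fun φ => ∀ j < p.L, ∃ i, φ i = j),
      if w = ((edg Y p.r).map fun q => p.wS q (p.J - 1)).sum +
        ∑ i : Fin (fobj p.V₁ p.r Y).length, p.wS (fobj p.V₁ p.r Y)[i] (φ i) then 1 else 0 := by
  have hs : ∀ l : List (Sym2 ℕ), sieveSum p.L (l.map fun q j => (X : (ZMod 2)[X]) ^ p.wS q j) =
      ∑ φ ∈ (Fintype.piFinset fun _ : Fin l.length => Finset.range p.L).filter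
      (fun φ => ∀ j < p.L, ∃ i, φ i = j), X ^ ∑ i : Fin l.length, p.wS l[i] (φ i) := by
    intro l
    rw [sieveSum_eq]
    have hlen : l.length = (l.map fun q j => (X : (ZMod 2)[X]) ^ p.wS q j).length := by simp
    refine Finset.sum_bij' (fun φ _ => fun i => φ (Fin.cast hlen i))
      (fun φ _ => fun i => φ (Fin.cast hlen.symm i)) ?_ ?_ ?_ ?_ ?_
    · intro φ hφ
      simp only [Finset.mem_filter, Fintype.mem_piFinset] at hφ ⊢
      refine ⟨fun i => hφ.1 _, fun j hj => ?_⟩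
      obtain ⟨i, hi⟩ := hφ.2 j hj
      exact ⟨Fin.cast hlen.symm i, hi⟩
    · intro φ hφ
      simp only [Finset.mem_filter, Fintype.mem_piFinset] at hφ ⊢
      refine ⟨fun i => hφ.1 _, fun j hj => ?_⟩
      obtain ⟨i, hi⟩ := hφ.2 j hj
      exact ⟨Fin.cast hlen i, hi⟩
    · intro φ _; rfl
    · intro φ _; rfl
    · intro φ _
      rw [← Finset.prod_pow_eq_pow_sum]
      exact Fintype.prod_equiv (finCongr hlen.symm) _ _ fun i => by simp
  rw [κ, hs, Finset.mul_sum, finsetSum_coeff]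
  refine Finset.sum_congr rfl fun φ _ => ?_
  rw [← pow_add, coeff_X_pow]

/-- The coefficient in the degree of the least weight receives a single 1, from the unique lightest
labelled tree. A degree of `W₁` or more is impossible by `coeff_κ_of_le`. -/
theorem exists_coeff_ne_zero (hp : p.Fits wmax B) {wt : ℕ → ℕ}
    (hwt : ∀ q j, p.wS q j = wt (idx p.n p.J (q, j))) {N k : ℕ} (hiso : Isolates wt (p.fam N k)) :
    ∃ w < p.W₁, (∑ Y ∈ p.good N k, p.κ Y).coeff w ≠ 0 := by
  obtain ⟨_, ⟨Y, hY, φ, hφ, hs, rfl⟩, hmin⟩ := hiso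
  have h1 : (∑ Y ∈ p.good N k, p.κ Y).coeff (∑ i ∈ (p.pset Y φ).image (idx p.n p.J), wt i) = 1 := by
    rw [finsetSum_coeff, Finset.sum_eq_single_of_mem Y hY, coeff_κ, Finset.sum_eq_single_of_mem φ]
    · rw [sum_pset hp hwt hY hφ, if_pos rfl]
    · rw [Finset.mem_filter, Fintype.mem_piFinset]
      exact ⟨fun i => Finset.mem_range.2 (hφ i), hs⟩
    · intro φ' hφ' hne
      rw [Finset.mem_filter, Fintype.mem_piFinset] at hφ'
      have hφ'' := fun i => Finset.mem_range.1 (hφ'.1 i)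
      rw [← sum_pset hp hwt hY hφ'', if_neg]
      refine (hmin _ ⟨Y, hY, φ', hφ'', hφ'.2, rfl⟩ fun h => hne ?_).ne
      exact eq_of_heq (pset_inj hp hY hY hφ'' hφ h).2
    · intro Y' hY' hne
      rw [coeff_κ]
      refine Finset.sum_eq_zero fun φ' hφ' => ?_
      rw [Finset.mem_filter, Fintype.mem_piFinset] at hφ'
      have hφ'' := fun i => Finset.mem_range.1 (hφ'.1 i)
      rw [← sum_pset hp hwt hY' hφ'', if_neg]
      refine (hmin _ ⟨Y', hY', φ', hφ'', hφ'.2, rfl⟩ fun h => hne ?_).ne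
      exact (pset_inj hp hY' hY hφ'' hφ h).1
  refine ⟨_, ?_, by rw [h1]; exact one_ne_zero⟩
  by_contra hle
  rw [finsetSum_coeff, Finset.sum_eq_zero] at h1
  · exact zero_ne_one h1
  · intro Y' hY'
    exact coeff_κ_of_le hp ((mem_good hp).1 hY').1.2 (not_lt.1 hle)

theorem fam_nonempty {N k : ℕ} {Y : BinaryTree ℕ} (hp : p.Fits wmax B) (hY : Y ∈ p.good N k) :
    (p.fam N k).Nonempty := by
  have hlen := ((mem_good hp).1 hY).2.1.2.1
  exact ⟨_, Y, hY, fun i => i, fun i => by rw [← hlen]; exact i.2,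
    fun j hj => ⟨⟨j, by rw [hlen]; exact hj⟩, rfl⟩, rfl⟩

end SieveData

end BranchingWalk


/-! ### The isolation lemma -/

/-- If the minimum is not unique, there are two different minimisers, and one of them contains an
index that the other lacks. -/
theorem exists_swap_of_not_isolates {wt : ℕ → ℕ} {F : Set (Finset ℕ)} (hF : F.Nonempty)
    (h : ¬ Isolates wt F) : ∃ i, ∃ s ∈ F, ∃ s' ∈ F, i ∈ s ∧ i ∉ s' ∧
      (∀ t ∈ F, ∑ j ∈ s, wt j ≤ ∑ j ∈ t, wt j) ∧ ∑ j ∈ s, wt j = ∑ j ∈ s', wt j := by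
  obtain ⟨s, hs, hmin⟩ : ∃ s ∈ F, ∀ t ∈ F, ∑ j ∈ s, wt j ≤ ∑ j ∈ t, wt j := by
    refine ⟨Function.argminOn (fun s => ∑ j ∈ s, wt j) F hF, Function.argminOn_mem _ _ _,
      fun t ht => Function.argminOn_le (fun s => ∑ j ∈ s, wt j) F ht⟩
  unfold Isolates at h
  push Not at h
  obtain ⟨s', hs', hne, hle⟩ := h s hs
  have heq := (hmin s' hs').antisymm hle
  by_cases hsub : s ⊆ s'
  · obtain ⟨i, hi, hi'⟩ := Finset.not_subset.1 fun h => hne (h.antisymm hsub)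
    exact ⟨i, s', hs', s, hs, hi, hi', fun t ht => heq ▸ hmin t ht, heq.symm⟩
  · obtain ⟨i, hi, hi'⟩ := Finset.not_subset.1 hsub
    exact ⟨i, s, hs, s', hs', hi, hi', hmin, heq⟩

/-- With the other weights fixed, the least weight of a set avoiding i is some α, and that of a set
containing i is β plus the weight of i. A tie forces this weight to be α - β. -/
theorem eq_of_swap {wt wt' : ℕ → ℕ} {F : Set (Finset ℕ)} {i : ℕ} (hag : ∀ j ≠ i, wt j = wt' j)
    {s s' t t' : Finset ℕ} (hs : s ∈ F) (hs' : s' ∈ F) (his : i ∈ s) (his' : i ∉ s')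
    (hmin : ∀ u ∈ F, ∑ j ∈ s, wt j ≤ ∑ j ∈ u, wt j) (he : ∑ j ∈ s, wt j = ∑ j ∈ s', wt j)
    (ht : t ∈ F) (ht' : t' ∈ F) (hit : i ∈ t) (hit' : i ∉ t')
    (hmin' : ∀ u ∈ F, ∑ j ∈ t, wt' j ≤ ∑ j ∈ u, wt' j) (he' : ∑ j ∈ t, wt' j = ∑ j ∈ t', wt' j) :
    wt i = wt' i := by
  have out : ∀ u : Finset ℕ, i ∉ u → ∑ j ∈ u, wt j = ∑ j ∈ u, wt' j := fun u hu =>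
    Finset.sum_congr rfl fun j hj => hag j fun h => hu (h ▸ hj)
  have inn : ∀ u : Finset ℕ, i ∈ u → ∑ j ∈ u, wt j + wt' i = ∑ j ∈ u, wt' j + wt i := by
    intro u hu
    rw [← Finset.add_sum_erase _ _ hu, ← Finset.add_sum_erase _ _ hu,
      out (u.erase i) (Finset.notMem_erase i u)]
    ring
  have h1 := hmin t ht
  have h2 := hmin' s hs
  have h3 := inn s his
  have h4 := inn t hit
  have h5 := hmin t' ht'
  have h6 := hmin' s' hs'
  have h7 := out s' his'
  have h8 := out t' hit'
  omega

section isolation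

variable {U : ℕ} {K : Type*} [Fintype K] [DecidableEq K]

/-- The weights that are given by `f`. -/
def extWt (v : K → ℕ) (f : Fin U → K) (i : ℕ) : ℕ := if h : i < U then v (f ⟨i, h⟩) else 0

open Classical in
-- Union bound over the indices i at which a tie can occur: each has probability at most 1 / |K|,
-- and there are at most |K| / 2 of them.
theorem card_not_isolates {v : K → ℕ} (hv : Function.Injective v) {F : Set (Finset ℕ)}
    (hF : F.Nonempty) (hU : ∀ s ∈ F, s ⊆ Finset.range U) (hK : 2 * U ≤ Fintype.card K) :
    2 * (Finset.univ.filter fun f : Fin U → K => ¬ Isolates (extWt v f) F).card ≤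
      Fintype.card (Fin U → K) := by
  let bad : Fin U → Finset (Fin U → K) := fun i => Finset.univ.filter fun f =>
    ∃ s ∈ F, ∃ s' ∈ F, (i : ℕ) ∈ s ∧ (i : ℕ) ∉ s' ∧
      (∀ t ∈ F, ∑ j ∈ s, extWt v f j ≤ ∑ j ∈ t, extWt v f j) ∧
      ∑ j ∈ s, extWt v f j = ∑ j ∈ s', extWt v f j
  have hcov : (Finset.univ.filter fun f : Fin U → K => ¬ Isolates (extWt v f) F) ⊆
      Finset.univ.biUnion bad := by
    intro f hf
    obtain ⟨i, s, hs, s', hs', h⟩ := exists_swap_of_not_isolates hF (Finset.mem_filter.1 hf).2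
    have hi := Finset.mem_range.1 (hU s hs h.1)
    exact Finset.mem_biUnion.2 ⟨⟨i, hi⟩, Finset.mem_univ _,
      Finset.mem_filter.2 ⟨Finset.mem_univ _, s, hs, s', hs', h⟩⟩
  -- By `eq_of_swap` a bad assignment is determined by its values off i. So overwriting its value at
  -- i by an arbitrary x is injective in the pair of assignment and x.
  have hbad : ∀ i, (bad i).card * Fintype.card K ≤ Fintype.card (Fin U → K) := by
    intro i
    rw [← Finset.card_univ, ← Finset.card_product, ← Finset.card_univ (α := Fin U → K)]
    refine Finset.card_le_card_of_injOn (fun q => Function.update q.1 i q.2)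
      (fun _ _ => Finset.mem_coe.2 (Finset.mem_univ _)) ?_
    rintro ⟨f, x⟩ hf ⟨g, y⟩ hg h
    simp only [Finset.coe_product, Set.mem_prod, Finset.mem_coe] at hf hg
    have hxy : x = y := by simpa using congrFun h i
    have hoff : ∀ j ≠ i, f j = g j := fun j hj => by simpa [hj] using congrFun h j
    obtain ⟨-, s, hs, s', hs', a1, a2, a3, a4⟩ := Finset.mem_filter.1 hf.1
    obtain ⟨-, t, ht, t', ht', b1, b2, b3, b4⟩ := Finset.mem_filter.1 hg.1
    have hwi : extWt v f i = extWt v g i := by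
      refine eq_of_swap (F := F) (fun j hj => ?_) hs hs' a1 a2 a3 a4 ht ht' b1 b2 b3 b4
      unfold extWt
      split_ifs with hjU
      · rw [hoff ⟨j, hjU⟩ fun h => hj (congrArg Fin.val h)]
      · rfl
    simp only [extWt, i.2, dif_pos] at hwi
    have hi : f i = g i := hv hwi
    refine Prod.ext (funext fun j => ?_) hxy
    by_cases hj : j = i
    · subst hj; exact hi
    · exact hoff j hj
  have h1 : (Finset.univ.filter fun f : Fin U → K => ¬ Isolates (extWt v f) F).card ≤
      ∑ i, (bad i).card := (Finset.card_le_card hcov).trans Finset.card_biUnion_le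
  rcases Nat.eq_zero_or_pos U with rfl | hU0
  · have h0 : ∑ i, (bad i).card = 0 := Fin.sum_univ_zero _
    omega
  have h2 : (∑ i, (bad i).card) * Fintype.card K ≤ U * Fintype.card (Fin U → K) := by
    rw [Finset.sum_mul]
    exact (Finset.sum_le_card_nsmul _ _ _ fun i _ => hbad i).trans (by simp)
  have h3 : (∑ i, (bad i).card) * (2 * U) ≤ U * Fintype.card (Fin U → K) :=
    (Nat.mul_le_mul_left _ hK).trans h2
  have h4 : 2 * ∑ i, (bad i).card ≤ Fintype.card (Fin U → K) := by
    refine Nat.le_of_mul_le_mul_left (a := 2 * ∑ i, (bad i).card) ?_ hU0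
    linarith
  omega

end isolation

/-- The number with the binary digits `g 0, …, g (c - 1)`. -/
def bitsVal (g : ℕ → Bool) : ℕ → ℕ
  | 0 => 0
  | t + 1 => 2 * bitsVal g t + (g t).toNat

theorem bitsVal_lt (g : ℕ → Bool) (c : ℕ) : bitsVal g c < 2 ^ c := by
  induction c with
  | zero => simp [bitsVal]
  | succ c ih =>
    have := Bool.toNat_le (g c)
    simp only [bitsVal, pow_succ]; omega

theorem bitsVal_inj {g g' : ℕ → Bool} {c : ℕ} (h : bitsVal g c = bitsVal g' c) {t : ℕ} (ht : t < c) :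
    g t = g' t := by
  induction c with
  | zero => omega
  | succ c ih =>
    simp only [bitsVal] at h
    have h1 := Bool.toNat_le (g c)
    have h2 := Bool.toNat_le (g' c)
    rcases Nat.lt_succ_iff_lt_or_eq.1 ht with h3 | rfl
    · exact ih (by omega) h3
    · cases h3 : g t <;> cases h4 : g' t <;> simp [h3, h4] at h h1 h2 ⊢ <;> omega

/-- The `i`-th random weight: `c` coin tosses. -/
def coinWt (ω : ℕ → Bool) (c i : ℕ) : ℕ := bitsVal (fun t => ω (i * c + t)) c

open MeasureTheory in
theorem coinMeasure_cylinder (m : ℕ) (g : ℕ → Bool) :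
    coinMeasure {ω | ∀ j < m, ω j = g j} = (2⁻¹ : ENNReal) ^ m := by
  have : {ω : ℕ → Bool | ∀ j < m, ω j = g j} = Set.pi (Finset.range m : Finset ℕ) (fun j => {g j}) := by
    ext ω; simp [Set.mem_pi]
  rw [this, coinMeasure, Measure.infinitePi_pi _ (fun _ _ => measurableSet_singleton _)]
  simp [PMF.uniformOfFintype_apply]

open Classical MeasureTheory in
/-- Random weights isolate with probability at least one half. -/
theorem coinMeasure_isolates {U c : ℕ} {F : Set (Finset ℕ)} (hF : F.Nonempty)
    (hU : ∀ s ∈ F, s ⊆ Finset.range U) (hc : 2 * U ≤ 2 ^ c) :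
    1 / 2 ≤ coinMeasure {ω | Isolates (coinWt ω c) F} := by
  let v : (Fin c → Bool) → ℕ := fun b => bitsVal (fun t => if h : t < c then b ⟨t, h⟩ else false) c
  have hv : Function.Injective v := by
    intro b b' h
    funext t
    have := bitsVal_inj h t.2
    simpa using this
  have hcard := card_not_isolates (U := U) hv hF hU (by simpa using hc)
  let G := Finset.univ.filter fun f : Fin U → Fin c → Bool => Isolates (extWt v f) F
  have hG : Fintype.card (Fin U → Fin c → Bool) ≤ 2 * G.card := by
    have := Finset.card_filter_add_card_filter_not (s := Finset.univ)
      (fun f : Fin U → Fin c → Bool => Isolates (extWt v f) F)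
    rw [Finset.card_univ] at this
    simp only [G]; omega
  -- An assignment of the U weights fixes the first U * c coins. The corresponding cylinders are
  -- disjoint and have equal measure, so measuring is counting.
  let cyl : (Fin U → Fin c → Bool) → Set (ℕ → Bool) := fun f =>
    {ω | ∀ i : Fin U, ∀ t : Fin c, ω (i * c + t) = f i t}
  have hcyl : ∀ f, coinMeasure (cyl f) = (2⁻¹ : ENNReal) ^ (U * c) ∧ MeasurableSet (cyl f) := by
    intro f
    constructor
    · rw [← coinMeasure_cylinder (U * c) (fun j => if h : j / c < U ∧ 0 < c then
        f ⟨j / c, h.1⟩ ⟨j % c, Nat.mod_lt _ h.2⟩ else false)]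
      congr 1
      ext ω
      simp only [cyl, Set.mem_ofPred_eq]
      constructor
      · intro h j hj
        have hc0 : 0 < c := Nat.pos_of_ne_zero fun h => by simp [h] at hj
        have hj' : j / c < U := Nat.div_lt_of_lt_mul (by rwa [mul_comm])
        rw [dif_pos ⟨hj', hc0⟩, ← h]
        simp only
        rw [Nat.div_add_mod']
      · intro h i t
        have hc0 : 0 < c := t.pos
        have hlt : (i : ℕ) * c + t < U * c := by
          calc (i : ℕ) * c + t < i * c + c := by have := t.2; omega
            _ = (i + 1) * c := by ring
            _ ≤ _ := Nat.mul_le_mul_right _ i.2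
        have e1 : ((i : ℕ) * c + t) / c = i := by
          rw [mul_comm, Nat.mul_add_div hc0, Nat.div_eq_of_lt t.2, add_zero]
        have e2 : ((i : ℕ) * c + t) % c = t := by
          rw [mul_comm, Nat.mul_add_mod, Nat.mod_eq_of_lt t.2]
        rw [h _ hlt]
        simp only [e1, e2, i.2, hc0, and_self, dif_pos, Fin.eta]
    · simp only [cyl, Set.ofPred_forall]
      refine MeasurableSet.iInter fun i => MeasurableSet.iInter fun t => ?_
      have hm : Measurable fun ω : ℕ → Bool => ω (i * c + t) := measurable_pi_apply _
      exact hm (measurableSet_singleton (f i t))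
  have hsub : (⋃ f ∈ G, cyl f) ⊆ {ω | Isolates (coinWt ω c) F} := by
    intro ω hω
    simp only [Set.mem_iUnion] at hω
    obtain ⟨f, hf, hωf⟩ := hω
    have hiso := (Finset.mem_filter.1 hf).2
    -- `extWt` vanishes from U on and `coinWt` does not, but the sets of `F` contain no index beyond
    -- U.
    have hagree : ∀ i < U, extWt v f i = coinWt ω c i := by
      intro i hi
      have hb : ∀ c' ≤ c, bitsVal (fun t => if h : t < c then f ⟨i, hi⟩ ⟨t, h⟩ else false) c' =
          bitsVal (fun t => ω (i * c + t)) c' := by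
        intro c' hc'
        induction c' with
        | zero => rfl
        | succ d ih =>
          simp only [bitsVal]
          rw [ih (by omega), dif_pos (by omega : d < c)]
          have := hωf ⟨i, hi⟩ ⟨d, by omega⟩
          simp only at this
          rw [this]
      simp only [extWt, hi, dif_pos, v, coinWt]
      exact hb c le_rfl
    obtain ⟨s, hs, hmin⟩ := hiso
    have hsum : ∀ t ∈ F, ∑ i ∈ t, extWt v f i = ∑ i ∈ t, coinWt ω c i := fun t ht =>
      Finset.sum_congr rfl fun i hi => hagree i (Finset.mem_range.1 (hU t ht hi))
    refine ⟨s, hs, fun t ht hne => ?_⟩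
    rw [← hsum s hs, ← hsum t ht]
    exact hmin t ht hne
  refine le_trans ?_ (measure_mono hsub)
  rw [measure_biUnion_finset]
  · simp only [hcyl, Finset.sum_const, nsmul_eq_mul]
    have h1 : Fintype.card (Fin U → Fin c → Bool) = 2 ^ (U * c) := by
      simp [← pow_mul, mul_comm]
    rw [h1] at hG
    have h2 : ((2 : ENNReal) ^ (U * c)) ≤ 2 * (G.card : ENNReal) := by exact_mod_cast hG
    rw [ENNReal.inv_pow.symm, ← div_eq_mul_inv, ENNReal.div_le_iff_le_mul (by simp) (by simp),
      mul_comm, mul_div_assoc']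
    rw [ENNReal.le_div_iff_mul_le (by simp) (by simp)]
    rwa [one_mul]
  · intro f _ g _ hne
    simp only [Function.onFun]
    rw [Set.disjoint_left]
    intro ω h1 h2
    exact hne (funext fun i => funext fun t => (h1 i t).symm.trans (h2 i t))
  · exact fun f _ => (hcyl f).2


/-! ### Notation for expressions and rules for loops -/

namespace RamExpr

instance : Add RamExpr := ⟨.op .add⟩
instance : Sub RamExpr := ⟨.op .sub⟩
instance : Mul RamExpr := ⟨.op .mul⟩
instance : Div RamExpr := ⟨.op .div⟩
instance (u : ℕ) : OfNat RamExpr u := ⟨.lit u⟩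

variable (M : Memory)

@[simp] theorem val_add (e f : RamExpr) : (e + f).val M = e.val M + f.val M := rfl
@[simp] theorem val_sub (e f : RamExpr) : (e - f).val M = e.val M - f.val M := rfl
@[simp] theorem val_mul (e f : RamExpr) : (e * f).val M = e.val M * f.val M := rfl
@[simp] theorem val_div (e f : RamExpr) : (e / f).val M = e.val M / f.val M := rfl
@[simp] theorem val_lit (u : ℕ) : (lit u).val M = u := rfl
@[simp] theorem val_ofNat (u : ℕ) [u.AtLeastTwo] : (ofNat(u) : RamExpr).val M = u := rfl
@[simp] theorem val_zero : (0 : RamExpr).val M = 0 := rfl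
@[simp] theorem val_one : (1 : RamExpr).val M = 1 := rfl
@[simp] theorem val_read (a : ℕ) (i : RamExpr) : (read a i).val M = M (a, i.val M) := rfl

/-- The remainder modulo `f`. -/
def rem (e f : RamExpr) : RamExpr := e - f * (e / f)

@[simp] theorem val_rem (e f : RamExpr) : (e.rem f).val M = e.val M % f.val M := by
  rw [rem, val_sub, val_mul, val_div, Nat.mod_eq_sub]

/-- Nonzero unless `e` and `f` are equal. -/
def neq (e f : RamExpr) : RamExpr := (e - f) + (f - e)

theorem val_neq (e f : RamExpr) : (e.neq f).val M = 0 ↔ e.val M = f.val M := by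
  simp only [neq, val_add, val_sub]; omega

end RamExpr

/-- No coins are tossed. -/
def Cmd.tossFree : Cmd → Bool
  | skip => true
  | asg _ _ _ => true
  | toss _ _ => false
  | seq P Q => P.tossFree && Q.tossFree
  | ite _ P Q => P.tossFree && Q.tossFree
  | rep _ _ _ P => P.tossFree

theorem Exec.tossed_eq {ω : ℕ → Bool} {c : Cmd} {σ τ : RamState} {t s : ℕ}
    (h : Exec ω c.compile σ τ t s) (hc : c.tossFree = true) : τ.tossed = σ.tossed := by
  induction c generalizing σ τ t s with
  | skip => cases h; rfl
  | asg b j e => cases h; rfl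
  | toss b j => simp [Cmd.tossFree] at hc
  | seq P Q hP hQ =>
    simp only [Cmd.tossFree, Bool.and_eq_true] at hc
    cases h with | seq h1 h2 => rw [hQ h2 hc.2, hP h1 hc.1]
  | ite e P Q hP hQ =>
    simp only [Cmd.tossFree, Bool.and_eq_true] at hc
    cases h with
    | condTrue _ h1 => exact hP h1 hc.1
    | condFalse _ h1 => exact hQ h1 hc.2
  | rep big x e P hP =>
    have key : ∀ {R : RamProg} {σ τ : RamState} {t s : ℕ}, Exec ω R σ τ t s →
        R = (.loop (.op .sub e (.var x))
        (.seq P.compile (.assign x (.lit 0) (.op .add (.var x) (.lit 1))))) →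
        τ.tossed = σ.tossed := by
      intro R σ τ t s h
      induction h with
      | loopExit _ => intro _; rfl
      | loopStep he h1 h2 _ ih =>
        intro hR
        rw [ih hR]
        injection hR with _ hR
        subst hR
        cases h1 with | seq h3 h4 =>
        cases h4
        have h5 := hP h3 hc
        exact h5
      | _ => intro hR; cases hR
    simp only [Cmd.compile] at h
    cases h with | seq h1 h2 =>
    rw [key h2 rfl]
    cases h1; rfl

/-- The memories agree outside the arrays `ws`. -/
def Keeps (ws : List ℕ) (σ τ : RamState) : Prop := ∀ a, a ∉ ws → ∀ i, τ.mem (a, i) = σ.mem (a, i)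

theorem Keeps.trans {ws : List ℕ} {σ τ ρ : RamState} (h : Keeps ws σ τ) (h' : Keeps ws τ ρ) :
    Keeps ws σ ρ := fun a ha i => (h' a ha i).trans (h a ha i)

namespace WP

variable {ev : Env} {σ : RamState} {post : RamState → Prop}

theorem frm {c : Cmd} (ws : List ℕ) (hws : c.wr = ws) (h : WP ev c σ post) :
    WP ev c σ fun τ => post τ ∧ Keeps ws σ τ := by
  subst hws; exact h.frame

theorem tossed {c : Cmd} (h : WP ev c σ post) (hc : c.tossFree = true) :
    WP ev c σ fun τ => post τ ∧ τ.tossed = σ.tossed := by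
  intro hok
  obtain ⟨τ, t, s, h1, h2, h3, h4, h5⟩ := h hok
  exact ⟨τ, t, s, h1, h2, h3, h4, h5, h1.tossed_eq hc⟩

/-- The rule for loops whose invariant does not mention the loop variable. -/
theorem loop {big : Bool} {x : ℕ} {e : RamExpr} {P : Cmd} (ws : List ℕ) (hws : P.wr = ws)
    (N : ℕ) (I : ℕ → RamState → Prop)
    (hx : x < ev.m) (hD : 0 < ev.D) (hN : N ≤ bif big then ev.E else ev.D) (hN' : N < 2 ^ ev.D)
    (hxP : x ∉ ws) (hind : ∀ j ρ v, I j ρ → I j (ρ.set x 0 v)) (h0 : I 0 σ)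
    (hval : ∀ ρ, Keeps (x :: ws) σ ρ → e.val ρ.mem = N)
    (hstep : ∀ j < N, ∀ ρ, I j ρ → ρ.mem (x, 0) = j → Keeps (x :: ws) σ ρ → WP ev P ρ (I (j + 1)))
    (hpost : ∀ ρ, I N ρ → Keeps (x :: ws) σ ρ → post ρ) : WP ev (.rep big x e P) σ post := by
  have hset : ∀ (ρ : RamState) v, Keeps (x :: ws) ρ (ρ.set x 0 v) := by
    intro ρ v a ha i
    simp only [List.mem_cons, not_or] at ha
    simp [RamState.set_mem, ha.1]
  refine WP.rep N (fun j ρ => I j ρ ∧ Keeps (x :: ws) σ ρ) hx hD hN hN' ⟨hind _ _ _ h0, hset _ _⟩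
    (fun j _ ρ h _ => hval ρ h.2) (fun j hj ρ h hxj => ?_) fun ρ h _ => hpost ρ h.1 h.2
  refine ((hstep j hj ρ h.1 hxj h.2).frm ws hws).mono fun τ hτ => ?_
  refine ⟨by rw [hτ.2 x hxP, hxj], hind _ _ _ hτ.1, (h.2.trans ?_).trans (hset _ _)⟩
  intro a ha i
  exact hτ.2 a (fun h => ha (List.mem_cons_of_mem _ h)) i

/-- The program that sets the flag `f` if the test succeeds for some value of the loop variable. -/
theorem flag {x f : ℕ} {e t : RamExpr} (N : ℕ) (C : ℕ → Prop) [DecidablePred C]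
    (hx : x < ev.m) (hf : f < ev.m) (hD : 0 < ev.D) (hN : N ≤ ev.D) (hxf : x ≠ f)
    (hval : ∀ ρ, Keeps [x, f] σ ρ → e.val ρ.mem = N)
    (ht : ∀ j < N, ∀ ρ, ρ.mem (x, 0) = j → Keeps [x, f] σ ρ → (t.val ρ.mem ≠ 0 ↔ C j))
    (hpost : ∀ ρ, ρ.mem (f, 0) = (if ∃ j < N, C j then 1 else σ.mem (f, 0)) → Keeps [x, f] σ ρ →
      post ρ) :
    WP ev (.rep false x e (.ite t (.asg f 0 1) .skip)) σ post := by
  have hN' : N < 2 ^ ev.D := hN.trans_lt Nat.lt_two_pow_self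
  refine WP.loop [f] rfl N
    (fun j ρ => ρ.mem (f, 0) = if ∃ i < j, C i then 1 else σ.mem (f, 0)) hx hD hN hN'
    (by simpa using hxf) ?_ (by simp) hval ?_ hpost
  · intro j ρ v h
    rw [RamState.set_mem, if_neg (fun h => hxf h.1.symm), h]
  · intro j hj ρ hI hxj hfr
    refine WP.ite (fun h1 => ?_) fun h1 => ?_
    · have hc := (ht j hj ρ hxj hfr).1 h1
      refine WP.asg rfl rfl hf hD (Nat.one_lt_two_pow (by omega)) ?_
      rw [RamState.set_mem, if_pos ⟨rfl, rfl⟩, if_pos ⟨j, by omega, hc⟩]; rfl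
    · have hc : ¬ C j := fun h => (ht j hj ρ hxj hfr).2 h h1
      refine WP.skip ?_
      rw [hI]
      refine if_congr ⟨fun ⟨i, h1, h2⟩ => ⟨i, by omega, h2⟩, fun ⟨i, h1, h2⟩ => ⟨i, ?_, h2⟩⟩ rfl rfl
      rcases Nat.lt_succ_iff_lt_or_eq.1 h1 with h3 | rfl
      · exact h3
      · exact absurd h2 hc

end WP


/-! ### Connectedness and colouring

The arrays of the program: `0` and `1` hold `n` and `k`, `2` the adjacency matrix, `3` the vertices
reached in few steps, `4` colours, `5` powers of two, `6` weights, `7` labels, `8` sums over walks,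
`9` the set `V₁`; `10`–`17` hold parameters, `18` and `19` flags, the others are loop variables and
auxiliary. -/

/-- Reading from a matrix with `n` columns. -/
abbrev RamExpr.mat (a : ℕ) (i j : RamExpr) : RamExpr := .read a (i * .var 0 + j)

/-- The memory holds the graph `a` on `{0, …, n - 1}`. -/
structure Input (a : ℕ → ℕ → Prop) [DecidableRel a] (n : ℕ) (σ : RamState) : Prop where
  n_eq : σ.mem (0, 0) = n
  adj : ∀ v < n, ∀ u < n, σ.mem (2, v * n + u) = if a v u then 1 else 0

theorem Input.keep {a : ℕ → ℕ → Prop} [DecidableRel a] {n : ℕ} {σ ρ : RamState} {ws : List ℕ}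
    (h : Input a n σ) (hk : Keeps ws σ ρ) (h0 : 0 ∉ ws) (h2 : 2 ∉ ws) : Input a n ρ :=
  ⟨by rw [hk 0 h0, h.n_eq], fun v hv u hu => by rw [hk 2 h2, h.adj v hv u hu]⟩

section models

variable (a : ℕ → ℕ → Prop) [DecidableRel a] (n : ℕ)

/-- Whether `v` can be reached from `0` in at most `t` steps. -/
def reachM : ℕ → ℕ → ℕ
  | 0, v => if v = 0 then 1 else 0
  | t + 1, v => if ∃ u < n, a v u ∧ reachM t u ≠ 0 then 1 else reachM t v

/-- A colour for `v` that is not used by its neighbours. -/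
def pickM (col : ℕ → ℕ) (v : ℕ) : ℕ → ℕ
  | 0 => 1
  | c + 1 => if ∃ u < n, a v u ∧ col u = c + 1 then pickM col v c else c + 1

/-- Colouring of a level. -/
def colV (Δ t : ℕ) (col : ℕ → ℕ) : ℕ → ℕ → ℕ
  | 0 => col
  | v + 1 => if reachM a n (t + 1) v ≠ 0 ∧ reachM a n t v = 0 then
      Function.update (colV Δ t col v) v (pickM a n (colV Δ t col v) v Δ) else colV Δ t col v

/-- Colouring by decreasing distance from `0`. -/
def colM (Δ : ℕ) : ℕ → ℕ → ℕ
  | 0 => fun _ => 0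
  | s + 1 => colV a n Δ (n - (s + 1)) (colM Δ s) n

end models

namespace Program

open RamExpr (mat)

/-- Computes `reachM`. -/
def reachP : Cmd := .seq (.asg 3 0 1) <|
  .rep false 20 (.var 0) <| .rep false 21 (.var 0) <|
    .seq (.asg 23 0 (mat 3 (.var 20) (.var 21))) <|
    .seq (.rep false 22 (.var 0) <|
      .ite (mat 2 (.var 21) (.var 22) * mat 3 (.var 20) (.var 22)) (.asg 23 0 1) .skip) <|
    .asg 3 ((.var 20 + 1) * .var 0 + .var 21) (.var 23)

/-- Sets the flag `19` if the graph is not connected. -/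
def connP : Cmd := .rep false 21 (.var 0) <|
  .ite (1 - mat 3 (.var 0) (.var 21)) (.asg 19 0 1) .skip

/-- Computes `colM`. -/
def colP (Δ : ℕ) : Cmd := .rep false 20 (.var 0) <| .rep false 21 (.var 0) <|
  .ite (mat 3 (.var 0 - .var 20) (.var 21) - mat 3 (.var 0 - (.var 20 + 1)) (.var 21))
    (.seq (.asg 24 0 1) <|
      .seq (.rep false 25 (.lit Δ) <|
        .seq (.asg 23 0 0) <|
        .seq (.rep false 22 (.var 0) <|
          .ite (mat 2 (.var 21) (.var 22) * (1 - (RamExpr.read 4 (.var 22)).neq (.var 25 + 1)))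
            (.asg 23 0 1) .skip) <|
        .ite (.var 23) .skip (.asg 24 0 (.var 25 + 1))) <|
      .asg 4 (.var 21) (.var 24))
    .skip

end Program

section verification

variable {ev : Env} {σ : RamState} {a : ℕ → ℕ → Prop} [DecidableRel a] {n Δ : ℕ}

theorem reachM_le_one (t v : ℕ) : reachM a n t v ≤ 1 := by
  induction t generalizing v with
  | zero => simp only [reachM]; split_ifs <;> simp
  | succ t ih => simp only [reachM]; split_ifs; exacts [le_rfl, ih v]

theorem reachM_mono {t t' : ℕ} (h : t ≤ t') {v : ℕ} (hv : reachM a n t v ≠ 0) :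
    reachM a n t' v ≠ 0 := by
  induction h with
  | refl => exact hv
  | step _ ih => simp only [reachM]; split_ifs; exacts [one_ne_zero, ih]

theorem pickM_le (col : ℕ → ℕ) (v m : ℕ) : pickM a n col v m ≤ max 1 m := by
  induction m with
  | zero => simp [pickM]
  | succ m ih => simp only [pickM]; split_ifs <;> omega

theorem colV_le (hΔ : 1 ≤ Δ) {t : ℕ} {col : ℕ → ℕ} (h : ∀ u, col u ≤ Δ) (m u : ℕ) :
    colV a n Δ t col m u ≤ Δ := by
  induction m generalizing u with
  | zero => exact h u
  | succ m ih =>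
    simp only [colV]
    split_ifs
    · rw [Function.update_apply]
      split_ifs
      · exact (pickM_le _ _ _).trans (by omega)
      · exact ih u
    · exact ih u

theorem colM_le (hΔ : 1 ≤ Δ) (s u : ℕ) : colM a n Δ s u ≤ Δ := by
  induction s generalizing u with
  | zero => simp [colM]
  | succ s ih => exact colV_le hΔ ih n u

open Program BranchingWalk

theorem row_lt {t v n : ℕ} (ht : t ≤ n) (hv : v < n) : t * n + v < n * n + n := by
  have := Nat.mul_le_mul_right n ht
  omega

theorem wp_reach (hm : 40 ≤ ev.m) (hD : n * n + n + 2 ≤ ev.D) (hin : Input a n σ)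
    (h0 : ∀ i, σ.mem (3, i) = 0) :
    WP ev reachP σ fun τ => ∀ t ≤ n, ∀ v < n, τ.mem (3, t * n + v) = reachM a n t v := by
  have hD1 : 1 < 2 ^ ev.D := Nat.one_lt_two_pow (by omega)
  have hnD : n < 2 ^ ev.D := lt_of_lt_of_le (by omega) Nat.lt_two_pow_self.le
  refine WP.seq (WP.asg rfl rfl (by omega) (by simp; omega) hD1 ?_)
  refine WP.loop [21, 23, 22, 23, 3] rfl n
    (fun t ρ => ∀ t' ≤ t, ∀ v < n, ρ.mem (3, t' * n + v) = reachM a n t' v)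
    (by omega) (by omega) (by simp; omega) hnD (by decide) ?_ ?_ ?_ ?_ (fun ρ h _ => h)
  · intro j ρ v h t' ht' w hw
    rw [RamState.set_mem, if_neg (by simp), h t' ht' w hw]
  · intro t' ht' v hv
    obtain rfl : t' = 0 := by omega
    simp [RamState.set_mem, reachM, h0]
  · intro ρ hk
    rw [RamExpr.val_read, hk 0 (by decide)]
    simp [RamState.set_mem, hin.n_eq]
  intro t ht ρ hI ht20 hk
  have hin1 : Input a n ρ :=
    (hin.keep (ws := [3]) (fun a ha i => by
      simp only [List.mem_singleton] at ha; simp [RamState.set_mem, ha]) (by decide) (by decide)).keep hk (by decide) (by decide)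
  refine WP.loop [23, 22, 23, 3] rfl n
    (fun v ρ => (∀ t' ≤ t, ∀ v < n, ρ.mem (3, t' * n + v) = reachM a n t' v) ∧
      ∀ v' < v, ρ.mem (3, (t + 1) * n + v') = reachM a n (t + 1) v')
    (by omega) (by omega) (by simp; omega) hnD (by decide) ?_ ⟨hI, by simp⟩ ?_ ?_ ?_
  · intro j ρ v h
    exact ⟨fun t' ht' w hw => by rw [RamState.set_mem, if_neg (by simp), h.1 t' ht' w hw],
      fun w hw => by rw [RamState.set_mem, if_neg (by simp), h.2 w hw]⟩
  · intro ρ' hk'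
    simp [hk' 0 (by decide), hin1.n_eq]
  · intro v hv ρ1 hI1 hv21 hk1
    have hin2 := hin1.keep hk1 (by decide) (by decide)
    have ht1 : ρ1.mem (20, 0) = t := by rw [hk1 20 (by decide), ht20]
    refine WP.seq (WP.asg rfl (v := reachM a n t v) ?_ (by omega) (by simp; omega) ?_ ?_)
    · simp [ht1, hv21, hin2.n_eq, hI1.1 t le_rfl v hv]
    · exact (reachM_le_one t v).trans_lt hD1
    refine WP.seq ?_
    refine WP.flag n (fun u => a v u ∧ reachM a n t u ≠ 0) (by omega) (by omega) (by omega)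
      (by omega) (by decide) ?_ ?_ ?_
    · intro ρ' hk'
      simp [hk' 0 (by decide), RamState.set_mem, hin2.n_eq]
    · intro u hu ρ' hu' hk'
      have e1 : ρ'.mem (0, 0) = n := by simp [hk' 0 (by decide), RamState.set_mem, hin2.n_eq]
      have e2 : ρ'.mem (21, 0) = v := by simp [hk' 21 (by decide), RamState.set_mem, hv21]
      have e3 : ρ'.mem (20, 0) = t := by simp [hk' 20 (by decide), RamState.set_mem, ht1]
      have e4 : ρ'.mem (2, v * n + u) = if a v u then 1 else 0 := by
        simp [hk' 2 (by decide), RamState.set_mem, hin2.adj v hv u hu]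
      have e5 : ρ'.mem (3, t * n + u) = reachM a n t u := by
        simp [hk' 3 (by decide), RamState.set_mem, hI1.1 t le_rfl u hu]
      simp [e1, e2, e3, hu', e4, e5]
    · intro ρ' hs hk'
      have e1 : ρ'.mem (0, 0) = n := by simp [hk' 0 (by decide), RamState.set_mem, hin2.n_eq]
      have e2 : ρ'.mem (21, 0) = v := by simp [hk' 21 (by decide), RamState.set_mem, hv21]
      have e3 : ρ'.mem (20, 0) = t := by simp [hk' 20 (by decide), RamState.set_mem, ht1]
      have e4 : ∀ i, ρ'.mem (3, i) = ρ1.mem (3, i) := by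
        intro i; simp [hk' 3 (by decide), RamState.set_mem]
      have hs' : ρ'.mem (23, 0) = reachM a n (t + 1) v := by
        rw [hs, reachM]; simp [RamState.set_mem]
      refine WP.asg (x := (t + 1) * n + v) (v := reachM a n (t + 1) v) (by simp [e1, e2, e3])
        (by simp [hs']) (by omega) ?_ ((reachM_le_one _ v).trans_lt hD1) ?_
      · have := row_lt (show t + 1 ≤ n from ht) hv; omega
      · refine ⟨fun t' ht' w hw => ?_, fun w hw => ?_⟩
        -- Writing row t + 1 does not disturb earlier rows, since row and column are recovered from
        -- the address.
        · rw [RamState.set_mem, if_neg, e4, hI1.1 t' ht' w hw]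
          rintro ⟨-, he⟩
          have := (radix_unique hw hv he).1
          omega
        · rw [RamState.set_mem]
          by_cases hwv : w = v
          · subst hwv; simp
          · rw [if_neg, e4, hI1.2 w (by omega)]
            rintro ⟨-, he⟩
            omega
  · intro ρ' h _ t' ht' v hv
    rcases Nat.le_succ_iff.1 ht' with h1 | rfl
    · exact h.1 t' h1 v hv
    · exact h.2 v hv

theorem wp_conn (hm : 40 ≤ ev.m) (hD : n * n + n + 2 ≤ ev.D) (hin : Input a n σ)
    (hr : ∀ t ≤ n, ∀ v < n, σ.mem (3, t * n + v) = reachM a n t v) (h0 : σ.mem (19, 0) = 0) :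
    WP ev connP σ fun τ => τ.mem (19, 0) = if ∃ v < n, reachM a n n v = 0 then 1 else 0 := by
  refine WP.flag n (fun v => reachM a n n v = 0) (by omega) (by omega) (by omega)
      (by omega) (by decide) ?_ ?_ ?_
  · intro ρ' hk'
    simp [hk' 0 (by decide), hin.n_eq]
  · intro u hu ρ' hu' hk'
    have := reachM_le_one (a := a) (n := n) n u
    simp [hk' 0 (by decide), hin.n_eq, hu', hk' 3 (by decide), hr n le_rfl u hu]
    omega
  · intro ρ h _
    rw [h, h0]

/-- Round s treats the vertices at distance n - s from 0, recognised as those reached in n - s steps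
but not in one step less. The inner loop runs upwards through the colours and overwrites its choice,
so the largest free colour remains, as in `pickM`. -/
theorem wp_col (hm : 40 ≤ ev.m) (hD : n * n + n + Δ + 2 ≤ ev.D) (hΔ : 1 ≤ Δ) (hin : Input a n σ)
    (hr : ∀ t ≤ n, ∀ v < n, σ.mem (3, t * n + v) = reachM a n t v) (h0 : ∀ i, σ.mem (4, i) = 0) :
    WP ev (colP Δ) σ fun τ => ∀ u, τ.mem (4, u) = colM a n Δ n u := by
  have hD1 : 1 < 2 ^ ev.D := Nat.one_lt_two_pow (by omega)
  have hnD : n < 2 ^ ev.D := lt_of_lt_of_le (by omega) Nat.lt_two_pow_self.le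
  have hΔD : Δ < 2 ^ ev.D := lt_of_lt_of_le (by omega) Nat.lt_two_pow_self.le
  refine WP.loop [21, 24, 25, 23, 22, 23, 24, 4] rfl n
    (fun s ρ => ∀ u, ρ.mem (4, u) = colM a n Δ s u)
    (by omega) (by omega) (by simp; omega) hnD (by decide) ?_ ?_ ?_ ?_ (fun ρ h _ => h)
  · intro j ρ v h u
    rw [RamState.set_mem, if_neg (by simp), h u]
  · intro u; simp [h0, colM]
  · intro ρ hk
    simp [hk 0 (by decide), hin.n_eq]
  intro s hs ρ hI hs20 hk
  have hin1 := hin.keep hk (by decide) (by decide)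
  refine WP.loop [24, 25, 23, 22, 23, 24, 4] rfl n
    (fun v ρ => ∀ u, ρ.mem (4, u) = colV a n Δ (n - (s + 1)) (colM a n Δ s) v u)
    (by omega) (by omega) (by simp; omega) hnD (by decide) ?_ hI ?_ ?_ (fun ρ h _ => h)
  · intro j ρ v h u
    rw [RamState.set_mem, if_neg (by simp), h u]
  · intro ρ hk
    simp [hk 0 (by decide), hin1.n_eq]
  intro v hv ρ1 hI1 hv21 hk1
  have hin2 := hin1.keep hk1 (by decide) (by decide)
  have hs1 : ρ1.mem (20, 0) = s := by rw [hk1 20 (by decide), hs20]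
  have hr1 : ∀ t ≤ n, ∀ v < n, ρ1.mem (3, t * n + v) = reachM a n t v := fun t ht v hv => by
    rw [hk1 3 (by decide), hk 3 (by decide), hr t ht v hv]
  have htest : (RamExpr.mat 3 (.var 0 - .var 20) (.var 21) -
      RamExpr.mat 3 (.var 0 - (.var 20 + 1)) (.var 21)).val
      ρ1.mem ≠ 0 ↔ reachM a n (n - (s + 1) + 1) v ≠ 0 ∧ reachM a n (n - (s + 1)) v = 0 := by
    have e1 := reachM_le_one (a := a) (n := n) (n - (s + 1) + 1) v
    have e2 := reachM_le_one (a := a) (n := n) (n - (s + 1)) v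
    have e3 : n - s = n - (s + 1) + 1 := by omega
    simp only [RamExpr.val_sub, RamExpr.val_read, RamExpr.val_add, RamExpr.val_mul, RamExpr.val_lit,
      RamExpr.val_one, hin2.n_eq, hs1, hv21, e3, hr1 (n - (s + 1) + 1) (by omega) v hv,
      hr1 (n - (s + 1)) (by omega) v hv]
    omega
  refine WP.ite (fun h => ?_) fun h => ?_
  · rw [htest] at h
    set col := colV a n Δ (n - (s + 1)) (colM a n Δ s) v with hcol
    refine WP.seq (WP.asg rfl rfl (by omega) (by simp; omega) hD1 (WP.seq ?_))
    refine WP.loop [23, 22, 23, 24] rfl Δ (fun c ρ => ρ.mem (24, 0) = pickM a n col v c)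
      (by omega) (by omega) (by simp; omega) hΔD (by decide) ?_ ?_ ?_ ?_ ?_
    · intro j ρ v h
      rw [RamState.set_mem, if_neg (by simp), h]
    · simp [RamState.set_mem, pickM]
    · intro ρ hk
      simp
    · intro c hc ρ2 hI2 hc25 hk2
      have e1 : ρ2.mem (0, 0) = n := by simp [hk2 0 (by decide), RamState.set_mem, hin2.n_eq]
      have e2 : ρ2.mem (21, 0) = v := by simp [hk2 21 (by decide), RamState.set_mem, hv21]
      have e3 : ∀ u, ρ2.mem (4, u) = col u := by
        intro u; simp [hk2 4 (by decide), RamState.set_mem, hI1 u]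
      have e4 : ∀ u < n, ρ2.mem (2, v * n + u) = if a v u then 1 else 0 := by
        intro u hu
        simp [hk2 2 (by decide), RamState.set_mem, hin2.adj v hv u hu]
      refine WP.seq (WP.asg rfl rfl (by omega) (by simp; omega) (by simp) (WP.seq ?_))
      refine WP.flag n (fun u => a v u ∧ col u = c + 1) (by omega) (by omega) (by omega)
        (by omega) (by decide) ?_ ?_ ?_
      · intro ρ' hk'
        simp [hk' 0 (by decide), RamState.set_mem, e1]
      · intro u hu ρ' hu' hk'
        have f1 : ρ'.mem (0, 0) = n := by simp [hk' 0 (by decide), RamState.set_mem, e1]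
        have f2 : ρ'.mem (21, 0) = v := by simp [hk' 21 (by decide), RamState.set_mem, e2]
        have f3 : ρ'.mem (25, 0) = c := by simp [hk' 25 (by decide), RamState.set_mem, hc25]
        have f4 : ρ'.mem (2, v * n + u) = if a v u then 1 else 0 := by
          simp [hk' 2 (by decide), RamState.set_mem, e4 u hu]
        have f5 : ρ'.mem (4, u) = col u := by simp [hk' 4 (by decide), RamState.set_mem, e3]
        have f6 := RamExpr.val_neq ρ'.mem (RamExpr.read 4 (.var 22)) (.var 25 + 1)
        simp only [RamExpr.val_read, RamExpr.val_add, RamExpr.val_lit, RamExpr.val_one, hu', f5,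
          f3] at f6
        simp only [RamExpr.val_mul, RamExpr.val_read, RamExpr.val_add, RamExpr.val_lit,
          RamExpr.val_sub, RamExpr.val_one, f1, f2, hu', f4, ← f6]
        by_cases hau : a v u
        · simp only [hau, if_true, one_mul, true_and]; omega
        · simp [hau]
      · intro ρ' hf hk'
        have f3 : ρ'.mem (25, 0) = c := by simp [hk' 25 (by decide), RamState.set_mem, hc25]
        have f4 : ρ'.mem (24, 0) = pickM a n col v c := by
          simp [hk' 24 (by decide), RamState.set_mem, hI2]
        have f5 : ρ'.mem (23, 0) = if ∃ u < n, a v u ∧ col u = c + 1 then 1 else 0 := by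
          rw [hf]; simp [RamState.set_mem]
        refine WP.ite (fun h => ?_) fun h => ?_
        · have : ∃ u < n, a v u ∧ col u = c + 1 := by
            by_contra hno; simp [f5, hno] at h
          refine WP.skip ?_
          rw [f4, pickM, if_pos this]
        · have : ¬ ∃ u < n, a v u ∧ col u = c + 1 := by
            intro hno; simp [f5, hno] at h
          refine WP.asg rfl (v := c + 1) (by simp [f3]) (by omega) (by simp; omega)
            (lt_of_lt_of_le (by omega) Nat.lt_two_pow_self.le) ?_
          rw [RamState.set_mem, if_pos ⟨rfl, rfl⟩, pickM, if_neg this]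
    · intro ρ2 hI2 hk2
      have e2 : ρ2.mem (21, 0) = v := by simp [hk2 21 (by decide), RamState.set_mem, hv21]
      have e3 : ∀ u, ρ2.mem (4, u) = col u := by
        intro u; simp [hk2 4 (by decide), RamState.set_mem, hI1 u]
      refine WP.asg (x := v) (v := pickM a n col v Δ) (by simp [e2]) (by simp [hI2]) (by omega)
        (by omega) ?_ fun u => ?_
      · have := pickM_le (a := a) (n := n) col v Δ
        exact lt_of_le_of_lt (this.trans (by omega)) hΔD
      · rw [RamState.set_mem, colV, if_pos h, ← hcol, Function.update_apply, e3]
        simp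
  · refine WP.skip fun u => ?_
    rw [hI1, colV, if_neg fun hc => htest.2 hc h]

end verification


/-! ### Parameters, powers of two and random weights -/

/-- The constants that the program depends on. -/
structure Consts where
  Δ : ℕ
  p₁ : ℕ
  d₁ : ℕ
  p₂ : ℕ
  d₂ : ℕ
  c₀ : ℕ

namespace Consts

variable (C : Consts) (n k : ℕ)

/-- The number of inner nodes in question. -/
def kk : ℕ := min k (n + 1)
/-- The largest number of labels. -/
def Lmax : ℕ := min (C.p₁ * kk n k / C.d₁) (C.p₂ * n / C.d₂) + C.c₀
/-- The number of weights for each object. -/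
def J : ℕ := C.p₂ * n + C.c₀ + 2
/-- The number of weights. -/
def U : ℕ := n * n * C.J n
/-- The number of bits of a weight. -/
def cb : ℕ := Nat.clog 2 (2 * C.U n)
def W₁ : ℕ := (3 * n + 2) * 2 ^ C.cb n
def W₂ : ℕ := C.W₁ n * (n + 2)
def W₃ : ℕ := C.W₂ n * (2 * n + 2 + C.J n)
/-- The number of bits of a digit. -/
def B : ℕ := (2 * C.J n + n) * n + 2 * C.J n + n + 1
/-- The number of bits of the modulus. -/
def K : ℕ := C.B n * ((n + 1) * C.W₃ n)
/-- A bound for addresses and for the number of bits of each number. -/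
def need : ℕ :=
  8 * C.K n + 4 * (n * n * n + n * n + n) + 8 * C.U n + 2 ^ C.Δ + C.Δ + Nat.size k + 100

theorem W₁_pos : 2 ^ C.cb n ≤ C.W₁ n := Nat.le_mul_of_pos_left _ (by omega)
theorem W₂_le : 2 * C.W₁ n ≤ C.W₂ n := by
  rw [W₂, mul_comm]; exact Nat.mul_le_mul_left _ (by omega)
theorem W₃_le : C.W₂ n * (C.J n + 2) ≤ C.W₃ n := Nat.mul_le_mul_left _ (by omega)
theorem W₃_le' : 2 * C.W₂ n ≤ C.W₃ n := by
  refine le_trans ?_ (C.W₃_le n)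
  rw [mul_comm]; exact Nat.mul_le_mul_left _ (by omega)
theorem J_le : C.J n ≤ C.W₃ n := by
  refine le_trans ?_ (C.W₃_le n)
  have := C.W₁_pos n
  have := C.W₂_le n
  have h : 0 < 2 ^ C.cb n := by positivity
  exact (Nat.le_add_right _ 2).trans (Nat.le_mul_of_pos_left _ (by omega))
theorem B_pos : 0 < C.B n := Nat.succ_pos _
theorem nW₃_le : (n + 1) * C.W₃ n ≤ C.K n := Nat.le_mul_of_pos_left _ (C.B_pos n)
theorem W₃_le_K : C.W₃ n ≤ C.K n := (Nat.le_mul_of_pos_left _ (Nat.succ_pos n)).trans (C.nW₃_le n)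
theorem B_le_K : C.B n ≤ C.K n := by
  have := C.W₁_pos n
  have := C.W₂_le n
  have := C.W₃_le' n
  have h : 0 < 2 ^ C.cb n := by positivity
  have : 0 < C.W₃ n := by omega
  exact Nat.le_mul_of_pos_right _ (by positivity)
theorem U_le : 2 * C.U n ≤ 2 ^ C.cb n := Nat.le_pow_clog (by norm_num) _
-- All labels in use are then smaller than J - 1, which leaves slot J - 1 for the weight of the edge
-- itself.
theorem Lmax_lt : C.Lmax n k < C.J n := by
  have : C.p₂ * n / C.d₂ ≤ C.p₂ * n := Nat.div_le_self _ _
  unfold Lmax J; omega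

end Consts

namespace Program

/-- Computes the parameters. -/
def paramP (C : Consts) : Cmd :=
  .seq (.asg 10 0 (.var 0 + 1 - (.var 0 + 1 - .var 1))) <|
  .seq (.asg 17 0 (.lit C.p₁ * .var 10 / .lit C.d₁ -
    (.lit C.p₁ * .var 10 / .lit C.d₁ - .lit C.p₂ * .var 0 / .lit C.d₂) + .lit C.c₀)) <|
  .seq (.asg 11 0 (.lit C.p₂ * .var 0 + .lit C.c₀ + 2)) <|
  .seq (.asg 38 0 (.var 0 * .var 0 * .var 11)) <|
  .seq (.asg 12 0 0) <|
  .seq (.asg 26 0 1) <|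
  .seq (.rep false 20 (2 * .var 38) <| .ite (2 * .var 38 - .var 26)
    (.seq (.asg 26 0 (2 * .var 26)) (.asg 12 0 (.var 12 + 1))) .skip) <|
  .seq (.asg 13 0 ((3 * .var 0 + 2) * .var 26)) <|
  .seq (.asg 14 0 (.var 13 * (.var 0 + 2))) <|
  .seq (.asg 15 0 (.var 14 * (2 * .var 0 + 2 + .var 11))) <|
  .seq (.asg 16 0 ((2 * .var 11 + .var 0) * .var 0 + 2 * .var 11 + .var 0 + 1)) <|
  .asg 37 0 (.var 16 * ((.var 0 + 1) * .var 15))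

/-- Computes powers of two. -/
def twP : Cmd := .seq (.asg 5 0 1) <|
  .rep false 20 (.var 37) <| .asg 5 (.var 20 + 1) (2 * .read 5 (.var 20))

/-- Tosses coins for the weights. -/
def wtP : Cmd := .rep false 20 (.var 38) <|
  .seq (.asg 27 0 0) <|
  .seq (.rep false 21 (.var 12) <| .seq (.toss 35 0) (.asg 27 0 (2 * .var 27 + .var 35))) <|
  .asg 6 (.var 20) (.var 27)

end Program

/-- The parameters are stored in the memory. -/
structure HasParams (C : Consts) (n k : ℕ) (σ : RamState) : Prop where
  kk : σ.mem (10, 0) = Consts.kk n k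
  J : σ.mem (11, 0) = C.J n
  cb : σ.mem (12, 0) = C.cb n
  W₁ : σ.mem (13, 0) = C.W₁ n
  W₂ : σ.mem (14, 0) = C.W₂ n
  W₃ : σ.mem (15, 0) = C.W₃ n
  B : σ.mem (16, 0) = C.B n
  Lmax : σ.mem (17, 0) = C.Lmax n k
  K : σ.mem (37, 0) = C.K n
  U : σ.mem (38, 0) = C.U n

theorem HasParams.keep {C : Consts} {n k : ℕ} {σ ρ : RamState} {ws : List ℕ}
    (h : HasParams C n k σ) (hk : Keeps ws σ ρ)
    (hd : ∀ x ∈ [10, 11, 12, 13, 14, 15, 16, 17, 37, 38], x ∉ ws) : HasParams C n k ρ := by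
  obtain ⟨h1, h2, h3, h4, h5, h6, h7, h8, h9, h10⟩ := h
  constructor <;> rw [hk _ (hd _ (by decide))] <;> assumption

section verification

variable {ev : Env} {σ : RamState} {C : Consts} {n k : ℕ}

open Program

theorem lt_two_pow_of_le {D v : ℕ} (h : v ≤ D) : v < 2 ^ D := h.trans_lt Nat.lt_two_pow_self

theorem wp_param (hm : 40 ≤ ev.m) (hD : C.need n k ≤ ev.D) (h0 : σ.mem (0, 0) = n)
    (h1 : σ.mem (1, 0) = k) : WP ev (paramP C) σ (HasParams C n k) := by
  have hW1 := C.W₁_pos n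
  have hW2 := C.W₂_le n
  have hW3 := C.W₃_le' n
  have hJ := C.J_le n
  have hK := C.W₃_le_K n
  have hBK := C.B_le_K n
  have hU := C.U_le n
  have hL := C.Lmax_lt n k
  unfold Consts.need at hD
  have hΔ : 0 < 2 ^ C.Δ := by positivity
  -- The machine computes minima by truncated subtraction.
  have hmin : ∀ x y : ℕ, x - (x - y) = min x y := by omega
  have d0 : 0 < ev.D := by omega
  refine WP.seq (WP.asg (x := 0) (v := Consts.kk n k) rfl
    (by simp [h0, h1, Consts.kk]; omega) (by omega) d0
    (lt_two_pow_of_le (by unfold Consts.kk; omega)) ?_)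
  refine WP.seq (WP.asg (x := 0) (v := C.Lmax n k) rfl
    (by simp [RamState.set_mem, h0, Consts.Lmax, hmin]) (by omega) d0
    (lt_two_pow_of_le (by omega)) ?_)
  refine WP.seq (WP.asg (x := 0) (v := C.J n) rfl
    (by simp [RamState.set_mem, h0, Consts.J]) (by omega) d0 (lt_two_pow_of_le (by omega)) ?_)
  refine WP.seq (WP.asg (x := 0) (v := C.U n) rfl
    (by simp [RamState.set_mem, h0, Consts.U]) (by omega) d0 (lt_two_pow_of_le (by omega)) ?_)
  refine WP.seq (WP.asg (x := 0) (v := 0) rfl rfl (by omega) d0 (lt_two_pow_of_le (by omega)) ?_)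
  refine WP.seq (WP.asg (x := 0) (v := 1) rfl rfl (by omega) d0 (lt_two_pow_of_le (by omega)) ?_)
  refine WP.seq ?_
  -- Cell 26 is doubled until it is at least 2 * U, and cell 12 counts the doublings, which yields
  -- `Nat.clog`. The 2 * U rounds are more than enough, and the superfluous ones do nothing.
  refine WP.loop [26, 12] rfl (2 * C.U n)
    (fun i ρ => ρ.mem (12, 0) = min i (C.cb n) ∧ ρ.mem (26, 0) = 2 ^ (min i (C.cb n)))
    (by omega) d0 (by simp; omega) (lt_two_pow_of_le (by omega)) (by decide) ?_ ?_ ?_ ?_ ?_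
  · intro j ρ v h
    simpa [RamState.set_mem] using h
  · simp [RamState.set_mem]
  · intro ρ hk
    simp [hk 38 (by decide), RamState.set_mem]
  · intro i hi ρ hI _ hk
    have e1 : ρ.mem (38, 0) = C.U n := by simp [hk 38 (by decide), RamState.set_mem]
    refine WP.ite (fun h => ?_) fun h => ?_
    · simp only [RamExpr.val_sub, RamExpr.val_mul, RamExpr.val_ofNat, RamExpr.val_read,
        RamExpr.val_lit, e1, hI.2] at h
      have h3 : min i (C.cb n) < C.cb n := by
        rw [Consts.cb, Nat.lt_clog_iff_pow_lt (by norm_num)]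
        change 2 ^ min i (C.cb n) < 2 * C.U n
        omega
      have h4 : min (i + 1) (C.cb n) = min i (C.cb n) + 1 := by omega
      have h5 : 2 ^ (min i (C.cb n) + 1) ≤ 2 ^ C.cb n := Nat.pow_le_pow_right (by norm_num) h3
      have h6 : C.cb n < 2 ^ C.cb n := Nat.lt_two_pow_self
      refine WP.seq (WP.asg (x := 0) (v := 2 ^ (min i (C.cb n) + 1)) rfl
        (by simp [hI.2, pow_succ, mul_comm]) (by omega) d0 (lt_two_pow_of_le (by omega)) ?_)
      refine WP.asg (x := 0) (v := min i (C.cb n) + 1) rfl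
        (by simp [RamState.set_mem, hI.1]) (by omega) d0 (lt_two_pow_of_le (by omega)) ?_
      simp [RamState.set_mem, h4]
    · simp only [RamExpr.val_sub, RamExpr.val_mul, RamExpr.val_ofNat, RamExpr.val_read,
        RamExpr.val_lit, e1, hI.2] at h
      have h3 : C.cb n ≤ min i (C.cb n) := by
        rw [Consts.cb, Nat.clog_le_iff_le_pow (by norm_num)]
        change 2 * C.U n ≤ 2 ^ min i (C.cb n)
        omega
      have h4 : min (i + 1) (C.cb n) = min i (C.cb n) := by omega
      refine WP.skip ?_
      simp only [h4]
      exact hI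
  · intro ρ hI hk
    have h3 : min (2 * C.U n) (C.cb n) = C.cb n := by
      refine min_eq_right ?_
      rw [Consts.cb, Nat.clog_le_iff_le_pow (by norm_num)]
      exact Nat.lt_two_pow_self.le
    rw [h3] at hI
    have e0 : ρ.mem (0, 0) = n := by simp [hk 0 (by decide), RamState.set_mem, h0]
    have e10 : ρ.mem (10, 0) = Consts.kk n k := by simp [hk 10 (by decide), RamState.set_mem]
    have e11 : ρ.mem (11, 0) = C.J n := by simp [hk 11 (by decide), RamState.set_mem]
    have e17 : ρ.mem (17, 0) = C.Lmax n k := by simp [hk 17 (by decide), RamState.set_mem]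
    have e38 : ρ.mem (38, 0) = C.U n := by simp [hk 38 (by decide), RamState.set_mem]
    refine WP.seq (WP.asg (x := 0) (v := C.W₁ n) rfl
      (by simp [e0, hI.2, Consts.W₁]) (by omega) d0 (lt_two_pow_of_le (by omega)) ?_)
    refine WP.seq (WP.asg (x := 0) (v := C.W₂ n) rfl
      (by simp [RamState.set_mem, e0, Consts.W₂]) (by omega) d0 (lt_two_pow_of_le (by omega)) ?_)
    refine WP.seq (WP.asg (x := 0) (v := C.W₃ n) rfl
      (by simp [RamState.set_mem, e0, e11, Consts.W₃]) (by omega) d0 (lt_two_pow_of_le (by omega)) ?_)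
    refine WP.seq (WP.asg (x := 0) (v := C.B n) rfl
      (by simp [RamState.set_mem, e0, e11, Consts.B]) (by omega) d0 (lt_two_pow_of_le (by omega)) ?_)
    refine WP.asg (x := 0) (v := C.K n) rfl
      (by simp [RamState.set_mem, e0, Consts.K]) (by omega) d0 (lt_two_pow_of_le (by omega)) ?_
    constructor <;> simp [RamState.set_mem, e10, e11, e17, e38, hI.1]

theorem wp_tw (hm : 40 ≤ ev.m) (hD : C.need n k ≤ ev.D) (hp : HasParams C n k σ) :
    WP ev twP σ fun τ => ∀ i ≤ C.K n, τ.mem (5, i) = 2 ^ i := by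
  unfold Consts.need at hD
  have hΔ : 0 < 2 ^ C.Δ := by positivity
  have d0 : 0 < ev.D := by omega
  refine WP.seq (WP.asg (x := 0) (v := 1) rfl rfl (by omega) d0 (lt_two_pow_of_le (by omega)) ?_)
  refine WP.loop [5] rfl (C.K n) (fun j ρ => ∀ i ≤ j, ρ.mem (5, i) = 2 ^ i)
    (by omega) d0 (by simp; omega) (lt_two_pow_of_le (by omega)) (by decide) ?_ ?_ ?_ ?_
    (fun ρ h _ => h)
  · intro j ρ v h i hi
    rw [RamState.set_mem, if_neg (by simp), h i hi]
  · intro i hi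
    obtain rfl : i = 0 := by omega
    simp [RamState.set_mem]
  · intro ρ hk
    simp [hk 37 (by decide), RamState.set_mem, hp.K]
  · intro j hj ρ hI hj' hk
    refine WP.asg (x := j + 1) (v := 2 ^ (j + 1)) (by simp [hj'])
      (by simp [hj', hI j le_rfl, pow_succ, mul_comm]) (by omega) (by omega)
      (Nat.pow_lt_pow_right (by norm_num) (by omega)) fun i hi => ?_
    rw [RamState.set_mem]
    by_cases h : i = j + 1
    · simp [h]
    · rw [if_neg (by simp [h]), hI i (by omega)]

theorem wp_wt (hm : 40 ≤ ev.m) (hD : C.need n k ≤ ev.D) (hp : HasParams C n k σ)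
    (ht : σ.tossed = 0) :
    WP ev wtP σ fun τ => ∀ i < C.U n, τ.mem (6, i) = coinWt ev.ω (C.cb n) i := by
  have hW1 := C.W₁_pos n
  have hW2 := C.W₂_le n
  have hW3 := C.W₃_le' n
  have hK := C.W₃_le_K n
  have hcb : C.cb n < 2 ^ C.cb n := Nat.lt_two_pow_self
  unfold Consts.need at hD
  have hΔ : 0 < 2 ^ C.Δ := by positivity
  have d0 : 0 < ev.D := by omega
  -- The number of coins tossed belongs to the invariant: weight j has to use the coins from j * cb
  -- on, as in `coinWt`.
  refine WP.loop [27, 21, 35, 27, 6] rfl (C.U n)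
    (fun j ρ => (∀ i < j, ρ.mem (6, i) = coinWt ev.ω (C.cb n) i) ∧ ρ.tossed = j * C.cb n)
    (by omega) d0 (by simp; omega) (lt_two_pow_of_le (by omega)) (by decide) ?_ ?_ ?_ ?_
    (fun ρ h _ => h.1)
  · intro j ρ v h
    exact ⟨fun i hi => by rw [RamState.set_mem, if_neg (by simp), h.1 i hi], h.2⟩
  · simp [ht]
  · intro ρ hk
    simp [hk 38 (by decide), hp.U]
  · intro j hj ρ hI hj' hk
    refine WP.seq (WP.asg (x := 0) (v := 0) rfl rfl (by omega) d0 (lt_two_pow_of_le (by omega)) ?_)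
    refine WP.seq ?_
    refine WP.loop [35, 27] rfl (C.cb n)
      (fun t ρ' => ρ'.mem (27, 0) = bitsVal (fun t => ev.ω (j * C.cb n + t)) t ∧
        ρ'.tossed = j * C.cb n + t)
      (by omega) d0 (by simp; omega) (lt_two_pow_of_le (by omega)) (by decide) ?_ ?_ ?_ ?_ ?_
    · intro t ρ' v h
      exact ⟨by rw [RamState.set_mem, if_neg (by simp), h.1], h.2⟩
    · simp [RamState.set_mem, bitsVal, hI.2]
    · intro ρ' hk'
      simp [hk' 12 (by decide), RamState.set_mem, hk 12 (by decide), hp.cb]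
    · intro t ht ρ' hI' ht' hk'
      have hb := bitsVal_lt (fun t => ev.ω (j * C.cb n + t)) (t + 1)
      have hb' : 2 ^ (t + 1) ≤ 2 ^ ev.D := Nat.pow_le_pow_right (by norm_num) (by omega)
      refine WP.seq (WP.toss (x := 0) rfl (by omega) d0 ?_)
      refine WP.asg (x := 0) (v := bitsVal (fun t => ev.ω (j * C.cb n + t)) (t + 1)) rfl ?_
        (by omega) d0 (by omega) ?_
      · simp [RamState.set_mem, hI'.1, hI'.2, bitsVal]
      · simp [RamState.set_mem, hI'.2, add_assoc]
    · intro ρ' hI' hk'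
      have hb := bitsVal_lt (fun t => ev.ω (j * C.cb n + t)) (C.cb n)
      refine WP.asg (x := j) (v := coinWt ev.ω (C.cb n) j)
        (by simp [hk' 20 (by decide), RamState.set_mem, hj']) (by simp [hI'.1, coinWt])
        (by omega) (by omega) (lt_of_lt_of_le hb (Nat.pow_le_pow_right (by norm_num) (by omega))) ?_
      refine ⟨fun i hi => ?_, ?_⟩
      · rw [RamState.set_mem]
        by_cases h : i = j
        · simp [h]
        · rw [if_neg (by simp [h]), hk' 6 (by decide), RamState.set_mem, if_neg (by simp),
            hI.1 i (by omega)]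
      · rw [RamState.set_tossed, hI'.2]; ring

end verification


/-! ### The sieve as a program -/

open BranchingWalk

/-- The data of the sieve in one round of the program. -/
def sieve (C : Consts) (a : ℕ → ℕ → Prop) (n : ℕ) (col : ℕ → ℕ) (ω : ℕ → Bool) (S r L : ℕ) :
    SieveData where
  adj := a
  n := n
  r := r
  V₁ v := S.testBit (col v - 1)
  wS q j := coinWt ω (C.cb n) (idx n (C.J n) (q, j))
  L := L
  J := C.J n
  W₁ := C.W₁ n
  W₂ := C.W₂ n
  W₃ := C.W₃ n

namespace Program

open RamExpr (mat read var)

/-- The number of the weight of a pair of vertices and a label. -/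
def idxE (v w j : RamExpr) : RamExpr := ((v - (v - w)) * .var 0 + (v + (w - v))) * .var 11 + j

/-- Computes the set `V₁`. -/
def v1P : Cmd := .rep false 21 (.var 0) <|
  .asg 9 (.var 21) ((.var 28 / read 5 (read 4 (.var 21) - 1)).rem 2)

/-- Computes the weights of objects. -/
def labP : Cmd := .rep false 21 (.var 0) <| .rep false 22 (.var 0) <|
  .seq (.asg 27 0 0) <|
  .seq (.rep false 36 (.var 30) <| .ite ((.var 31 / read 5 (.var 36)).rem 2)
    (.asg 27 0 (.var 27 + read 5 (.var 16 * (.var 14 + read 6 (idxE (.var 21) (.var 22) (.var 36))))))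
    .skip) <|
  .asg 7 (.var 21 * .var 0 + .var 22) (.var 27)

/-- One entry of the table. -/
def entryP : Cmd :=
  .seq (.asg 27 0 1) <|
  .seq (.rep false 36 (.var 0) <| .ite ((RamExpr.var 36).neq (.var 21))
    (.asg 27 0 ((.var 27 * (1 + mat 8 (.var 20 * .var 0 + .var 22) (.var 36))).rem
      (read 5 (.var 37)))) .skip) <|
  .seq (.ite (mat 2 (.var 21) (.var 22))
    (.ite (read 9 (.var 21) + read 9 (.var 22))
      (.asg 23 0 (read 5 (.var 16 * (.var 15 + read 6 (idxE (.var 21) (.var 22) (.var 11 - 1))))))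
      (.asg 23 0 (read 5 (.var 16 * (.var 15 + read 6 (idxE (.var 21) (.var 22) (.var 11 - 1)))) *
        mat 7 (.var 21) (.var 22))))
    (.asg 23 0 0)) <|
  .seq (.ite (read 9 (.var 22)) (.asg 24 0 (mat 7 (.var 22) (.var 22) * read 5 (.var 16 * .var 13)))
    (.asg 24 0 (read 5 (.var 16 * .var 13)))) <|
  .asg 8 (((.var 20 + 1) * .var 0 + .var 21) * .var 0 + .var 22)
    ((.var 23 * (mat 7 (.var 22) (.var 22) + .var 24 * (.var 27 + (read 5 (.var 37) - 1)))).rem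
      (read 5 (.var 37)))

/-- Computes the table. -/
def tblP : Cmd :=
  .seq (.rep false 20 (.var 0 * .var 0) <| .asg 8 (.var 20) 0) <|
  .rep false 20 (.var 0) <| .rep false 21 (.var 0) <| .rep false 22 (.var 0) entryP

/-- Computes the sum over all sets of labels. -/
def totP : Cmd := .seq (.asg 32 0 0) <|
  .rep true 31 (read 5 (.var 30)) <|
    .seq labP <| .seq tblP <|
    .rep false 25 (.var 0) <| .asg 32 0 (.var 32 + mat 7 (.var 29) (.var 29) *
      mat 8 (.var 0 * .var 0 + .var 29) (.var 25))

/-- Looks for an odd coefficient. -/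
def scanP : Cmd := .rep false 20 (.var 0 + 1) <| .rep false 21 (.var 13) <|
  .ite ((.var 32 / read 5 (.var 16 * (.var 20 * .var 15 + .var 30 * .var 14 + .var 10 * .var 13 +
    .var 21))).rem 2) (.asg 18 0 1) .skip

/-- The rounds of the sieve. -/
def mainP (Δ : ℕ) : Cmd := .rep false 28 (.lit (2 ^ Δ)) <| .seq v1P <|
  .rep false 29 (.var 0) <| .rep false 30 (.var 17 + 1) <| .seq totP scanP

end Program

/-- The memory before the rounds of the sieve. -/
structure Ready (C : Consts) (a : ℕ → ℕ → Prop) [DecidableRel a] (n k : ℕ) (col : ℕ → ℕ)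
    (ω : ℕ → Bool) (σ : RamState) : Prop where
  input : Input a n σ
  params : HasParams C n k σ
  tw : ∀ i ≤ C.K n, σ.mem (5, i) = 2 ^ i
  wt : ∀ i < C.U n, σ.mem (6, i) = coinWt ω (C.cb n) i
  col : ∀ v, σ.mem (4, v) = col v

theorem Ready.keep {C : Consts} {a : ℕ → ℕ → Prop} [DecidableRel a] {n k : ℕ} {col : ℕ → ℕ}
    {ω : ℕ → Bool} {σ ρ : RamState} {ws : List ℕ} (h : Ready C a n k col ω σ) (hk : Keeps ws σ ρ)
    (hd : ∀ x ∈ [0, 2, 4, 5, 6, 10, 11, 12, 13, 14, 15, 16, 17, 37, 38], x ∉ ws) :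
    Ready C a n k col ω ρ where
  input := h.input.keep hk (hd _ (by decide)) (hd _ (by decide))
  params := h.params.keep hk fun x hx => hd x (by
    simp only [List.mem_cons, List.not_mem_nil, or_false] at hx ⊢; tauto)
  tw i hi := by rw [hk 5 (hd _ (by decide)), h.tw i hi]
  wt i hi := by rw [hk 6 (hd _ (by decide)), h.wt i hi]
  col v := by rw [hk 4 (hd _ (by decide)), h.col v]

section bounds

variable (C : Consts) (a : ℕ → ℕ → Prop) (n : ℕ) (col : ℕ → ℕ) (ω : ℕ → Bool) (S r L : ℕ)

/-- Powers of two are looked up in array 5, which is filled up to the exponent K. This estimate and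
the next ones show that no lookup goes further. -/
theorem exp_label_le (q : Sym2 ℕ) (j : ℕ) :
    C.B n * (C.W₂ n + (sieve C a n col ω S r L).wS q j) ≤ C.K n := by
  refine Nat.mul_le_mul_left _ ?_
  have h1 : (sieve C a n col ω S r L).wS q j < 2 ^ C.cb n := bitsVal_lt _ _
  have := C.W₁_pos n
  have := C.W₂_le n
  have := C.W₃_le' n
  have : C.W₃ n ≤ (n + 1) * C.W₃ n := Nat.le_mul_of_pos_left _ (Nat.succ_pos n)
  omega

theorem exp_edge_le (hn : 0 < n) (q : Sym2 ℕ) (j : ℕ) :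
    C.B n * (C.W₃ n + (sieve C a n col ω S r L).wS q j) ≤ C.K n := by
  refine Nat.mul_le_mul_left _ ?_
  have h1 : (sieve C a n col ω S r L).wS q j < 2 ^ C.cb n := bitsVal_lt _ _
  have := C.W₁_pos n
  have := C.W₂_le n
  have := C.W₃_le' n
  have : 2 * C.W₃ n ≤ (n + 1) * C.W₃ n := Nat.mul_le_mul_right _ (by omega)
  omega

theorem exp_inner_le : C.B n * C.W₁ n ≤ C.K n := by
  refine Nat.mul_le_mul_left _ ?_
  have := C.W₂_le n
  have := C.W₃_le' n
  have : C.W₃ n ≤ (n + 1) * C.W₃ n := Nat.le_mul_of_pos_left _ (Nat.succ_pos n)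
  omega

theorem exp_scan_lt {N k L w : ℕ} (hN : N ≤ n) (hk : k ≤ n + 1) (hL : L < C.J n)
    (hw : w < C.W₁ n) : N * C.W₃ n + L * C.W₂ n + k * C.W₁ n + w < (n + 1) * C.W₃ n := by
  have h1 : k * C.W₁ n + w < C.W₂ n := by
    calc k * C.W₁ n + w < k * C.W₁ n + C.W₁ n := by omega
      _ = C.W₁ n * (k + 1) := by ring
      _ ≤ _ := Nat.mul_le_mul_left _ (by omega)
  have h2 : L * C.W₂ n + C.W₂ n ≤ C.W₃ n := by
    calc L * C.W₂ n + C.W₂ n = C.W₂ n * (L + 1) := by ring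
      _ ≤ _ := Nat.mul_le_mul_left _ (by omega)
  have h3 : N * C.W₃ n + C.W₃ n ≤ (n + 1) * C.W₃ n := by
    rw [← Nat.succ_mul]; exact Nat.mul_le_mul_right _ (by omega)
  omega

theorem J_lt_two_pow : C.J n < 2 ^ C.K n :=
  lt_two_pow_of_le ((C.J_le n).trans (C.W₃_le_K n))

theorem label_sum_le {L : ℕ} (hL : L ≤ C.J n) (A : ℕ) (q : Sym2 ℕ) {m : ℕ} (hm : m ≤ L) :
    (∑ j ∈ Finset.range m, if A.testBit j then
      (2 ^ C.B n) ^ (C.W₂ n + (sieve C a n col ω S r L).wS q j) else 0) ≤ 2 ^ (2 * C.K n) := by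
  have h1 : ∀ j ∈ Finset.range m, (if A.testBit j then
      (2 ^ C.B n) ^ (C.W₂ n + (sieve C a n col ω S r L).wS q j) else 0) ≤ 2 ^ C.K n := by
    intro j _
    split_ifs
    · rw [← pow_mul]
      exact Nat.pow_le_pow_right (by norm_num) (exp_label_le C a n col ω S r L q j)
    · exact Nat.zero_le _
  refine (Finset.sum_le_card_nsmul _ _ _ h1).trans ?_
  rw [Finset.card_range, smul_eq_mul, two_mul, pow_add]
  have := J_lt_two_pow C n
  exact Nat.mul_le_mul_right _ (by omega)

theorem O_le {L : ℕ} (hL : L ≤ C.J n) (A : ℕ) (q : Sym2 ℕ) :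
    (sieve C a n col ω S r L).O (2 ^ C.B n) A q ≤ 2 ^ (2 * C.K n) :=
  label_sum_le C a n col ω S r hL A q le_rfl

end bounds

theorem tblAcc_le {M : ℕ} (hM : 1 ≤ M) (v : ℕ) (row : ℕ → ℕ) (m : ℕ) : tblAcc M v row m ≤ M := by
  induction m with
  | zero => exact hM
  | succ m ih =>
    simp only [tblAcc]
    split_ifs
    · exact ih
    · exact (Nat.mod_lt _ hM).le

theorem tbl_le {M : ℕ} (hM : 1 ≤ M) (n : ℕ) (ed : ℕ → ℕ → ℕ) (nl ni : ℕ → ℕ) (t v w : ℕ) :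
    tbl M n ed nl ni t v w ≤ M := by
  cases t with
  | zero => exact Nat.zero_le _
  | succ t => exact (Nat.mod_lt _ hM).le

section verification

variable {ev : Env} {σ : RamState} {C : Consts} {a : ℕ → ℕ → Prop} [DecidableRel a] {n k : ℕ}
  {col : ℕ → ℕ} {ω : ℕ → Bool} {S r L : ℕ}

open Program

theorem toNat_testBit (x i : ℕ) : x / 2 ^ i % 2 = if x.testBit i then 1 else 0 := by
  rw [Nat.testBit_eq_decide_div_mod_eq]
  rcases Nat.mod_two_eq_zero_or_one (x / 2 ^ i) with h | h <;> simp [h]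

theorem wp_v1 (hm : 40 ≤ ev.m) (hD : C.need n k ≤ ev.D) (hR : Ready C a n k col ω σ)
    (hcol : ∀ v, col v ≤ C.J n) (hS : σ.mem (28, 0) = S) :
    WP ev v1P σ fun τ => ∀ v < n, τ.mem (9, v) = if S.testBit (col v - 1) then 1 else 0 := by
  have hJ := (C.J_le n).trans (C.W₃_le_K n)
  unfold Consts.need at hD
  have hΔ : 0 < 2 ^ C.Δ := by positivity
  have d0 : 0 < ev.D := by omega
  refine WP.loop [9] rfl n
    (fun j ρ => ∀ v < j, ρ.mem (9, v) = if S.testBit (col v - 1) then 1 else 0)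
    (by omega) d0 (by simp; omega) (lt_two_pow_of_le (by omega)) (by decide) ?_ (by simp) ?_ ?_
    (fun ρ h _ => h)
  · intro j ρ v h i hi
    rw [RamState.set_mem, if_neg (by simp), h i hi]
  · intro ρ hk; simp [hk 0 (by decide), hR.input.n_eq]
  · intro v hv ρ hI hv' hk
    have h1 : ρ.mem (5, col v - 1) = 2 ^ (col v - 1) := by
      rw [hk 5 (by decide), hR.tw _ (by have := hcol v; omega)]
    refine WP.asg (x := v) (v := if S.testBit (col v - 1) then 1 else 0) (by simp [hv']) ?_
      (by omega) (by omega) (lt_two_pow_of_le (by split_ifs <;> omega)) fun w hw => ?_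
    · simp only [RamExpr.val_rem, RamExpr.val_div, RamExpr.val_read, RamExpr.val_sub,
        RamExpr.val_lit, RamExpr.val_one, RamExpr.val_ofNat, hv', hk 4 (by decide), hR.col,
        hk 28 (by decide), hS, h1]
      exact toNat_testBit _ _
    · rw [RamState.set_mem]
      by_cases h : w = v
      · subst h; simp
      · rw [if_neg (by simp [h]), hI w (by omega)]

/-- With truncated subtraction, v - (v - w) is the minimum and v + (w - v) the maximum, so both
orders of a pair lead to the same random weight. -/
theorem val_idxE {M : Memory} {v w j : ℕ} {ve we je : RamExpr} (hv : ve.val M = v)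
    (hw : we.val M = w) (hj : je.val M = j) (h0 : M (0, 0) = n) (h11 : M (11, 0) = C.J n) :
    (idxE ve we je).val M = idx n (C.J n) (s(v, w), j) := by
  have h1 : v - (v - w) = v ⊓ w := by rw [Nat.sub_sub_eq_min]
  have h2 : v + (w - v) = v ⊔ w := by rw [Nat.add_comm, Nat.sub_add_eq_max, max_comm]
  simp only [idxE, RamExpr.val_add, RamExpr.val_mul, RamExpr.val_sub, hv, hw, hj,
    RamExpr.val_read, RamExpr.val_lit, h0, h11, idx, Sym2.inf_mk, Sym2.sup_mk, h1, h2]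

theorem Ready.wt_eq (hR : Ready C a n k col ω σ) {v w j : ℕ} (hv : v < n) (hw : w < n)
    (hj : j < C.J n) : σ.mem (6, idx n (C.J n) (s(v, w), j)) =
      (sieve C a n col ω S r L).wS s(v, w) j :=
  hR.wt _ (idx_lt (by simp [hv]) (by simp [hv, hw]) hj)

theorem wp_lab (hm : 40 ≤ ev.m) (hD : C.need n k ≤ ev.D) (hR : Ready C a n k col ω σ)
    (hL : L < C.J n) {A : ℕ} (h30 : σ.mem (30, 0) = L) (h31 : σ.mem (31, 0) = A) :
    WP ev labP σ fun τ => ∀ v < n, ∀ w < n,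
      τ.mem (7, v * n + w) = (sieve C a n col ω S r L).O (2 ^ C.B n) A s(v, w) := by
  have hJ := (C.J_le n).trans (C.W₃_le_K n)
  unfold Consts.need at hD
  have hΔ : 0 < 2 ^ C.Δ := by positivity
  have d0 : 0 < ev.D := by omega
  have hn2 : ∀ v < n, ∀ w < n, v * n + w < ev.D := by
    intro v hv w hw
    have := row_lt hv.le hw
    omega
  have h2K : 2 ^ (2 * C.K n) < 2 ^ ev.D := Nat.pow_lt_pow_right (by norm_num) (by omega)
  refine WP.loop [22, 27, 36, 27, 7] rfl n
    (fun j ρ => ∀ v < j, ∀ w < n,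
      ρ.mem (7, v * n + w) = (sieve C a n col ω S r L).O (2 ^ C.B n) A s(v, w))
    (by omega) d0 (by simp; omega) (lt_two_pow_of_le (by omega)) (by decide) ?_ (by simp) ?_ ?_
    (fun ρ h _ => h)
  · intro j ρ x h v hv w hw
    rw [RamState.set_mem, if_neg (by simp), h v hv w hw]
  · intro ρ hk; simp [hk 0 (by decide), hR.input.n_eq]
  intro v hv ρ hI hv' hk
  have hR1 := hR.keep hk (by decide)
  refine WP.loop [27, 36, 27, 7] rfl n
    (fun j ρ => (∀ v' < v, ∀ w < n,
      ρ.mem (7, v' * n + w) = (sieve C a n col ω S r L).O (2 ^ C.B n) A s(v', w)) ∧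
      ∀ w < j, ρ.mem (7, v * n + w) = (sieve C a n col ω S r L).O (2 ^ C.B n) A s(v, w))
    (by omega) d0 (by simp; omega) (lt_two_pow_of_le (by omega)) (by decide) ?_ ⟨hI, by simp⟩
    ?_ ?_ ?_
  · intro j ρ x h
    exact ⟨fun v hv w hw => by rw [RamState.set_mem, if_neg (by simp), h.1 v hv w hw],
      fun w hw => by rw [RamState.set_mem, if_neg (by simp), h.2 w hw]⟩
  · intro ρ hk; simp [hk 0 (by decide), hR1.input.n_eq]
  · intro w hw ρ1 hI1 hw' hk1
    have hR2 := hR1.keep hk1 (by decide)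
    refine WP.seq (WP.asg (x := 0) (v := 0) rfl rfl (by omega) d0 (lt_two_pow_of_le (by omega)) ?_)
    refine WP.seq ?_
    refine WP.loop [27] rfl L
      (fun m ρ => ρ.mem (27, 0) = ∑ j ∈ Finset.range m, if A.testBit j then
        (2 ^ C.B n) ^ (C.W₂ n + (sieve C a n col ω S r L).wS s(v, w) j) else 0)
      (by omega) d0 (by simp; omega) (lt_two_pow_of_le (by omega)) (by decide) ?_ ?_ ?_ ?_ ?_
    · intro j ρ x h
      rw [RamState.set_mem, if_neg (by simp), h]
    · simp [RamState.set_mem]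
    · intro ρ hk2
      simp [hk2 30 (by decide), RamState.set_mem, hk1 30 (by decide), hk 30 (by decide), h30]
    · intro j hj ρ2 hI2 hj' hk2
      have hk2' : Keeps [36, 27] ρ1 ρ2 := Keeps.trans (τ := ρ1.set 27 0 0) (fun b hb i => by
        simp only [List.mem_cons, not_or] at hb; simp [RamState.set_mem, hb.2.1]) hk2
      have hR3 := hR2.keep hk2' (by decide)
      have e21 : ρ2.mem (21, 0) = v := by rw [hk2' 21 (by decide), hk1 21 (by decide), hv']
      have e22 : ρ2.mem (22, 0) = w := by rw [hk2' 22 (by decide), hw']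
      have e31 : ρ2.mem (31, 0) = A := by
        rw [hk2' 31 (by decide), hk1 31 (by decide), hk 31 (by decide), h31]
      have htest : (((RamExpr.var 31 / .read 5 (.var 36)).rem 2).val ρ2.mem ≠ 0) ↔
          A.testBit j = true := by
        simp only [RamExpr.val_rem, RamExpr.val_div, RamExpr.val_read, RamExpr.val_lit,
          RamExpr.val_ofNat, e31, hj', hR3.tw j (by omega), toNat_testBit]
        split_ifs with h <;> simp [h]
      refine WP.ite (fun h => ?_) fun h => ?_
      · rw [htest] at h
        have hle := label_sum_le C a n col ω S r hL.le A s(v, w) hj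
        rw [Finset.sum_range_succ, if_pos h] at hle
        refine WP.asg (x := 0) rfl (v := _) ?_ (by omega) d0 (hle.trans_lt h2K) ?_
        · simp only [RamExpr.val_add, RamExpr.val_read, RamExpr.val_mul, RamExpr.val_lit, hI2,
            hR3.params.B, hR3.params.W₂,
            val_idxE (C := C) (v := v) (w := w) (j := j) (ve := .var 21) (we := .var 22)
              (je := .var 36) (by simp [e21]) (by simp [e22]) (by simp [hj']) hR3.input.n_eq
              hR3.params.J, hR3.wt_eq (S := S) (r := r) (L := L) hv hw (hj.trans hL),
            hR3.tw _ (exp_label_le C a n col ω S r L s(v, w) j), pow_mul]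
        · rw [RamState.set_mem, if_pos ⟨rfl, rfl⟩, Finset.sum_range_succ, if_pos h]
      · have h' : ¬ A.testBit j = true := fun h1 => htest.2 h1 h
        refine WP.skip ?_
        rw [Finset.sum_range_succ, if_neg h', add_zero, hI2]
    · intro ρ2 hI2 hk2
      have hk2' : Keeps [36, 27] ρ1 ρ2 := Keeps.trans (τ := ρ1.set 27 0 0) (fun b hb i => by
        simp only [List.mem_cons, not_or] at hb; simp [RamState.set_mem, hb.2.1]) hk2
      have hR3 := hR2.keep hk2' (by decide)
      have e21 : ρ2.mem (21, 0) = v := by rw [hk2' 21 (by decide), hk1 21 (by decide), hv']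
      have e22 : ρ2.mem (22, 0) = w := by rw [hk2' 22 (by decide), hw']
      refine WP.asg (x := v * n + w) (by simp [e21, e22, hR3.input.n_eq]) hI2 (by omega)
        (hn2 v hv w hw) ((O_le C a n col ω S r hL.le A s(v, w)).trans_lt h2K) ⟨?_, ?_⟩
      · intro v' hv'' w' hw''
        rw [RamState.set_mem, if_neg, hk2' 7 (by decide), hI1.1 v' hv'' w' hw'']
        rintro ⟨-, he⟩
        have := (radix_unique hw'' hw he).1
        omega
      · intro w' hw''
        rw [RamState.set_mem]
        by_cases h : w' = w
        · subst h; simp; rfl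
        · rw [if_neg, hk2' 7 (by decide), hI1.2 w' (by omega)]
          rintro ⟨-, he⟩
          omega
  · intro ρ1 h _ v' hv'' w hw
    rcases Nat.lt_succ_iff_lt_or_eq.1 hv'' with h1 | rfl
    · exact h.1 v' h1 w hw
    · exact h.2 w hw

end verification


/-! ### Verification of the table and of the sum over label sets -/

open BranchingWalk

/-- The memory holds `V₁` and the weights of objects. -/
structure Labelled (p : SieveData) (B A : ℕ) (σ : RamState) : Prop where
  v1 : ∀ v < p.n, σ.mem (9, v) = if p.V₁ v then 1 else 0
  lab : ∀ v < p.n, ∀ w < p.n, σ.mem (7, v * p.n + w) = p.O (2 ^ B) A s(v, w)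

theorem Labelled.keep {p : SieveData} {B A : ℕ} {σ ρ : RamState} {ws : List ℕ}
    (h : Labelled p B A σ) (hk : Keeps ws σ ρ) (h7 : 7 ∉ ws) (h9 : 9 ∉ ws) : Labelled p B A ρ :=
  ⟨fun v hv => by rw [hk 9 h9, h.v1 v hv], fun v hv w hw => by rw [hk 7 h7, h.lab v hv w hw]⟩

section verification

variable {ev : Env} {σ : RamState} {C : Consts} {a : ℕ → ℕ → Prop} [DecidableRel a] {n k : ℕ}
  {col : ℕ → ℕ} {ω : ℕ → Bool} {S r L A : ℕ}

open Program

/-- The table of a round. -/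
noncomputable def roundTbl (C : Consts) (p : SieveData) (A : ℕ) : ℕ → ℕ → ℕ → ℕ :=
  tbl (2 ^ C.K p.n) p.n (p.ed (2 ^ C.B p.n) A) (p.nl (2 ^ C.B p.n) A) (p.ni (2 ^ C.B p.n) A)

theorem cube_lt {t v w n : ℕ} (ht : t ≤ n) (hv : v < n) (hw : w < n) :
    (t * n + v) * n + w < n * n * n + n * n := by
  have h1 := row_lt ht hv
  calc (t * n + v) * n + w < (t * n + v) * n + n := by omega
    _ = (t * n + v + 1) * n := by ring
    _ ≤ (n * n + n) * n := Nat.mul_le_mul_right _ h1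
    _ = _ := by ring

theorem wp_entry (hm : 40 ≤ ev.m) (hD : C.need n k ≤ ev.D) (hR : Ready C a n k col ω σ)
    (hL : L < C.J n) (hlab : Labelled (sieve C a n col ω S r L) (C.B n) A σ) {t v w : ℕ}
    (ht : t < n) (hv : v < n) (hw : w < n) (h20 : σ.mem (20, 0) = t) (h21 : σ.mem (21, 0) = v)
    (h22 : σ.mem (22, 0) = w)
    (hT : ∀ u < n, σ.mem (8, (t * n + w) * n + u) = roundTbl C (sieve C a n col ω S r L) A t w u) :
    WP ev entryP σ fun τ => ∀ i, τ.mem (8, i) = if i = ((t + 1) * n + v) * n + w then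
      roundTbl C (sieve C a n col ω S r L) A (t + 1) v w else σ.mem (8, i) := by
  have hJ := (C.J_le n).trans (C.W₃_le_K n)
  unfold Consts.need at hD
  have hΔ : 0 < 2 ^ C.Δ := by positivity
  have d0 : 0 < ev.D := by omega
  -- Only numbers that are stored have to be smaller than 2 ^ D; intermediate values inside an
  -- expression are charged by `bitBound`.
  have h2K : ∀ x, x ≤ 2 ^ (3 * C.K n) → x < 2 ^ ev.D := fun x hx =>
    hx.trans_lt (Nat.pow_lt_pow_right (by norm_num) (by omega))
  have hM : 1 ≤ 2 ^ C.K n := Nat.one_le_two_pow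
  set p := sieve C a n col ω S r L with hp
  have hpn : p.n = n := rfl
  have hacc := tblAcc_le hM v (roundTbl C p A t w)
  have hKle : 2 ^ C.K n ≤ 2 ^ (3 * C.K n) := Nat.pow_le_pow_right (by norm_num) (by omega)
  refine WP.seq (WP.asg (x := 0) (v := 1) rfl rfl (by omega) d0 (lt_two_pow_of_le (by omega)) ?_)
  refine WP.seq ?_
  refine WP.loop [27] rfl n
    (fun j ρ => ρ.mem (27, 0) = tblAcc (2 ^ C.K n) v (roundTbl C p A t w) j)
    (by omega) d0 (by simp; omega) (lt_two_pow_of_le (by omega)) (by decide) ?_ ?_ ?_ ?_ ?_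
  · intro j ρ x h
    rw [RamState.set_mem, if_neg (by simp), h]
  · simp [RamState.set_mem, tblAcc]
  · intro ρ hk
    simp [hk 0 (by decide), RamState.set_mem, hR.input.n_eq]
  · intro j hj ρ hI hj' hk
    have hk' : Keeps [36, 27] σ ρ := Keeps.trans (τ := σ.set 27 0 1) (fun b hb i => by
        simp only [List.mem_cons, not_or] at hb; simp [RamState.set_mem, hb.2.1]) hk
    have hR1 := hR.keep hk' (by decide)
    have e21 : ρ.mem (21, 0) = v := by rw [hk' 21 (by decide), h21]
    have f6 := RamExpr.val_neq ρ.mem (RamExpr.var 36) (.var 21)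
    simp only [RamExpr.val_read, RamExpr.val_lit, hj', e21] at f6
    refine WP.ite (fun h => ?_) fun h => ?_
    · have hne : j ≠ v := fun h1 => h (f6.2 h1)
      have heq : tblAcc (2 ^ C.K n) v (roundTbl C p A t w) (j + 1) =
        tblAcc (2 ^ C.K n) v (roundTbl C p A t w) j * (1 + roundTbl C p A t w j) % 2 ^ C.K n := by
        rw [tblAcc, if_neg hne]
      refine WP.asg (x := 0) (v := tblAcc (2 ^ C.K n) v (roundTbl C p A t w) (j + 1)) rfl ?_
        (by omega) d0 (h2K _ ((hacc _).trans hKle)) (by simp [RamState.set_mem])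
      simp only [RamExpr.val_rem, RamExpr.val_mul, RamExpr.val_add, RamExpr.val_one,
        RamExpr.val_read, RamExpr.val_lit, hI, hj', hR1.input.n_eq, hk' 20 (by decide), h20,
        hk' 22 (by decide), h22, hk' 8 (by decide), hT j hj, hR1.params.K, hR1.tw _ le_rfl, heq]
    · refine WP.skip ?_
      rw [hI, tblAcc, if_pos (f6.1 h)]
  intro ρ hI hk
  have hk' : Keeps [36, 27] σ ρ := Keeps.trans (τ := σ.set 27 0 1) (fun b hb i => by
      simp only [List.mem_cons, not_or] at hb; simp [RamState.set_mem, hb.2.1]) hk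
  have hR1 := hR.keep hk' (by decide)
  have hlab1 := hlab.keep hk' (by decide) (by decide)
  have e20 : ρ.mem (20, 0) = t := by rw [hk' 20 (by decide), h20]
  have e21 : ρ.mem (21, 0) = v := by rw [hk' 21 (by decide), h21]
  have e22 : ρ.mem (22, 0) = w := by rw [hk' 22 (by decide), h22]
  have e8 : ∀ i, ρ.mem (8, i) = σ.mem (8, i) := hk' 8 (by decide)
  have hO := O_le C a n col ω S r hL.le A
  rw [← hp] at hO
  have hEle : p.E (2 ^ C.B n) s(v, w) ≤ 2 ^ C.K n := by
    rw [SieveData.E, ← pow_mul]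
    exact Nat.pow_le_pow_right (by norm_num) (exp_edge_le C a n col ω S r L (by omega) s(v, w) _)
  have hE : (RamExpr.read 5 (.var 16 * (.var 15 + .read 6 (idxE (.var 21) (.var 22) (.var 11 - 1))))).val
      ρ.mem = p.E (2 ^ C.B n) s(v, w) := by
    have h1 : (idxE (.var 21) (.var 22) (.var 11 - 1)).val ρ.mem =
        idx n (C.J n) (s(v, w), C.J n - 1) := val_idxE (C := C) (by simp [e21]) (by simp [e22])
          (by simp [hR1.params.J]) hR1.input.n_eq hR1.params.J
    simp only [RamExpr.val_read, RamExpr.val_mul, RamExpr.val_add, RamExpr.val_lit, h1,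
      hR1.params.B, hR1.params.W₃, hR1.wt_eq (S := S) (r := r) (L := L) hv hw
        (show C.J n - 1 < C.J n by omega),
      hR1.tw _ (exp_edge_le C a n col ω S r L (by omega) s(v, w) _)]
    rw [SieveData.E, pow_mul]
    rfl
  have h3 : 2 ^ C.K n * 2 ^ (2 * C.K n) = 2 ^ (3 * C.K n) := by rw [← pow_add]; congr 1; ring
  have h4 : 1 ≤ 2 ^ (2 * C.K n) := Nat.one_le_two_pow
  have hedge : WP ev (.ite (.mat 2 (.var 21) (.var 22))
    (.ite (.read 9 (.var 21) + .read 9 (.var 22))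
      (.asg 23 0 (.read 5 (.var 16 * (.var 15 + .read 6 (idxE (.var 21) (.var 22) (.var 11 - 1))))))
      (.asg 23 0 (.read 5 (.var 16 * (.var 15 + .read 6 (idxE (.var 21) (.var 22) (.var 11 - 1)))) *
        .mat 7 (.var 21) (.var 22))))
    (.asg 23 0 0)) ρ (fun τ => τ.mem (23, 0) = p.ed (2 ^ C.B n) A v w) := by
    have e2 : (RamExpr.mat 2 (.var 21) (.var 22)).val ρ.mem = if a v w then 1 else 0 := by
      simp [hR1.input.n_eq, e21, e22, hR1.input.adj v hv w hw]
    have e7 : (RamExpr.mat 7 (.var 21) (.var 22)).val ρ.mem = p.O (2 ^ C.B n) A s(v, w) := by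
      simp only [RamExpr.val_read, RamExpr.val_add, RamExpr.val_mul, RamExpr.val_lit,
        hR1.input.n_eq, e21, e22]
      exact hlab1.lab v hv w hw
    have e9 : (RamExpr.read 9 (.var 21) + .read 9 (.var 22)).val ρ.mem =
        (if p.V₁ v then 1 else 0) + if p.V₁ w then 1 else 0 := by
      simp only [RamExpr.val_add, RamExpr.val_read, RamExpr.val_lit, e21, e22]
      rw [hlab1.v1 v hv, hlab1.v1 w hw]
    refine WP.ite (fun h => ?_) fun h => ?_
    · have hvw : p.adj v w := by
        by_contra hno
        exact h (e2.trans (if_neg hno))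
      refine WP.ite (fun h' => ?_) fun h' => ?_
      · have hc : ¬ (p.V₁ v = false ∧ p.V₁ w = false) := by
          rintro ⟨k1, k2⟩; rw [e9, k1, k2] at h'; simp at h'
        have hed : p.ed (2 ^ C.B n) A v w = p.E (2 ^ C.B n) s(v, w) := by
          rw [SieveData.ed, if_pos hvw, if_neg hc, mul_one]
        exact WP.asg (x := 0) rfl hE (by omega) d0 (h2K _ (hEle.trans hKle))
          (by simp [RamState.set_mem, hed])
      · have hc : p.V₁ v = false ∧ p.V₁ w = false := by
          rw [e9] at h'
          constructor
          · by_contra hno; simp [hno] at h'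
          · by_contra hno; simp [hno] at h'
        have hed : p.ed (2 ^ C.B n) A v w = p.E (2 ^ C.B n) s(v, w) * p.O (2 ^ C.B n) A s(v, w) := by
          rw [SieveData.ed, if_pos hvw, if_pos hc]
        refine WP.asg (x := 0) (v := p.E (2 ^ C.B n) s(v, w) * p.O (2 ^ C.B n) A s(v, w)) rfl ?_
          (by omega) d0 (h2K _ ?_) (by simp [RamState.set_mem, hed])
        · rw [RamExpr.val_mul, hE, e7]
        · rw [← h3]; exact Nat.mul_le_mul hEle (hO _)
    · have hvw : ¬ p.adj v w := fun hno => by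
        rw [e2, if_pos (show a v w from hno)] at h; exact one_ne_zero h
      exact WP.asg (x := 0) (v := 0) rfl rfl (by omega) d0 (by positivity)
          (by simp [RamState.set_mem, SieveData.ed_of_not _ _ hvw])
  refine WP.seq ((hedge.frm [23, 23, 23] rfl).mono fun ρ1 ⟨h23, hk1⟩ => ?_)
  have hR2 := hR1.keep hk1 (by decide)
  have hlab2 := hlab1.keep hk1 (by decide) (by decide)
  have e22' : ρ1.mem (22, 0) = w := by rw [hk1 22 (by decide), e22]
  have e7 : (RamExpr.mat 7 (.var 22) (.var 22)).val ρ1.mem = p.nl (2 ^ C.B n) A w := by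
    simp only [RamExpr.val_read, RamExpr.val_add, RamExpr.val_mul, RamExpr.val_lit,
      hR2.input.n_eq, e22']
    exact hlab2.lab w hw w hw
  have eI : (RamExpr.read 5 (.var 16 * .var 13)).val ρ1.mem = (2 ^ C.B n) ^ C.W₁ n := by
    simp only [RamExpr.val_read, RamExpr.val_mul, RamExpr.val_lit, hR2.params.B, hR2.params.W₁,
      hR2.tw _ (exp_inner_le C n), pow_mul]
  have hIle : (2 ^ C.B n) ^ C.W₁ n ≤ 2 ^ C.K n := by
    rw [← pow_mul]; exact Nat.pow_le_pow_right (by norm_num) (exp_inner_le C n)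
  have hinner : WP ev (.ite (.read 9 (.var 22))
      (.asg 24 0 (.mat 7 (.var 22) (.var 22) * .read 5 (.var 16 * .var 13)))
      (.asg 24 0 (.read 5 (.var 16 * .var 13)))) ρ1
      (fun τ => τ.mem (24, 0) = p.ni (2 ^ C.B n) A w) := by
    have e9 : (RamExpr.read 9 (.var 22)).val ρ1.mem = if p.V₁ w then 1 else 0 := by
      simp only [RamExpr.val_read, RamExpr.val_lit, e22']
      rw [hlab2.v1 w hw]
    refine WP.ite (fun h => ?_) fun h => ?_
    · have hc : p.V₁ w = true := by by_contra hno; exact h (e9.trans (if_neg hno))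
      have hni : p.ni (2 ^ C.B n) A w = p.nl (2 ^ C.B n) A w * (2 ^ C.B n) ^ C.W₁ n := by
        rw [SieveData.ni, if_pos hc]; rfl
      refine WP.asg (x := 0) (v := p.nl (2 ^ C.B n) A w * (2 ^ C.B n) ^ C.W₁ n) rfl ?_
        (by omega) d0 (h2K _ ?_) (by simp [RamState.set_mem, hni])
      · rw [RamExpr.val_mul, e7, eI]
      · rw [← h3, mul_comm]; exact Nat.mul_le_mul hIle (hO _)
    · have hc : ¬ p.V₁ w = true := fun hno => by
        rw [e9, if_pos hno] at h; exact one_ne_zero h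
      have hni : p.ni (2 ^ C.B n) A w = (2 ^ C.B n) ^ C.W₁ n := by
        rw [SieveData.ni, if_neg hc, one_mul]; rfl
      exact WP.asg (x := 0) (v := (2 ^ C.B n) ^ C.W₁ n) rfl eI (by omega) d0
        (h2K _ (hIle.trans hKle)) (by simp [RamState.set_mem, hni])
  refine WP.seq ((hinner.frm [24, 24] rfl).mono fun ρ2 ⟨h24, hk2⟩ => ?_)
  have hR3 := hR2.keep hk2 (by decide)
  have f7 : (RamExpr.mat 7 (.var 22) (.var 22)).val ρ2.mem = p.nl (2 ^ C.B n) A w := by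
    rw [← e7]
    simp only [RamExpr.val_read, RamExpr.val_add, RamExpr.val_mul, RamExpr.val_lit,
      hk2 0 (by decide), hk2 22 (by decide), hk2 7 (by decide)]
  have f20 : ρ2.mem (20, 0) = t := by rw [hk2 20 (by decide), hk1 20 (by decide), e20]
  have f21 : ρ2.mem (21, 0) = v := by rw [hk2 21 (by decide), hk1 21 (by decide), e21]
  have f22 : ρ2.mem (22, 0) = w := by rw [hk2 22 (by decide), e22']
  have f23 : ρ2.mem (23, 0) = p.ed (2 ^ C.B n) A v w := by rw [hk2 23 (by decide), h23]
  have f27 : ρ2.mem (27, 0) = tblAcc (2 ^ C.K n) v (roundTbl C p A t w) n := by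
    rw [hk2 27 (by decide), hk1 27 (by decide), hI]
  refine WP.asg (x := ((t + 1) * n + v) * n + w) (v := roundTbl C p A (t + 1) v w)
    (by simp [f20, f21, f22, hR3.input.n_eq]) ?_ (by omega)
    (by have := cube_lt (show t + 1 ≤ n from ht) hv hw; omega)
    (h2K _ ((tbl_le hM _ _ _ _ _ _ _).trans hKle)) fun i => ?_
  · rw [RamExpr.val_rem, RamExpr.val_mul, RamExpr.val_add, f7]
    simp only [RamExpr.val_mul, RamExpr.val_add, RamExpr.val_sub, RamExpr.val_one,
        RamExpr.val_read, RamExpr.val_lit, f23, h24, f27, hR3.params.K, hR3.tw _ le_rfl]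
    rfl
  · rw [RamState.set_mem]
    simp only [true_and]
    refine if_congr Iff.rfl rfl ?_
    rw [hk2 8 (by decide), hk1 8 (by decide), e8]

theorem wp_tbl (hm : 40 ≤ ev.m) (hD : C.need n k ≤ ev.D) (hR : Ready C a n k col ω σ)
    (hL : L < C.J n) (hlab : Labelled (sieve C a n col ω S r L) (C.B n) A σ) :
    WP ev tblP σ fun τ => ∀ t ≤ n, ∀ v < n, ∀ w < n, τ.mem (8, (t * n + v) * n + w) =
      roundTbl C (sieve C a n col ω S r L) A t v w := by
  have hD' := hD
  unfold Consts.need at hD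
  have hΔ : 0 < 2 ^ C.Δ := by positivity
  have d0 : 0 < ev.D := by omega
  set T := roundTbl C (sieve C a n col ω S r L) A with hTdef
  refine WP.seq ?_
  -- Clearing layer 0 explicitly makes the result independent of what array 8 held before.
  refine WP.loop [8] rfl (n * n) (fun j ρ => ∀ i < j, ρ.mem (8, i) = 0)
    (by omega) d0 (by simp; omega) (lt_two_pow_of_le (by omega)) (by decide) ?_ (by simp) ?_ ?_ ?_
  · intro j ρ x h i hi
    rw [RamState.set_mem, if_neg (by simp), h i hi]
  · intro ρ hk
    simp [hk 0 (by decide), hR.input.n_eq]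
  · intro j hj ρ hI hj' hk
    refine WP.asg (x := j) (v := 0) (by simp [hj']) rfl (by omega) (by omega) (by positivity)
      fun i hi => ?_
    rw [RamState.set_mem]
    split_ifs with h
    · rfl
    · exact hI i (by omega)
  intro ρ hI hk
  have hR1 := hR.keep hk (by decide)
  have hlab1 := hlab.keep hk (by decide) (by decide)
  refine WP.loop [21, 22, 27, 36, 27, 23, 23, 23, 24, 24, 8] rfl n
    (fun t ρ => ∀ t' ≤ t, ∀ v < n, ∀ w < n, ρ.mem (8, (t' * n + v) * n + w) = T t' v w)
    (by omega) d0 (by simp; omega) (lt_two_pow_of_le (by omega)) (by decide) ?_ ?_ ?_ ?_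
    (fun ρ h _ => h)
  · intro j ρ x h t' ht' v hv w hw
    rw [RamState.set_mem, if_neg (by simp), h t' ht' v hv w hw]
  · intro t' ht' v hv w hw
    obtain rfl : t' = 0 := by omega
    rw [hI]
    · rfl
    · have h1 : v * n + w < n * n := by
        calc v * n + w < v * n + n := by omega
          _ = (v + 1) * n := by ring
          _ ≤ _ := Nat.mul_le_mul_right _ hv
      simpa using h1
  · intro ρ' hk'
    simp [hk' 0 (by decide), hR1.input.n_eq]
  intro t ht ρ1 hI1 h20 hk1
  have hR2 := hR1.keep hk1 (by decide)
  have hlab2 := hlab1.keep hk1 (by decide) (by decide)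
  refine WP.loop [22, 27, 36, 27, 23, 23, 23, 24, 24, 8] rfl n
    (fun v0 ρ => (∀ t' ≤ t, ∀ v < n, ∀ w < n, ρ.mem (8, (t' * n + v) * n + w) = T t' v w) ∧
      ∀ v < v0, ∀ w < n, ρ.mem (8, ((t + 1) * n + v) * n + w) = T (t + 1) v w)
    (by omega) d0 (by simp; omega) (lt_two_pow_of_le (by omega)) (by decide) ?_ ⟨hI1, by simp⟩ ?_ ?_
    ?_
  · intro j ρ x h
    exact ⟨fun t' ht' v hv w hw => by rw [RamState.set_mem, if_neg (by simp), h.1 t' ht' v hv w hw],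
      fun v hv w hw => by rw [RamState.set_mem, if_neg (by simp), h.2 v hv w hw]⟩
  · intro ρ' hk'
    simp [hk' 0 (by decide), hR2.input.n_eq]
  · intro v hv ρ2 hI2 h21 hk2
    have hR3 := hR2.keep hk2 (by decide)
    have hlab3 := hlab2.keep hk2 (by decide) (by decide)
    refine WP.loop [27, 36, 27, 23, 23, 23, 24, 24, 8] rfl n
      (fun w0 ρ => (∀ t' ≤ t, ∀ v < n, ∀ w < n, ρ.mem (8, (t' * n + v) * n + w) = T t' v w) ∧
        (∀ v' < v, ∀ w < n, ρ.mem (8, ((t + 1) * n + v') * n + w) = T (t + 1) v' w) ∧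
        ∀ w < w0, ρ.mem (8, ((t + 1) * n + v) * n + w) = T (t + 1) v w)
      (by omega) d0 (by simp; omega) (lt_two_pow_of_le (by omega)) (by decide) ?_
      ⟨hI2.1, hI2.2, by simp⟩ ?_ ?_ ?_
    · intro j ρ x h
      exact ⟨fun t' ht' v hv w hw => by
          rw [RamState.set_mem, if_neg (by simp), h.1 t' ht' v hv w hw],
        fun v hv w hw => by rw [RamState.set_mem, if_neg (by simp), h.2.1 v hv w hw],
        fun w hw => by rw [RamState.set_mem, if_neg (by simp), h.2.2 w hw]⟩
    · intro ρ' hk'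
      simp [hk' 0 (by decide), hR3.input.n_eq]
    · intro w hw ρ3 hI3 h22 hk3
      have hR4 := hR3.keep hk3 (by decide)
      have hlab4 := hlab3.keep hk3 (by decide) (by decide)
      refine (wp_entry hm hD' hR4 hL hlab4 ht hv hw
        (by rw [hk3 20 (by decide), hk2 20 (by decide), h20]) (by rw [hk3 21 (by decide), h21]) h22
        fun u hu => hI3.1 t le_rfl w hw u hu).mono fun τ hτ => ?_
      have key : ∀ {t' v' w'}, v' < n → w' < n → ((t' * n + v') * n + w' = ((t + 1) * n + v) * n + w ↔
          t' = t + 1 ∧ v' = v ∧ w' = w) := by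
        intro t' v' w' hv' hw'
        constructor
        · intro he
          obtain ⟨h1, h2⟩ := radix_unique hw' hw he
          obtain ⟨h3, h4⟩ := radix_unique hv' hv h1
          exact ⟨h3, h4, h2⟩
        · rintro ⟨rfl, rfl, rfl⟩; rfl
      refine ⟨fun t' ht' v' hv' w' hw' => ?_, fun v' hv' w' hw' => ?_, fun w' hw' => ?_⟩
      · rw [hτ, if_neg, hI3.1 t' ht' v' hv' w' hw']
        rw [key hv' hw']; omega
      · rw [hτ, if_neg, hI3.2.1 v' hv' w' hw']
        rw [key (by omega) hw']; omega
      · rw [hτ]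
        by_cases h : w' = w
        · subst h; rw [if_pos rfl]
        · rw [if_neg, hI3.2.2 w' (by omega)]
          rw [key hv (by omega)]; omega
    · intro ρ' h _
      refine ⟨h.1, fun v' hv' w' hw' => ?_⟩
      rcases Nat.lt_succ_iff_lt_or_eq.1 hv' with h1 | rfl
      · exact h.2.1 v' h1 w' hw'
      · exact h.2.2 w' hw'
  · intro ρ' h _ t' ht' v hv w hw
    rcases Nat.le_succ_iff.1 ht' with h1 | rfl
    · exact h.1 t' h1 v hv w hw
    · exact h.2 v hv w hw

theorem wp_tot (hm : 40 ≤ ev.m) (hD : C.need n k ≤ ev.D) (hR : Ready C a n k col ω σ)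
    (hL : L < C.J n) (hE : 2 ^ L ≤ ev.E) (hr : r < n) (h29 : σ.mem (29, 0) = r)
    (h30 : σ.mem (30, 0) = L)
    (h9 : ∀ v < n, σ.mem (9, v) = if (sieve C a n col ω S r L).V₁ v then 1 else 0) :
    WP ev totP σ fun τ => τ.mem (32, 0) = (sieve C a n col ω S r L).tot (C.B n) := by
  have hD' := hD
  have hJ := (C.J_le n).trans (C.W₃_le_K n)
  unfold Consts.need at hD
  have hΔ : 0 < 2 ^ C.Δ := by positivity
  have d0 : 0 < ev.D := by omega
  set p := sieve C a n col ω S r L with hp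
  set T := roundTbl C p with hTdef
  have hnK : n < 2 ^ C.K n := by
    refine lt_two_pow_of_le ?_
    have h1 := C.nW₃_le n
    have h2 := C.W₁_pos n
    have h3 := C.W₂_le n
    have h4 := C.W₃_le' n
    have : 0 < 2 ^ C.cb n := by positivity
    have : n + 1 ≤ (n + 1) * C.W₃ n := Nat.le_mul_of_pos_right _ (by omega)
    omega
  -- A term has at most 3K bits in its bound; the sums over c and over A each add K, and one more K
  -- covers the addition of both partial sums. Hence the bound 2 ^ (6K), within the 8K of `need`.
  have hterm : ∀ A c, p.nl (2 ^ C.B n) A r * T A n r c ≤ 2 ^ (3 * C.K n) := by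
    intro A c
    have h1 : p.nl (2 ^ C.B n) A r ≤ 2 ^ (2 * C.K n) := O_le C a n col ω S r hL.le A s(r, r)
    have h2 : T A n r c ≤ 2 ^ C.K n := tbl_le Nat.one_le_two_pow _ _ _ _ _ _ _
    calc _ ≤ 2 ^ (2 * C.K n) * 2 ^ C.K n := Nat.mul_le_mul h1 h2
      _ = _ := by rw [← pow_add]; congr 1; ring
  have hrow : ∀ A m, m ≤ n → ∑ c ∈ Finset.range m, p.nl (2 ^ C.B n) A r * T A n r c ≤
      2 ^ (4 * C.K n) := by
    intro A m hm
    refine (Finset.sum_le_card_nsmul _ _ _ fun c _ => hterm A c).trans ?_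
    rw [Finset.card_range, smul_eq_mul]
    calc _ ≤ 2 ^ C.K n * 2 ^ (3 * C.K n) := Nat.mul_le_mul_right _ (by omega)
      _ = _ := by rw [← pow_add]; congr 1; ring
  have hpart : ∀ A ≤ 2 ^ L, ∑ A' ∈ Finset.range A, ∑ c ∈ Finset.range n,
      p.nl (2 ^ C.B n) A' r * T A' n r c ≤ 2 ^ (5 * C.K n) := by
    intro A hA
    refine (Finset.sum_le_card_nsmul _ _ _ fun A' _ => hrow A' n le_rfl).trans ?_
    rw [Finset.card_range, smul_eq_mul]
    calc _ ≤ 2 ^ C.K n * 2 ^ (4 * C.K n) := Nat.mul_le_mul_right _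
          (hA.trans (Nat.pow_le_pow_right (by norm_num) (by omega)))
      _ = _ := by rw [← pow_add]; congr 1; ring
  have hbig : ∀ x, x ≤ 2 ^ (6 * C.K n) → x < 2 ^ ev.D := fun x hx =>
    hx.trans_lt (Nat.pow_lt_pow_right (by norm_num) (by omega))
  refine WP.seq (WP.asg (x := 0) (v := 0) rfl rfl (by omega) d0 (by positivity) ?_)
  -- This loop is the only one with exponentially many rounds. It keeps just a running sum, so the
  -- space remains polynomial.
  refine WP.loop ([21, 22, 27, 36, 27, 7] ++ ([20, 8, 20, 21, 22, 27, 36, 27, 23, 23, 23, 24, 24, 8] ++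
    [25, 32])) rfl (2 ^ L)
    (fun A ρ => ρ.mem (32, 0) = ∑ A' ∈ Finset.range A, ∑ c ∈ Finset.range n,
      p.nl (2 ^ C.B n) A' r * T A' n r c)
    (by omega) d0 hE (Nat.pow_lt_pow_right (by norm_num) (by omega)) (by decide) ?_ ?_ ?_ ?_ ?_
  · intro j ρ x h
    rw [RamState.set_mem, if_neg (by simp), h]
  · simp [RamState.set_mem]
  · intro ρ hk
    simp only [RamExpr.val_read, RamExpr.val_lit]
    rw [hk 30 (by decide), RamState.set_mem, if_neg (by simp), h30, hk 5 (by decide),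
      RamState.set_mem, if_neg (by simp), hR.tw _ (by omega)]
  · intro A hA ρ hI h31 hk
    have hk' : Keeps (32 :: 31 :: ([21, 22, 27, 36, 27, 7] ++
        ([20, 8, 20, 21, 22, 27, 36, 27, 23, 23, 23, 24, 24, 8] ++ [25, 32]))) σ ρ :=
      fun b hb i => by
        simp only [List.mem_cons, not_or] at hb
        rw [hk b (by simpa using hb.2) i]; simp [RamState.set_mem, hb.1]
    have hR1 := hR.keep hk' (by decide)
    refine WP.seq (((wp_lab (S := S) (r := r) hm hD' hR1 hL (by rw [hk' 30 (by decide), h30])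
      h31).frm _ rfl).mono fun ρ1 ⟨hl, hk1⟩ => ?_)
    have hR2 := hR1.keep hk1 (by decide)
    have hlab : Labelled p (C.B n) A ρ1 :=
      ⟨fun v hv => by rw [hk1 9 (by decide), hk' 9 (by decide)]; exact h9 v hv, hl⟩
    refine WP.seq (((wp_tbl hm hD' hR2 hL hlab).frm _ rfl).mono fun ρ2 ⟨ht, hk2⟩ => ?_)
    have hR3 := hR2.keep hk2 (by decide)
    have hlab2 := hlab.keep hk2 (by decide) (by decide)
    have e29 : ρ2.mem (29, 0) = r := by
      rw [hk2 29 (by decide), hk1 29 (by decide), hk' 29 (by decide), h29]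
    refine WP.loop [32] rfl n
      (fun m ρ' => ρ'.mem (32, 0) = ∑ A' ∈ Finset.range A, ∑ c ∈ Finset.range n,
        p.nl (2 ^ C.B n) A' r * T A' n r c +
        ∑ c ∈ Finset.range m, p.nl (2 ^ C.B n) A r * T A n r c)
      (by omega) d0 (by simp; omega) (lt_two_pow_of_le (by omega)) (by decide) ?_ ?_ ?_ ?_ ?_
    · intro j ρ x h
      rw [RamState.set_mem, if_neg (by simp), h]
    · rw [hk2 32 (by decide), hk1 32 (by decide), hI]; simp
    · intro ρ' hk''
      simp [hk'' 0 (by decide), hR3.input.n_eq]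
    · intro c hc ρ' hI' hc' hk''
      have hR4 := hR3.keep hk'' (by decide)
      have e1 : (RamExpr.mat 7 (.var 29) (.var 29)).val ρ'.mem = p.nl (2 ^ C.B n) A r := by
        simp only [RamExpr.val_read, RamExpr.val_add, RamExpr.val_mul, RamExpr.val_lit,
          hR4.input.n_eq, hk'' 29 (by decide), e29]
        exact (hlab2.keep hk'' (by decide) (by decide)).lab r hr r hr
      have e2 : (RamExpr.mat 8 (.var 0 * .var 0 + .var 29) (.var 25)).val ρ'.mem = T A n r c := by
        simp only [RamExpr.val_read, RamExpr.val_add, RamExpr.val_mul, RamExpr.val_lit,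
          hR4.input.n_eq, hk'' 29 (by decide), e29, hc', hk'' 8 (by decide)]
        exact ht n le_rfl r hr c hc
      refine WP.asg (x := 0) rfl (v := _) (by
        rw [RamExpr.val_add, RamExpr.val_mul, e1, e2, RamExpr.val_read, RamExpr.val_lit, hI'])
        (by omega) d0 (hbig _ ?_) ?_
      · have h1 := hpart A hA.le
        have h2 := hrow A (c + 1) hc
        rw [Finset.sum_range_succ] at h2
        have h3 : 2 ^ (4 * C.K n) ≤ 2 ^ (5 * C.K n) := Nat.pow_le_pow_right (by norm_num) (by omega)
        have h4 : 2 * 2 ^ (5 * C.K n) ≤ 2 ^ (6 * C.K n) := by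
          rw [← pow_succ']
          refine Nat.pow_le_pow_right (by norm_num) ?_
          have : 0 < C.K n := by
            have : 0 < 2 ^ C.K n := by positivity
            by_contra h0
            have : C.K n = 0 := by omega
            rw [this] at hnK; omega
          omega
        omega
      · rw [RamState.set_mem, if_pos ⟨rfl, rfl⟩, Finset.sum_range_succ]; ring
    · intro ρ' hI' _
      rw [hI', Finset.sum_range_succ]
  · intro ρ hI _
    rw [hI]
    rfl

end verification


/-! ### The whole algorithm -/

open BranchingWalk

namespace Program

/-- The algorithm. -/
def algorithm (C : Consts) : Cmd :=
  .seq (paramP C) <| .seq twP <| .seq wtP <| .seq reachP <| .seq connP <| .seq (colP C.Δ) <|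
  .seq (.asg 18 0 (1 - .var 10)) <| .seq (mainP C.Δ) <|
  .ite (.var 0) (.asg 0 0 ((1 - .var 19) * .var 18)) (.asg 0 0 0)

end Program

/-- The flag `18` has been set if `P` holds. -/
def Flagged (P : Prop) (σ ρ : RamState) : Prop :=
  (P → ρ.mem (18, 0) = 1) ∧ (¬ P → ρ.mem (18, 0) = σ.mem (18, 0))

theorem Flagged.refl (σ : RamState) : Flagged False σ σ := ⟨False.elim, fun _ => rfl⟩

theorem Flagged.congr {P Q : Prop} {σ ρ : RamState} (h : Flagged P σ ρ) (hPQ : P ↔ Q) :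
    Flagged Q σ ρ := by rwa [← propext hPQ]

theorem Flagged.of_eq {P : Prop} {σ ρ σ' ρ' : RamState} (h : Flagged P σ ρ)
    (h1 : σ'.mem (18, 0) = σ.mem (18, 0)) (h2 : ρ'.mem (18, 0) = ρ.mem (18, 0)) : Flagged P σ' ρ' := by
  unfold Flagged at *
  rwa [h1, h2]

theorem Flagged.step {Q : ℕ → Prop} {j : ℕ} {σ ρ τ : RamState} (h : Flagged (∃ i < j, Q i) σ ρ)
    (h' : Flagged (Q j) ρ τ) : Flagged (∃ i < j + 1, Q i) σ τ := by
  constructor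
  · rintro ⟨i, hi, hq⟩
    by_cases hj : Q j
    · exact h'.1 hj
    · rw [h'.2 hj]
      refine h.1 ⟨i, ?_, hq⟩
      rcases Nat.lt_succ_iff_lt_or_eq.1 hi with h1 | rfl
      · exact h1
      · exact absurd hq hj
  · intro hno
    rw [h'.2 fun hj => hno ⟨j, Nat.lt_succ_self j, hj⟩,
      h.2 fun ⟨i, hi, hq⟩ => hno ⟨i, Nat.lt_succ_of_lt hi, hq⟩]

section verification

variable {ev : Env} {σ : RamState} {C : Consts} {a : ℕ → ℕ → Prop} [DecidableRel a] {n k : ℕ}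
  {col : ℕ → ℕ} {ω : ℕ → Bool} {S r L : ℕ}

open Program

/-- The rule for loops that search. -/
theorem WP.search {x : ℕ} {e : RamExpr} {P : Cmd} (ws : List ℕ) (hws : P.wr = ws) (N : ℕ)
    (Q : ℕ → Prop) (hx : x < ev.m) (hN : N < ev.D) (hxP : x ∉ ws) (hx18 : x ≠ 18)
    (hval : ∀ ρ, Keeps (x :: ws) σ ρ → e.val ρ.mem = N)
    (hstep : ∀ j < N, ∀ ρ, ρ.mem (x, 0) = j → Keeps (x :: ws) σ ρ →
      WP ev P ρ (Flagged (Q j) ρ)) :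
    WP ev (.rep false x e P) σ (Flagged (∃ j < N, Q j) σ) := by
  refine WP.loop ws hws N (fun j ρ => Flagged (∃ i < j, Q i) σ ρ) hx (by omega) (by simp; omega)
    (lt_two_pow_of_le (by omega)) hxP ?_ ((Flagged.refl σ).congr (by simp)) hval ?_ (fun ρ h _ => h)
  · intro j ρ v h
    refine h.of_eq rfl ?_
    rw [RamState.set_mem, if_neg (fun h => hx18 h.1.symm)]
  · intro j hj ρ hI hxj hk
    exact (hstep j hj ρ hxj hk).mono fun τ hτ => hI.step hτ

/-- The coefficient of the given degrees is odd. -/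
def Hit (C : Consts) (p : SieveData) (kk N w : ℕ) : Prop :=
  p.tot (C.B p.n) / (2 ^ C.B p.n) ^ (N * p.W₃ + p.L * p.W₂ + kk * p.W₁ + w) % 2 = 1

theorem wp_scan (hm : 40 ≤ ev.m) (hD : C.need n k ≤ ev.D) (hR : Ready C a n k col ω σ)
    (hL : L < C.J n) (h30 : σ.mem (30, 0) = L)
    (h32 : σ.mem (32, 0) = (sieve C a n col ω S r L).tot (C.B n)) :
    WP ev scanP σ (Flagged (∃ N < n + 1, ∃ w < C.W₁ n,
      Hit C (sieve C a n col ω S r L) (Consts.kk n k) N w) σ) := by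
  have hW2 := C.W₂_le n
  have hW3 := C.W₃_le' n
  have hK := C.W₃_le_K n
  unfold Consts.need at hD
  have hΔ : 0 < 2 ^ C.Δ := by positivity
  classical
  refine WP.search [21, 18] rfl (n + 1) _ (by omega) (by omega) (by decide) (by decide) ?_ ?_
  · intro ρ hk
    simp [hk 0 (by decide), hR.input.n_eq]
  · intro N hN ρ h20 hk
    have hR1 := hR.keep hk (by decide)
    refine WP.flag (C.W₁ n)
      (fun w => Hit C (sieve C a n col ω S r L) (Consts.kk n k) N w)
      (by omega) (by omega) (by omega) (by omega) (by decide) ?_ ?_ ?_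
    · intro ρ' hk'
      simp [hk' 13 (by decide), hR1.params.W₁]
    · intro w hw ρ' hw' hk'
      have hR2 := hR1.keep hk' (by decide)
      have hexp : C.B n * (N * C.W₃ n + L * C.W₂ n + Consts.kk n k * C.W₁ n + w) ≤ C.K n :=
        Nat.mul_le_mul_left _ (exp_scan_lt C n (by omega) (by unfold Consts.kk; omega) hL hw).le
      simp only [RamExpr.val_rem, RamExpr.val_div, RamExpr.val_read, RamExpr.val_lit,
        RamExpr.val_mul, RamExpr.val_add, RamExpr.val_ofNat, hw', hR2.params.B, hR2.params.W₃,
        hR2.params.W₂, hR2.params.W₁, hR2.params.kk, hk' 20 (by decide), h20,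
        hk' 30 (by decide), hk 30 (by decide), h30, hk' 32 (by decide), hk 32 (by decide), h32,
        hR2.tw _ hexp]
      rw [pow_mul, Nat.mod_two_ne_zero]
      rfl
    · intro ρ' h _
      constructor
      · intro hP; rw [h, if_pos hP]
      · intro hP; rw [h, if_neg hP]

theorem wp_main (hm : 40 ≤ ev.m) (hD : C.need n k ≤ ev.D) (hE : 2 ^ C.Lmax n k ≤ ev.E)
    (hR : Ready C a n k col ω σ) (hcol : ∀ v, col v ≤ C.J n) :
    WP ev (mainP C.Δ) σ (Flagged (∃ S < 2 ^ C.Δ, ∃ r < n, ∃ L < C.Lmax n k + 1, ∃ N < n + 1,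
      ∃ w < C.W₁ n, Hit C (sieve C a n col ω S r L) (Consts.kk n k) N w) σ) := by
  have hLm := C.Lmax_lt n k
  have hD' := hD
  have hJ := (C.J_le n).trans (C.W₃_le_K n)
  unfold Consts.need at hD
  have hΔ : 0 < 2 ^ C.Δ := by positivity
  have d0 : 0 < ev.D := by omega
  set wt := [32, 31] ++ ([21, 22, 27, 36, 27, 7] ++
    ([20, 8, 20, 21, 22, 27, 36, 27, 23, 23, 23, 24, 24, 8] ++ [25, 32])) with hwt
  refine WP.search ([21, 9] ++ (29 :: 30 :: (wt ++ [20, 21, 18]))) rfl (2 ^ C.Δ) _ (by omega)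
    (by omega) (by decide) (by decide) (fun ρ _ => by simp) ?_
  intro S hS ρ h28 hk
  have hR1 := hR.keep hk (by decide)
  refine WP.seq (((wp_v1 hm hD' hR1 hcol h28).frm [21, 9] rfl).mono fun ρ1 ⟨h9, hk1⟩ => ?_)
  have hR2 := hR1.keep hk1 (by decide)
  refine WP.mono (WP.search (30 :: (wt ++ [20, 21, 18])) rfl n
    (fun r => ∃ L < C.Lmax n k + 1, ∃ N < n + 1,
      ∃ w < C.W₁ n, Hit C (sieve C a n col ω S r L) (Consts.kk n k) N w) (by omega) (by omega)
      (by decide) (by decide) ?_ ?_) fun τ hτ => hτ.of_eq (hk1 18 (by decide) 0).symm rfl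
  · intro ρ' hk'
    simp [hk' 0 (by decide), hR2.input.n_eq]
  intro r hr ρ2 h29 hk2
  have hR3 := hR2.keep hk2 (by decide)
  refine WP.search (wt ++ [20, 21, 18]) rfl (C.Lmax n k + 1) _ (by omega) (by omega) (by decide)
    (by decide) ?_ ?_
  · intro ρ' hk'
    simp [hk' 17 (by decide), hR3.params.Lmax]
  intro L hL ρ3 h30 hk3
  have hR4 := hR3.keep hk3 (by decide)
  have hLJ : L < C.J n := by omega
  refine WP.seq (((wp_tot (S := S) hm hD' hR4 hLJ
    ((Nat.pow_le_pow_right (by norm_num) (by omega)).trans hE) hr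
    (by rw [hk3 29 (by decide), h29]) h30 fun v hv => ?_).frm wt rfl).mono fun ρ4 ⟨h32, hk4⟩ => ?_)
  · rw [hk3 9 (by decide), hk2 9 (by decide), h9 v hv]; rfl
  · have hR5 := hR4.keep hk4 (by decide)
    exact (wp_scan hm hD' hR5 hLJ (by rw [hk4 30 (by decide), h30]) h32).mono fun τ hτ =>
      hτ.of_eq (hk4 18 (by decide) 0).symm rfl

/-- What the algorithm computes. -/
theorem wp_algorithm (hm : 40 ≤ ev.m) (hD : C.need n k ≤ ev.D) (hE : 2 ^ C.Lmax n k ≤ ev.E)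
    (hΔ : 1 ≤ C.Δ) (hc : C.Δ ≤ C.c₀) (hin : Input a n σ) (h1 : σ.mem (1, 0) = k)
    (h0 : ∀ b, 3 ≤ b → ∀ i, σ.mem (b, i) = 0) (ht : σ.tossed = 0) :
    WP ev (algorithm C) σ fun τ => τ.mem (0, 0) = 1 ↔ 0 < n ∧ (∀ v < n, reachM a n n v ≠ 0) ∧
      (k = 0 ∨ ∃ S < 2 ^ C.Δ, ∃ r < n, ∃ L < C.Lmax n k + 1, ∃ N < n + 1, ∃ w < C.W₁ n,
        Hit C (sieve C a n (colM a n C.Δ n) ev.ω S r L) (Consts.kk n k) N w) := by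
  have hD' := hD
  have hJ : C.c₀ ≤ C.J n := by unfold Consts.J; omega
  unfold Consts.need at hD
  have hΔ2 : 0 < 2 ^ C.Δ := by positivity
  have d0 : 0 < ev.D := by omega
  refine WP.seq ((((wp_param hm hD' hin.n_eq h1).tossed rfl).frm
    [10, 17, 11, 38, 12, 26, 20, 26, 12, 13, 14, 15, 16, 37] rfl).mono fun ρ1 ⟨⟨hp1, ht1⟩, hk1⟩ => ?_)
  refine WP.seq ((((wp_tw hm hD' hp1).tossed rfl).frm [5, 20, 5] rfl).mono
    fun ρ2 ⟨⟨htw, ht2⟩, hk2⟩ => ?_)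
  have hp2 := hp1.keep hk2 (by decide)
  refine WP.seq (((wp_wt hm hD' hp2 (by rw [ht2, ht1, ht])).frm [20, 27, 21, 35, 27, 6] rfl).mono
    fun ρ3 ⟨hwt, hk3⟩ => ?_)
  have hp3 := hp2.keep hk3 (by decide)
  have hin3 := ((hin.keep hk1 (by decide) (by decide)).keep hk2 (by decide) (by decide)).keep hk3
    (by decide) (by decide)
  have z3 : ∀ b ∉ [10, 17, 11, 38, 12, 26, 20, 26, 12, 13, 14, 15, 16, 37], b ∉ [5, 20, 5] →
      b ∉ [20, 27, 21, 35, 27, 6] → 3 ≤ b → ∀ i, ρ3.mem (b, i) = 0 := fun b g1 g2 g3 g4 i => by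
    rw [hk3 b g3, hk2 b g2, hk1 b g1, h0 b g4]
  refine WP.seq (((wp_reach hm (by omega) hin3
    (z3 3 (by decide) (by decide) (by decide) (by decide))).frm
    [3, 20, 21, 23, 22, 23, 3] rfl).mono fun ρ4 ⟨hr, hk4⟩ => ?_)
  have hin4 := hin3.keep hk4 (by decide) (by decide)
  refine WP.seq (((wp_conn hm (by omega) hin4 hr (by rw [hk4 19 (by decide),
    z3 19 (by decide) (by decide) (by decide) (by decide)])).frm [21, 19] rfl).mono
    fun ρ5 ⟨hc5, hk5⟩ => ?_)
  have hin5 := hin4.keep hk5 (by decide) (by decide)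
  refine WP.seq (((wp_col (Δ := C.Δ) hm (by omega) hΔ hin5
    (fun t ht v hv => by rw [hk5 3 (by decide), hr t ht v hv])
    (fun i => by rw [hk5 4 (by decide), hk4 4 (by decide),
      z3 4 (by decide) (by decide) (by decide) (by decide)])).frm
    [20, 21, 24, 25, 23, 22, 23, 24, 4] rfl).mono fun ρ6 ⟨hcol, hk6⟩ => ?_)
  have hp6 := ((hp3.keep hk4 (by decide)).keep hk5 (by decide)).keep hk6 (by decide)
  have hR6 : Ready C a n k (colM a n C.Δ n) ev.ω ρ6 :=
    ⟨hin5.keep hk6 (by decide) (by decide), hp6,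
      fun i hi => by rw [hk6 5 (by decide), hk5 5 (by decide), hk4 5 (by decide), hk3 5 (by decide),
        htw i hi],
      fun i hi => by rw [hk6 6 (by decide), hk5 6 (by decide), hk4 6 (by decide), hwt i hi], hcol⟩
  -- The flag starts as 1 exactly if k = 0, where connectedness alone decides; the sieve needs a
  -- tree with an inner node.
  refine WP.seq (WP.asg (x := 0) (v := 1 - Consts.kk n k) rfl (by simp [hp6.kk]) (by omega) d0
    (lt_two_pow_of_le (by omega)) ?_)
  have hk7 : Keeps [18] ρ6 (ρ6.set 18 0 (1 - Consts.kk n k)) := fun b hb i => by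
    simp only [List.mem_singleton] at hb; simp [RamState.set_mem, hb]
  refine WP.seq (((wp_main hm hD' hE (hR6.keep hk7 (by decide))
    fun v => (colM_le hΔ n v).trans (hc.trans hJ)).frm
    (28 :: ([21, 9] ++ (29 :: 30 :: (([32, 31] ++ ([21, 22, 27, 36, 27, 7] ++
      ([20, 8, 20, 21, 22, 27, 36, 27, 23, 23, 23, 24, 24, 8] ++ [25, 32]))) ++ [20, 21, 18]))))
    rfl).mono fun ρ8 ⟨hf, hk8⟩ => ?_)
  have e0 : ρ8.mem (0, 0) = n := by rw [hk8 0 (by decide), hk7 0 (by decide), hR6.input.n_eq]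
  have e19 : ρ8.mem (19, 0) = if ∃ v < n, reachM a n n v = 0 then 1 else 0 := by
    rw [hk8 19 (by decide), hk7 19 (by decide), hk6 19 (by decide), hc5]
  set P := ∃ S < 2 ^ C.Δ, ∃ r < n, ∃ L < C.Lmax n k + 1, ∃ N < n + 1, ∃ w < C.W₁ n,
        Hit C (sieve C a n (colM a n C.Δ n) ev.ω S r L) (Consts.kk n k) N w
  have e18 : (ρ8.mem (18, 0) = 1 ∧ (k = 0 ∨ P)) ∨ (ρ8.mem (18, 0) = 0 ∧ ¬ (k = 0 ∨ P)) := by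
    by_cases hP : P
    · exact .inl ⟨hf.1 hP, .inr hP⟩
    · have h2 := hf.2 hP
      rw [RamState.set_mem, if_pos ⟨rfl, rfl⟩] at h2
      by_cases hk0 : k = 0
      · exact .inl ⟨by rw [h2, hk0]; simp [Consts.kk], .inl hk0⟩
      · refine .inr ⟨?_, fun h => h.elim hk0 hP⟩
        rw [h2]; unfold Consts.kk; omega
  -- Cell 0 of array 0 still holds n and is overwritten by the answer only now. For n = 0 the answer
  -- is NO, as a tree has a vertex.
  refine WP.ite (fun h => ?_) fun h => ?_
  · have hn : 0 < n := by
      simp only [RamExpr.val_read, RamExpr.val_lit, e0] at h; omega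
    refine WP.asg (x := 0) (v := (1 - ρ8.mem (19, 0)) * ρ8.mem (18, 0)) rfl (by simp) (by omega) d0 ?_ ?_
    · refine lt_two_pow_of_le ?_
      have : (1 - ρ8.mem (19, 0)) * ρ8.mem (18, 0) ≤ 1 * 1 :=
        Nat.mul_le_mul (by omega) (by rcases e18 with h | h <;> omega)
      omega
    · rw [RamState.set_mem, if_pos ⟨rfl, rfl⟩, e19]
      by_cases hcon : ∃ v < n, reachM a n n v = 0
      · rw [if_pos hcon]
        obtain ⟨v, hv, hv0⟩ := hcon
        simp only [tsub_self, zero_mul, zero_ne_one, false_iff]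
        exact fun h => h.2.1 v hv hv0
      · rw [if_neg hcon]
        have hall : ∀ v < n, reachM a n n v ≠ 0 := fun v hv hz => hcon ⟨v, hv, hz⟩
        rcases e18 with ⟨e, hP⟩ | ⟨e, hP⟩
        · simp only [e, true_iff]; exact ⟨hn, hall, hP⟩
        · simp only [e, mul_zero, zero_ne_one, false_iff]; exact fun h => hP h.2.2
  · have hn : n = 0 := by simpa [e0] using h
    refine WP.asg (x := 0) (v := 0) rfl rfl (by omega) d0 (by positivity) ?_
    rw [RamState.set_mem, if_pos ⟨rfl, rfl⟩]
    simp [hn]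

end verification


/-! ### Correctness of the sieve -/

open BranchingWalk

section sieve

variable {C : Consts} {a : ℕ → ℕ → Prop} {n k : ℕ} {col : ℕ → ℕ} {ω : ℕ → Bool} {S r L N w : ℕ}

theorem sieve_fits (hirr : ∀ v, ¬ a v v) (hsymm : ∀ v w, a v w → a w v)
    (hlt : ∀ v w, a v w → w < n) (hL : L < C.J n) :
    (sieve C a n col ω S r L).Fits (2 ^ C.cb n) (C.B n) where
  irr := hirr
  symm := hsymm
  lt := hlt
  L_lt := hL
  wS_lt _ _ := bitsVal_lt _ _
  W₁_eq := rfl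
  W₂_eq := rfl
  W₃_eq := rfl
  B_eq := rfl

theorem Consts.kk_lt (n k : ℕ) : Consts.kk n k < n + 2 := by unfold Consts.kk; omega

/-- There are no false positives. -/
theorem Hit.exists_walk (hirr : ∀ v, ¬ a v v) (hsymm : ∀ v w, a v w → a w v)
    (hlt : ∀ v w, a v w → w < n) (hL : L < C.J n) (hN : N ≤ n) (hw : w < C.W₁ n)
    (h : Hit C (sieve C a n col ω S r L) (Consts.kk n k) N w) :
    ∃ Y, IsWalk a n r Y ∧ inn Y = k ∧
      (fobj (fun v => S.testBit (col v - 1)) r Y).Nodup ∧ Genuine r Y := by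
  have hp := sieve_fits (col := col) (ω := ω) (S := S) (r := r) hirr hsymm hlt hL
  have h1 := (SieveData.odd_tot_iff hp (N := N) hN (Consts.kk_lt n k) hw).1 h
  have h2 : ∃ Y ∈ (sieve C a n col ω S r L).good N (Consts.kk n k), True := by
    by_contra hno
    refine h1 ?_
    rw [Finset.sum_eq_zero]
    · simp
    · exact fun Y hY => absurd ⟨Y, hY, trivial⟩ hno
  obtain ⟨Y, hY, -⟩ := h2
  obtain ⟨⟨g1, g2⟩, ⟨-, -, g3⟩, g4, g5⟩ := (SieveData.mem_good hp).1 hY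
  refine ⟨Y, g1, ?_, g4, g5⟩
  -- A walk with at most n edges has at most n inner nodes, so the truncation of k to n + 1 has not
  -- taken place.
  have h3 : Consts.kk n k ≤ n := g3 ▸ (inn_le Y).trans g2
  unfold Consts.kk at g3 h3
  omega

/-- A tree with few labels is found with probability at least `1 / 2`. -/
theorem half_le_coinMeasure_hit (hirr : ∀ v, ¬ a v v) (hsymm : ∀ v w, a v w → a w v)
    (hlt : ∀ v w, a v w → w < n) (hL : L < C.J n) {Y : BinaryTree ℕ} (hY : IsWalk a n r Y)
    (hYn : Y.numNodes ≤ n) (hYk : inn Y = k)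
    (hYL : (fobj (fun v => S.testBit (col v - 1)) r Y).length = L)
    (hYd : (fobj (fun v => S.testBit (col v - 1)) r Y).Nodup) (hYg : Genuine r Y) :
    1 / 2 ≤ coinMeasure {ω | ∃ w < C.W₁ n,
      Hit C (sieve C a n col ω S r L) (Consts.kk n k) Y.numNodes w} := by
  have hp := fun ω => sieve_fits (col := col) (ω := ω) (S := S) (r := r) hirr hsymm hlt hL
  have hkk : Consts.kk n k = k := by
    have := inn_le Y
    unfold Consts.kk; omega
  let ω₀ : ℕ → Bool := fun _ => false
  let F := (sieve C a n col ω₀ S r L).fam Y.numNodes k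
  have hmem : Y ∈ (sieve C a n col ω₀ S r L).good Y.numNodes k :=
    (SieveData.mem_good (hp ω₀)).2 ⟨⟨hY, hYn⟩, ⟨rfl, hYL, hYk⟩, hYd, hYg⟩
  refine (coinMeasure_isolates (F := F) (SieveData.fam_nonempty (hp ω₀) hmem)
    (fun s hs => SieveData.fam_subset (hp ω₀) hs) (C.U_le n)).trans
    (MeasureTheory.measure_mono fun ω hω => ?_)
  -- The family of labelled trees does not involve the weights, so it is the same for `ω` as for
  -- `ω₀`. The isolation lemma requires a family fixed before the coins are tossed.
  have hω' : Isolates (coinWt ω (C.cb n)) ((sieve C a n col ω S r L).fam Y.numNodes k) := hω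
  obtain ⟨w, hw, hc⟩ := SieveData.exists_coeff_ne_zero (hp ω) (fun _ _ => rfl) hω'
  refine ⟨w, hw, ?_⟩
  rw [hkk]
  exact (SieveData.odd_tot_iff (hp ω) (N := Y.numNodes) (k := k) hYn
    (hkk ▸ Consts.kk_lt n k) hw).2 hc

end sieve


/-! ### Correctness of the search and of the colouring -/

section colouring

/-- The adjacency of `G` as a relation of natural numbers. -/
def natAdj {n : ℕ} (G : SimpleGraph (Fin n)) (v w : ℕ) : Prop :=
  ∃ (hv : v < n) (hw : w < n), G.Adj ⟨v, hv⟩ ⟨w, hw⟩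

variable {n : ℕ} {G : SimpleGraph (Fin n)}

theorem natAdj_val {v w : Fin n} : natAdj G v w ↔ G.Adj v w :=
  ⟨fun ⟨_, _, h⟩ => h, fun h => ⟨v.2, w.2, h⟩⟩

theorem natAdj_irrefl (v : ℕ) : ¬ natAdj G v v := fun ⟨_, _, h⟩ => h.ne rfl

theorem natAdj_symm (v w : ℕ) (h : natAdj G v w) : natAdj G w v :=
  let ⟨hv, hw, h⟩ := h; ⟨hw, hv, h.symm⟩

theorem natAdj_lt (v w : ℕ) (h : natAdj G v w) : w < n := h.2.1

theorem card_natAdj_le [DecidableRel (natAdj G)] {Δ : ℕ} (hG : MaxDegreeLE G Δ) (v : ℕ) :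
    ((Finset.range n).filter (natAdj G v)).card ≤ Δ := by
  by_cases hv : v < n
  · refine le_trans ?_ (hG ⟨v, hv⟩)
    rw [← Set.ncard_coe_finset, ← Set.ncard_image_of_injective _ Fin.val_injective]
    refine Set.ncard_le_ncard (fun w hw => ?_) (Set.toFinite _)
    obtain ⟨_, hw', h⟩ := (Finset.mem_filter.1 (Finset.mem_coe.1 hw)).2
    exact ⟨⟨w, hw'⟩, h, rfl⟩
  · rw [Finset.filter_false_of_mem fun w _ h => hv h.1]
    simp

variable [DecidableRel (natAdj G)]

theorem reachM_succ {t v : ℕ} : reachM (natAdj G) n (t + 1) v ≠ 0 ↔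
    (∃ u, natAdj G v u ∧ reachM (natAdj G) n t u ≠ 0) ∨ reachM (natAdj G) n t v ≠ 0 := by
  simp only [reachM]
  split_ifs with h
  · simp only [ne_eq, one_ne_zero, not_false_eq_true, true_iff]
    obtain ⟨u, -, h⟩ := h
    exact .inl ⟨u, h⟩
  · refine ⟨.inr, fun h' => h'.resolve_left fun ⟨u, hu⟩ => h ⟨u, hu.1.2.1, hu⟩⟩

theorem reachable_of_reachM (hn : 0 < n) {t v : ℕ} (h : reachM (natAdj G) n t v ≠ 0) (hv : v < n) :
    G.Reachable ⟨v, hv⟩ ⟨0, hn⟩ := by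
  induction t generalizing v with
  | zero =>
    have : v = 0 := by simpa [reachM] using h
    subst this
    rfl
  | succ t ih =>
    rcases reachM_succ.1 h with ⟨u, ⟨_, hu, h1⟩, h2⟩ | h2
    · exact h1.reachable.trans (ih h2 hu)
    · exact ih h2 hv

theorem reachM_of_walk (hn : 0 < n) {v w : Fin n} (p : G.Walk v w) (hw : w = ⟨0, hn⟩) :
    reachM (natAdj G) n p.length v ≠ 0 := by
  induction p with
  | nil => simp [hw, reachM]
  | cons h p ih => exact reachM_succ.2 (.inl ⟨_, natAdj_val.2 h, ih hw⟩)

/-- A path has fewer than n edges, so n steps of the search suffice. -/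
theorem connected_iff_reachM (hn : 0 < n) :
    G.Connected ↔ ∀ v < n, reachM (natAdj G) n n v ≠ 0 := by
  constructor
  · intro h v hv
    obtain ⟨p, hp⟩ := h.exists_isPath ⟨v, hv⟩ ⟨0, hn⟩
    have h1 := hp.length_lt
    rw [Fintype.card_fin] at h1
    exact reachM_mono h1.le (reachM_of_walk hn p rfl)
  · intro h
    refine (SimpleGraph.connected_iff _).2 ⟨fun v w => ?_, ⟨⟨0, hn⟩⟩⟩
    exact (reachable_of_reachM hn (h v v.2) v.2).trans (reachable_of_reachM hn (h w w.2) w.2).symm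

theorem pickM_spec {col : ℕ → ℕ} {v d : ℕ}
    (h : ∃ c, 1 ≤ c ∧ c ≤ d ∧ ∀ u, natAdj G v u → col u ≠ c) :
    pickM (natAdj G) n col v d ≠ 0 ∧ ∀ u, natAdj G v u → col u ≠ pickM (natAdj G) n col v d := by
  induction d with
  | zero => obtain ⟨c, h1, h2, -⟩ := h; omega
  | succ d ih =>
    simp only [pickM]
    split_ifs with hu
    · obtain ⟨u, -, h1, h2⟩ := hu
      obtain ⟨c, k1, k2, k3⟩ := h
      refine ih ⟨c, k1, ?_, k3⟩
      have := k3 u h1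
      omega
    · exact ⟨by omega, fun u h1 h2 => hu ⟨u, h1.2.1, h1, h2⟩⟩

/-- If all of 1, …, Δ occurred next to `v`, then together with the 0 of the uncoloured neighbour
there would be Δ + 1 different values on at most Δ neighbours. -/
theorem exists_colour {Δ : ℕ} (hG : MaxDegreeLE G Δ) {col : ℕ → ℕ} {v : ℕ}
    (h : ∃ u, natAdj G v u ∧ col u = 0) :
    ∃ c, 1 ≤ c ∧ c ≤ Δ ∧ ∀ u, natAdj G v u → col u ≠ c := by
  by_contra! hno
  obtain ⟨u, hu, h0⟩ := h
  have hsub : insert 0 (Finset.Icc 1 Δ) ⊆ ((Finset.range n).filter (natAdj G v)).image col := by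
    intro c hc
    rw [Finset.mem_image]
    rcases Finset.mem_insert.1 hc with rfl | hc
    · exact ⟨u, by simpa using ⟨hu.2.1, hu⟩, h0⟩
    · obtain ⟨w, h1, h2⟩ := hno c (Finset.mem_Icc.1 hc).1 (Finset.mem_Icc.1 hc).2
      exact ⟨w, by simpa using ⟨h1.2.1, h1⟩, h2⟩
  have h1 := Finset.card_le_card hsub
  rw [Finset.card_insert_of_notMem (by simp), Nat.card_Icc] at h1
  have h2 := h1.trans (Finset.card_image_le.trans (card_natAdj_le hG v))
  omega

/-- The state of the colouring: the vertices that are not reached in `t + 1` steps, and those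
below `m` not reached in `t` steps, have been coloured. -/
structure IsColouring (G : SimpleGraph (Fin n)) [DecidableRel (natAdj G)] (t m : ℕ) (col : ℕ → ℕ) :
    Prop where
  dom : ∀ x < n, col x ≠ 0 ↔ reachM (natAdj G) n (t + 1) x = 0 ∨
    (x < m ∧ reachM (natAdj G) n t x = 0)
  proper : ∀ x y, natAdj G x y → col x ≠ 0 → col x ≠ col y

/-- A vertex first reached in t + 1 steps has a neighbour reached in t steps. That neighbour is not
yet coloured, as colouring proceeds towards 0, so a colour is free. -/
theorem isColouring_colV {Δ : ℕ} (hG : MaxDegreeLE G Δ) {t : ℕ} {col : ℕ → ℕ}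
    (h : IsColouring G t 0 col) {m : ℕ} (hm : m ≤ n) :
    IsColouring G t m (colV (natAdj G) n Δ t col m) := by
  induction m with
  | zero => exact h
  | succ m ih =>
    have hI := ih (by omega)
    simp only [colV]
    split_ifs with hc
    · obtain ⟨u, hu, hu'⟩ := (reachM_succ.1 hc.1).resolve_right (by simpa using hc.2)
      have hu0 : colV (natAdj G) n Δ t col m u = 0 := by
        by_contra hne
        rcases (hI.dom u hu.2.1).1 hne with h1 | ⟨-, h1⟩
        · exact reachM_mono (Nat.le_succ t) hu' h1
        · exact hu' h1
      obtain ⟨p1, p2⟩ := pickM_spec (exists_colour hG ⟨u, hu, hu0⟩)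
      constructor
      · intro x hx
        rw [Function.update_apply]
        split_ifs with hxm
        · subst hxm
          simp only [p1, ne_eq, not_false_eq_true, true_iff]
          exact .inr ⟨by omega, hc.2⟩
        · rw [hI.dom x hx]
          have : x < m + 1 ↔ x < m := by omega
          rw [this]
      · intro x y hxy h0
        have hne : x ≠ y := fun e => natAdj_irrefl (G := G) y (e ▸ hxy)
        simp only [Function.update_apply] at h0 ⊢
        split_ifs at h0 ⊢ with e1 e2 e2
        · exact absurd (e1.trans e2.symm) hne
        · subst e1; exact (p2 y hxy).symm
        · subst e2; exact p2 x (natAdj_symm _ _ hxy)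
        · exact hI.proper x y hxy h0
    · refine ⟨fun x hx => ?_, hI.proper⟩
      rw [hI.dom x hx]
      constructor
      · rintro (h1 | ⟨h1, h2⟩)
        exacts [.inl h1, .inr ⟨by omega, h2⟩]
      · rintro (h1 | ⟨h1, h2⟩)
        · exact .inl h1
        · rcases Nat.lt_succ_iff_lt_or_eq.1 h1 with h3 | rfl
          · exact .inr ⟨h3, h2⟩
          · left
            by_contra h3
            exact hc ⟨h3, h2⟩

theorem isColouring_colM {Δ : ℕ} (hG : MaxDegreeLE G Δ)
    (hc : ∀ v < n, reachM (natAdj G) n n v ≠ 0) {s : ℕ} (hs : s ≤ n) :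
    (∀ x < n, colM (natAdj G) n Δ s x ≠ 0 ↔ reachM (natAdj G) n (n - s) x = 0) ∧
      ∀ x y, natAdj G x y → colM (natAdj G) n Δ s x ≠ 0 →
        colM (natAdj G) n Δ s x ≠ colM (natAdj G) n Δ s y := by
  induction s with
  | zero => exact ⟨fun x hx => by simpa [colM] using hc x hx, fun x y _ h => absurd rfl h⟩
  | succ s ih =>
    obtain ⟨h1, h2⟩ := ih (by omega)
    have he : n - (s + 1) + 1 = n - s := by omega
    have h0 : IsColouring G (n - (s + 1)) 0 (colM (natAdj G) n Δ s) :=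
      ⟨fun x hx => by rw [h1 x hx, he]; simp, h2⟩
    have h3 := isColouring_colV hG h0 le_rfl
    refine ⟨fun x hx => (h3.dom x hx).trans ⟨?_, fun h => .inr ⟨hx, h⟩⟩, h3.proper⟩
    rintro (h4 | ⟨-, h4⟩)
    · by_contra h5
      exact reachM_mono (Nat.le_succ _) h5 h4
    · exact h4

/-- Vertex 0 is never coloured and keeps the value 0, which truncated subtraction merges with the
class of colour 1. Hence 0 has to be excluded. -/
theorem colM_ne {Δ : ℕ} (hG : MaxDegreeLE G Δ) (hc : ∀ v < n, reachM (natAdj G) n n v ≠ 0)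
    {x y : ℕ} (h : natAdj G x y) (hx : x ≠ 0) (hy : y ≠ 0) :
    colM (natAdj G) n Δ n x - 1 ≠ colM (natAdj G) n Δ n y - 1 := by
  obtain ⟨h1, h2⟩ := isColouring_colM hG hc le_rfl
  have hx' : colM (natAdj G) n Δ n x ≠ 0 := (h1 x h.1).2 (by simp [reachM, hx])
  have hy' : colM (natAdj G) n Δ n y ≠ 0 := (h1 y h.2.1).2 (by simp [reachM, hy])
  have := h2 x y h hx'
  omega

end colouring


/-! ### Spanning trees from branching walks -/

section soundness

open BranchingWalk

/-- Every vertex of a cycle has an edge, so it lies in the range of `f`, where the image is an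
isomorphic copy of `G`. -/
theorem SimpleGraph.IsAcyclic.map {V V' : Type*} {G : SimpleGraph V} (h : G.IsAcyclic) (f : V ↪ V') :
    (G.map f).IsAcyclic := by
  have hr : ∀ x y, (G.map f).Adj x y → x ∈ Set.range f := by
    rintro x y ⟨-, u, v, -, rfl, rfl⟩
    exact ⟨u, rfl⟩
  have hI : ((G.map f).induce (Set.range f)).IsAcyclic :=
    (SimpleGraph.Embedding.map f G).isoInduceRange.isAcyclic_iff.1 h
  intro v c hc
  have hs : ∀ x ∈ c.support, x ∈ Set.range f := by
    intro x hx
    obtain ⟨y, hy⟩ : ∃ y, (G.map f).Adj x y := by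
      obtain ⟨e, he, hxe⟩ := (SimpleGraph.Walk.mem_support_iff_exists_mem_edges_of_not_nil hc.not_nil).1 hx
      induction e using Sym2.ind with
      | _ u w =>
        have := c.adj_of_mem_edges he
        rcases Sym2.mem_iff.1 hxe with rfl | rfl
        exacts [⟨_, this⟩, ⟨_, this.symm⟩]
    exact hr x y hy
  have hc' := hc
  rw [← c.map_induce hs] at hc'
  exact hI _ ((SimpleGraph.Walk.isCycle_map_iff_of_injective
    (SimpleGraph.Embedding.induce (G := G.map f) (Set.range f)).injective).1 hc')

/-- A genuine walk embeds its tree of nodes into G. An acyclic subgraph of a connected graph extends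
to a spanning tree, and degrees only grow, so inner nodes remain internal. -/
theorem hasInternalSpanningTree_of_walk {n r : ℕ} {G : SimpleGraph (Fin n)} (hG : G.Connected)
    {V₁ : ℕ → Bool} {X : BinaryTree ℕ} (h : IsWalk (natAdj G) n r X) (hn : (fobj V₁ r X).Nodup)
    (hg : Genuine r X) : HasInternalSpanningTree G (inn X) := by
  classical
  obtain ⟨hnd, hS⟩ := h.isSys natAdj_irrefl natAdj_symm hn
  set S := (fblk r X).toFinset with hSdef
  have hne : ∀ b ∈ S, b.2.Nonempty := fun b hb => h.nonempty_fblk (List.mem_toFinset.1 hb)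
  have hlt : ∀ b ∈ S, b.1 < n := by
    intro b hb
    obtain ⟨w, hw⟩ := hne b hb
    exact (hS.adj b.1 b.2 hb w hw).1
  let f : S ↪ Fin n := ⟨fun b => ⟨b.1.1, hlt b.1 b.2⟩, fun b b' he =>
    Subtype.ext (hg _ (List.mem_toFinset.1 b.2) _ (List.mem_toFinset.1 b'.2) (by simpa using he))⟩
  have hle : (lnkGraph S).map f ≤ G := by
    rintro x y ⟨-, b, b', hb, rfl, rfl⟩
    exact natAdj_val.1 (hS.adj b.1.1 b.1.2 b.2 _ hb.2.2.2.1)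
  obtain ⟨T, hT1, hT2, hT⟩ := hG.exists_isTree_le_of_le_of_isAcyclic hle
    ((hS.isTree natAdj_irrefl).2.map f)
  refine ⟨T, hT2, hT, ?_⟩
  rw [h.inn_eq, countP_eq_card_filter hnd rfl, ← hSdef]
  have hsub : (((S.filter fun b => b.2.card ≠ 1).image Prod.fst : Finset ℕ) : Set ℕ) ⊆
      Fin.val '' {v | 2 ≤ (T.neighborSet v).ncard} := by
    intro v hv
    obtain ⟨b, hb, rfl⟩ := Finset.mem_image.1 (Finset.mem_coe.1 hv)
    obtain ⟨hb, hc⟩ := Finset.mem_filter.1 hb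
    refine ⟨f ⟨b, hb⟩, ?_, rfl⟩
    have h2 : 2 ≤ b.2.card := by
      have := (hne b hb).card_pos
      omega
    refine h2.trans ?_
    rw [← Set.ncard_coe_finset, ← Set.ncard_image_of_injective _ Fin.val_injective]
    refine Set.ncard_le_ncard (fun w hw => ?_) (Set.toFinite _)
    obtain ⟨M, hM, hbM⟩ := hS.symm b.1 b.2 hb w hw
    have hL : Lnk S b (w, M) := ⟨hb, hM, hw, hbM⟩
    refine ⟨f ⟨(w, M), hM⟩, ?_, rfl⟩
    refine hT1 ((SimpleGraph.map_adj_apply (f := f)).2 ⟨fun he => ?_, hL⟩)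
    exact hS.ne_of_lnk natAdj_irrefl hL (congrArg (fun z : S => z.1.1) he)
  have h1 := Set.ncard_le_ncard hsub (Set.toFinite _)
  rw [Set.ncard_coe_finset, Set.ncard_image_of_injective _ Fin.val_injective,
    Finset.card_image_of_injOn] at h1
  · simpa using h1
  · intro b hb b' hb' he
    exact hg _ (List.mem_toFinset.1 (Finset.mem_filter.1 hb).1) _
      (List.mem_toFinset.1 (Finset.mem_filter.1 hb').1) he

end soundness


/-! ### Pruning trees -/

section pruning

open SimpleGraph Finset

theorem degree_induce_compl {V : Type*} [Fintype V] [DecidableEq V] {T : SimpleGraph V}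
    [DecidableRel T.Adj] (x : V) (v : ({x}ᶜ : Set V)) [Fintype ((T.induce {x}ᶜ).neighborSet v)] :
    (T.induce {x}ᶜ).degree v = ((T.neighborFinset v).erase x).card := by
  rw [← card_neighborFinset_eq_degree, ← card_image_of_injective _ Subtype.val_injective]
  congr 1
  ext w
  simp only [mem_image, mem_neighborFinset, mem_erase, comap_adj]
  constructor
  · rintro ⟨w, hw, rfl⟩
    exact ⟨w.2, hw⟩
  · rintro ⟨hw, h⟩
    exact ⟨⟨w, hw⟩, h, rfl⟩

open Classical in
/-- A tree with at least `k` internal vertices contains one with exactly `k` internal vertices,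
where moreover the neighbours of leaves have degree `2`. -/
theorem exists_pruned {V : Type} [Fintype V] {T : SimpleGraph V} (hT : T.IsTree) {k : ℕ}
    (hk : k ≤ #{v | 2 ≤ T.degree v}) :
    ∃ (W : Type) (_ : Fintype W) (T' : SimpleGraph W) (_ : T' ↪g T), T'.IsTree ∧
      #{v | 2 ≤ T'.degree v} = k ∧ ∀ x y, T'.Adj x y → T'.degree x = 1 → T'.degree y = 2 := by
  induction hN : Fintype.card V using Nat.strong_induction_on generalizing V with
  | _ N ih =>
    by_cases hgood : #{v | 2 ≤ T.degree v} = k ∧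
        ∀ x y, T.Adj x y → T.degree x = 1 → T.degree y = 2
    · exact ⟨V, inferInstance, T, Embedding.refl, hT, hgood⟩
    -- A leaf `x` can be deleted safely in both cases that remain. Only its neighbour may cease to
    -- be internal, and only if that has degree 2. With more than k internal vertices one loss is
    -- affordable; with exactly k, a leaf whose neighbour has degree different from 2 causes none.
    have hx : ∃ x, T.degree x = 1 ∧
        k ≤ #{v | 2 ≤ T.degree v ∧ ¬ (T.Adj x v ∧ T.degree v = 2)} := by
      by_cases h1 : #{v | 2 ≤ T.degree v} = k
      · have h2 : ∃ x y, T.Adj x y ∧ T.degree x = 1 ∧ T.degree y ≠ 2 := by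
          by_contra hno
          push Not at hno
          exact hgood ⟨h1, hno⟩
        obtain ⟨x, y, hxy, hx, hy⟩ := h2
        obtain ⟨y', -, hy'⟩ := degree_eq_one_iff_existsUnique_adj.1 hx
        refine ⟨x, hx, hk.trans (card_le_card fun v hv => ?_)⟩
        simp only [mem_filter, mem_univ, true_and] at hv ⊢
        refine ⟨hv, fun h => hy ?_⟩
        rw [hy' y hxy, ← hy' v h.1, h.2]
      · have h2 : k < #{v | 2 ≤ T.degree v} := lt_of_le_of_ne hk (Ne.symm h1)
        obtain ⟨v, hv⟩ := card_pos.1 (by omega : 0 < #{v | 2 ≤ T.degree v})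
        have hv2 : 2 ≤ T.degree v := by simpa using hv
        obtain ⟨w, hw⟩ := (T.degree_pos_iff_exists_adj v).1 (by omega)
        have : Nontrivial V := ⟨v, w, hw.ne⟩
        obtain ⟨x, hx⟩ := hT.exists_vert_degree_one_of_nontrivial
        obtain ⟨y, -, hy⟩ := degree_eq_one_iff_existsUnique_adj.1 hx
        refine ⟨x, hx, ?_⟩
        have h3 : k ≤ #((univ.filter fun v => 2 ≤ T.degree v).erase y) := by
          have := pred_card_le_card_erase (s := univ.filter fun v => 2 ≤ T.degree v) (a := y)
          omega
        refine h3.trans (card_le_card fun v hv => ?_)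
        simp only [mem_erase, mem_filter, mem_univ, true_and] at hv ⊢
        exact ⟨hv.2, fun h => hv.1 (hy v h.1)⟩
    obtain ⟨x, hx, hkx⟩ := hx
    have hT' : (T.induce {x}ᶜ).IsTree :=
      ⟨hT.1.induce_compl_singleton_of_degree_eq_one hx, hT.2.induce _⟩
    have hc : Fintype.card ({x}ᶜ : Set V) < N := by
      rw [← hN]
      exact Fintype.card_subtype_lt (x := x) (by simp)
    have hk' : k ≤ #{v | 2 ≤ (T.induce {x}ᶜ).degree v} := by
      refine hkx.trans ?_
      rw [← card_image_of_injective (univ.filter fun v => 2 ≤ (T.induce {x}ᶜ).degree v)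
        Subtype.val_injective]
      refine card_le_card fun v hv => ?_
      obtain ⟨h2, h3⟩ := by simpa using hv
      have hvx : v ≠ x := by rintro rfl; omega
      refine mem_image.2 ⟨⟨v, hvx⟩, ?_, rfl⟩
      simp only [mem_filter, mem_univ, true_and]
      rw [degree_induce_compl]
      by_cases hxv : T.Adj x v
      · have h4 := pred_card_le_card_erase (s := T.neighborFinset v) (a := x)
        rw [card_neighborFinset_eq_degree] at h4
        have := h3 hxv
        simp only
        omega
      · rw [erase_eq_of_notMem, card_neighborFinset_eq_degree]
        · exact h2
        · rw [mem_neighborFinset]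
          exact fun h => hxv h.symm
    obtain ⟨W, iW, T', φ, h⟩ := ih _ hc hT' hk' rfl
    exact ⟨W, iW, T', φ.trans (Embedding.induce _), h⟩

/-- A set of vertices that is closed under adjacency contains everything that is reachable. -/
theorem SimpleGraph.Reachable.mem_of_closed {V : Type*} {T : SimpleGraph V} {v w : V}
    (h : T.Reachable v w) {s : Set V} (hs : ∀ x ∈ s, ∀ y, T.Adj x y → y ∈ s) (hv : v ∈ s) :
    w ∈ s := by
  obtain ⟨p⟩ := h
  induction p with
  | nil => exact hv
  | cons h p ih => exact ih (hs _ hv _ h)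

variable {W : Type*} [Fintype W] {T : SimpleGraph W} [DecidableRel T.Adj]

theorem one_le_degree (hT : T.IsTree) (h2 : ∃ v, 2 ≤ T.degree v) (v : W) : 1 ≤ T.degree v := by
  obtain ⟨u, hu⟩ := h2
  obtain ⟨w, hw⟩ := (T.degree_pos_iff_exists_adj u).1 (by omega)
  have : Nontrivial W := ⟨u, w, hw.ne⟩
  exact hT.1.preconnected.degree_pos_of_nontrivial v

theorem card_leaves_add (hT : T.IsTree) (h2 : ∃ v, 2 ≤ T.degree v) :
    #{v | T.degree v = 1} + #{v | 2 ≤ T.degree v} = Fintype.card W := by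
  rw [← card_univ, ← card_filter_add_card_filter_not (s := univ) (fun v => T.degree v = 1)]
  congr 2
  ext v
  have := one_le_degree hT h2 v
  simp only [mem_filter, mem_univ, true_and]
  omega

/-- There are few leaves if the neighbours of leaves have degree `2`. -/
theorem card_leaves_le (hT : T.IsTree) (h2 : ∃ v, 2 ≤ T.degree v)
    (hl : ∀ x y, T.Adj x y → T.degree x = 1 → T.degree y = 2) {Δ : ℕ} (hΔ : 2 ≤ Δ)
    (hd : ∀ v, T.degree v ≤ Δ) :
    (Δ - 1) * #{v | T.degree v = 1} ≤ (Δ - 2) * #{v | 2 ≤ T.degree v} + Δ := by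
  classical
  have hk : 1 ≤ #{v | 2 ≤ T.degree v} := by
    obtain ⟨v, hv⟩ := h2
    exact card_pos.2 ⟨v, by simpa using hv⟩
  have hnb : ∀ x, T.degree x = 1 → ∃ y, T.Adj x y := fun x hx =>
    (T.degree_pos_iff_exists_adj x).1 (by omega)
  choose! nb hnb using hnb
  -- Mapping a leaf to its neighbour is injective unless two leaves share a neighbour of degree 2,
  -- and then the tree is a path on three vertices.
  by_cases hinj : ∀ x x', T.degree x = 1 → T.degree x' = 1 → nb x = nb x' → x = x'
  · have h1 : #{v | T.degree v = 1} ≤ #{v | T.degree v = 2} := by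
      refine card_le_card_of_injOn nb (fun x hx => ?_) (fun x hx x' hx' he => ?_)
      · have hx : T.degree x = 1 := by simpa using hx
        simpa using hl _ _ (hnb x hx) hx
      · exact hinj x x' (by simpa using hx) (by simpa using hx') he
    have h3 := T.sum_degrees_eq_twice_card_edges
    have h4 := hT.card_edgeFinset
    have h5 := card_leaves_add hT h2
    rw [← sum_filter_add_sum_filter_not univ (fun v => T.degree v = 1)] at h3
    have h6 : ∑ v ∈ univ.filter (fun v => T.degree v = 1), T.degree v = #{v | T.degree v = 1} := by
      rw [sum_congr rfl fun v hv => (mem_filter.1 hv).2]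
      simp
    -- An internal vertex has degree at most Δ, and one of degree 2 falls short of this by Δ - 2. As
    -- there are at least as many vertices of degree 2 as leaves, the sum of the degrees bounds the
    -- leaves.
    have h7 : ∑ v ∈ univ.filter (fun v => ¬ T.degree v = 1), T.degree v +
        (Δ - 2) * #{v | T.degree v = 2} ≤ Δ * #{v | 2 ≤ T.degree v} := by
      have e1 : (univ.filter fun v => ¬ T.degree v = 1) = univ.filter fun v => 2 ≤ T.degree v := by
        ext v
        have := one_le_degree hT h2 v
        simp only [mem_filter, mem_univ, true_and]
        omega
      have e2 : #{v | T.degree v = 2} =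
          ∑ v ∈ univ.filter (fun v => 2 ≤ T.degree v), if T.degree v = 2 then 1 else 0 := by
        rw [← card_filter, filter_filter]
        congr 1
        ext v
        simp only [mem_filter, mem_univ, true_and]
        omega
      rw [e1, e2, mul_sum, ← sum_add_distrib, mul_comm, ← smul_eq_mul, ← sum_const]
      refine sum_le_sum fun v _ => ?_
      have := hd v
      split_ifs <;> omega
    obtain ⟨d, rfl⟩ := Nat.exists_eq_add_of_le hΔ
    have e1 : 2 + d - 2 = d := by omega
    have e2 : 2 + d - 1 = d + 1 := by omega
    rw [e1] at h7 ⊢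
    rw [e2]
    have := Nat.mul_le_mul_left d h1
    have e3 : (2 + d) * #{v | 2 ≤ T.degree v} = 2 * #{v | 2 ≤ T.degree v} +
      d * #{v | 2 ≤ T.degree v} := by ring
    have e4 : (d + 1) * #{v | T.degree v = 1} = d * #{v | T.degree v = 1} + #{v | T.degree v = 1} := by
      ring
    omega
  · push Not at hinj
    obtain ⟨x, x', hx, hx', he, hne⟩ := hinj
    have hy := hl _ _ (hnb x hx) hx
    have hyN : ({x, x'} : Finset W) = T.neighborFinset (nb x) := by
      refine eq_of_subset_of_card_le ?_ ?_
      · intro z hz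
        rw [mem_neighborFinset]
        rcases mem_insert.1 hz with rfl | hz
        · exact (hnb _ hx).symm
        · rw [mem_singleton.1 hz, he]
          exact (hnb _ hx').symm
      · rw [card_neighborFinset_eq_degree, hy, card_pair hne]
    have hall : ∀ w, w ∈ ({x, x', nb x} : Set W) := by
      intro w
      refine (hT.1.preconnected (nb x) w).mem_of_closed ?_ (by simp)
      intro u hu v huv
      have huniq : ∀ z, T.degree z = 1 → T.Adj z v → v = nb z := fun z hz hv =>
        (degree_eq_one_iff_existsUnique_adj.1 hz).unique hv (hnb z hz)
      rcases hu with rfl | rfl | rfl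
      · simp [huniq _ hx huv]
      · simp [huniq _ hx' huv, he]
      · have : v ∈ T.neighborFinset (nb x) := by rwa [mem_neighborFinset]
        rw [← hyN] at this
        rcases mem_insert.1 this with rfl | h
        · simp
        · simp [mem_singleton.1 h]
    have h3 : #{v | T.degree v = 1} ≤ 2 := by
      rw [← card_pair hne]
      refine card_le_card fun w hw => ?_
      have hw1 : T.degree w = 1 := by simpa using hw
      rcases hall w with rfl | rfl | rfl
      · simp
      · simp
      · omega
    -- With two leaves and one internal vertex the inequality is an equality; the additive Δ stems
    -- from this case.
    have h4 := Nat.mul_le_mul_left (Δ - 1) h3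
    have h5 := Nat.le_mul_of_pos_right (Δ - 2) hk
    omega

end pruning


/-! ### Branching walks from trees -/

section completeness

open SimpleGraph Finset BranchingWalk Relation

variable {W : Type} [Fintype W] {T : SimpleGraph W} [DecidableRel T.Adj] {f : W → ℕ}

/-- The vertices of a tree, each with its neighbours. -/
def nodesOf (T : SimpleGraph W) [DecidableRel T.Adj] (f : W → ℕ) : Finset (ℕ × Finset ℕ) :=
  univ.image fun w => (f w, (T.neighborFinset w).image f)

theorem nodesOf_injective (hf : Function.Injective f) :
    Function.Injective fun w => (f w, (T.neighborFinset w).image f) := fun _ _ h =>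
  hf (congrArg Prod.fst h)

theorem mem_nodesOf {v : ℕ} {N : Finset ℕ} :
    (v, N) ∈ nodesOf T f ↔ ∃ w, f w = v ∧ (T.neighborFinset w).image f = N := by
  simp [nodesOf]

theorem eq_of_mem_nodesOf (hf : Function.Injective f) {v : ℕ} {N N' : Finset ℕ}
    (h : (v, N) ∈ nodesOf T f) (h' : (v, N') ∈ nodesOf T f) : N = N' := by
  obtain ⟨w, rfl, rfl⟩ := mem_nodesOf.1 h
  obtain ⟨w', he, rfl⟩ := mem_nodesOf.1 h'
  rw [hf he]

theorem isSys_nodesOf (hT : T.IsTree) (hf : Function.Injective f) {a : ℕ → ℕ → Prop}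
    (ha : ∀ u v, T.Adj u v → a (f u) (f v)) {ρ : W} (hρ : T.degree ρ = 1) (V₁ : ℕ → Bool) :
    IsSys a V₁ (f ρ) (nodesOf T f) where
  adj v N h w hw := by
    obtain ⟨u, rfl, rfl⟩ := mem_nodesOf.1 h
    obtain ⟨x, hx, rfl⟩ := mem_image.1 hw
    exact ha u x ((mem_neighborFinset _ _ _).1 hx)
  uniq v N N' h h' _ _ _ := eq_of_mem_nodesOf hf h h'
  symm v N h w hw := by
    obtain ⟨u, rfl, rfl⟩ := mem_nodesOf.1 h
    obtain ⟨x, hx, rfl⟩ := mem_image.1 hw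
    refine ⟨_, mem_nodesOf.2 ⟨x, rfl, rfl⟩, mem_image_of_mem f ?_⟩
    rw [mem_neighborFinset] at hx ⊢
    exact hx.symm
  root := by
    obtain ⟨c, hc⟩ := card_eq_one.1 hρ
    exact ⟨f c, mem_nodesOf.2 ⟨ρ, rfl, by rw [hc, image_singleton]⟩⟩
  leaf v x y h h' := by simpa using eq_of_mem_nodesOf hf h h'
  one v N N' _ h h' := eq_of_mem_nodesOf hf h h'
  conn := by
    rintro ⟨v, N⟩ h ⟨v', N'⟩ h'
    obtain ⟨u, rfl, rfl⟩ := mem_nodesOf.1 h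
    obtain ⟨u', rfl, rfl⟩ := mem_nodesOf.1 h'
    obtain ⟨p⟩ := hT.1.preconnected u u'
    clear h h'
    induction p with
    | nil => exact .refl
    | cons hadj p ih =>
      refine .head ⟨mem_nodesOf.2 ⟨_, rfl, rfl⟩, mem_nodesOf.2 ⟨_, rfl, rfl⟩,
        mem_image_of_mem f ?_, mem_image_of_mem f ?_⟩ ih
      · rw [mem_neighborFinset]; exact hadj
      · rw [mem_neighborFinset]; exact hadj.symm
  card := by
    rw [nodesOf, sum_image (nodesOf_injective hf).injOn, card_image_of_injective _
      (nodesOf_injective hf), card_univ, ← hT.card_edgeFinset]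
    have h := T.sum_degrees_eq_twice_card_edges
    have : ∑ w, ((T.neighborFinset w).image f).card = ∑ w, T.degree w :=
      sum_congr rfl fun w _ => card_image_of_injective _ hf
    simp only [this, h]
    omega

open Classical in
/-- The number of labels of a tree. -/
noncomputable def labels (T : SimpleGraph W) [DecidableRel T.Adj] (V₁ : W → Bool) : ℕ :=
  #{w | V₁ w = true ∨ T.degree w = 1} + #{e ∈ T.edgeFinset | ∀ w ∈ e, V₁ w = false}

/-- The nodes of the tree form a system for every V₁, so one and the same walk serves all V₁ and may
be chosen before averaging over V₁. -/
theorem exists_walk_of_tree (hT : T.IsTree) (hf : Function.Injective f) {a : ℕ → ℕ → Prop} {n : ℕ}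
    (hirr : ∀ v, ¬ a v v) (hlt : ∀ v w, a v w → w < n)
    (ha : ∀ u v, T.Adj u v → a (f u) (f v)) {ρ : W} (hρ : T.degree ρ = 1) :
    ∃ X, IsWalk a n (f ρ) X ∧ X.numNodes + 1 = Fintype.card W ∧ inn X = #{w | T.degree w ≠ 1} ∧
      Genuine (f ρ) X ∧ ∀ V₁ : ℕ → Bool, (fobj V₁ (f ρ) X).Nodup ∧
        (fobj V₁ (f ρ) X).length ≤ labels T fun w => V₁ (f w) := by
  classical
  obtain ⟨X, hX, hn, hS⟩ :=
    (isSys_nodesOf hT hf ha hρ fun _ => false).exists_isWalk hirr hlt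
  have hmem : ∀ b, b ∈ fblk (f ρ) X ↔ b ∈ nodesOf T f := fun b => by rw [← hS, List.mem_toFinset]
  refine ⟨X, hX, ?_, ?_, ?_, fun V₁ => ?_⟩
  · have h1 := List.toFinset_card_of_nodup hn
    rw [hS, nodesOf, card_image_of_injective _ (nodesOf_injective hf), card_univ, fblk,
      List.length_cons, length_blk] at h1
    exact h1.symm
  · rw [hX.inn_eq, countP_eq_card_filter hn hS, nodesOf, filter_image,
      card_image_of_injective _ (nodesOf_injective hf)]
    simp only [card_image_of_injective _ hf, card_neighborFinset_eq_degree]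
  · rintro ⟨v, N⟩ hb ⟨v', N'⟩ hb' (rfl : v = v')
    rw [eq_of_mem_nodesOf hf ((hmem _).1 hb) ((hmem _).1 hb')]
  · have hnd := hX.fobj_nodup (V₁ := V₁) hirr (isSys_nodesOf hT hf ha hρ V₁) hn hS
    refine ⟨hnd, ?_⟩
    rw [← List.toFinset_card_of_nodup hnd]
    have hsub : (fobj V₁ (f ρ) X).toFinset ⊆
        (univ.filter fun w => V₁ (f w) = true ∨ T.degree w = 1).image (fun w => s(f w, f w)) ∪
        (T.edgeFinset.filter fun e => ∀ w ∈ e, V₁ (f w) = false).image (Sym2.map f) := by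
      intro q hq
      rw [List.mem_toFinset, ← List.count_pos_iff] at hq
      rw [mem_union, mem_image, mem_image]
      induction q using Sym2.ind with
      | _ v v' =>
        by_cases hv : v = v'
        · subst hv
          rw [← hX.count_diag hirr, List.countP_pos_iff] at hq
          obtain ⟨⟨u, N⟩, hb, hq⟩ := hq
          obtain ⟨w, rfl, rfl⟩ := mem_nodesOf.1 ((hmem _).1 hb)
          rw [card_image_of_injective _ hf, card_neighborFinset_eq_degree, decide_eq_true_eq] at hq
          obtain ⟨rfl, hq⟩ := hq
          exact .inl ⟨w, by simpa using hq, rfl⟩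
        · rw [hX.count_obj hv] at hq
          split_ifs at hq with h1
          · rw [List.count_pos_iff, hX.mem_edg_iff hirr] at hq
            obtain ⟨⟨u, N⟩, hb, rfl, hw⟩ := hq
            obtain ⟨w, rfl, rfl⟩ := mem_nodesOf.1 ((hmem _).1 hb)
            obtain ⟨x, hx, rfl⟩ := mem_image.1 hw
            refine .inr ⟨s(w, x), ?_, rfl⟩
            rw [mem_filter, mem_edgeFinset, mem_edgeSet]
            rw [mem_neighborFinset] at hx
            refine ⟨hx, fun y hy => ?_⟩
            rcases Sym2.mem_iff.1 hy with rfl | rfl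
            exacts [h1.1, h1.2]
          · omega
    refine (card_le_card hsub).trans ((card_union_le _ _).trans ?_)
    exact Nat.add_le_add card_image_le card_image_le

end completeness


/-! ### Averaging over sets of colours -/

section averaging

open SimpleGraph Finset

theorem testBit_sum_two_pow (s : Finset ℕ) (i : ℕ) : (∑ j ∈ s, 2 ^ j).testBit i = true ↔ i ∈ s := by
  rw [← Nat.mem_bitIndices, ← List.mem_toFinset, toFinset_bitIndices_sum_two_pow]

theorem filter_notMem_powersetCard {x i : ℕ} {t : Finset ℕ} :
    (powersetCard x t).filter (fun s => i ∉ s) = powersetCard x (t.erase i) := by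
  ext s
  simp only [mem_filter, mem_powersetCard, subset_erase]
  tauto

theorem card_notMem {Δ x i : ℕ} (hi : i < Δ) :
    #{s ∈ powersetCard x (range Δ) | i ∉ s} * Δ = (Δ - x) * Δ.choose x := by
  rw [filter_notMem_powersetCard, card_powersetCard, card_erase_of_mem (mem_range.2 hi), card_range]
  obtain ⟨d, rfl⟩ := Nat.exists_eq_succ_of_ne_zero (by omega : Δ ≠ 0)
  rw [Nat.succ_sub_one, Nat.succ_eq_add_one, Nat.choose_mul_succ_eq, mul_comm]

theorem card_mem {Δ x i : ℕ} (hi : i < Δ) (hx : x ≤ Δ) :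
    #{s ∈ powersetCard x (range Δ) | i ∈ s} * Δ = x * Δ.choose x := by
  have h1 := card_notMem (x := x) hi
  have h2 := card_filter_add_card_filter_not (s := powersetCard x (range Δ)) (fun s => i ∈ s)
  rw [card_powersetCard, card_range] at h2
  obtain ⟨d, rfl⟩ := Nat.exists_eq_add_of_le hx
  rw [Nat.add_sub_cancel_left] at h1
  rw [← h2, mul_add] at h1 ⊢
  nlinarith

/-- Two applications of the identity that relates the binomial coefficients of d and d + 1 over x.
-/
theorem card_notMem_notMem {Δ x i j : ℕ} (hi : i < Δ) (hj : j < Δ) (hij : i ≠ j) :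
    #{s ∈ powersetCard x (range Δ) | i ∉ s ∧ j ∉ s} * (Δ * (Δ - 1)) =
      (Δ - x) * (Δ - x - 1) * Δ.choose x := by
  rw [← filter_filter, filter_notMem_powersetCard, filter_notMem_powersetCard, card_powersetCard,
    card_erase_of_mem (mem_erase.2 ⟨hij.symm, mem_range.2 hj⟩), card_erase_of_mem (mem_range.2 hi),
    card_range]
  obtain ⟨d, rfl⟩ := Nat.exists_eq_add_of_le (show 2 ≤ Δ by omega)
  have e1 : 2 + d - 1 - 1 = d := by omega
  have e2 : 2 + d - 1 = d + 1 := by omega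
  have e3 : 2 + d - x - 1 = d + 1 - x := by omega
  have e4 : d + 1 + 1 = 2 + d := by omega
  have h1 := Nat.choose_mul_succ_eq d x
  have h2 := Nat.choose_mul_succ_eq (d + 1) x
  rw [e4] at h2
  rw [e1, e2, e3]
  calc d.choose x * ((2 + d) * (d + 1)) = d.choose x * (d + 1) * (2 + d) := by ring
    _ = (d + 1).choose x * (2 + d) * (d + 1 - x) := by rw [h1]; ring
    _ = _ := by rw [h2]; ring

variable {W : Type} [Fintype W] {T : SimpleGraph W} [DecidableRel T.Adj]

open Classical in
/-- Some set of `x` colours leads to few labels. -/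
theorem exists_labels_le {Δ x : ℕ} (hx : x ≤ Δ) {c : W → ℕ}
    (hc : ∀ w, c w < Δ) (hbad : #{e ∈ T.edgeFinset | ∃ i, ∀ w ∈ e, c w = i} ≤ Δ) :
    ∃ s ∈ powersetCard x (range Δ), Δ * (Δ - 1) * labels T (fun w => decide (c w ∈ s)) ≤
      Fintype.card W * (x * (Δ - 1)) + #{w | T.degree w = 1} * ((Δ - x) * (Δ - 1)) +
        #T.edgeFinset * ((Δ - x) * (Δ - x - 1)) + Δ * (Δ * (Δ - 1)) := by
  set P := powersetCard x (range Δ) with hP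
  have hPc : #P = Δ.choose x := by rw [hP, card_powersetCard, card_range]
  have hne : P.Nonempty := by
    rw [← card_pos, hPc]
    exact Nat.choose_pos hx
  refine exists_le_of_sum_le hne ?_
  rw [sum_const, smul_eq_mul, hPc, ← mul_sum]
  -- A labelled vertex has its colour in s or is a leaf with colour outside s. The monochromatic
  -- edges, at most Δ, are charged for every s; the others avoid V₁ if two different colours lie
  -- outside s.
  have hlab : ∀ s : Finset ℕ, labels T (fun w => decide (c w ∈ s)) ≤
      ∑ w, (if c w ∈ s then 1 else 0) +
      ∑ w ∈ univ.filter (fun w => T.degree w = 1), (if c w ∉ s then 1 else 0) +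
      (∑ e ∈ T.edgeFinset.filter (fun e => ¬ ∃ i, ∀ w ∈ e, c w = i),
        (if ∀ w ∈ e, c w ∉ s then 1 else 0) + Δ) := by
    intro s
    refine Nat.add_le_add ?_ ?_
    · rw [← card_filter, ← card_filter]
      refine (card_le_card fun w hw => ?_).trans (card_union_le _ _)
      simp only [mem_filter, mem_univ, true_and, decide_eq_true_eq, mem_union] at hw ⊢
      tauto
    · rw [← card_filter]
      refine le_trans (card_le_card fun e he => ?_)
        ((card_union_le _ _).trans (Nat.add_le_add_left hbad _))
      simp only [mem_filter, mem_union, decide_eq_false_iff_not] at he ⊢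
      tauto
  have h0 := sum_le_sum fun s (_ : s ∈ P) => hlab s
  rw [sum_add_distrib, sum_add_distrib, sum_add_distrib, sum_comm, sum_comm (s := P),
    sum_comm (s := P), sum_const, hPc, smul_eq_mul] at h0
  simp only [← card_filter] at h0
  have e1 : (∑ w, #{s ∈ P | c w ∈ s}) * Δ = Fintype.card W * (x * Δ.choose x) := by
    rw [sum_mul, sum_congr rfl fun w _ => card_mem (hc w) hx]
    simp
  have e2 : (∑ w ∈ univ.filter (fun w => T.degree w = 1), #{s ∈ P | c w ∉ s}) * Δ =
      #{w | T.degree w = 1} * ((Δ - x) * Δ.choose x) := by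
    rw [sum_mul, sum_congr rfl fun w _ => card_notMem (hc w)]
    simp
  have e3 : (∑ e ∈ T.edgeFinset.filter (fun e => ¬ ∃ i, ∀ w ∈ e, c w = i),
      #{s ∈ P | ∀ w ∈ e, c w ∉ s}) * (Δ * (Δ - 1)) ≤
      #T.edgeFinset * ((Δ - x) * (Δ - x - 1) * Δ.choose x) := by
    rw [sum_mul]
    have : ∀ e ∈ T.edgeFinset.filter (fun e => ¬ ∃ i, ∀ w ∈ e, c w = i),
        #{s ∈ P | ∀ w ∈ e, c w ∉ s} * (Δ * (Δ - 1)) = (Δ - x) * (Δ - x - 1) * Δ.choose x := by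
      intro e he
      obtain ⟨-, he⟩ := mem_filter.1 he
      induction e using Sym2.ind with
      | _ u v =>
        rw [← card_notMem_notMem (hc u) (hc v) fun h => he ⟨c u, by simp [h]⟩]
        simp only [Sym2.mem_iff, forall_eq_or_imp, forall_eq, hP]
    rw [sum_congr rfl this, sum_const, smul_eq_mul]
    exact Nat.mul_le_mul_right _ (card_filter_le _ _)
  calc Δ * (Δ - 1) * ∑ s ∈ P, labels T (fun w => decide (c w ∈ s))
      ≤ Δ * (Δ - 1) * _ := Nat.mul_le_mul_left _ h0
    _ = ((∑ w, #{s ∈ P | c w ∈ s}) * Δ) * (Δ - 1) +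
        ((∑ w ∈ univ.filter (fun w => T.degree w = 1), #{s ∈ P | c w ∉ s}) * Δ) * (Δ - 1) +
        ((∑ e ∈ T.edgeFinset.filter (fun e => ¬ ∃ i, ∀ w ∈ e, c w = i),
          #{s ∈ P | ∀ w ∈ e, c w ∉ s}) * (Δ * (Δ - 1)) + Δ.choose x * Δ * (Δ * (Δ - 1))) := by ring
    _ ≤ _ := Nat.add_le_add_left (Nat.add_le_add_right e3 _) _
    _ = _ := by rw [e1, e2]; ring

end averaging


/-! ### Existence of a tree with few labels -/

section existence

open SimpleGraph Finset BranchingWalk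

/-- `Δ * (Δ - 1)` times the average number of labels per vertex. -/
def avgVertex (Δ x : ℕ) : ℕ := x * (Δ - 1) + (Δ - x) * (Δ - x - 1)

/-- `Δ * (Δ - 1)` times the average number of further labels per leaf. -/
def avgLeaf (Δ x : ℕ) : ℕ := (Δ - x) * (Δ - 1)

/-- The constants of the algorithm. -/
def treeConsts (Δ x : ℕ) : Consts where
  Δ := Δ
  p₁ := (Δ - 1) * avgVertex Δ x + (Δ - 2) * (avgVertex Δ x + avgLeaf Δ x)
  d₁ := Δ * (Δ - 1) * (Δ - 1)
  p₂ := (2 * Δ - 3) * avgVertex Δ x + (Δ - 2) * avgLeaf Δ x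
  d₂ := Δ * (Δ - 1) * (2 * Δ - 3)
  c₀ := Δ + 4

/-- Inserting the bound for leaves, once relative to k and once relative to N = k + l, gives the two
quotients. In `c₀` the Δ pays for the monochromatic edges, and the 4 for the additive Δ in the bound
for leaves, which costs at most 2Δ / (Δ - 1). -/
theorem labels_le_Lmax {Δ x : ℕ} (hΔ : 2 ≤ Δ) (hx : x ≤ Δ) {N l k n lab : ℕ} (hN : N = k + l)
    (hNn : N ≤ n) (hl : (Δ - 1) * l ≤ (Δ - 2) * k + Δ)
    (hlab : Δ * (Δ - 1) * lab ≤ N * avgVertex Δ x + l * avgLeaf Δ x + Δ * (Δ * (Δ - 1))) :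
    lab ≤ (treeConsts Δ x).Lmax n k := by
  have hA : avgVertex Δ x ≤ Δ * (Δ - 1) := by
    obtain ⟨y, rfl⟩ := Nat.exists_eq_add_of_le hx
    rw [avgVertex, Nat.add_sub_cancel_left, add_mul]
    exact Nat.add_le_add_left (Nat.mul_le_mul_left _ (by omega)) _
  have hB : avgLeaf Δ x ≤ Δ * (Δ - 1) := Nat.mul_le_mul_right _ (Nat.sub_le _ _)
  have hkk : Consts.kk n k = k := by unfold Consts.kk; omega
  rw [Consts.Lmax, hkk, treeConsts]
  simp only
  generalize avgVertex Δ x = A at *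
  generalize avgLeaf Δ x = B at *
  obtain ⟨d, rfl⟩ := Nat.exists_eq_add_of_le hΔ
  have e1 : 2 + d - 2 = d := by omega
  have e2 : 2 + d - 1 = d + 1 := by omega
  have e3 : 2 * (2 + d) - 3 = 2 * d + 1 := by omega
  rw [e2] at hA hB hlab
  rw [e1, e2] at hl
  rw [e1, e2]
  rw [e3]
  set D := (2 + d) * (d + 1) with hD
  have hD0 : 0 < D := by positivity
  subst hN
  rw [← tsub_le_iff_right]
  refine le_min ?_ ?_
  · rw [Nat.le_div_iff_mul_le (by positivity), tsub_mul, tsub_le_iff_right]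
    have h1 := Nat.mul_le_mul_left (d + 1) hlab
    have h2 := Nat.mul_le_mul_right (A + B) hl
    have h3 := Nat.mul_le_mul_left (d + 2) (Nat.add_le_add hA hB)
    have h4 : 0 ≤ d * D := Nat.zero_le _
    linarith
  · rw [Nat.le_div_iff_mul_le (by positivity), tsub_mul, tsub_le_iff_right]
    have h0 : (2 * d + 1) * l ≤ d * (k + l) + (2 + d) := by linarith
    have h1 := Nat.mul_le_mul_left (2 * d + 1) hlab
    have h2 := Nat.mul_le_mul_right B h0
    have h3 := Nat.mul_le_mul_left (d + 2) hB
    have h4 : 0 ≤ d * D := Nat.zero_le _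
    have h5 := Nat.mul_le_mul_left ((2 * d + 1) * A + d * B) hNn
    linarith

theorem HasInternalSpanningTree.connected {n k : ℕ} {G : SimpleGraph (Fin n)}
    (h : HasInternalSpanningTree G k) : G.Connected :=
  let ⟨_, hle, hT, _⟩ := h; hT.1.mono hle

/-- Completeness: the pruned tree is rooted at one of its leaves and V₁ consists of the colour
classes found by averaging, coded in binary by S. -/
theorem exists_walk_of_hasInternalSpanningTree {Δ x n k : ℕ} (hΔ : 2 ≤ Δ) (hx : x ≤ Δ)
    {G : SimpleGraph (Fin n)} (hG : MaxDegreeLE G Δ) (hk : 1 ≤ k)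
    (h : HasInternalSpanningTree G k) {col : ℕ → ℕ} (hcol : ∀ v, col v ≤ Δ)
    (hproper : ∀ u v, natAdj G u v → u ≠ 0 → v ≠ 0 → col u - 1 ≠ col v - 1) :
    ∃ S < 2 ^ Δ, ∃ r < n, ∃ Y, IsWalk (natAdj G) n r Y ∧ Y.numNodes ≤ n ∧ inn Y = k ∧
      (fobj (fun v => S.testBit (col v - 1)) r Y).length ≤ (treeConsts Δ x).Lmax n k ∧
      (fobj (fun v => S.testBit (col v - 1)) r Y).Nodup ∧ Genuine r Y := by
  classical
  obtain ⟨T, hTG, hT, hkT⟩ := h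
  have hncard : ∀ v, (T.neighborSet v).ncard = T.degree v := fun v => by
    rw [← card_neighborFinset_eq_degree, ← Set.ncard_coe_finset, coe_neighborFinset]
  have hk' : k ≤ #{v | 2 ≤ T.degree v} := by
    refine hkT.trans_eq ?_
    rw [← Set.ncard_coe_finset]
    congr 1
    ext v
    simp [hncard]
  obtain ⟨W, iW, T', φ, hT', hk'', hl⟩ := exists_pruned hT hk'
  let f : W → ℕ := fun w => φ w
  have hf : Function.Injective f := Fin.val_injective.comp φ.injective
  have ha : ∀ u v, T'.Adj u v → natAdj G (f u) (f v) := fun u v huv =>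
    natAdj_val.2 (hTG (φ.map_adj_iff.2 huv))
  have h2 : ∃ v, 2 ≤ T'.degree v := by
    obtain ⟨v, hv⟩ := card_pos.1 (by omega : 0 < #{v | 2 ≤ T'.degree v})
    exact ⟨v, by simpa using hv⟩
  have hd : ∀ v, T'.degree v ≤ Δ := by
    intro v
    refine le_trans ?_ (hG (φ v))
    rw [← card_neighborFinset_eq_degree, ← card_image_of_injective _ φ.injective,
      ← Set.ncard_coe_finset]
    refine Set.ncard_le_ncard (fun w hw => ?_) (Set.toFinite _)
    obtain ⟨u, hu, rfl⟩ := mem_image.1 (mem_coe.1 hw)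
    exact hTG (φ.map_adj_iff.2 ((mem_neighborFinset _ _ _).1 hu))
  obtain ⟨ρ, hρ⟩ : ∃ ρ, T'.degree ρ = 1 := by
    obtain ⟨u, hu⟩ := h2
    obtain ⟨w, hw⟩ := (T'.degree_pos_iff_exists_adj u).1 (by omega)
    have : Nontrivial W := ⟨u, w, hw.ne⟩
    exact hT'.exists_vert_degree_one_of_nontrivial
  obtain ⟨X, hX, hXn, hXi, hXg, hXV⟩ :=
    exists_walk_of_tree (n := n) hT' hf natAdj_irrefl natAdj_lt ha hρ
  have hWn : Fintype.card W ≤ n := by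
    simpa using Fintype.card_le_of_injective _ φ.injective
  let c : W → ℕ := fun w => col (f w) - 1
  have hc : ∀ w, c w < Δ := fun w => by
    have := hcol (f w)
    simp only [c]; omega
  -- The colouring is proper away from vertex 0, so monochromatic edges are incident with 0, whose
  -- degree is at most Δ.
  have hbad : #{e ∈ T'.edgeFinset | ∃ i, ∀ w ∈ e, c w = i} ≤ Δ := by
    have key : ∀ e ∈ T'.edgeFinset.filter (fun e => ∃ i, ∀ w ∈ e, c w = i), ∃ w ∈ e, f w = 0 := by
      intro e he
      obtain ⟨he, i, hi⟩ := mem_filter.1 he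
      induction e using Sym2.ind with
      | _ u v =>
        by_contra hno
        push Not at hno
        rw [mem_edgeFinset, mem_edgeSet] at he
        refine hproper _ _ (ha u v he) (hno u (by simp)) (hno v (by simp)) ?_
        exact (hi u (by simp)).trans (hi v (by simp)).symm
    by_cases hw : ∃ w₀, f w₀ = 0
    · obtain ⟨w₀, hw₀⟩ := hw
      refine le_trans (card_le_card fun e he => ?_) ((T'.card_incidenceFinset_eq_degree w₀).trans_le
        (hd w₀))
      obtain ⟨w, hwe, hw⟩ := key e he
      rw [mem_incidenceFinset, ← hf (hw.trans hw₀.symm)]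
      exact ⟨mem_edgeFinset.1 (mem_filter.1 he).1, hwe⟩
    · rw [filter_eq_empty_iff.2 fun e he hi => ?_]
      · simp
      · obtain ⟨w, -, h0⟩ := key e (mem_filter.2 ⟨he, hi⟩)
        exact hw ⟨w, h0⟩
  obtain ⟨s, hs, hlab⟩ := exists_labels_le hx hc hbad
  obtain ⟨hs1, -⟩ := mem_powersetCard.1 hs
  have hNeq := card_leaves_add hT' h2
  refine ⟨∑ j ∈ s, 2 ^ j, Nat.geomSum_lt le_rfl fun j hj => mem_range.1 (hs1 hj), f ρ, (φ ρ).2, X, hX,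
    by omega, ?_, ?_, (hXV _).1, hXg⟩
  · rw [hXi, ← hk'']
    congr 1
    ext v
    have := one_le_degree hT' h2 v
    simp only [mem_filter, mem_univ, true_and]
    omega
  · refine (hXV _).2.trans ?_
    have e1 : (fun w => (∑ j ∈ s, 2 ^ j).testBit (col (f w) - 1)) = fun w => decide (c w ∈ s) := by
      funext w
      rw [Bool.eq_iff_iff, testBit_sum_two_pow, decide_eq_true_eq]
    rw [e1]
    have hE := hT'.card_edgeFinset
    have hle := card_leaves_le hT' h2 hl hΔ hd
    rw [hk''] at hle hNeq
    refine labels_le_Lmax hΔ hx (N := Fintype.card W) (by omega) hWn hle (hlab.trans ?_)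
    rw [avgVertex, avgLeaf, mul_add (Fintype.card W)]
    have := Nat.mul_le_mul_right ((Δ - x) * (Δ - x - 1)) (show #T'.edgeFinset ≤ Fintype.card W by omega)
    omega

end existence


/-! ### The exponents -/

section exponents

/-- The construction works for every integer x between 0 and Δ. The exponents are quadratic in x
with positive leading coefficient, and the integer nearest to the vertex of the parabola minimises
them. -/
theorem exists_xRound_eq {Δ : ℕ} (hΔ : 2 ≤ Δ) : ∃ x : ℕ, x ≤ Δ ∧ xRound Δ = x := by
  have h2 : (2 : ℝ) ≤ Δ := by exact_mod_cast hΔ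
  have hpos : (0 : ℝ) < 2 * (2 * Δ - 3) := by linarith
  set y : ℝ := (3 * (Δ : ℝ) ^ 2 - 6 * Δ + 2) / (2 * (2 * Δ - 3)) with hy
  have h0 : 0 ≤ y := div_nonneg (by nlinarith) hpos.le
  have h1 : y ≤ Δ := by
    rw [hy, div_le_iff₀ hpos]
    nlinarith
  have hr : 0 ≤ round y := by
    rw [round_eq]
    exact Int.floor_nonneg.2 (by linarith)
  have hr' : round y < (Δ : ℤ) + 1 := by
    rw [round_eq, Int.floor_lt]
    push_cast
    linarith
  refine ⟨(round y).toNat, by omega, ?_⟩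
  rw [xRound, ← hy]
  exact_mod_cast (Int.toNat_of_nonneg hr).symm

theorem cast_avgVertex {Δ x : ℕ} (hΔ : 2 ≤ Δ) (hx : x ≤ Δ) :
    (avgVertex Δ x : ℝ) = x * (Δ - 1) + (Δ - x) * (Δ - x - 1) := by
  rw [avgVertex, Nat.cast_add, Nat.cast_mul, Nat.cast_mul, Nat.cast_sub (by omega : 1 ≤ Δ),
    Nat.cast_sub hx, Nat.cast_one]
  rcases hx.eq_or_lt with rfl | h
  · simp
  · rw [Nat.cast_sub (by omega), Nat.cast_sub hx, Nat.cast_one]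

theorem cast_avgLeaf {Δ x : ℕ} (hΔ : 2 ≤ Δ) (hx : x ≤ Δ) :
    (avgLeaf Δ x : ℝ) = (Δ - x) * (Δ - 1) := by
  rw [avgLeaf, Nat.cast_mul, Nat.cast_sub hx, Nat.cast_sub (by omega), Nat.cast_one]

theorem kExponent_eq {Δ x : ℕ} (hΔ : 2 ≤ Δ) (hx : x ≤ Δ) (h : xRound Δ = x) :
    kExponent Δ = (treeConsts Δ x).p₁ / (treeConsts Δ x).d₁ := by
  have h2 : (2 : ℝ) ≤ Δ := by exact_mod_cast hΔ
  have h0 : (Δ : ℝ) ≠ 0 := by linarith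
  have h1 : (Δ : ℝ) - 1 ≠ 0 := by linarith
  simp only [kExponent, h, treeConsts, Nat.cast_add, Nat.cast_mul, cast_avgVertex hΔ hx,
    cast_avgLeaf hΔ hx, Nat.cast_sub hΔ, Nat.cast_sub (by omega : 1 ≤ Δ), Nat.cast_one,
    Nat.cast_ofNat]
  field_simp
  ring

theorem nExponent_eq {Δ x : ℕ} (hΔ : 2 ≤ Δ) (hx : x ≤ Δ) (h : xRound Δ = x) :
    nExponent Δ = (treeConsts Δ x).p₂ / (treeConsts Δ x).d₂ := by
  have h2 : (2 : ℝ) ≤ Δ := by exact_mod_cast hΔ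
  have h0 : (Δ : ℝ) ≠ 0 := by linarith
  have h1 : (Δ : ℝ) - 1 ≠ 0 := by linarith
  have h3 : 2 * (Δ : ℝ) - 3 ≠ 0 := by linarith
  simp only [nExponent, h, treeConsts, Nat.cast_add, Nat.cast_mul, cast_avgVertex hΔ hx,
    cast_avgLeaf hΔ hx, Nat.cast_sub hΔ, Nat.cast_sub (by omega : 1 ≤ Δ), Nat.cast_one,
    Nat.cast_ofNat, Nat.cast_sub (by omega : 3 ≤ 2 * Δ)]
  field_simp
  ring

/-- Rounding down in the divisions and truncating k only make the exponent smaller; `c₀` becomes a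
constant factor. -/
theorem two_pow_Lmax_le (C : Consts) (n k : ℕ) : ((2 ^ C.Lmax n k : ℕ) : ℝ) ≤
    2 ^ C.c₀ * min ((2 : ℝ) ^ ((C.p₁ : ℝ) / C.d₁ * k)) ((2 : ℝ) ^ ((C.p₂ : ℝ) / C.d₂ * n)) := by
  rw [Nat.cast_pow, Nat.cast_ofNat, Consts.Lmax, pow_add, mul_comm]
  refine mul_le_mul_of_nonneg_left (le_min ?_ ?_) (by positivity) <;>
    rw [← Real.rpow_natCast] <;> refine Real.rpow_le_rpow_of_exponent_le one_le_two ?_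
  · refine (Nat.cast_le.2 (min_le_left _ _)).trans (Nat.cast_div_le.trans ?_)
    rw [Nat.cast_mul, mul_div_right_comm]
    exact mul_le_mul_of_nonneg_left (Nat.cast_le.2 (min_le_left _ _)) (by positivity)
  · refine (Nat.cast_le.2 (min_le_right _ _)).trans (Nat.cast_div_le.trans ?_)
    rw [Nat.cast_mul, mul_div_right_comm]

end exponents

/-! ### The bounds are polynomial -/

section bounds

theorem Consts.two_pow_cb_le (C : Consts) (n : ℕ) : 2 ^ C.cb n ≤ 4 * C.U n + 1 := by
  unfold Consts.cb
  by_cases h : 1 < 2 * C.U n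
  · have h1 := Nat.pow_pred_clog_lt_self (b := 2) (by norm_num) h
    have h2 : 0 < Nat.clog 2 (2 * C.U n) := Nat.clog_pos (by norm_num) h
    obtain ⟨m, hm⟩ := Nat.exists_eq_succ_of_ne_zero h2.ne'
    rw [hm] at h1 ⊢
    rw [Nat.pred_succ] at h1
    rw [pow_succ]
    omega
  · rw [Nat.clog_of_right_le_one (by omega)]
    omega

/-- Because k is truncated to n + 1, it enters `need` only through its length. -/
theorem Consts.exists_need_le (C : Consts) :
    ∃ p : Polynomial ℕ, ∀ n k, C.need n k ≤ p.eval (instanceSize n k) := by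
  have hJ : PolyBdd C.J := (((PolyBdd.const C.p₂).mul .id).add (.const C.c₀)).add (.const 2)
  have hU : PolyBdd C.U := (PolyBdd.id.mul .id).mul hJ
  have hcb : PolyBdd fun n => 2 ^ C.cb n :=
    (((PolyBdd.const 4).mul hU).add (.const 1)).of_le C.two_pow_cb_le
  have h1 : PolyBdd C.W₁ := (((PolyBdd.const 3).mul .id).add (.const 2)).mul hcb
  have h2 : PolyBdd C.W₂ := h1.mul (PolyBdd.id.add (.const 2))
  have h3 : PolyBdd C.W₃ := h2.mul ((((PolyBdd.const 2).mul .id).add (.const 2)).add hJ)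
  have hB : PolyBdd C.B := ((((((PolyBdd.const 2).mul hJ).add .id).mul .id).add
    ((PolyBdd.const 2).mul hJ)).add .id).add (.const 1)
  have hK : PolyBdd C.K := hB.mul ((PolyBdd.id.add (.const 1)).mul h3)
  have h : PolyBdd fun n => 8 * C.K n + 4 * (n * n * n + n * n + n) + 8 * C.U n + 2 ^ C.Δ + C.Δ :=
    (((((PolyBdd.const 8).mul hK).add ((PolyBdd.const 4).mul
      ((((PolyBdd.id.mul .id).mul .id).add (PolyBdd.id.mul .id)).add .id))).add
      ((PolyBdd.const 8).mul hU)).add (.const _)).add (.const _)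
  obtain ⟨p, hp⟩ := h
  refine ⟨p + .X + .C 100, fun n k => ?_⟩
  have hn : n ≤ instanceSize n k := by
    have := Nat.le_mul_self n
    unfold instanceSize; omega
  have := (hp n).trans (p.eval_nat_mono hn)
  have hk : Nat.size k ≤ instanceSize n k := by unfold instanceSize; omega
  simp only [Polynomial.eval_add, Polynomial.eval_X, Polynomial.eval_C]
  unfold Consts.need
  dsimp only at this
  omega

end bounds

/-! ### The input -/

section input

variable {n k : ℕ} {G : SimpleGraph (Fin n)}

open Classical in
theorem instanceMemory_apply (a i : ℕ) : instanceMemory G k (a, i) =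
    (if a = 0 ∧ i = 0 then n else 0) + (if a = 1 ∧ i = 0 then k else 0) +
      if ∃ v u : Fin n, a = 2 ∧ i = v * n + u ∧ G.Adj v u then 1 else 0 := by
  rw [instanceMemory, Finsupp.add_apply, Finsupp.add_apply, Finsupp.single_apply,
    Finsupp.single_apply, Finsupp.finsetSum_apply]
  congr 1
  · simp only [Prod.mk.injEq, eq_comm (a := 0), eq_comm (a := 1)]
  · simp only [Finsupp.finsetSum_apply, Finsupp.single_apply, Prod.mk.injEq]
    split_ifs with h
    · obtain ⟨v, u, rfl, rfl, hadj⟩ := h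
      have huniq : ∀ v' u' : Fin n, (v' : ℕ) * n + u' = v * n + u → v' = v ∧ u' = u := by
        intro v' u' h
        obtain ⟨h1, h2⟩ := BranchingWalk.radix_unique u'.2 u.2 h
        exact ⟨Fin.ext h1, Fin.ext h2⟩
      rw [Finset.sum_eq_single v, Finset.sum_eq_single u]
      · simp [hadj]
      · intro u' _ hu
        rw [if_neg fun h => hu (huniq v u' h.2).2]
      · simp
      · intro v' _ hv
        refine Finset.sum_eq_zero fun u' _ => ?_
        rw [if_neg fun h => hv (huniq v' u' h.2).1]
      · simp
    · refine Finset.sum_eq_zero fun v _ => Finset.sum_eq_zero fun u _ => ?_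
      split_ifs with h1 h2
      · exact absurd ⟨v, u, h1.1.symm, h1.2.symm, h2⟩ h
      · rfl
      · rfl

theorem input_instanceMemory [DecidableRel (natAdj G)] : Input (natAdj G) n ⟨instanceMemory G k, 0⟩ where
  n_eq := by rw [instanceMemory_apply]; simp
  adj v hv u hu := by
    classical
    rw [instanceMemory_apply, if_neg (by omega), if_neg (by omega), zero_add, zero_add]
    refine if_congr ⟨?_, ?_⟩ rfl rfl
    · rintro ⟨v', u', -, he, h⟩
      obtain ⟨rfl, rfl⟩ := BranchingWalk.radix_unique hu u'.2 he
      exact natAdj_val.2 h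
    · rintro ⟨hv, hu, h⟩
      exact ⟨⟨v, hv⟩, ⟨u, hu⟩, rfl, rfl, h⟩

theorem memOK_instanceMemory {D : ℕ} (hD : n * n + n + Nat.size k + 1 ≤ D) :
    MemOK 40 D (instanceMemory G k) := by
  intro a i h
  have hn : n < 2 ^ D := lt_two_pow_of_le (by omega)
  have hk : k < 2 ^ D := (Nat.lt_size_self k).trans_le (Nat.pow_le_pow_right (by norm_num) (by omega))
  have h1 : 1 < 2 ^ D := Nat.one_lt_two_pow (by omega)
  rw [instanceMemory_apply] at h ⊢
  by_cases e0 : a = 0 ∧ i = 0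
  · obtain ⟨rfl, rfl⟩ := e0
    simpa using ⟨by omega, hn⟩
  by_cases e1 : a = 1 ∧ i = 0
  · obtain ⟨rfl, rfl⟩ := e1
    simpa using ⟨by omega, hk⟩
  rw [if_neg e0, if_neg e1, zero_add, zero_add] at h ⊢
  split_ifs at h ⊢ with h2
  · obtain ⟨v, u, rfl, rfl, -⟩ := h2
    refine ⟨by omega, ?_, h1⟩
    calc (v : ℕ) * n + u < v * n + n := by omega
      _ = (v + 1) * n := by ring
      _ ≤ n * n := Nat.mul_le_mul_right _ v.2
      _ ≤ D := by omega
  · exact absurd rfl h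

end input


/-! ### Assembly -/

open BranchingWalk Program

/-- So the time bound contains the factor 2 ^ Lmax only once. -/
theorem bigDepth_algorithm (C : Consts) : (algorithm C).bigDepth = 1 := rfl

/-- What the algorithm answers. -/
def Answer (C : Consts) {n : ℕ} (G : SimpleGraph (Fin n)) [DecidableRel (natAdj G)] (k : ℕ)
    (ω : ℕ → Bool) : Prop :=
  0 < n ∧ (∀ v < n, reachM (natAdj G) n n v ≠ 0) ∧
    (k = 0 ∨ ∃ S < 2 ^ C.Δ, ∃ r < n, ∃ L < C.Lmax n k + 1, ∃ N < n + 1, ∃ w < C.W₁ n,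
      Hit C (sieve C (natAdj G) n (colM (natAdj G) n C.Δ n) ω S r L) (Consts.kk n k) N w)

section main

variable {n k : ℕ} {G : SimpleGraph (Fin n)} [DecidableRel (natAdj G)]

theorem exec_algorithm {C : Consts} (hΔ : 1 ≤ C.Δ) (hc : C.Δ ≤ C.c₀) (ω : ℕ → Bool) :
    ∃ τ t s, Exec ω (algorithm C).compile ⟨instanceMemory G k, 0⟩ τ t s ∧
      t ≤ (algorithm C).time (C.need n k) (2 ^ C.Lmax n k) ∧
      s ≤ 2 * 40 * C.need n k * C.need n k ∧ (τ.mem (0, 0) = 1 ↔ Answer C G k ω) := by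
  have h := wp_algorithm (ev := ⟨ω, 40, C.need n k, 2 ^ C.Lmax n k⟩) (C := C) (a := natAdj G) (n := n)
    (k := k) (σ := ⟨instanceMemory G k, 0⟩) le_rfl le_rfl le_rfl hΔ hc input_instanceMemory
    (by rw [instanceMemory_apply]; simp)
    (fun b hb i => by
      rw [instanceMemory_apply, if_neg (by omega), if_neg (by omega), if_neg]
      rintro ⟨_, _, h, -⟩
      omega) rfl
  obtain ⟨τ, t, s, h1, h2, h3, -, h4⟩ := h (memOK_instanceMemory (by
    have : 0 < 2 ^ C.Δ := by positivity
    simp only [Consts.need]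
    omega))
  exact ⟨τ, t, s, h1, h2, h3, h4⟩

theorem accepts_iff {C : Consts} (hΔ : 1 ≤ C.Δ) (hc : C.Δ ≤ C.c₀) (ω : ℕ → Bool) :
    Accepts (algorithm C).compile (instanceMemory G k) ω ↔ Answer C G k ω := by
  obtain ⟨τ, t, s, h1, -, -, h4⟩ := exec_algorithm (G := G) (k := k) hΔ hc ω
  rw [← h4]
  constructor
  · rintro ⟨τ', t', s', h, h0⟩
    rwa [(h1.deterministic h).1]
  · exact fun h => ⟨τ, t, s, h1, h⟩

theorem Answer.sound {C : Consts} {ω : ℕ → Bool} (h : Answer C G k ω) :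
    HasInternalSpanningTree G k := by
  obtain ⟨hn, hr, h⟩ := h
  have hG := (connected_iff_reachM hn).2 hr
  rcases h with rfl | ⟨S, -, r, -, L, hL, N, hN, w, hw, h⟩
  · obtain ⟨T, hT1, hT2⟩ := hG.exists_isTree_le
    exact ⟨T, hT1, hT2, Nat.zero_le _⟩
  · have hLJ := C.Lmax_lt n k
    obtain ⟨Y, h1, h2, h3, h4⟩ := h.exists_walk natAdj_irrefl natAdj_symm natAdj_lt (by omega)
      (by omega) hw
    exact h2 ▸ hasInternalSpanningTree_of_walk hG h1 h3 h4

theorem half_le_coinMeasure_answer {Δ x : ℕ} (hΔ : 2 ≤ Δ) (hx : x ≤ Δ) (hG : MaxDegreeLE G Δ)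
    (h : HasInternalSpanningTree G k) :
    1 / 2 ≤ coinMeasure {ω | Answer (treeConsts Δ x) G k ω} := by
  have hcon := h.connected
  have hn : 0 < n := by
    obtain ⟨v⟩ := hcon.nonempty
    exact v.pos
  have hr := (connected_iff_reachM hn).1 hcon
  rcases Nat.eq_zero_or_pos k with rfl | hk
  -- For k = 0 the answer is certain; the whole space is viewed as a cylinder without conditions to
  -- find its measure.
  · have h1 : {ω | Answer (treeConsts Δ x) G 0 ω} = {ω | ∀ j < 0, ω j = false} := by
      ext ω
      simp only [Set.mem_ofPred_eq]
      exact iff_of_true ⟨hn, hr, .inl rfl⟩ (by simp)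
    rw [h1, coinMeasure_cylinder 0 fun _ => false, pow_zero, one_div, ENNReal.inv_le_one]
    exact one_le_two
  · obtain ⟨S, hS, r, hr', Y, h1, h2, h3, h4, h5, h6⟩ :=
      exists_walk_of_hasInternalSpanningTree hΔ hx hG hk h (col := colM (natAdj G) n Δ n)
        (colM_le (by omega) n) fun u v huv hu hv => colM_ne hG hr huv hu hv
    have hLJ := (treeConsts Δ x).Lmax_lt n k
    refine (half_le_coinMeasure_hit (C := treeConsts Δ x) (k := k) natAdj_irrefl natAdj_symm natAdj_lt
      -- The sieve is tried for every L up to `Lmax`, so L may be taken as the exact number of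
      -- objects of the walk.
      (h4.trans_lt hLJ) h1 h2 h3 rfl h5 h6).trans (MeasureTheory.measure_mono fun ω hω => ?_)
    obtain ⟨w, hw, hit⟩ := hω
    exact ⟨hn, hr, .inr ⟨S, hS, r, hr', _, Nat.lt_succ_of_le h4, Y.numNodes, Nat.lt_succ_of_le h2, w, hw,
      hit⟩⟩

end main

theorem mainTheorem9 (Δ : ℕ) (hΔ : 2 ≤ Δ) :
    ∃ (P : RamProg) (p q : Polynomial ℕ),
      ∀ (n k : ℕ) (G : SimpleGraph (Fin n)), MaxDegreeLE G Δ →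
        MonteCarlo P (instanceMemory G k) (HasInternalSpanningTree G k)
          ((p.eval (instanceSize n k) : ℕ) *
            min ((2 : ℝ) ^ (kExponent Δ * k)) ((2 : ℝ) ^ (nExponent Δ * n)))
          ((q.eval (instanceSize n k) : ℕ) : ℝ) := by
  classical
  obtain ⟨x, hx, hxr⟩ := exists_xRound_eq hΔ
  set C := treeConsts Δ x with hC
  obtain ⟨pD, hpD⟩ := C.exists_need_le
  obtain ⟨f, ⟨pf, hpf⟩, hf⟩ := (algorithm C).exists_time_le
  -- The time polynomial bounds the steps per round of the big loop and absorbs the constant 2 ^ c₀;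
  -- in the space polynomial, 40 is the number of arrays.
  refine ⟨(algorithm C).compile, pf.comp pD * .C (2 ^ C.c₀), .C (2 * 40) * pD * pD, fun n k G hG => ?_⟩
  have h1 : 1 ≤ C.Δ := one_le_two.trans hΔ
  have hc : C.Δ ≤ C.c₀ := Nat.le_add_right _ _
  refine ⟨fun ω => ?_, fun hno ω hω => hno ((accepts_iff h1 hc ω).1 hω).sound, fun h => ?_⟩
  · obtain ⟨τ, t, s, he, ht, hs, -⟩ := exec_algorithm (G := G) (k := k) h1 hc ω
    refine ⟨τ, t, s, he, ?_, ?_⟩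
    · have h2 := ht.trans (hf _ _ Nat.one_le_two_pow)
      rw [bigDepth_algorithm, pow_one] at h2
      have h3 : f (C.need n k) ≤ (pf.comp pD).eval (instanceSize n k) := by
        rw [Polynomial.eval_comp]
        exact (hpf _).trans (pf.eval_nat_mono (hpD n k))
      rw [kExponent_eq hΔ hx hxr, nExponent_eq hΔ hx hxr, ← hC, Polynomial.eval_mul, Polynomial.eval_C,
        Nat.cast_mul, mul_assoc]
      refine (Nat.cast_le.2 (h2.trans (Nat.mul_le_mul_right _ h3))).trans ?_
      rw [Nat.cast_mul]
      refine mul_le_mul_of_nonneg_left ((two_pow_Lmax_le C n k).trans_eq ?_) (Nat.cast_nonneg _)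
      push_cast
      rfl
    · refine Nat.cast_le.2 (hs.trans ?_)
      simp only [Polynomial.eval_mul, Polynomial.eval_C]
      exact Nat.mul_le_mul (Nat.mul_le_mul_left _ (hpD n k)) (hpD n k)
  · refine (half_le_coinMeasure_answer hΔ hx hG h).trans (MeasureTheory.measure_mono fun ω hω => ?_)
    exact (accepts_iff h1 hc ω).2 hω
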